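/- **Setting.** Fix $\alpha,\sigma_w,\sigma_{h}>0$ and put $K=2\alpha\sqrt{4}=4\alpha$ and $\mathrm{MOD}_{K}(z)=z-\lfloor \mathrm{Re}(z)/K+\tfrac12\rfloor K-j\lfloor \mathrm{Im}(z)/K+\tfrac12\rfloor K$. Consider the ODDM system with time-domain Tomlinson–Harashima precoding (THP) and Gray-mapped 4-QAM, with $M\ge 1$ delay bins and $N\ge1$ Doppler bins. The symbols $X[m,k]\in\{\pm1\pm j\}$ carry i.i.d. fair bits, and $x_{\rm T}[nM+m]=\frac1{\sqrt N}\sum_{k=0}^{N-1}X[m,k]e^{j2\pi kn/N}$. The channel has finitely many paths $p=1,\dots,P$ with integer delays $l_1=0$, $l_p\ge 1$ for $p\ge2$, integer Doppler indices $k_p$ and random gains $h_p$; write $h_p[t]=h_pe^{j2\pi k_pt/(NM)}$. The transmitter sends, for $0\le t<NM$, $$x^{\rm THP}[t]=\mathrm{MOD}_K\Big(x_{\rm T}[t]-\sum_{p=2}^{P}\frac{h_p[t-l_p]\,x^{\rm THP}[t-l_p]}{h_1[t]}\Big),\qquad x^{\rm THP}[t]=0 \text{ for } t<0,$$ and $y[t]=\sum_{p=1}^P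 h_p[t-l_p]x^{\rm THP}[t-l_p]+w[t]$ is received, where the $w[t]\sim\mathcal{CN}(0,\sigma_w^2)$ are i.i.d., $h_1\sim\mathcal{CN}(0,\sigma_{h}^2)$, the joint law of $(h_1,\dots,h_P)$ is otherwise arbitrary, and the bits, the gains and the noise are independent of each other. The receiver computes $r[t]=\mathrm{MOD}_{|h_1|K}\big(\overline{h_1[t]}\,y[t]/|h_1[t]|\big)$ and $\hat Y[m,k]=\frac1{|h_1|\sqrt N}\sum_{n=0}^{N-1}r[nM+m]e^{-j2\pi nk/N}$, and decides for the 4-QAM symbol nearest to $\hat Y[m,k]$. Let $\mathcal P_e$ be the resulting bit error rate, i.e. the probability of a wrong bit decision, averaged over the $2NM$ bits of the frame (and over gains, data and noise). **Loss-specific bit error rates.** Let $Q$ be the tail function of the standard normal law and $\mathcal E=2$ the mean symbol energy. Put $$\mathcal P^{\rm PL}=\frac12\left(1-\sqrt{\frac{\mathcal E\sigma_h^2/\sigma_w^2}{2+\mathcal E\sigma_h^2/\sigma_w^2}}\right),$$ $$\mathcal P^{\rm MNL}=\frac12\left(s(4\alpha-1)-s(2\alpha-1)+s(2\alpha+1)-s(1)\right),\qquad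 s(a)=\sqrt{\frac{\sigma_h^2a^2}{\sigma_w^2+\sigma_h^2a^2}},$$ $$\mathcal P^{\rm MSL}=Q\big(\sqrt{2/V}\big),\qquad V=\sum_{\eta\in\mathbb Z}2\eta^2K^2\Big(Q\big(\sqrt{\tfrac{2}{\mathcal E}}(2\eta-1)\tfrac K2\big)-Q\big(\sqrt{\tfrac2{\mathcal E}}(2\eta+1)\tfrac K2\big)\Big).$$ **Theorem.** There is an $N_0$, depending only on $\alpha,\sigma_w,\sigma_h$, such that for all $N\ge N_0$, all $M\ge1$, and all choices of the paths, of their delays and Doppler indices and of the joint law of the gains as above, $$\mathcal P_e\ \ge\ \max\{\mathcal P^{\rm PL},\ \mathcal P^{\rm MSL}\},$$ and, if moreover $|\alpha-\tfrac12|\ge\tfrac1{10}$, $$\mathcal P_e\ \ge\ \max\{\mathcal P^{\rm PL},\ \mathcal P^{\rm MNL},\ \mathcal P^{\rm MSL}\}.$$ -/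

import Mathlib

open MeasureTheory ProbabilityTheory

noncomputable section

namespace ODDM

/-- The circularly symmetric complex Gaussian law `CN(0, σ²)`: real and imaginary parts are
independent and `N(0, σ²/2)`. -/
def complexGaussian (σ : ℝ) : Measure ℂ :=
  ((gaussianReal 0 (Real.toNNReal (σ ^ 2 / 2))).prod
    (gaussianReal 0 (Real.toNNReal (σ ^ 2 / 2)))).map (fun p : ℝ × ℝ => (⟨p.1, p.2⟩ : ℂ))

/-- The Gaussian tail function `Q(x) = P(Z > x)`, `Z ~ N(0,1)`. -/
def gaussianQ (x : ℝ) : ℝ := (gaussianReal 0 1).real (Set.Ioi x)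

/-- The complex modulo operation `MOD_K`. -/
def modC (K : ℝ) (z : ℂ) : ℂ :=
  ⟨z.re - (⌊z.re / K + 1 / 2⌋ : ℝ) * K, z.im - (⌊z.im / K + 1 / 2⌋ : ℝ) * K⟩

/-- The constellation size of 4-QAM. -/
def qamOrder : ℝ := 4

/-- The mean energy of the 4-QAM symbols `±1 ± j`. -/
def symbolEnergy : ℝ := 2 * (qamOrder - 1) / 3

/-- The modified modulus `K = 2 α √𝓜`. -/
def modulus (α : ℝ) : ℝ := 2 * α * √qamOrder

/-- Gray-mapped 4-QAM: the first bit is the sign of the real part, the second bit the sign of the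
imaginary part. -/
def qam (b : Bool × Bool) : ℂ := ⟨if b.1 then 1 else -1, if b.2 then 1 else -1⟩

/-- The channel coefficient `h_p[t] = h_p exp(j 2π ν_p t T / M)` with `ν_p = k_p / (N T)`. -/
def tap (M N : ℕ) {P : ℕ} (k : Fin (P + 1) → ℤ) (h : Fin (P + 1) → ℂ) (p : Fin (P + 1)) (t : ℕ) :
    ℂ :=
  h p * Complex.exp (2 * Real.pi * Complex.I * (k p : ℂ) * (t : ℂ) / ((N : ℂ) * (M : ℂ)))

/-- The row-wise inverse DFT, giving the time-delay symbols `x_TD[m,n]`. -/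
def timeDelay {M N : ℕ} (X : Fin M → Fin N → ℂ) (m : Fin M) (n : ℕ) : ℂ :=
  (1 / (√(N : ℝ) : ℂ)) *
    ∑ k : Fin N, X m k * Complex.exp (2 * Real.pi * Complex.I * (k : ℕ) * (n : ℂ) / (N : ℂ))

/-- Parallel-to-serial conversion: `x_T[n M + m] = x_TD[m, n]`. -/
def timeSymbols {M N : ℕ} [NeZero M] (X : Fin M → Fin N → ℂ) (t : ℕ) : ℂ :=
  timeDelay X (Fin.ofNat M t) (t / M)

/-- Time-domain Tomlinson-Harashima precoding with a zero prefix. Path `0` is the first path, with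
zero delay; the interference of the paths `1, …, P` of delay `l p` is cancelled successively, and
each cancelled symbol is reduced by `MOD_K`. (The guard `0 < l p` makes the recursion well-founded;
it holds for all those paths in the system considered.) -/
def precode {P : ℕ} (K : ℝ) (l : Fin (P + 1) → ℕ) (c : Fin (P + 1) → ℕ → ℂ) (x : ℕ → ℂ) (t : ℕ) :
    ℂ :=
  modC K (x t - ∑ p : Fin P,
    if _hp : 0 < l p.succ ∧ l p.succ ≤ t then
      c p.succ (t - l p.succ) * precode K l c x (t - l p.succ) / c 0 t
    else 0)
termination_by t
decreasing_by omega

/-- The output of the linear time-varying channel at time `t` (signal before time `0` is zero), with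
additive noise sample `w`. -/
def received {P : ℕ} (l : Fin (P + 1) → ℕ) (c : Fin (P + 1) → ℕ → ℂ) (u : ℕ → ℂ) (t : ℕ) (w : ℂ) :
    ℂ :=
  (∑ p : Fin (P + 1), if l p ≤ t then c p (t - l p) * u (t - l p) else 0) + w

/-- The signal after the receiver's modulo operation with modulus `|h₁| K`, at the time
`t = n M + m`. -/
def modReceived {M N P : ℕ} [NeZero M] (K : ℝ) (l : Fin (P + 1) → ℕ) (k : Fin (P + 1) → ℤ)
    (h : Fin (P + 1) → ℂ) (X w : Fin M → Fin N → ℂ) (m : Fin M) (n : Fin N) : ℂ :=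
  let c := tap M N k h
  let t : ℕ := (n : ℕ) * M + (m : ℕ)
  modC (‖h 0‖ * K)
    ((starRingEnd ℂ) (c 0 t) * received l c (precode K l c (timeSymbols X)) t (w m n) / ‖c 0 t‖)

/-- The delay-Doppler symbol `Ŷ_DD[m,k']` after the DFT and the single-tap equalizer. -/
def equalized {M N P : ℕ} [NeZero M] (K : ℝ) (l : Fin (P + 1) → ℕ) (k : Fin (P + 1) → ℤ)
    (h : Fin (P + 1) → ℂ) (X w : Fin M → Fin N → ℂ) (m : Fin M) (k' : Fin N) : ℂ :=
  ((1 / (√(N : ℝ) : ℂ)) * ∑ n : Fin N, modReceived K l k h X w m n *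
    Complex.exp (-(2 * Real.pi * Complex.I * (n : ℕ) * (k' : ℕ) / (N : ℂ)))) / ‖h 0‖

/-- The joint law of path gains, data bits and noise: path gains of law `ν`, fair independent bits,
and independent `CN(0, σw²)` noise samples, the three families being independent. -/
def systemLaw {P : ℕ} (M N : ℕ) (ν : Measure (Fin (P + 1) → ℂ)) (σw : ℝ) :
    Measure ((Fin (P + 1) → ℂ) × (Fin M → Fin N → Bool × Bool) × (Fin M → Fin N → ℂ)) :=
  ν.prod ((uniformOn Set.univ).prod
    (Measure.pi fun _ : Fin M => Measure.pi fun _ : Fin N => complexGaussian σw))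

/-- The bit error rate: the probability that a transmitted bit is decided wrongly by minimum
distance detection of 4-QAM, averaged over all `2 N M` bits of a frame. -/
def ber {P : ℕ} (M N : ℕ) [NeZero M] (α σw : ℝ) (l : Fin (P + 1) → ℕ) (k : Fin (P + 1) → ℤ)
    (ν : Measure (Fin (P + 1) → ℂ)) : ℝ :=
  (∑ m : Fin M, ∑ k' : Fin N,
    ((systemLaw M N ν σw).real {ω | ¬ ((ω.2.1 m k').1 = true ↔
        0 ≤ (equalized (modulus α) l k ω.1 (fun i j => qam (ω.2.1 i j)) ω.2.2 m k').re)} +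
      (systemLaw M N ν σw).real {ω | ¬ ((ω.2.1 m k').2 = true ↔
        0 ≤ (equalized (modulus α) l k ω.1 (fun i j => qam (ω.2.1 i j)) ω.2.2 m k').im)})) /
    (2 * (N : ℝ) * (M : ℝ))

/-- The power-loss bit error rate. -/
def berPL (σw σh : ℝ) : ℝ :=
  1 / 2 * (1 - √((symbolEnergy * σh ^ 2 / σw ^ 2) / (2 + symbolEnergy * σh ^ 2 / σw ^ 2)))

/-- The modulo-noise-loss bit error rate. -/
def berMNL (α σw σh : ℝ) : ℝ :=
  1 / 2 * √(σh ^ 2 * (4 * α - 1) ^ 2 / (σw ^ 2 + σh ^ 2 * (4 * α - 1) ^ 2))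
    - 1 / 2 * √(σh ^ 2 * (2 * α - 1) ^ 2 / (σw ^ 2 + σh ^ 2 * (2 * α - 1) ^ 2))
    + 1 / 2 * √(σh ^ 2 * (2 * α + 1) ^ 2 / (σw ^ 2 + σh ^ 2 * (2 * α + 1) ^ 2))
    - 1 / 2 * √(σh ^ 2 / (σw ^ 2 + σh ^ 2))

/-- The variance of the high-SNR modulo interference: with `K = 2 α √𝓜` and `E` the mean symbol
energy, `∑_η 2 η² K² (Q(√(2/E) (2η-1) K/2) - Q(√(2/E) (2η+1) K/2))` over all integers `η`. -/
def modSignalVar (α : ℝ) : ℝ :=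
  ∑' η : ℤ, 2 * (η : ℝ) ^ 2 * modulus α ^ 2 *
    (gaussianQ (√(2 / symbolEnergy) * (2 * (η : ℝ) - 1) * (modulus α / 2)) -
      gaussianQ (√(2 / symbolEnergy) * (2 * (η : ℝ) + 1) * (modulus α / 2)))

/-- The modulo-signal-loss bit error rate. -/
def berMSL (α : ℝ) : ℝ := gaussianQ (√(2 / modSignalVar α))

end ODDM

end

/-!
The bit error rate is compared, gain by gain, with its limit for long frames.

*Reduction.* Precoding removes the interference of the delayed paths exactly, up to Gaussian-integer
multiples of the modulus `K`, and these disappear in the modulo operation of the receiver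
(`exists_received_precode_eq`, `modReceived_eq`). Given the gain `z` of the first path, one row of the
frame is therefore the real system `ζ = Oᵀ f(O ξ + τ W)`: `ξ` are the bits as independent signs, `W`
is standard normal, `O` is the inverse discrete Fourier transform in real coordinates, `f = rmod K`
is the modulo operation and `τ = σw / (√2 ‖z‖)` (`equalized_eq_output`). Hence the bit error rate is
an average over `z` of a quantity that depends only on `N`, `K` and `τ` (`ber_eq_integral`), which is
why `N₀` can be chosen independently of `M` and of the channel.

*Limit.* Let `s = √(1 + τ²)`, `a = gain K s = E[f(s Y) Y] / s` and `P = power K s = E[f(s Y)²]`, with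
`Y` standard normal. Given its own input `b = ±1`, an output coordinate is asymptotically normal with
mean `a b` and variance `P - a²`. Given `ξ`, it is a sum of independent terms, with conditional
characteristic function close to `exp L(ξ)` for an explicit smooth `L`; the signs in `L` are replaced
by normal variables one at a time. A sign and a normal variable share three moments, so each
replacement costs a fourth derivative, and these are small because the first derivatives of `L` are
linear statistics `∑ wₙ p((O ξ)ₙ)` with centred `p`, in which there is square-root cancellation
(`integral_sq_linStat_le`, `integral_fourth_linStat_le`, `norm_frozen_sub_le`). For normal inputs
`O ξ` is standard normal and everything factorizes. The error `C(t) N ^ (-1 / 4)` is uniform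
(`norm_charFun_output_sub_le`), so by Lévy's theorem the error probability is asymptotically at least
`Q(R)` with `R = limitRatio K τ = a / √(P - a²)`, and Fatou's lemma reduces the theorem to pointwise
strict bounds on `Q(R)` (`exists_forall_integral_le_ber`).

*Scalar inequalities.* Let `u = 1 / τ`. After averaging over the Rayleigh distributed `‖z‖`, the three
loss-specific rates correspond to `Q(u)`, to a constant, and to `foldedQ K u`.

* `Q(u) < Q(R)` (`gaussianQ_inv_lt_limitRatio`): the power `E[(s Y - f(s Y))²]` of the removed
  multiples of `K` is at least `s² (1 - a)`, because the density decreases across each cell of the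
  modulo operation (`le_excess`).
* `berMSL α < Q(R)` (`berMSL_lt_limitRatio`): that power increases with the noise, and without noise it
  is half the variance in `berMSL`.
* `foldedQ K u < Q(R)` (`foldedQ_lt_limitRatio`), with `K = 4 α` outside `(1.6, 2.4)`. For small `K`
  the gain is tiny and `Q(R)` is close to `1 / 2`. For `u K ≥ 5` the nearest folded levels are explicit
  tails, and the loss `1 - a` is bounded below by `4 μ φ(μ)` with `μ = K / (2 s)`
  (`foldedQ_lt_of_spatial`). For `u K ≤ 5` Poisson summation expresses `foldedQ`, `a` and `P` through
  rapidly convergent theta series, whose first terms decide (`foldedQ_lt_of_fourier`).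
-/

namespace ODDM

set_option linter.unusedSectionVars false

/-! ### Fair signs and standard normal variables -/

section

open scoped ENNReal

/-- The law of a fair sign. -/
noncomputable def rademacher : Measure ℝ :=
  (2⁻¹ : ℝ≥0∞) • Measure.dirac 1 + (2⁻¹ : ℝ≥0∞) • Measure.dirac (-1)

/-- The standard normal law on the line. -/
noncomputable abbrev stdNormal : Measure ℝ := gaussianReal 0 1

instance : IsProbabilityMeasure rademacher := by
  constructor
  simp [rademacher, ENNReal.inv_two_add_inv_two]

section OneDim

variable {E : Type*} [NormedAddCommGroup E] [NormedSpace ℝ E]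

lemma integral_rademacher [CompleteSpace E] (F : ℝ → E) :
    ∫ x, F x ∂rademacher = (1 / 2 : ℝ) • (F 1 + F (-1)) := by
  have h : ∀ a : ℝ, Integrable F ((2⁻¹ : ℝ≥0∞) • Measure.dirac a) := fun a =>
    (integrable_dirac (by simp)).smul_measure (by simp)
  rw [rademacher, integral_add_measure (h 1) (h (-1)), integral_smul_measure,
    integral_smul_measure, integral_dirac, integral_dirac, smul_add]
  simp

lemma integrable_exp_mul_abs_stdNormal (c : ℝ) :
    Integrable (fun x => Real.exp (c * |x|)) stdNormal := by
  refine Integrable.mono' ((integrable_exp_mul_gaussianReal c).add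
    (integrable_exp_mul_gaussianReal (-c))) (by fun_prop) (Filter.Eventually.of_forall fun x => ?_)
  rw [Real.norm_eq_abs, abs_of_pos (Real.exp_pos _)]
  simp only [Pi.add_apply]
  rcases abs_cases x with h | h
  · rw [h.1]; have := Real.exp_pos (-c * x); linarith
  · rw [h.1]; have := Real.exp_pos (c * x)
    have h2 : c * -x = -c * x := by ring
    rw [h2]; linarith

lemma pow_abs_le_exp (n : ℕ) (x : ℝ) : |x| ^ n ≤ n.factorial * Real.exp |x| := by
  have := Real.pow_div_factorial_le_exp |x| (abs_nonneg x) n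
  rw [div_le_iff₀ (by positivity)] at this
  linarith

lemma integrable_pow_stdNormal (n : ℕ) : Integrable (fun x : ℝ => x ^ n) stdNormal := by
  refine Integrable.mono' ((integrable_exp_mul_abs_stdNormal 1).const_mul (n.factorial : ℝ))
    (by fun_prop) (Filter.Eventually.of_forall fun x => ?_)
  rw [Real.norm_eq_abs, abs_pow, one_mul]
  exact pow_abs_le_exp n x

lemma integral_odd_stdNormal {F : ℝ → E} (hF : ∀ x, F (-x) = -F x) :
    ∫ x, F x ∂stdNormal = 0 := by
  have h : stdNormal.map (fun x => -x) = stdNormal := by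
    rw [gaussianReal_map_neg, neg_zero]
  have h1 : ∫ x, F x ∂stdNormal = ∫ x, F (-x) ∂stdNormal := by
    conv_lhs => rw [← h]
    exact integral_map_equiv (MeasurableEquiv.neg ℝ) F
  simp only [hF, integral_neg] at h1
  have h2 : (2 : ℝ) • ∫ x, F x ∂stdNormal = 0 := by
    rw [two_smul]; nth_rewrite 1 [h1]; simp
  simpa using h2

lemma integral_sq_stdNormal : ∫ x, x ^ 2 ∂stdNormal = 1 := by
  have := variance_fun_id_gaussianReal (μ := 0) (v := 1)
  rw [variance_eq_integral (by fun_prop)] at this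
  simpa using this

lemma norm_sub_le_of_deriv_le {R R' : ℝ → E} (h : ∀ x, HasDerivAt R (R' x) x) {r M : ℝ}
    (hM : ∀ y, |y| ≤ r → ‖R' y‖ ≤ M) {y : ℝ} (hy : |y| ≤ r) : ‖R y - R 0‖ ≤ M * |y| := by
  have := (convex_Icc (-r) r).norm_image_sub_le_of_norm_hasDerivWithin_le (f := R) (f' := R')
    (C := M) (x := 0) (y := y) (fun x _ => (h x).hasDerivWithinAt)
    (fun x hx => hM x (abs_le.2 hx)) (by
      have := (abs_nonneg y).trans hy
      constructor <;> linarith) (abs_le.1 hy)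
  simpa using this

/-- Third order Taylor expansion at the origin, with a non-sharp constant. -/
lemma taylor_three {F F1 F2 F3 F4 : ℝ → E} (h0 : ∀ x, HasDerivAt F (F1 x) x)
    (h1 : ∀ x, HasDerivAt F1 (F2 x) x) (h2 : ∀ x, HasDerivAt F2 (F3 x) x)
    (h3 : ∀ x, HasDerivAt F3 (F4 x) x) {x M : ℝ} (hM : ∀ y, |y| ≤ |x| → ‖F4 y‖ ≤ M) :
    ‖F x - (F 0 + x • F1 0 + (x ^ 2 / 2) • F2 0 + (x ^ 3 / 6) • F3 0)‖ ≤ M * |x| ^ 4 := by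
  have hM0 : 0 ≤ M := (norm_nonneg _).trans (hM 0 (by simp))
  have step : ∀ {c : ℝ} {y : ℝ}, 0 ≤ c → |y| ≤ |x| → c * |y| ≤ c * |x| := fun hc hy =>
    mul_le_mul_of_nonneg_left hy hc
  have e3 : ∀ y, |y| ≤ |x| → ‖F3 y - F3 0‖ ≤ M * |x| := fun y hy =>
    (norm_sub_le_of_deriv_le h3 hM hy).trans (step hM0 hy)
  have e2 : ∀ y, |y| ≤ |x| → ‖F2 y - F2 0 - y • F3 0‖ ≤ M * |x| * |x| := by
    intro y hy
    have hd : ∀ z, HasDerivAt (fun z => F2 z - F2 0 - z • F3 0) (F3 z - F3 0) z := fun z => by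
      simpa using ((h2 z).sub_const (F2 0)).fun_sub ((hasDerivAt_id z).smul_const (F3 0))
    have := norm_sub_le_of_deriv_le hd e3 hy
    simp only [sub_self, zero_smul, sub_zero] at this
    exact this.trans (step (by positivity) hy)
  have e1 : ∀ y, |y| ≤ |x| →
      ‖F1 y - F1 0 - y • F2 0 - (y ^ 2 / 2) • F3 0‖ ≤ M * |x| * |x| * |x| := by
    intro y hy
    have hd : ∀ z, HasDerivAt (fun z => F1 z - F1 0 - z • F2 0 - (z ^ 2 / 2) • F3 0)
        (F2 z - F2 0 - z • F3 0) z := fun z => by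
      have hq : HasDerivAt (fun z : ℝ => z ^ 2 / 2) z z := by
        simpa using (hasDerivAt_pow 2 z).div_const 2
      simpa using (((h1 z).sub_const (F1 0)).fun_sub ((hasDerivAt_id z).smul_const (F2 0))).fun_sub
        (hq.smul_const (F3 0))
    have := norm_sub_le_of_deriv_le hd e2 hy
    simp only [sub_self, zero_smul, sub_zero, ne_eq, OfNat.ofNat_ne_zero, not_false_eq_true,
      zero_pow, zero_div] at this
    exact this.trans (step (by positivity) hy)
  have hd : ∀ z, HasDerivAt
      (fun z => F z - F 0 - z • F1 0 - (z ^ 2 / 2) • F2 0 - (z ^ 3 / 6) • F3 0)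
      (F1 z - F1 0 - z • F2 0 - (z ^ 2 / 2) • F3 0) z := fun z => by
    have hq : HasDerivAt (fun z : ℝ => z ^ 2 / 2) z z := by
      simpa using (hasDerivAt_pow 2 z).div_const 2
    have hc : HasDerivAt (fun z : ℝ => z ^ 3 / 6) (z ^ 2 / 2) z := by
      refine ((hasDerivAt_pow 3 z).div_const 6).congr_deriv ?_
      norm_num; ring
    simpa using ((((h0 z).sub_const (F 0)).fun_sub ((hasDerivAt_id z).smul_const (F1 0))).fun_sub
        (hq.smul_const (F2 0))).fun_sub (hc.smul_const (F3 0))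
  have := norm_sub_le_of_deriv_le hd e1 le_rfl
  simp only [sub_self, zero_smul, sub_zero, ne_eq, OfNat.ofNat_ne_zero, not_false_eq_true,
      zero_pow, zero_div] at this
  calc _ = ‖F x - F 0 - x • F1 0 - (x ^ 2 / 2) • F2 0 - (x ^ 3 / 6) • F3 0‖ := by
        congr 1; abel
    _ ≤ _ := this
    _ = M * |x| ^ 4 := by ring

/-- The constant of the fourth-moment comparison of a fair sign with a standard normal. -/
noncomputable def swapConst : ℝ :=
  Real.exp 5 + ∫ x, Real.exp (5 * |x|) * |x| ^ 4 ∂stdNormal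

lemma integrable_exp_mul_pow_stdNormal (n : ℕ) :
    Integrable (fun x => Real.exp (5 * |x|) * |x| ^ n) stdNormal := by
  refine Integrable.mono' ((integrable_exp_mul_abs_stdNormal 6).const_mul (n.factorial : ℝ))
    (by fun_prop) (Filter.Eventually.of_forall fun x => ?_)
  rw [Real.norm_eq_abs, abs_of_nonneg (by positivity)]
  calc _ ≤ Real.exp (5 * |x|) * (n.factorial * Real.exp |x|) := by
        gcongr; exact pow_abs_le_exp n x
    _ = n.factorial * (Real.exp (5 * |x|) * Real.exp |x|) := by ring
    _ = _ := by rw [← Real.exp_add]; ring_nf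

lemma swapConst_pos : 0 < swapConst := by
  have : 0 ≤ ∫ x, Real.exp (5 * |x|) * |x| ^ 4 ∂stdNormal :=
    integral_nonneg fun x => by positivity
  have := Real.exp_pos 5
  unfold swapConst; linarith

lemma integrable_of_fourth_deriv {F F1 F2 F3 F4 : ℝ → E} (h0 : ∀ x, HasDerivAt F (F1 x) x)
    (h1 : ∀ x, HasDerivAt F1 (F2 x) x) (h2 : ∀ x, HasDerivAt F2 (F3 x) x)
    (h3 : ∀ x, HasDerivAt F3 (F4 x) x) {B : ℝ} (hB : ∀ x, ‖F4 x‖ ≤ B * Real.exp (5 * |x|)) :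
    Integrable (fun x => F x - (F 0 + x • F1 0 + (x ^ 2 / 2) • F2 0 + (x ^ 3 / 6) • F3 0))
      stdNormal ∧
    ∀ x, ‖F x - (F 0 + x • F1 0 + (x ^ 2 / 2) • F2 0 + (x ^ 3 / 6) • F3 0)‖ ≤
      B * (Real.exp (5 * |x|) * |x| ^ 4) := by
  have hB0 : 0 ≤ B := by
    have := (norm_nonneg _).trans (hB 0)
    simpa using this
  have key : ∀ x, ‖F x - (F 0 + x • F1 0 + (x ^ 2 / 2) • F2 0 + (x ^ 3 / 6) • F3 0)‖ ≤
      B * (Real.exp (5 * |x|) * |x| ^ 4) := fun x => by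
    rw [← mul_assoc]
    refine taylor_three h0 h1 h2 h3 fun y hy => (hB y).trans ?_
    gcongr
  refine ⟨?_, key⟩
  have hc : Continuous F := continuous_iff_continuousAt.2 fun x => (h0 x).continuousAt
  exact Integrable.mono' ((integrable_exp_mul_pow_stdNormal 4).const_mul B)
    (by fun_prop) (Filter.Eventually.of_forall key)

lemma integrable_cubic (A B C D : E) :
    Integrable (fun x : ℝ => A + x • B + (x ^ 2 / 2) • C + (x ^ 3 / 6) • D) stdNormal := by
  have i1 : Integrable (fun x : ℝ => x) stdNormal := by
    simpa using integrable_pow_stdNormal 1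
  exact (((integrable_const _).add (i1.smul_const _)).add
    (((integrable_pow_stdNormal 2).div_const 2).smul_const _)).add
    (((integrable_pow_stdNormal 3).div_const 6).smul_const _)

variable [CompleteSpace E]

/-- A fair sign and a standard normal have the same first three moments: replacing one by the
other costs only a fourth derivative. -/
lemma norm_rademacher_sub_stdNormal_le {F F1 F2 F3 F4 : ℝ → E}
    (h0 : ∀ x, HasDerivAt F (F1 x) x)
    (h1 : ∀ x, HasDerivAt F1 (F2 x) x) (h2 : ∀ x, HasDerivAt F2 (F3 x) x)
    (h3 : ∀ x, HasDerivAt F3 (F4 x) x) {B : ℝ} (hB : ∀ x, ‖F4 x‖ ≤ B * Real.exp (5 * |x|)) :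
    ‖∫ x, F x ∂rademacher - ∫ x, F x ∂stdNormal‖ ≤ swapConst * B := by
  obtain ⟨hi, key⟩ := integrable_of_fourth_deriv h0 h1 h2 h3 hB
  set T : ℝ → E := fun x => F 0 + x • F1 0 + (x ^ 2 / 2) • F2 0 + (x ^ 3 / 6) • F3 0 with hT
  have i1 : Integrable (fun x : ℝ => x) stdNormal := by
    simpa using integrable_pow_stdNormal 1
  have iT : Integrable T stdNormal := integrable_cubic _ _ _ _
  have hTγ : ∫ x, T x ∂stdNormal = F 0 + (1 / 2 : ℝ) • F2 0 := by
    have j1 : Integrable (fun x : ℝ => x • F1 0) stdNormal := i1.smul_const _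
    have j2 : Integrable (fun x : ℝ => (x ^ 2 / 2) • F2 0) stdNormal :=
      ((integrable_pow_stdNormal 2).div_const 2).smul_const _
    have j3 : Integrable (fun x : ℝ => (x ^ 3 / 6) • F3 0) stdNormal :=
      ((integrable_pow_stdNormal 3).div_const 6).smul_const _
    have j0 : Integrable (fun _ : ℝ => F 0) stdNormal := integrable_const _
    have j01 : Integrable (fun x : ℝ => F 0 + x • F1 0) stdNormal := j0.add j1
    have j02 : Integrable (fun x : ℝ => F 0 + x • F1 0 + (x ^ 2 / 2) • F2 0) stdNormal :=
      j01.add j2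
    simp only [hT]
    rw [integral_add j02 j3, integral_add j01 j2, integral_add j0 j1,
      integral_smul_const, integral_smul_const, integral_smul_const, integral_div,
      integral_div, integral_sq_stdNormal, integral_odd_stdNormal (F := fun x : ℝ => x) (by simp),
      integral_odd_stdNormal (F := fun x : ℝ => x ^ 3) (by intro x; ring)]
    simp
  have hTR : ∫ x, T x ∂rademacher = F 0 + (1 / 2 : ℝ) • F2 0 := by
    rw [integral_rademacher]
    simp only [hT]
    module
  have eγ : ∫ x, F x ∂stdNormal = ∫ x, (F x - T x) ∂stdNormal + ∫ x, T x ∂stdNormal := by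
    rw [← integral_add hi iT]
    exact integral_congr_ae (Filter.Eventually.of_forall fun x => by simp [hT])
  have eR : ∫ x, F x ∂rademacher = ∫ x, (F x - T x) ∂rademacher + ∫ x, T x ∂rademacher := by
    rw [integral_rademacher, integral_rademacher, integral_rademacher]; module
  rw [eγ, eR, hTγ, hTR, add_sub_add_right_eq_sub, swapConst, add_mul]
  refine (norm_sub_le _ _).trans (add_le_add ?_ ?_)
  · rw [integral_rademacher, norm_smul]
    have k1 := key 1
    have k2 := key (-1)
    simp only [abs_one, abs_neg, mul_one, one_pow] at k1 k2
    have := norm_add_le (F 1 - T 1) (F (-1) - T (-1))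
    rw [Real.norm_eq_abs, abs_of_pos (by norm_num)]
    simp only [hT] at this ⊢
    linarith
  · rw [mul_comm, ← integral_const_mul]
    exact norm_integral_le_of_norm_le ((integrable_exp_mul_pow_stdNormal 4).const_mul B)
      (Filter.Eventually.of_forall key)

end OneDim

/-- The constant in `le_dominationConst_mul_integral`. -/
noncomputable def dominationConst : ℝ := (∫ x, Real.exp (-1 - |x|) ∂stdNormal)⁻¹

lemma integrable_exp_neg_abs : Integrable (fun x => Real.exp (-1 - |x|)) stdNormal := by
  refine Integrable.of_bound (by fun_prop) 1 (Filter.Eventually.of_forall fun x => ?_)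
  rw [Real.norm_eq_abs, abs_of_pos (Real.exp_pos _), Real.exp_le_one_iff]
  have := abs_nonneg x; linarith

lemma integral_exp_neg_abs_pos : 0 < ∫ x, Real.exp (-1 - |x|) ∂stdNormal :=
  integral_exp_pos integrable_exp_neg_abs

lemma one_le_dominationConst : 1 ≤ dominationConst := by
  rw [dominationConst, one_le_inv₀ integral_exp_neg_abs_pos]
  calc _ ≤ ∫ x, (1 : ℝ) ∂stdNormal := by
        refine integral_mono integrable_exp_neg_abs (integrable_const _) fun x => ?_
        simp only [Real.exp_le_one_iff]
        have := abs_nonneg x; linarith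
    _ = 1 := by simp

lemma le_dominationConst_mul_integral {F : ℝ → ℝ} {v : ℝ} (hF : Integrable F stdNormal)
    (h : ∀ x, v ≤ Real.exp (1 + |x|) * F x) : v ≤ dominationConst * ∫ x, F x ∂stdNormal := by
  have h1 : v * ∫ x, Real.exp (-1 - |x|) ∂stdNormal ≤ ∫ x, F x ∂stdNormal := by
    rw [← integral_const_mul]
    refine integral_mono (integrable_exp_neg_abs.const_mul v) hF fun x => ?_
    have h2 := h x
    have h3 : Real.exp (-1 - |x|) = (Real.exp (1 + |x|))⁻¹ := by
      rw [← Real.exp_neg]; ring_nf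
    simp only
    rw [h3, ← div_eq_mul_inv, div_le_iff₀ (Real.exp_pos _)]
    linarith
  rw [dominationConst, inv_mul_eq_div, le_div_iff₀ integral_exp_neg_abs_pos]
  exact h1

end

/-! ### Exchanging the factors of a product measure -/

section

section Product

variable {ι : Type*} [Fintype ι] [DecidableEq ι]

lemma measurable_update_prod (j : ι) :
    Measurable fun p : (ι → ℝ) × ℝ => Function.update p.1 j p.2 := by
  refine measurable_pi_iff.2 fun i => ?_
  rcases eq_or_ne i j with rfl | h
  · simpa using measurable_snd
  · simpa [Function.update_of_ne h, Function.comp_def] using (measurable_pi_apply i).comp measurable_fst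

/-- Resampling one coordinate of a product measure changes that factor only. -/
lemma pi_prod_map_update {μ μ' : ι → Measure ℝ} [∀ i, IsProbabilityMeasure (μ i)]
    [∀ i, IsProbabilityMeasure (μ' i)] (j : ι) (h : ∀ i, i ≠ j → μ i = μ' i) :
    ((Measure.pi μ).prod (μ' j)).map (fun p => Function.update p.1 j p.2) = Measure.pi μ' := by
  symm
  refine Measure.pi_eq fun s hs => ?_
  rw [Measure.map_apply (measurable_update_prod j) (MeasurableSet.univ_pi hs)]
  have : (fun p : (ι → ℝ) × ℝ => Function.update p.1 j p.2) ⁻¹' (Set.univ.pi s) =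
      (Set.univ.pi (Function.update s j Set.univ)) ×ˢ s j := by
    ext p
    simp only [Set.mem_preimage, Set.mem_pi, Set.mem_univ, true_implies, Set.mem_prod]
    constructor
    · intro hp
      refine ⟨fun i => ?_, by simpa using hp j⟩
      rcases eq_or_ne i j with rfl | hi
      · simp
      · simpa [Function.update_of_ne hi] using hp i
    · rintro ⟨h1, h2⟩ i
      rcases eq_or_ne i j with rfl | hi
      · simpa using h2
      · simpa [Function.update_of_ne hi] using h1 i
  rw [this, Measure.prod_prod, Measure.pi_pi, ← Finset.mul_prod_erase _ _ (Finset.mem_univ j),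
    ← Finset.mul_prod_erase _ (fun i => μ' i (s i)) (Finset.mem_univ j)]
  simp only [Function.update_self, measure_univ, one_mul]
  rw [mul_comm]
  congr 1
  refine Finset.prod_congr rfl fun i hi => ?_
  have hij := Finset.ne_of_mem_erase hi
  rw [Function.update_of_ne hij, h i hij]

variable {E : Type*} [NormedAddCommGroup E] [NormedSpace ℝ E]

section
variable {μ μ' : ι → Measure ℝ} [∀ i, IsProbabilityMeasure (μ i)]
    [∀ i, IsProbabilityMeasure (μ' i)] {F : (ι → ℝ) → E} {M : ℝ}

lemma integrable_prod_update (j : ι) (h : ∀ i, i ≠ j → μ i = μ' i)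
    (hF : Integrable F (Measure.pi μ')) :
    Integrable (fun p : (ι → ℝ) × ℝ => F (Function.update p.1 j p.2))
      ((Measure.pi μ).prod (μ' j)) := by
  rw [← pi_prod_map_update j h] at hF
  exact (integrable_map_measure hF.aestronglyMeasurable
    (measurable_update_prod j).aemeasurable).1 hF

lemma integral_pi_eq_update (j : ι) (h : ∀ i, i ≠ j → μ i = μ' i)
    (hF : Integrable F (Measure.pi μ')) :
    ∫ ξ, F ξ ∂Measure.pi μ' =
      ∫ ξ, ∫ x, F (Function.update ξ j x) ∂μ' j ∂Measure.pi μ := by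
  have hi := integrable_prod_update j h hF
  rw [← integral_prod _ hi, ← integral_map (measurable_update_prod j).aemeasurable
    (f := F), pi_prod_map_update j h]
  rw [pi_prod_map_update j h]
  exact hF.aestronglyMeasurable

lemma integrable_integral_update (j : ι) (h : ∀ i, i ≠ j → μ i = μ' i)
    (hF : Integrable F (Measure.pi μ')) :
    Integrable (fun ξ => ∫ x, F (Function.update ξ j x) ∂μ' j) (Measure.pi μ) :=
  (integrable_prod_update j h hF).integral_prod_left
end

lemma integrable_pi_of_bound {μ : ι → Measure ℝ} [∀ i, IsProbabilityMeasure (μ i)]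
    {F : (ι → ℝ) → E} [SecondCountableTopology E] {M : ℝ} (hF : Continuous F)
    (hM : ∀ ξ, ‖F ξ‖ ≤ M) :
    Integrable F (Measure.pi μ) := by
  borelize E
  exact Integrable.of_bound hF.aestronglyMeasurable M (Filter.Eventually.of_forall hM)

/-- The product of the laws `μ₁ i` for `i ∈ S` and `μ₀ i` for `i ∉ S`. -/
def hybrid (μ₁ μ₀ : ι → Measure ℝ) (S : Finset ι) (i : ι) : Measure ℝ :=
  if i ∈ S then μ₁ i else μ₀ i

instance (μ₁ μ₀ : ι → Measure ℝ) [∀ i, IsProbabilityMeasure (μ₁ i)]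
    [∀ i, IsProbabilityMeasure (μ₀ i)] (S : Finset ι) (i : ι) :
    IsProbabilityMeasure (hybrid μ₁ μ₀ S i) := by
  unfold hybrid; split_ifs <;> infer_instance

lemma hybrid_univ (μ₁ μ₀ : ι → Measure ℝ) : hybrid μ₁ μ₀ Finset.univ = μ₁ := by
  ext1 i; simp [hybrid]

lemma hybrid_empty (μ₁ μ₀ : ι → Measure ℝ) : hybrid μ₁ μ₀ ∅ = μ₀ := by
  ext1 i; simp [hybrid]

lemma hybrid_insert_of_ne (μ₁ μ₀ : ι → Measure ℝ) (S : Finset ι) {i j : ι} (h : i ≠ j) :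
    hybrid μ₁ μ₀ S i = hybrid μ₁ μ₀ (insert j S) i := by
  simp [hybrid, h]

/-- One-dimensional comparisons with the standard normal law tensorize. -/
lemma integral_pi_le_of_coord_le {μ : ι → Measure ℝ} [∀ i, IsProbabilityMeasure (μ i)]
    {F : (ι → ℝ) → ℝ} {M : ℝ} (hF : Continuous F) (hM : ∀ ξ, ‖F ξ‖ ≤ M) (hF0 : ∀ ξ, 0 ≤ F ξ)
    {a c : ι → ℝ} (ha : ∀ i, 1 ≤ a i) (hc : ∀ i, 0 ≤ c i)
    (h : ∀ j ξ, ∫ x, F (Function.update ξ j x) ∂μ j ≤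
      a j * ∫ x, F (Function.update ξ j x) ∂stdNormal + c j) :
    ∫ ξ, F ξ ∂Measure.pi μ ≤
      (∏ i, a i) * (∫ ξ, F ξ ∂Measure.pi (fun _ : ι => stdNormal) + ∑ i, c i) := by
  set γ : ι → Measure ℝ := fun _ => stdNormal with hγ
  have key : ∀ S : Finset ι, ∫ ξ, F ξ ∂Measure.pi (hybrid μ γ S) ≤
      (∏ i ∈ S, a i) * (∫ ξ, F ξ ∂Measure.pi γ + ∑ i ∈ S, c i) := by
    intro S
    induction S using Finset.induction_on with
    | empty => simp [hybrid_empty]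
    | insert j S hj ih =>
      have e1 := integral_pi_eq_update (μ := hybrid μ γ S) (μ' := hybrid μ γ (insert j S)) j
        (fun i hi => hybrid_insert_of_ne μ γ S hi) (integrable_pi_of_bound hF hM)
      have i1 := integrable_integral_update (μ := hybrid μ γ S) (μ' := hybrid μ γ (insert j S)) j
        (fun i hi => hybrid_insert_of_ne μ γ S hi) (integrable_pi_of_bound hF hM)
      have e2 := integral_pi_eq_update (μ := hybrid μ γ S) (μ' := hybrid μ γ S) j
        (fun i hi => rfl) (integrable_pi_of_bound hF hM)
      have i2 := integrable_integral_update (μ := hybrid μ γ S) (μ' := hybrid μ γ S) j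
        (fun i hi => rfl) (integrable_pi_of_bound hF hM)
      have h1 : hybrid μ γ (insert j S) j = μ j := by simp [hybrid]
      have h2 : hybrid μ γ S j = stdNormal := by simp [hybrid, hj, hγ]
      rw [h1] at e1 i1
      rw [h2] at e2 i2
      have hP : 1 ≤ ∏ i ∈ S, a i := by
        calc (1 : ℝ) = ∏ i ∈ S, 1 := by simp
          _ ≤ _ := Finset.prod_le_prod (fun _ _ => zero_le_one) fun i _ => ha i
      have hI : 0 ≤ ∫ ξ, F ξ ∂Measure.pi γ := integral_nonneg hF0
      calc _ ≤ ∫ ξ, (a j * ∫ x, F (Function.update ξ j x) ∂stdNormal + c j)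
              ∂Measure.pi (hybrid μ γ S) := by
            rw [e1]
            exact integral_mono i1 ((i2.const_mul _).add (integrable_const _)) fun ξ => h j ξ
        _ = a j * ∫ ξ, F ξ ∂Measure.pi (hybrid μ γ S) + c j := by
            rw [integral_add (i2.const_mul _) (integrable_const _), integral_const_mul, ← e2]
            simp
        _ ≤ a j * ((∏ i ∈ S, a i) * (∫ ξ, F ξ ∂Measure.pi γ + ∑ i ∈ S, c i)) +
            (a j * ∏ i ∈ S, a i) * c j := by
            have h3 : 1 ≤ a j * ∏ i ∈ S, a i := one_le_mul_of_one_le_of_one_le (ha j) hP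
            have h4 := le_mul_of_one_le_left (hc j) h3
            have h5 := mul_le_mul_of_nonneg_left ih (zero_le_one.trans (ha j))
            linarith
        _ = _ := by
            rw [Finset.prod_insert hj, Finset.sum_insert hj]; ring
  have := key Finset.univ
  rwa [hybrid_univ] at this

/-- Telescoping: exchange the factors of a product measure one at a time. -/
lemma norm_integral_pi_sub_le {μ₁ μ₀ : ι → Measure ℝ} [∀ i, IsProbabilityMeasure (μ₁ i)]
    [∀ i, IsProbabilityMeasure (μ₀ i)] {F : (ι → ℝ) → ℂ} {M : ℝ} (hF : Continuous F)
    (hM : ∀ ξ, ‖F ξ‖ ≤ M) {ε : ι → ℝ} {B : ι → (ι → ℝ) → ℝ}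
    (hB : ∀ j ξ, ‖∫ x, F (Function.update ξ j x) ∂μ₁ j - ∫ x, F (Function.update ξ j x) ∂μ₀ j‖ ≤
      B j ξ)
    (hBi : ∀ j S, Integrable (B j) (Measure.pi (hybrid μ₁ μ₀ S)))
    (hε : ∀ j S, j ∉ S → ∫ ξ, B j ξ ∂Measure.pi (hybrid μ₁ μ₀ S) ≤ ε j) :
    ‖∫ ξ, F ξ ∂Measure.pi μ₁ - ∫ ξ, F ξ ∂Measure.pi μ₀‖ ≤ ∑ j, ε j := by
  have key : ∀ S : Finset ι, ‖∫ ξ, F ξ ∂Measure.pi (hybrid μ₁ μ₀ S) -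
      ∫ ξ, F ξ ∂Measure.pi μ₀‖ ≤ ∑ j ∈ S, ε j := by
    intro S
    induction S using Finset.induction_on with
    | empty => simp [hybrid_empty]
    | insert j S hj ih =>
      have e1 := integral_pi_eq_update (μ := hybrid μ₁ μ₀ S) (μ' := hybrid μ₁ μ₀ (insert j S)) j
        (fun i hi => hybrid_insert_of_ne μ₁ μ₀ S hi) (integrable_pi_of_bound hF hM)
      have i1 := integrable_integral_update (μ := hybrid μ₁ μ₀ S)
        (μ' := hybrid μ₁ μ₀ (insert j S)) j
        (fun i hi => hybrid_insert_of_ne μ₁ μ₀ S hi) (integrable_pi_of_bound hF hM)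
      have e2 := integral_pi_eq_update (μ := hybrid μ₁ μ₀ S) (μ' := hybrid μ₁ μ₀ S) j
        (fun i hi => rfl) (integrable_pi_of_bound hF hM)
      have i2 := integrable_integral_update (μ := hybrid μ₁ μ₀ S) (μ' := hybrid μ₁ μ₀ S) j
        (fun i hi => rfl) (integrable_pi_of_bound hF hM)
      have h1 : hybrid μ₁ μ₀ (insert j S) j = μ₁ j := by simp [hybrid]
      have h2 : hybrid μ₁ μ₀ S j = μ₀ j := by simp [hybrid, hj]
      rw [h1] at e1 i1
      rw [h2] at e2 i2
      have h3 : ‖∫ ξ, F ξ ∂Measure.pi (hybrid μ₁ μ₀ (insert j S)) -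
          ∫ ξ, F ξ ∂Measure.pi (hybrid μ₁ μ₀ S)‖ ≤ ε j := by
        rw [e1, e2, ← integral_sub i1 i2]
        exact (norm_integral_le_of_norm_le (hBi j S)
          (Filter.Eventually.of_forall (hB j))).trans (hε j S hj)
      rw [Finset.sum_insert hj]
      calc _ = ‖(∫ ξ, F ξ ∂Measure.pi (hybrid μ₁ μ₀ (insert j S)) -
          ∫ ξ, F ξ ∂Measure.pi (hybrid μ₁ μ₀ S)) + (∫ ξ, F ξ ∂Measure.pi (hybrid μ₁ μ₀ S) -
          ∫ ξ, F ξ ∂Measure.pi μ₀)‖ := by congr 1; ring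
        _ ≤ _ := (norm_add_le _ _).trans (add_le_add h3 ih)
  have := key Finset.univ
  rwa [hybrid_univ] at this

end Product

end

/-! ### Linear statistics of a rotated vector -/

section

open scoped Matrix ContDiff

variable {ι : Type*} [Fintype ι] [DecidableEq ι]

/-- `O` is orthogonal and its entries are as spread out as `η ^ 2 ≈ d ^ (-1 / 2)` allows, with `d`
the dimension. -/
structure Incoherent (O : Matrix ι ι ℝ) (η : ℝ) : Prop where
  mul_transpose : O * Oᵀ = 1
  transpose_mul : Oᵀ * O = 1
  abs_le : ∀ i j, |O i j| ≤ η ^ 2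
  eta_pos : 0 < η
  eta_le : η ≤ 1
  card_le : (Fintype.card ι : ℝ) * η ^ 4 ≤ 2

/-- `p` is smooth, and `p` and its first four derivatives are bounded by `A`. -/
structure SmoothBounded (p : ℝ → ℝ) (A : ℝ) : Prop where
  smooth : ContDiff ℝ ∞ p
  bound : ∀ m ≤ 4, ∀ x, |iteratedDeriv m p x| ≤ A

lemma hasDerivAt_iteratedDeriv {p : ℝ → ℝ} (h : ContDiff ℝ ∞ p) (m : ℕ) (x : ℝ) :
    HasDerivAt (iteratedDeriv m p) (iteratedDeriv (m + 1) p x) x := by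
  rw [iteratedDeriv_succ]
  exact ((h.differentiable_iteratedDeriv m (by exact_mod_cast WithTop.coe_lt_top _)) x).hasDerivAt

lemma continuous_iteratedDeriv {p : ℝ → ℝ} (h : ContDiff ℝ ∞ p) (m : ℕ) :
    Continuous (iteratedDeriv m p) :=
  continuous_iff_continuousAt.2 fun x => (hasDerivAt_iteratedDeriv h m x).continuousAt

lemma SmoothBounded.nonneg {p : ℝ → ℝ} {A : ℝ} (h : SmoothBounded p A) : 0 ≤ A :=
  (abs_nonneg _).trans (h.bound 0 (by norm_num) 0)

lemma SmoothBounded.abs_le {p : ℝ → ℝ} {A : ℝ} (h : SmoothBounded p A) (x : ℝ) : |p x| ≤ A := by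
  simpa using h.bound 0 (by norm_num) x

namespace Incoherent

variable {O : Matrix ι ι ℝ} {η : ℝ}

lemma sum_mul_col (h : Incoherent O η) (i j : ι) :
    ∑ n, O n i * O n j = if i = j then 1 else 0 := by
  have := congrFun (congrFun h.transpose_mul i) j
  simpa [Matrix.mul_apply, Matrix.one_apply] using this

lemma sum_sq_col (h : Incoherent O η) (j : ι) : ∑ n, O n j ^ 2 = 1 := by
  have := h.sum_mul_col j j
  simpa [sq] using this

lemma sum_abs_mul_le (h : Incoherent O η) (i j : ι) : ∑ n, |O n i * O n j| ≤ 1 := by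
  have h1 : ∀ n, |O n i * O n j| ≤ (O n i ^ 2 + O n j ^ 2) / 2 := fun n => by
    rw [_root_.abs_le]; constructor <;> nlinarith [sq_nonneg (O n i - O n j), sq_nonneg (O n i + O n j)]
  calc _ ≤ ∑ n, (O n i ^ 2 + O n j ^ 2) / 2 := Finset.sum_le_sum fun n _ => h1 n
    _ = 1 := by
      rw [← Finset.sum_div, Finset.sum_add_distrib, h.sum_sq_col, h.sum_sq_col]; norm_num

lemma mulVec_transpose_mulVec (h : Incoherent O η) (ξ : ι → ℝ) : Oᵀ *ᵥ (O *ᵥ ξ) = ξ := by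
  rw [Matrix.mulVec_mulVec, h.transpose_mul, Matrix.one_mulVec]

/-- The standard normal product law is invariant under orthogonal maps. -/
lemma measurePreserving (h : Incoherent O η) :
    MeasurePreserving (fun ξ : ι → ℝ => O *ᵥ ξ) (Measure.pi fun _ => stdNormal)
      (Measure.pi fun _ => stdNormal) := by
  have hm : Measurable (fun ξ : ι → ℝ => O *ᵥ ξ) :=
    (Continuous.matrix_mulVec continuous_const continuous_id).measurable
  refine ⟨hm, ?_⟩
  let L : EuclideanSpace ℝ ι →ₗᵢ[ℝ] EuclideanSpace ℝ ι :=
    { toLinearMap := Matrix.toEuclideanLin O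
      norm_map' := fun x => by
        rw [← sq_eq_sq₀ (norm_nonneg _) (norm_nonneg _), EuclideanSpace.real_norm_sq_eq,
          EuclideanSpace.real_norm_sq_eq]
        have h1 : (Matrix.toEuclideanLin O x).ofLp = O *ᵥ x.ofLp := rfl
        have h2 : (O *ᵥ x.ofLp) ⬝ᵥ (O *ᵥ x.ofLp) = x.ofLp ⬝ᵥ x.ofLp := by
          rw [Matrix.dotProduct_mulVec, Matrix.vecMul_mulVec, h.transpose_mul,
            Matrix.vecMul_one]
        simpa [h1, dotProduct, sq] using h2 }
  have hL := stdGaussian_map (L.toLinearIsometryEquiv rfl)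
  rw [← map_pi_eq_stdGaussian, Measure.map_map (by fun_prop) (by fun_prop)] at hL
  have h3 : (Measure.pi fun _ : ι => stdNormal) =
      ((Measure.pi fun _ : ι => stdNormal).map (WithLp.toLp 2)).map
        (WithLp.ofLp (p := 2) (V := ι → ℝ)) := by
    rw [Measure.map_map (by fun_prop) (by fun_prop)]
    exact Measure.map_id.symm
  conv_rhs => rw [h3, ← hL]
  rw [Measure.map_map (by fun_prop) (by fun_prop)]
  rfl

end Incoherent

lemma mulVec_update_apply (O : Matrix ι ι ℝ) (ξ : ι → ℝ) (j : ι) (x : ℝ) (n : ι) :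
    (O *ᵥ Function.update ξ j x) n = (O *ᵥ ξ) n + O n j * (x - ξ j) := by
  have : Function.update ξ j x = ξ + Pi.single j (x - ξ j) := by
    ext i
    rcases eq_or_ne i j with rfl | h
    · simp
    · simp [h]
  rw [this, Matrix.mulVec_add, Matrix.mulVec_single]
  simp

section Line

variable {E : Type*} [NormedAddCommGroup E] [NormedSpace ℝ E]

lemma hasDerivAt_sum_mulVec_update {φ φ' : ι → ℝ → E} (h : ∀ n x, HasDerivAt (φ n) (φ' n x) x)
    (O : Matrix ι ι ℝ) (ξ : ι → ℝ) (j : ι) (m : ℕ) (x : ℝ) :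
    HasDerivAt (fun x => ∑ n, O n j ^ m • φ n ((O *ᵥ Function.update ξ j x) n))
      (∑ n, O n j ^ (m + 1) • φ' n ((O *ᵥ Function.update ξ j x) n)) x := by
  refine HasDerivAt.fun_sum fun n _ => ?_
  have h1 : HasDerivAt (fun x => (O *ᵥ Function.update ξ j x) n) (O n j) x := by
    simp only [mulVec_update_apply]
    simpa using (((hasDerivAt_id x).sub_const (ξ j)).const_mul (O n j)).const_add ((O *ᵥ ξ) n)
  have h2 := ((h n _).scomp x h1).const_smul (O n j ^ m)
  rw [smul_smul, ← pow_succ] at h2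
  exact h2

end Line

lemma continuous_mulVec_apply (O : Matrix ι ι ℝ) (n : ι) :
    Continuous fun ξ : ι → ℝ => (O *ᵥ ξ) n :=
  (continuous_apply n).comp (Continuous.matrix_mulVec continuous_const continuous_id)

/-- The linear statistic `∑ₙ wₙ p((O ξ)ₙ)`. -/
noncomputable def linStat (O : Matrix ι ι ℝ) (w : ι → ℝ) (p : ℝ → ℝ) (ξ : ι → ℝ) : ℝ :=
  ∑ n, w n * p ((O *ᵥ ξ) n)

/-- The `m`-th derivative of `linStat` in the coordinate `j`. -/
noncomputable def linStatDeriv (O : Matrix ι ι ℝ) (w : ι → ℝ) (p : ℝ → ℝ) (j : ι) (m : ℕ)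
    (ξ : ι → ℝ) : ℝ :=
  ∑ n, O n j ^ m • (w n * iteratedDeriv m p ((O *ᵥ ξ) n))

lemma linStatDeriv_zero (O : Matrix ι ι ℝ) (w : ι → ℝ) (p : ℝ → ℝ) (j : ι) (ξ : ι → ℝ) :
    linStatDeriv O w p j 0 ξ = linStat O w p ξ := by
  simp [linStatDeriv, linStat]

lemma hasDerivAt_linStatDeriv (O : Matrix ι ι ℝ) (w : ι → ℝ) {p : ℝ → ℝ} (hp : ContDiff ℝ ∞ p)
    (j : ι) (m : ℕ) (ξ : ι → ℝ) (x : ℝ) :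
    HasDerivAt (fun x => linStatDeriv O w p j m (Function.update ξ j x))
      (linStatDeriv O w p j (m + 1) (Function.update ξ j x)) x :=
  hasDerivAt_sum_mulVec_update (φ := fun n z => w n * iteratedDeriv m p z)
    (φ' := fun n z => w n * iteratedDeriv (m + 1) p z)
    (fun n z => (hasDerivAt_iteratedDeriv hp m z).const_mul (w n)) O ξ j m x

lemma continuous_linStat (O : Matrix ι ι ℝ) (w : ι → ℝ) {p : ℝ → ℝ} (hp : Continuous p) :
    Continuous (linStat O w p) :=
  continuous_finsetSum _ fun n _ => continuous_const.mul (hp.comp (continuous_mulVec_apply O n))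

/-- Each differentiation in one coordinate gains a factor of the size of an entry of `O`. -/
lemma abs_linStatDeriv_le {O : Matrix ι ι ℝ} {η : ℝ} (hO : Incoherent O η) {w : ι → ℝ}
    (hw : ∑ n, |w n| ≤ 1) {p : ℝ → ℝ} {A : ℝ} (hp : SmoothBounded p A) (j : ι) {m : ℕ}
    (hm : m ≤ 4) (ξ : ι → ℝ) : |linStatDeriv O w p j m ξ| ≤ A * η ^ (2 * m) := by
  have hA := hp.nonneg
  calc _ ≤ ∑ n, |O n j ^ m • (w n * iteratedDeriv m p ((O *ᵥ ξ) n))| :=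
        Finset.abs_sum_le_sum_abs _ _
    _ ≤ ∑ n, (η ^ 2) ^ m * (|w n| * A) := by
        refine Finset.sum_le_sum fun n _ => ?_
        rw [smul_eq_mul, abs_mul, abs_mul, abs_pow]
        have h1 := pow_le_pow_left₀ (abs_nonneg _) (hO.abs_le n j) m
        have h2 := hp.bound m hm ((O *ᵥ ξ) n)
        gcongr
    _ = (η ^ 2) ^ m * A * ∑ n, |w n| := by rw [Finset.mul_sum]; congr 1; ext n; ring
    _ ≤ (η ^ 2) ^ m * A * 1 := by
        have := hO.eta_pos
        gcongr
    _ = _ := by rw [pow_mul]; ring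

lemma abs_linStat_le {O : Matrix ι ι ℝ} {w : ι → ℝ}
    (hw : ∑ n, |w n| ≤ 1) {p : ℝ → ℝ} {A : ℝ} (hp : SmoothBounded p A) (ξ : ι → ℝ) :
    |linStat O w p ξ| ≤ A := by
  have h0 : ∀ x, |p x| ≤ A := hp.abs_le
  calc _ ≤ ∑ n, |w n * p ((O *ᵥ ξ) n)| := Finset.abs_sum_le_sum_abs _ _
    _ ≤ ∑ n, |w n| * A := Finset.sum_le_sum fun n _ => by
        rw [abs_mul]; exact mul_le_mul_of_nonneg_left (h0 _) (abs_nonneg _)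
    _ ≤ A := by rw [← Finset.sum_mul]; exact mul_le_of_le_one_left hp.nonneg hw

lemma abs_linStat_update_sub_le {O : Matrix ι ι ℝ} {η : ℝ} (hO : Incoherent O η) {w : ι → ℝ}
    (hw : ∑ n, |w n| ≤ 1) {p : ℝ → ℝ} {A : ℝ} (hp : SmoothBounded p A) (ξ : ι → ℝ) (j : ι)
    (x y : ℝ) :
    |linStat O w p (Function.update ξ j x) - linStat O w p (Function.update ξ j y)| ≤
      A * η ^ 2 * |x - y| := by
  have := convex_univ.norm_image_sub_le_of_norm_hasDerivWithin_le
    (f := fun x => linStatDeriv O w p j 0 (Function.update ξ j x)) (C := A * η ^ 2) (x := y)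
    (y := x) (fun z _ => (hasDerivAt_linStatDeriv O w hp.smooth j 0 ξ z).hasDerivWithinAt)
    (fun z _ => abs_linStatDeriv_le hO hw hp j (by norm_num) _) (Set.mem_univ _) (Set.mem_univ _)
  simpa [linStatDeriv_zero] using this

end

/-! ### Exponential moments of linear statistics -/

section

open scoped Matrix ContDiff

/-- The chain of derivatives of `exp ∘ L`. -/
lemma hasDerivAt_exp_chain {L0 L1 L2 L3 L4 : ℝ → ℂ} (h0 : ∀ x, HasDerivAt L0 (L1 x) x)
    (h1 : ∀ x, HasDerivAt L1 (L2 x) x) (h2 : ∀ x, HasDerivAt L2 (L3 x) x)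
    (h3 : ∀ x, HasDerivAt L3 (L4 x) x) (x : ℝ) :
    HasDerivAt (fun x => Complex.exp (L0 x)) (Complex.exp (L0 x) * L1 x) x ∧
    HasDerivAt (fun x => Complex.exp (L0 x) * L1 x)
      (Complex.exp (L0 x) * (L1 x ^ 2 + L2 x)) x ∧
    HasDerivAt (fun x => Complex.exp (L0 x) * (L1 x ^ 2 + L2 x))
      (Complex.exp (L0 x) * (L1 x ^ 3 + 3 * L1 x * L2 x + L3 x)) x ∧
    HasDerivAt (fun x => Complex.exp (L0 x) * (L1 x ^ 3 + 3 * L1 x * L2 x + L3 x))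
      (Complex.exp (L0 x) * (L1 x ^ 4 + 6 * L1 x ^ 2 * L2 x + 3 * L2 x ^ 2 + 4 * L1 x * L3 x
        + L4 x)) x := by
  have e := (h0 x).cexp
  refine ⟨e, (e.fun_mul (h1 x)).congr_deriv (by ring), ?_, ?_⟩
  · refine (e.fun_mul (((h1 x).fun_pow 2).fun_add (h2 x))).congr_deriv ?_
    push_cast; ring
  · refine (e.fun_mul ((((h1 x).fun_pow 3).fun_add (((h1 x).const_mul 3).fun_mul (h2 x))).fun_add
      (h3 x))).congr_deriv ?_
    push_cast; ring

lemma norm_exp_chain_le (l1 l2 l3 l4 : ℂ) :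
    ‖l1 ^ 4 + 6 * l1 ^ 2 * l2 + 3 * l2 ^ 2 + 4 * l1 * l3 + l4‖ ≤
      ‖l1‖ ^ 4 + 6 * ‖l1‖ ^ 2 * ‖l2‖ + 3 * ‖l2‖ ^ 2 + 4 * ‖l1‖ * ‖l3‖ + ‖l4‖ := by
  refine (norm_add_le _ _).trans (add_le_add_left ((norm_add_le _ _).trans (add_le_add
    ((norm_add_le _ _).trans (add_le_add ((norm_add_le _ _).trans (add_le_add ?_ ?_)) ?_)) ?_)) _)
  all_goals simp

variable {ι : Type*} [Fintype ι] [DecidableEq ι]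

/-- Every coordinate is a fair sign or a standard normal, except for at most two coordinates, which
are frozen at values in `[-1, 1]`. -/
structure Mixed (μ : ι → Measure ℝ) (J : Finset ι) : Prop where
  card_le : J.card ≤ 2
  off : ∀ i ∉ J, μ i = rademacher ∨ μ i = stdNormal
  on : ∀ i ∈ J, ∃ b : ℝ, |b| ≤ 1 ∧ μ i = Measure.dirac b

variable {O : Matrix ι ι ℝ} {η : ℝ} {w : ι → ℝ} {p : ℝ → ℝ} {μ : ι → Measure ℝ} {J : Finset ι}

/-- For normal inputs the summands are independent, and a centred bounded summand contributes only
in second order. -/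
lemma integral_exp_linStat_stdNormal_le (hO : Incoherent O η) (hw4 : ∀ n, |w n| ≤ η ^ 4)
    (hw : ∑ n, |w n| ≤ 1) (hp : SmoothBounded p 1) (hp0 : ∫ x, p x ∂stdNormal = 0) {θ : ℝ}
    (hθ : |θ| * η ^ 2 ≤ 1) :
    ∫ ξ, Real.exp (θ * linStat O w p ξ) ∂Measure.pi (fun _ : ι => stdNormal) ≤ Real.exp 1 := by
  have hη := hO.eta_pos
  have hpc : Continuous p := hp.smooth.continuous
  have h1 : ∀ n, |θ * w n| ≤ 1 := fun n => by
    rw [abs_mul]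
    calc |θ| * |w n| ≤ |θ| * η ^ 4 := mul_le_mul_of_nonneg_left (hw4 n) (abs_nonneg _)
      _ = |θ| * η ^ 2 * η ^ 2 := by ring
      _ ≤ 1 * 1 := by gcongr; exact pow_le_one₀ hη.le hO.eta_le
      _ = 1 := one_mul 1
  have h2 : ∀ n, ∫ x, Real.exp (θ * w n * p x) ∂stdNormal ≤ Real.exp ((θ * w n) ^ 2) := fun n => by
    have hb : ∀ x, Real.exp (θ * w n * p x) ≤ 1 + θ * w n * p x + (θ * w n) ^ 2 := fun x => by
      have h3 : |θ * w n * p x| ≤ 1 := by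
        rw [abs_mul]; exact mul_le_one₀ (h1 n) (abs_nonneg _) (hp.abs_le x)
      have h4 := (abs_le.1 (Real.abs_exp_sub_one_sub_id_le h3)).2
      have h5 : (θ * w n * p x) ^ 2 ≤ (θ * w n) ^ 2 := by
        rw [mul_pow]
        refine mul_le_of_le_one_right (sq_nonneg _) ?_
        rw [sq_le_one_iff_abs_le_one]; exact hp.abs_le x
      linarith
    have hpi : Integrable p stdNormal := Integrable.of_bound (by fun_prop) 1
      (Filter.Eventually.of_forall hp.abs_le)
    calc _ ≤ ∫ x, (1 + θ * w n * p x + (θ * w n) ^ 2) ∂stdNormal := by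
          refine integral_mono (Integrable.of_bound (by fun_prop) (Real.exp 1)
            (Filter.Eventually.of_forall fun x => ?_))
            (((integrable_const _).add (hpi.const_mul _)).add (integrable_const _)) hb
          rw [Real.norm_eq_abs, abs_of_pos (Real.exp_pos _), Real.exp_le_exp]
          refine (le_abs_self _).trans ?_
          rw [abs_mul]; exact mul_le_one₀ (h1 n) (abs_nonneg _) (hp.abs_le x)
      _ = 1 + (θ * w n) ^ 2 := by
          have hi : Integrable (fun x => 1 + θ * w n * p x) stdNormal :=
            (integrable_const _).add (hpi.const_mul _)
          rw [integral_add hi (integrable_const _),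
            integral_add (integrable_const _) (hpi.const_mul _), integral_const_mul, hp0]
          simp
      _ ≤ _ := by rw [add_comm]; exact Real.add_one_le_exp _
  calc _ = ∫ z, Real.exp (θ * ∑ n, w n * p (z n)) ∂Measure.pi (fun _ : ι => stdNormal) := by
        conv_rhs => rw [← hO.measurePreserving.map_eq]
        rw [integral_map hO.measurePreserving.aemeasurable]
        · rfl
        · exact Continuous.aestronglyMeasurable (by fun_prop)
    _ = ∫ z, ∏ n, Real.exp (θ * w n * p (z n)) ∂Measure.pi (fun _ : ι => stdNormal) := by
        congr 1; ext z; rw [Finset.mul_sum, Real.exp_sum]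
        exact Finset.prod_congr rfl fun n _ => by rw [mul_assoc]
    _ = ∏ n, ∫ x, Real.exp (θ * w n * p x) ∂stdNormal :=
        integral_fintype_prod_eq_prod (fun n x => Real.exp (θ * w n * p x))
    _ ≤ ∏ n, Real.exp ((θ * w n) ^ 2) := Finset.prod_le_prod
        (fun n _ => integral_nonneg fun x => (Real.exp_pos _).le) fun n _ => h2 n
    _ = Real.exp (∑ n, (θ * w n) ^ 2) := (Real.exp_sum _ _).symm
    _ ≤ Real.exp 1 := by
        rw [Real.exp_le_exp]
        have h6 : ∀ n, (θ * w n) ^ 2 ≤ |w n| := fun n => by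
          rw [← sq_abs, abs_mul, mul_pow, sq |w n|, ← mul_assoc]
          refine mul_le_of_le_one_left (abs_nonneg _) ?_
          calc |θ| ^ 2 * |w n| ≤ |θ| ^ 2 * η ^ 4 := by gcongr; exact hw4 n
            _ = (|θ| * η ^ 2) ^ 2 := by ring
            _ ≤ 1 := pow_le_one₀ (by positivity) hθ
        exact (Finset.sum_le_sum fun n _ => h6 n).trans hw

/-- A uniform bound for the exponential moments of order `1 / η` of a linear statistic. -/
noncomputable def expConst : ℝ :=
  Real.exp (30 * swapConst * dominationConst) * dominationConst ^ 2 * Real.exp 1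

lemma expConst_pos : 0 < expConst := by
  have := one_le_dominationConst
  unfold expConst; positivity

/-- Exchanging a normal coordinate for a sign barely changes the exponential moment; freezing it
costs a constant factor. -/
lemma integral_exp_linStat_rademacher_le (hO : Incoherent O η) (hw : ∑ n, |w n| ≤ 1)
    (hp : SmoothBounded p 1) {θ : ℝ} (hθ : |θ| * η ≤ 1) (j : ι) (ξ : ι → ℝ) :
    ∫ x, Real.exp (θ * linStat O w p (Function.update ξ j x)) ∂rademacher ≤
      (1 + 15 * swapConst * dominationConst * η ^ 4) *
        ∫ x, Real.exp (θ * linStat O w p (Function.update ξ j x)) ∂stdNormal ∧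
    ∀ b : ℝ, |b| ≤ 1 → Real.exp (θ * linStat O w p (Function.update ξ j b)) ≤
      dominationConst * ∫ x, Real.exp (θ * linStat O w p (Function.update ξ j x)) ∂stdNormal := by
  have hη := hO.eta_pos
  have hη1 := hO.eta_le
  set Z : ℕ → ℝ → ℝ := fun m x => linStatDeriv O w p j m (Function.update ξ j x) with hZ
  have hZ0 : ∀ x, linStat O w p (Function.update ξ j x) = Z 0 x := fun x =>
    (linStatDeriv_zero O w p j _).symm
  have hd : ∀ m x, HasDerivAt (Z m) (Z (m + 1) x) x := fun m x =>
    hasDerivAt_linStatDeriv O w hp.smooth j m ξ x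
  have hb : ∀ m ≤ 4, ∀ x, |Z m x| ≤ η ^ (2 * m) := fun m hm x => by
    have := abs_linStatDeriv_le hO hw hp j hm (Function.update ξ j x)
    rwa [one_mul] at this
  simp only [hZ0]
  have hbdd : ∀ x, |θ * Z 0 x| ≤ |θ| := fun x => by
    rw [abs_mul]; exact mul_le_of_le_one_right (abs_nonneg _) (by simpa using hb 0 (by norm_num) x)
  have hcont : Continuous (Z 0) := continuous_iff_continuousAt.2 fun x => (hd 0 x).continuousAt
  have hint : Integrable (fun x => Real.exp (θ * Z 0 x)) stdNormal :=
    Integrable.of_bound (by fun_prop) (Real.exp |θ|) (Filter.Eventually.of_forall fun x => by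
      rw [Real.norm_eq_abs, abs_of_pos (Real.exp_pos _), Real.exp_le_exp]
      exact (le_abs_self _).trans (hbdd x))
  have hlip : ∀ x y, θ * Z 0 x - θ * Z 0 y ≤ |x - y| := fun x y => by
    have h1 := abs_linStat_update_sub_le hO hw hp ξ j x y
    rw [hZ0, hZ0, one_mul] at h1
    calc θ * Z 0 x - θ * Z 0 y ≤ |θ * (Z 0 x - Z 0 y)| := by
          rw [mul_sub]; exact le_abs_self _
      _ = |θ| * |Z 0 x - Z 0 y| := abs_mul _ _
      _ ≤ |θ| * (η ^ 2 * |x - y|) := mul_le_mul_of_nonneg_left h1 (abs_nonneg _)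
      _ = (|θ| * η) * η * |x - y| := by ring
      _ ≤ 1 * 1 * |x - y| := by gcongr
      _ = _ := by ring
  have hdom : ∀ b : ℝ, |b| ≤ 1 → Real.exp (θ * Z 0 b) ≤
      dominationConst * ∫ x, Real.exp (θ * Z 0 x) ∂stdNormal := fun b hb1 => by
    refine le_dominationConst_mul_integral hint fun x => ?_
    rw [← Real.exp_add, Real.exp_le_exp]
    have h1 := hlip b x
    have h2 : |b - x| ≤ 1 + |x| := (abs_sub _ _).trans (by linarith)
    linarith
  refine ⟨?_, hdom⟩
  have hchain := hasDerivAt_exp_chain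
    (L0 := fun x => ((θ * Z 0 x : ℝ) : ℂ)) (L1 := fun x => ((θ * Z 1 x : ℝ) : ℂ))
    (L2 := fun x => ((θ * Z 2 x : ℝ) : ℂ)) (L3 := fun x => ((θ * Z 3 x : ℝ) : ℂ))
    (L4 := fun x => ((θ * Z 4 x : ℝ) : ℂ))
    (fun x => ((hd 0 x).const_mul θ).ofReal_comp) (fun x => ((hd 1 x).const_mul θ).ofReal_comp)
    (fun x => ((hd 2 x).const_mul θ).ofReal_comp) (fun x => ((hd 3 x).const_mul θ).ofReal_comp)
  have hL : ∀ m, m ≤ 4 → ∀ x, ‖((θ * Z m x : ℝ) : ℂ)‖ ≤ |θ| * η ^ (2 * m) := fun m hm x => by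
    rw [Complex.norm_real, Real.norm_eq_abs, abs_mul]
    exact mul_le_mul_of_nonneg_left (hb m hm x) (abs_nonneg _)
  have hcmp := norm_rademacher_sub_stdNormal_le (fun x => (hchain x).1) (fun x => (hchain x).2.1)
    (fun x => (hchain x).2.2.1) (fun x => (hchain x).2.2.2)
    (B := 15 * η ^ 4 * Real.exp (θ * Z 0 0)) (fun x => by
      rw [norm_mul, ← Complex.ofReal_exp, Complex.norm_real, Real.norm_eq_abs,
        abs_of_pos (Real.exp_pos _)]
      have e1 : Real.exp (θ * Z 0 x) ≤ Real.exp (θ * Z 0 0) * Real.exp (5 * |x|) := by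
        rw [← Real.exp_add, Real.exp_le_exp]
        have := hlip x 0
        rw [sub_zero] at this
        have := abs_nonneg x
        linarith
      have k1 : |θ| * η ^ (2 * 1) ≤ η := by
        calc _ = (|θ| * η) * η := by ring
          _ ≤ _ := mul_le_of_le_one_left hη.le hθ
      have k2 : |θ| * η ^ (2 * 2) ≤ η ^ 3 := by
        calc _ = (|θ| * η) * η ^ 3 := by ring
          _ ≤ _ := mul_le_of_le_one_left (by positivity) hθ
      have k3 : |θ| * η ^ (2 * 3) ≤ η ^ 5 := by
        calc _ = (|θ| * η) * η ^ 5 := by ring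
          _ ≤ _ := mul_le_of_le_one_left (by positivity) hθ
      have k4 : |θ| * η ^ (2 * 4) ≤ η ^ 7 := by
        calc _ = (|θ| * η) * η ^ 7 := by ring
          _ ≤ _ := mul_le_of_le_one_left (by positivity) hθ
      have n1 := (hL 1 (by norm_num) x).trans k1
      have n2 := (hL 2 (by norm_num) x).trans k2
      have n3 := (hL 3 (by norm_num) x).trans k3
      have n4 := (hL 4 (by norm_num) x).trans k4
      have e2 := norm_exp_chain_le ((θ * Z 1 x : ℝ) : ℂ) ((θ * Z 2 x : ℝ) : ℂ)
        ((θ * Z 3 x : ℝ) : ℂ) ((θ * Z 4 x : ℝ) : ℂ)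
      have e3 : ‖((θ * Z 1 x : ℝ) : ℂ)‖ ^ 4 + 6 * ‖((θ * Z 1 x : ℝ) : ℂ)‖ ^ 2 *
          ‖((θ * Z 2 x : ℝ) : ℂ)‖ + 3 * ‖((θ * Z 2 x : ℝ) : ℂ)‖ ^ 2 +
          4 * ‖((θ * Z 1 x : ℝ) : ℂ)‖ * ‖((θ * Z 3 x : ℝ) : ℂ)‖ + ‖((θ * Z 4 x : ℝ) : ℂ)‖ ≤
          15 * η ^ 4 := by
        calc _ ≤ η ^ 4 + 6 * η ^ 2 * η ^ 3 + 3 * (η ^ 3) ^ 2 + 4 * η * η ^ 5 + η ^ 7 := by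
              gcongr
          _ = η ^ 4 * (1 + 6 * η + 3 * η ^ 2 + 4 * η ^ 2 + η ^ 3) := by ring
          _ ≤ η ^ 4 * (1 + 6 * 1 + 3 * 1 ^ 2 + 4 * 1 ^ 2 + 1 ^ 3) := by gcongr
          _ = _ := by ring
      calc _ ≤ Real.exp (θ * Z 0 0) * Real.exp (5 * |x|) * (15 * η ^ 4) :=
            mul_le_mul e1 (e2.trans e3) (norm_nonneg _) (by positivity)
        _ = _ := by ring)
  simp only [← Complex.ofReal_exp] at hcmp
  rw [integral_complex_ofReal, integral_complex_ofReal, ← Complex.ofReal_sub, Complex.norm_real,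
    Real.norm_eq_abs] at hcmp
  have h1 := (abs_le.1 hcmp).2
  have h2 := hdom 0 (by simp)
  have h3 : swapConst * (15 * η ^ 4 * Real.exp (θ * Z 0 0)) ≤ swapConst * (15 * η ^ 4 *
      (dominationConst * ∫ x, Real.exp (θ * Z 0 x) ∂stdNormal)) := by
    have := swapConst_pos
    gcongr
  linarith

lemma prod_ite_mem_le {a b : ℝ} (ha : 1 ≤ a) (hb : 1 ≤ b) {J : Finset ι} (hJ : J.card ≤ 2) :
    ∏ i, (if i ∈ J then b else a) ≤ a ^ Fintype.card ι * b ^ 2 := by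
  have h1 : ∀ i, (if i ∈ J then b else a) ≤ a * (if i ∈ J then b else 1) := fun i => by
    split_ifs
    · exact le_mul_of_one_le_left (by linarith) ha
    · simp
  calc _ ≤ ∏ i, (a * (if i ∈ J then b else 1)) :=
        Finset.prod_le_prod (fun i _ => by split_ifs <;> linarith) fun i _ => h1 i
    _ = a ^ Fintype.card ι * b ^ J.card := by
        rw [Finset.prod_mul_distrib, Finset.prod_const, Finset.prod_ite_mem, Finset.univ_inter,
          Finset.prod_const]; rfl
    _ ≤ _ := by gcongr

/-- Exponential moments of order `1 / η` of a linear statistic are bounded, uniformly over mixed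
inputs. -/
lemma integral_exp_linStat_le [∀ i, IsProbabilityMeasure (μ i)] (hO : Incoherent O η)
    (hw4 : ∀ n, |w n| ≤ η ^ 4) (hw : ∑ n, |w n| ≤ 1) (hp : SmoothBounded p 1)
    (hp0 : ∫ x, p x ∂stdNormal = 0) (hμ : Mixed μ J) {θ : ℝ} (hθ : |θ| * η ≤ 1) :
    ∫ ξ, Real.exp (θ * linStat O w p ξ) ∂Measure.pi μ ≤ expConst := by
  have hη := hO.eta_pos
  have hη1 := hO.eta_le
  have hs := swapConst_pos
  have hdc := one_le_dominationConst
  set a : ℝ := 1 + 15 * swapConst * dominationConst * η ^ 4 with ha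
  have ha1 : 1 ≤ a := by 
    have : 0 ≤ 15 * swapConst * dominationConst * η ^ 4 := by positivity
    linarith
  have hc : Continuous (linStat O w p) := continuous_linStat O w hp.smooth.continuous
  have hmain := integral_pi_le_of_coord_le (μ := μ)
    (F := fun ξ => Real.exp (θ * linStat O w p ξ)) (M := Real.exp |θ|) (by fun_prop)
    (fun ξ => by
      rw [Real.norm_eq_abs, abs_of_pos (Real.exp_pos _), Real.exp_le_exp]
      refine (le_abs_self _).trans ?_
      rw [abs_mul]; exact mul_le_of_le_one_right (abs_nonneg _) (abs_linStat_le hw hp ξ))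
    (fun ξ => (Real.exp_pos _).le) (a := fun i => if i ∈ J then dominationConst else a)
    (c := fun _ => 0) (fun i => by split_ifs <;> assumption) (fun i => le_rfl)
    (fun j ξ => by
      obtain ⟨h1, h2⟩ := integral_exp_linStat_rademacher_le hO hw hp hθ j ξ
      have h0 : 0 ≤ ∫ x, Real.exp (θ * linStat O w p (Function.update ξ j x)) ∂stdNormal :=
        integral_nonneg fun x => (Real.exp_pos _).le
      rw [add_zero]
      by_cases hj : j ∈ J
      · obtain ⟨b, hb, e⟩ := hμ.on j hj
        rw [e, integral_dirac, if_pos hj]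
        exact h2 b hb
      · rw [if_neg hj]
        rcases hμ.off j hj with e | e
        · rw [e]; exact h1
        · rw [e]; exact le_mul_of_one_le_left h0 ha1)
  refine hmain.trans ?_
  simp only [Finset.sum_const_zero, add_zero]
  have hb := integral_exp_linStat_stdNormal_le hO hw4 hw hp hp0 (θ := θ) (by
    calc |θ| * η ^ 2 = (|θ| * η) * η := by ring
      _ ≤ 1 * 1 := by gcongr
      _ = 1 := one_mul 1)
  have hprod := prod_ite_mem_le ha1 hdc hμ.card_le
  have hpow : a ^ Fintype.card ι ≤ Real.exp (30 * swapConst * dominationConst) := by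
    calc a ^ Fintype.card ι ≤ (Real.exp (15 * swapConst * dominationConst * η ^ 4)) ^
          Fintype.card ι := by
          gcongr
          rw [ha, add_comm]; exact Real.add_one_le_exp _
      _ = Real.exp (15 * swapConst * dominationConst * (Fintype.card ι * η ^ 4)) := by
          rw [← Real.exp_nat_mul]; congr 1; ring
      _ ≤ _ := by
          rw [Real.exp_le_exp]
          calc _ ≤ 15 * swapConst * dominationConst * 2 := by gcongr; exact hO.card_le
            _ = _ := by ring
  unfold expConst
  exact mul_le_mul (hprod.trans (by gcongr)) hb
    (integral_nonneg fun x => (Real.exp_pos _).le) (by positivity)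

end

/-! ### Second and fourth moments of linear statistics -/

section

open scoped Matrix ContDiff
variable {ι : Type*} [Fintype ι] [DecidableEq ι]
variable {O : Matrix ι ι ℝ} {η : ℝ} {w : ι → ℝ} {p : ℝ → ℝ} {μ : ι → Measure ℝ} {J : Finset ι}

lemma pow_abs_le_exp_add_exp (n : ℕ) (x : ℝ) :
    |x| ^ n ≤ n.factorial * (Real.exp x + Real.exp (-x)) := by
  refine (pow_abs_le_exp n x).trans (mul_le_mul_of_nonneg_left ?_ (by positivity))
  rcases abs_cases x with h | h
  · rw [h.1]; have := Real.exp_pos (-x); linarith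
  · rw [h.1]; have := Real.exp_pos x; linarith

/-- A power is controlled by exponentials of any scale, at the price of that scale. -/
lemma pow_abs_le_of_scale (n : ℕ) {s : ℝ} (hs : 0 < s) (z : ℝ) :
    |z| ^ n ≤ n.factorial * s ^ n * (Real.exp (s⁻¹ * z) + Real.exp (-s⁻¹ * z)) := by
  have h := pow_abs_le_exp_add_exp n (s⁻¹ * z)
  rw [abs_mul, mul_pow, abs_of_pos (inv_pos.2 hs), ← neg_mul] at h
  have h2 : |z| ^ n = s ^ n * (s⁻¹ ^ n * |z| ^ n) := by
    rw [← mul_assoc, ← mul_pow, mul_inv_cancel₀ hs.ne', one_pow, one_mul]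
  rw [h2]
  calc _ ≤ s ^ n * _ := mul_le_mul_of_nonneg_left h (by positivity)
    _ = _ := by ring

lemma integrable_exp_linStat [∀ i, IsProbabilityMeasure (μ i)] (hw : ∑ n, |w n| ≤ 1)
    (hp : SmoothBounded p 1) (θ : ℝ) :
    Integrable (fun ξ => Real.exp (θ * linStat O w p ξ)) (Measure.pi μ) := by
  have hc : Continuous (linStat O w p) := continuous_linStat O w hp.smooth.continuous
  refine integrable_pi_of_bound (M := Real.exp |θ|) (by fun_prop) fun ξ => ?_
  rw [Real.norm_eq_abs, abs_of_pos (Real.exp_pos _), Real.exp_le_exp]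
  refine (le_abs_self _).trans ?_
  rw [abs_mul]; exact mul_le_of_le_one_right (abs_nonneg _) (abs_linStat_le hw hp ξ)

lemma integrable_pow_linStat [∀ i, IsProbabilityMeasure (μ i)] (hw : ∑ n, |w n| ≤ 1)
    {A : ℝ} (hp : SmoothBounded p A) (m : ℕ) :
    Integrable (fun ξ => |linStat O w p ξ| ^ m) (Measure.pi μ) := by
  have hc : Continuous (linStat O w p) := continuous_linStat O w hp.smooth.continuous
  refine integrable_pi_of_bound (M := A ^ m) (by fun_prop) fun ξ => ?_
  rw [Real.norm_eq_abs, abs_of_nonneg (by positivity)]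
  exact pow_le_pow_left₀ (abs_nonneg _) (abs_linStat_le hw hp ξ) m

lemma integral_pow_linStat_le_of_exp [∀ i, IsProbabilityMeasure (μ i)] (hw : ∑ n, |w n| ≤ 1)
    (hp : SmoothBounded p 1) {s D : ℝ} (hs : 0 < s)
    (h1 : ∫ ξ, Real.exp (s⁻¹ * linStat O w p ξ) ∂Measure.pi μ ≤ D)
    (h2 : ∫ ξ, Real.exp (-s⁻¹ * linStat O w p ξ) ∂Measure.pi μ ≤ D) (m : ℕ) :
    ∫ ξ, |linStat O w p ξ| ^ m ∂Measure.pi μ ≤ 2 * m.factorial * D * s ^ m := by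
  have i1 := integrable_exp_linStat (O := O) (μ := μ) hw hp s⁻¹
  have i2 := integrable_exp_linStat (O := O) (μ := μ) hw hp (-s⁻¹)
  calc _ ≤ ∫ ξ, m.factorial * s ^ m * (Real.exp (s⁻¹ * linStat O w p ξ) +
        Real.exp (-s⁻¹ * linStat O w p ξ)) ∂Measure.pi μ :=
        integral_mono (integrable_pow_linStat hw hp m) ((i1.add i2).const_mul _)
          fun ξ => pow_abs_le_of_scale m hs _
    _ = m.factorial * s ^ m * (∫ ξ, Real.exp (s⁻¹ * linStat O w p ξ) ∂Measure.pi μ +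
        ∫ ξ, Real.exp (-s⁻¹ * linStat O w p ξ) ∂Measure.pi μ) := by
        rw [integral_const_mul, integral_add i1 i2]
    _ ≤ m.factorial * s ^ m * (D + D) := by gcongr
    _ = _ := by ring

lemma integral_sq_linStat_stdNormal_le (hO : Incoherent O η) (hw4 : ∀ n, |w n| ≤ η ^ 4)
    (hw : ∑ n, |w n| ≤ 1) (hp : SmoothBounded p 1) (hp0 : ∫ x, p x ∂stdNormal = 0) :
    ∫ ξ, |linStat O w p ξ| ^ 2 ∂Measure.pi (fun _ : ι => stdNormal) ≤
      4 * Real.exp 1 * η ^ 4 := by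
  have hη := hO.eta_pos
  have hs : (0 : ℝ) < η ^ 2 := by positivity
  have h := integral_pow_linStat_le_of_exp (O := O) (μ := fun _ : ι => stdNormal) hw hp hs
    (integral_exp_linStat_stdNormal_le hO hw4 hw hp hp0 (by
      rw [abs_of_pos (inv_pos.2 hs), inv_mul_cancel₀ hs.ne']))
    (integral_exp_linStat_stdNormal_le hO hw4 hw hp hp0 (by
      rw [abs_neg, abs_of_pos (inv_pos.2 hs), inv_mul_cancel₀ hs.ne'])) 2
  refine h.trans (le_of_eq ?_)
  simp [Nat.factorial]; ring

/-- Exchanging a normal coordinate for a sign, or freezing it, in the second moment. -/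
lemma integral_sq_linStat_coord_le (hO : Incoherent O η) (hw : ∑ n, |w n| ≤ 1)
    (hp : SmoothBounded p 1) (j : ι) (ξ : ι → ℝ) :
    ∫ x, |linStat O w p (Function.update ξ j x)| ^ 2 ∂rademacher ≤
      ∫ x, |linStat O w p (Function.update ξ j x)| ^ 2 ∂stdNormal + 16 * swapConst * η ^ 8 ∧
    ∀ b : ℝ, |b| ≤ 1 → |linStat O w p (Function.update ξ j b)| ^ 2 ≤
      2 * ∫ x, |linStat O w p (Function.update ξ j x)| ^ 2 ∂stdNormal + 8 * η ^ 4 := by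
  have hη := hO.eta_pos
  have hη1 := hO.eta_le
  set Z : ℕ → ℝ → ℝ := fun m x => linStatDeriv O w p j m (Function.update ξ j x) with hZ
  have hZ0 : ∀ x, linStat O w p (Function.update ξ j x) = Z 0 x := fun x =>
    (linStatDeriv_zero O w p j _).symm
  have hd : ∀ m x, HasDerivAt (Z m) (Z (m + 1) x) x := fun m x =>
    hasDerivAt_linStatDeriv O w hp.smooth j m ξ x
  have hb : ∀ m ≤ 4, ∀ x, |Z m x| ≤ η ^ (2 * m) := fun m hm x => by
    have := abs_linStatDeriv_le hO hw hp j hm (Function.update ξ j x)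
    rwa [one_mul] at this
  have hcont : Continuous (Z 0) := continuous_iff_continuousAt.2 fun x => (hd 0 x).continuousAt
  have hlip : ∀ x y, |Z 0 x - Z 0 y| ≤ η ^ 2 * |x - y| := fun x y => by
    have h1 := abs_linStat_update_sub_le hO hw hp ξ j x y
    rwa [hZ0, hZ0, one_mul] at h1
  simp only [hZ0, sq_abs]
  have hint : Integrable (fun x => Z 0 x ^ 2) stdNormal :=
    Integrable.of_bound (by fun_prop) 1 (Filter.Eventually.of_forall fun x => by
      have := hb 0 (by norm_num) x
      rw [Real.norm_eq_abs, abs_pow]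
      exact pow_le_one₀ (abs_nonneg _) (by simpa using this))
  constructor
  · have hcmp := norm_rademacher_sub_stdNormal_le (F := fun x => Z 0 x ^ 2)
      (F1 := fun x => 2 * Z 0 x * Z 1 x) (F2 := fun x => 2 * Z 1 x ^ 2 + 2 * Z 0 x * Z 2 x)
      (F3 := fun x => 6 * Z 1 x * Z 2 x + 2 * Z 0 x * Z 3 x)
      (F4 := fun x => 6 * Z 2 x ^ 2 + 8 * Z 1 x * Z 3 x + 2 * Z 0 x * Z 4 x)
      (fun x => ((hd 0 x).fun_pow 2).congr_deriv (by push_cast; ring))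
      (fun x => (((hd 0 x).const_mul 2).fun_mul (hd 1 x)).congr_deriv (by ring))
      (fun x => ((((hd 1 x).fun_pow 2).const_mul 2).fun_add
        (((hd 0 x).const_mul 2).fun_mul (hd 2 x))).congr_deriv (by push_cast; ring))
      (fun x => ((((hd 1 x).const_mul 6).fun_mul (hd 2 x)).fun_add
        (((hd 0 x).const_mul 2).fun_mul (hd 3 x))).congr_deriv (by ring))
      (B := 16 * η ^ 8) (fun x => by
        have k0 := hb 0 (by norm_num) x
        have k1 := hb 1 (by norm_num) x
        have k2 := hb 2 (by norm_num) x
        have k3 := hb 3 (by norm_num) x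
        have k4 := hb 4 (by norm_num) x
        rw [Real.norm_eq_abs]
        have e : |6 * Z 2 x ^ 2 + 8 * Z 1 x * Z 3 x + 2 * Z 0 x * Z 4 x| ≤
            6 * |Z 2 x| ^ 2 + 8 * |Z 1 x| * |Z 3 x| + 2 * |Z 0 x| * |Z 4 x| := by
          refine (abs_add_three _ _ _).trans (le_of_eq ?_)
          simp [abs_mul]
        have e2 : 6 * |Z 2 x| ^ 2 + 8 * |Z 1 x| * |Z 3 x| + 2 * |Z 0 x| * |Z 4 x| ≤
            6 * (η ^ (2 * 2)) ^ 2 + 8 * η ^ (2 * 1) * η ^ (2 * 3) +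
              2 * η ^ (2 * 0) * η ^ (2 * 4) := by gcongr
        have e3 : (1 : ℝ) ≤ Real.exp (5 * |x|) := Real.one_le_exp (by positivity)
        calc _ ≤ 16 * η ^ 8 * 1 := (e.trans e2).trans (le_of_eq (by ring))
          _ ≤ _ := by gcongr)
    have := (abs_le.1 hcmp).2
    linarith
  · intro b hb1
    have hx : ∀ x, Z 0 b ^ 2 ≤ 2 * Z 0 x ^ 2 + 4 * η ^ 4 * (1 + x ^ 2) := fun x => by
      have h1 := hlip b x
      have h2 : (Z 0 b - Z 0 x) ^ 2 ≤ (η ^ 2) ^ 2 * (b - x) ^ 2 := by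
        rw [← sq_abs, ← sq_abs (b - x), ← mul_pow]
        exact pow_le_pow_left₀ (abs_nonneg _) h1 2
      have h3 : (b - x) ^ 2 ≤ 2 * (1 + x ^ 2) := by
        have := (sq_le_one_iff_abs_le_one b).2 hb1
        nlinarith [sq_nonneg (b + x)]
      have h4 : (η ^ 2) ^ 2 * (b - x) ^ 2 ≤ (η ^ 2) ^ 2 * (2 * (1 + x ^ 2)) := by gcongr
      nlinarith [sq_nonneg (Z 0 b - 2 * Z 0 x)]
    have hi2 : Integrable (fun x : ℝ => 4 * η ^ 4 * (1 + x ^ 2)) stdNormal :=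
      ((integrable_const _).add (integrable_pow_stdNormal 2)).const_mul _
    calc Z 0 b ^ 2 = ∫ _, Z 0 b ^ 2 ∂stdNormal := by simp
      _ ≤ ∫ x, (2 * Z 0 x ^ 2 + 4 * η ^ 4 * (1 + x ^ 2)) ∂stdNormal :=
        integral_mono (integrable_const _) ((hint.const_mul 2).add hi2) hx
      _ = _ := by
        rw [integral_add (hint.const_mul 2) hi2, integral_const_mul, integral_const_mul,
          integral_add (integrable_const _) (integrable_pow_stdNormal 2), integral_sq_stdNormal]
        simp; ring

/-- A bound for the moments of a linear statistic, relative to the appropriate power of `η`. -/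
noncomputable def momentConst : ℝ :=
  4 * (4 * Real.exp 1 + 16 + 32 * swapConst) + 1440 * expConst

lemma momentConst_pos : 0 < momentConst := by
  have := swapConst_pos
  have := expConst_pos
  unfold momentConst; positivity

lemma integral_sq_linStat_le_aux [∀ i, IsProbabilityMeasure (μ i)] (hO : Incoherent O η)
    (hw4 : ∀ n, |w n| ≤ η ^ 4) (hw : ∑ n, |w n| ≤ 1) (hp : SmoothBounded p 1)
    (hp0 : ∫ x, p x ∂stdNormal = 0) (hμ : Mixed μ J) :
    ∫ ξ, |linStat O w p ξ| ^ 2 ∂Measure.pi μ ≤ momentConst * η ^ 4 := by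
  have hη := hO.eta_pos
  have hη1 := hO.eta_le
  have hs := swapConst_pos
  have hc : Continuous (linStat O w p) := continuous_linStat O w hp.smooth.continuous
  have hmain := integral_pi_le_of_coord_le (μ := μ)
    (F := fun ξ => |linStat O w p ξ| ^ 2) (M := 1) (by fun_prop)
    (fun ξ => by
      rw [Real.norm_eq_abs, abs_of_nonneg (by positivity)]
      exact pow_le_one₀ (abs_nonneg _) (abs_linStat_le hw hp ξ))
    (fun ξ => by positivity) (a := fun i => if i ∈ J then 2 else 1)
    (c := fun i => (if i ∈ J then 8 * η ^ 4 else 0) + 16 * swapConst * η ^ 8)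
    (fun i => by split_ifs <;> norm_num) (fun i => by positivity)
    (fun j ξ => by
      obtain ⟨h1, h2⟩ := integral_sq_linStat_coord_le hO hw hp j ξ
      have h0 : 0 ≤ ∫ x, |linStat O w p (Function.update ξ j x)| ^ 2 ∂stdNormal :=
        integral_nonneg fun x => by positivity
      have h3 : 0 ≤ 16 * swapConst * η ^ 8 := by positivity
      by_cases hj : j ∈ J
      · obtain ⟨b, hb, e⟩ := hμ.on j hj
        rw [e, integral_dirac, if_pos hj, if_pos hj]
        have := h2 b hb
        linarith
      · rw [if_neg hj, if_neg hj]
        rcases hμ.off j hj with e | e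
        · rw [e]; linarith
        · rw [e]; linarith)
  refine hmain.trans ?_
  have hprod : ∏ i, (if i ∈ J then (2 : ℝ) else 1) ≤ 4 := by
    have := prod_ite_mem_le (a := (1 : ℝ)) (b := 2) le_rfl (by norm_num) hμ.card_le
    rw [one_pow, one_mul] at this
    linarith
  have hsum : ∑ i, ((if i ∈ J then 8 * η ^ 4 else 0) + 16 * swapConst * η ^ 8) ≤
      (16 + 32 * swapConst) * η ^ 4 := by
    rw [Finset.sum_add_distrib, Finset.sum_ite_mem, Finset.univ_inter, Finset.sum_const,
      Finset.sum_const, nsmul_eq_mul, nsmul_eq_mul, Finset.card_univ]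
    have h1 : (J.card : ℝ) ≤ 2 := by exact_mod_cast hμ.card_le
    have h2 : (Fintype.card ι : ℝ) * (16 * swapConst * η ^ 8) ≤ 32 * swapConst * η ^ 4 := by
      calc _ = 16 * swapConst * η ^ 4 * (Fintype.card ι * η ^ 4) := by ring
        _ ≤ 16 * swapConst * η ^ 4 * 2 := by gcongr; exact hO.card_le
        _ = _ := by ring
    have h3 : (J.card : ℝ) * (8 * η ^ 4) ≤ 2 * (8 * η ^ 4) := by gcongr
    linarith
  have hg := integral_sq_linStat_stdNormal_le hO hw4 hw hp hp0
  have he := expConst_pos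
  calc _ ≤ 4 * (4 * Real.exp 1 * η ^ 4 + (16 + 32 * swapConst) * η ^ 4) :=
        mul_le_mul hprod (add_le_add hg hsum) (add_nonneg (integral_nonneg fun x => by positivity)
          (Finset.sum_nonneg fun i _ => by positivity)) (by norm_num)
    _ ≤ _ := by
        unfold momentConst
        have : 0 ≤ 1440 * expConst * η ^ 4 := by positivity
        linarith

/-- The fourth power interpolates between the second and the sixth,
`2 x ^ 4 ≤ η x ^ 2 + x ^ 6 / η`, and the sixth moment comes from the exponential one. -/
lemma integral_fourth_linStat_le_aux [∀ i, IsProbabilityMeasure (μ i)] (hO : Incoherent O η)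
    (hw4 : ∀ n, |w n| ≤ η ^ 4) (hw : ∑ n, |w n| ≤ 1) (hp : SmoothBounded p 1)
    (hp0 : ∫ x, p x ∂stdNormal = 0) (hμ : Mixed μ J) :
    ∫ ξ, |linStat O w p ξ| ^ 4 ∂Measure.pi μ ≤ momentConst * η ^ 5 := by
  have hη := hO.eta_pos
  have he := expConst_pos
  have hs := swapConst_pos
  have hsix := integral_pow_linStat_le_of_exp (O := O) (μ := μ) hw hp hη
    (integral_exp_linStat_le hO hw4 hw hp hp0 hμ (by
      rw [abs_of_pos (inv_pos.2 hη), inv_mul_cancel₀ hη.ne']))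
    (integral_exp_linStat_le hO hw4 hw hp hp0 hμ (by
      rw [abs_neg, abs_of_pos (inv_pos.2 hη), inv_mul_cancel₀ hη.ne'])) 6
  have hsq := integral_sq_linStat_le_aux hO hw4 hw hp hp0 hμ
  have i2 := integrable_pow_linStat (O := O) (μ := μ) hw hp 2
  have i6 := integrable_pow_linStat (O := O) (μ := μ) hw hp 6
  have hpt : ∀ z : ℝ, |z| ^ 4 ≤ η / 2 * |z| ^ 2 + (2 * η)⁻¹ * |z| ^ 6 := fun z => by
    have h1 : η / 2 * |z| ^ 2 + (2 * η)⁻¹ * |z| ^ 6 - |z| ^ 4 =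
        (2 * η)⁻¹ * (|z| * (η - |z| ^ 2)) ^ 2 := by
      field_simp; ring
    have h2 : 0 ≤ (2 * η)⁻¹ * (|z| * (η - |z| ^ 2)) ^ 2 := by positivity
    linarith
  calc _ ≤ ∫ ξ, (η / 2 * |linStat O w p ξ| ^ 2 + (2 * η)⁻¹ * |linStat O w p ξ| ^ 6)
        ∂Measure.pi μ :=
        integral_mono (integrable_pow_linStat hw hp 4) ((i2.const_mul _).add (i6.const_mul _))
          fun ξ => hpt _
    _ = η / 2 * ∫ ξ, |linStat O w p ξ| ^ 2 ∂Measure.pi μ +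
        (2 * η)⁻¹ * ∫ ξ, |linStat O w p ξ| ^ 6 ∂Measure.pi μ := by
        rw [integral_add (i2.const_mul _) (i6.const_mul _), integral_const_mul,
          integral_const_mul]
    _ ≤ η / 2 * (momentConst * η ^ 4) +
        (2 * η)⁻¹ * (2 * (Nat.factorial 6 : ℕ) * expConst * η ^ 6) := by gcongr
    _ = (momentConst / 2 + 720 * expConst) * η ^ 5 := by
        rw [show (Nat.factorial 6 : ℕ) = 720 from rfl]
        push_cast; field_simp
    _ ≤ _ := by
        gcongr
        unfold momentConst
        have := Real.exp_pos 1
        linarith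

lemma linStat_smul_div (O : Matrix ι ι ℝ) (w : ι → ℝ) (p : ℝ → ℝ) {A : ℝ} (hA : 0 < A)
    (ξ : ι → ℝ) : linStat O w p ξ = A * linStat O w (fun x => A⁻¹ * p x) ξ := by
  simp only [linStat, Finset.mul_sum]
  refine Finset.sum_congr rfl fun n _ => ?_
  field_simp

lemma SmoothBounded.inv_mul {A : ℝ} (hA : 0 < A) (hp : SmoothBounded p A) :
    SmoothBounded (fun x => A⁻¹ * p x) 1 := by
  refine ⟨contDiff_const.mul hp.smooth, fun m hm x => ?_⟩
  rw [iteratedDeriv_const_mul_field, abs_mul, abs_of_pos (inv_pos.2 hA), inv_mul_le_iff₀ hA,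
    mul_one]
  exact hp.bound m hm x

/-- Square-root cancellation, in mean square, in a linear statistic with a centred `p`. -/
lemma integral_sq_linStat_le [∀ i, IsProbabilityMeasure (μ i)] (hO : Incoherent O η)
    (hw4 : ∀ n, |w n| ≤ η ^ 4) (hw : ∑ n, |w n| ≤ 1) {A : ℝ} (hA : 0 < A)
    (hp : SmoothBounded p A) (hp0 : ∫ x, p x ∂stdNormal = 0) (hμ : Mixed μ J) :
    ∫ ξ, |linStat O w p ξ| ^ 2 ∂Measure.pi μ ≤ momentConst * A ^ 2 * η ^ 4 := by
  have h := integral_sq_linStat_le_aux hO hw4 hw (hp.inv_mul hA)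
    (by rw [integral_const_mul, hp0, mul_zero]) hμ
  simp only [linStat_smul_div O w p hA, abs_mul, mul_pow, abs_of_pos hA, integral_const_mul]
  calc _ ≤ A ^ 2 * (momentConst * η ^ 4) := by gcongr
    _ = _ := by ring

/-- Cancellation, in the mean of fourth powers, in a linear statistic with a centred `p`. The order
`η ^ 5` is not optimal, but suffices. -/
lemma integral_fourth_linStat_le [∀ i, IsProbabilityMeasure (μ i)] (hO : Incoherent O η)
    (hw4 : ∀ n, |w n| ≤ η ^ 4) (hw : ∑ n, |w n| ≤ 1) {A : ℝ} (hA : 0 < A)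
    (hp : SmoothBounded p A) (hp0 : ∫ x, p x ∂stdNormal = 0) (hμ : Mixed μ J) :
    ∫ ξ, |linStat O w p ξ| ^ 4 ∂Measure.pi μ ≤ momentConst * A ^ 4 * η ^ 5 := by
  have h := integral_fourth_linStat_le_aux hO hw4 hw (hp.inv_mul hA)
    (by rw [integral_const_mul, hp0, mul_zero]) hμ
  simp only [linStat_smul_div O w p hA, abs_mul, mul_pow, abs_of_pos hA, integral_const_mul]
  calc _ ≤ A ^ 4 * (momentConst * η ^ 5) := by gcongr
    _ = _ := by ring

end

/-! ### Lindeberg replacement in the conditional characteristic function -/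

section

open scoped Matrix ContDiff
variable {ι : Type*} [Fintype ι] [DecidableEq ι]
variable {O : Matrix ι ι ℝ} {η : ℝ} {g v : ℝ → ℝ} {a A : ℝ}

/-- A smooth bounded pair `(g, v)`, to be thought of as conditional mean and variance of one
received sample given its noiseless value. The number `a` is the mean slope of `g` under the standard
normal law, and `g''` is centred. -/
structure Profile (g v : ℝ → ℝ) (a A : ℝ) : Prop where
  one_le : 1 ≤ A
  mean : SmoothBounded g A
  slope : SmoothBounded (fun x => iteratedDeriv 1 g x - a) A
  curvature : SmoothBounded (iteratedDeriv 2 g) A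
  var : SmoothBounded v A
  var_nonneg : ∀ x, 0 ≤ v x
  integral_slope : ∫ x, (iteratedDeriv 1 g x - a) ∂stdNormal = 0
  integral_curvature : ∫ x, iteratedDeriv 2 g x ∂stdNormal = 0

/-- The Gaussian approximation of the logarithm of the conditional characteristic function, at
`t`, of the output coordinate `k`. -/
noncomputable def logChar (O : Matrix ι ι ℝ) (g v : ℝ → ℝ) (k : ι) (t : ℝ) (ξ : ι → ℝ) : ℂ :=
  Complex.I * (t * linStat O (fun n => O n k) g ξ : ℝ) -
    (t ^ 2 / 2 * linStat O (fun n => O n k ^ 2) v ξ : ℝ)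

/-- The `m`-th derivative of `logChar` in the coordinate `j`. -/
noncomputable def logCharDeriv (O : Matrix ι ι ℝ) (g v : ℝ → ℝ) (k : ι) (t : ℝ) (j : ι) (m : ℕ)
    (ξ : ι → ℝ) : ℂ :=
  Complex.I * (t * linStatDeriv O (fun n => O n k) g j m ξ : ℝ) -
    (t ^ 2 / 2 * linStatDeriv O (fun n => O n k ^ 2) v j m ξ : ℝ)

lemma logCharDeriv_zero (O : Matrix ι ι ℝ) (g v : ℝ → ℝ) (k : ι) (t : ℝ) (j : ι) (ξ : ι → ℝ) :
    logCharDeriv O g v k t j 0 ξ = logChar O g v k t ξ := by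
  simp only [logCharDeriv, logChar, linStatDeriv_zero]

lemma continuous_logChar (hg : Continuous g) (hv : Continuous v) (k : ι) (t : ℝ) :
    Continuous (logChar O g v k t) := by
  have h1 := continuous_linStat O (fun n => O n k) hg
  have h2 := continuous_linStat O (fun n => O n k ^ 2) hv
  unfold logChar
  fun_prop

lemma norm_I_mul_sub_le (x y : ℝ) : ‖Complex.I * (x : ℂ) - (y : ℂ)‖ ≤ |x| + |y| := by
  refine (norm_sub_le _ _).trans ?_
  simp

lemma norm_exp_logChar_le (hv : ∀ x, 0 ≤ v x) (k : ι) (t : ℝ) (ξ : ι → ℝ) :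
    ‖Complex.exp (logChar O g v k t ξ)‖ ≤ 1 := by
  have h : 0 ≤ linStat O (fun n => O n k ^ 2) v ξ :=
    Finset.sum_nonneg fun n _ => mul_nonneg (sq_nonneg _) (hv _)
  rw [Complex.norm_exp, Real.exp_le_one_iff, logChar]
  simp only [Complex.sub_re, Complex.mul_re, Complex.I_re, Complex.I_im, Complex.ofReal_re,
    Complex.ofReal_im]
  have : 0 ≤ t ^ 2 / 2 * linStat O (fun n => O n k ^ 2) v ξ := by positivity
  linarith

lemma abs_linStatDeriv_col_le (hO : Incoherent O η) (hg : SmoothBounded g A) (k j : ι) {m : ℕ}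
    (hm : m + 1 ≤ 4) (ξ : ι → ℝ) :
    |linStatDeriv O (fun n => O n k) g j (m + 1) ξ| ≤ A * η ^ (2 * m) := by
  have hA := hg.nonneg
  calc _ ≤ ∑ n, |O n j ^ (m + 1) • (O n k * iteratedDeriv (m + 1) g ((O *ᵥ ξ) n))| :=
        Finset.abs_sum_le_sum_abs _ _
    _ ≤ ∑ n, (η ^ 2) ^ m * (|O n j * O n k| * A) := by
        refine Finset.sum_le_sum fun n _ => ?_
        rw [smul_eq_mul, abs_mul, abs_mul, abs_pow, abs_mul, pow_succ]
        have h1 := pow_le_pow_left₀ (abs_nonneg _) (hO.abs_le n j) m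
        have h2 := hg.bound (m + 1) hm ((O *ᵥ ξ) n)
        calc _ = |O n j| ^ m * (|O n j| * |O n k| * |iteratedDeriv (m + 1) g ((O *ᵥ ξ) n)|) := by
              ring
          _ ≤ _ := by gcongr
    _ = (η ^ 2) ^ m * A * ∑ n, |O n j * O n k| := by rw [Finset.mul_sum]; congr 1; ext n; ring
    _ ≤ (η ^ 2) ^ m * A * 1 := by
        have := hO.eta_pos
        gcongr
        exact hO.sum_abs_mul_le j k
    _ = _ := by rw [← pow_mul]; ring

lemma sum_abs_sq_col_le (hO : Incoherent O η) (k : ι) : ∑ n, |O n k ^ 2| ≤ 1 := by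
  simp only [abs_of_nonneg (sq_nonneg (O _ k)), hO.sum_sq_col, le_refl]

lemma hasDerivAt_logCharDeriv (hg : SmoothBounded g A) (hv : SmoothBounded v A) (k : ι) (t : ℝ)
    (j : ι) (m : ℕ) (ξ : ι → ℝ) (x : ℝ) :
    HasDerivAt (fun x => logCharDeriv O g v k t j m (Function.update ξ j x))
      (logCharDeriv O g v k t j (m + 1) (Function.update ξ j x)) x :=
  ((((hasDerivAt_linStatDeriv O _ hg.smooth j m ξ x).const_mul t).ofReal_comp).const_mul _).fun_sub
    ((hasDerivAt_linStatDeriv O _ hv.smooth j m ξ x).const_mul (t ^ 2 / 2)).ofReal_comp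

lemma norm_logCharDeriv_le (hO : Incoherent O η) (hg : SmoothBounded g A)
    (hv : SmoothBounded v A) (k : ι) (t : ℝ) (j : ι) {m : ℕ} (hm : m + 1 ≤ 4) (ξ : ι → ℝ) :
    ‖logCharDeriv O g v k t j (m + 1) ξ‖ ≤ A * (1 + |t|) ^ 2 * η ^ (2 * m) := by
  have hη := hO.eta_pos
  have hA := hg.nonneg
  have h1 := abs_linStatDeriv_col_le hO hg k j hm ξ
  have h2 := abs_linStatDeriv_le hO (sum_abs_sq_col_le hO k) hv j hm ξ
  have h3 : A * η ^ (2 * (m + 1)) ≤ A * η ^ (2 * m) := by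
    refine mul_le_mul_of_nonneg_left (pow_le_pow_of_le_one hη.le hO.eta_le (by omega)) hA
  refine (norm_I_mul_sub_le _ _).trans ?_
  rw [abs_mul, abs_mul, abs_of_nonneg (show 0 ≤ t ^ 2 / 2 by positivity)]
  calc _ ≤ |t| * (A * η ^ (2 * m)) + t ^ 2 / 2 * (A * η ^ (2 * m)) := by
        gcongr; exact h2.trans h3
    _ = A * (|t| + t ^ 2 / 2) * η ^ (2 * m) := by ring
    _ ≤ _ := by
        gcongr
        rw [← sq_abs t]; nlinarith [abs_nonneg t]

/-- By orthogonality of the columns, the first derivative is a linear statistic of the centred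
function `g' - a`. -/
lemma linStatDeriv_one_eq (hO : Incoherent O η) (g : ℝ → ℝ) (a : ℝ) {k j : ι} (hjk : j ≠ k)
    (ξ : ι → ℝ) : linStatDeriv O (fun n => O n k) g j 1 ξ =
      linStat O (fun n => O n j * O n k) (fun x => iteratedDeriv 1 g x - a) ξ := by
  have h := hO.sum_mul_col j k
  rw [if_neg hjk] at h
  simp only [linStatDeriv, linStat, mul_sub, Finset.sum_sub_distrib]
  rw [← Finset.sum_mul, h, zero_mul, sub_zero]
  exact Finset.sum_congr rfl fun n _ => by rw [pow_one, smul_eq_mul, mul_assoc]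

lemma linStatDeriv_two_eq (hη : 0 < η) (g : ℝ → ℝ) (k j : ι)
    (ξ : ι → ℝ) : linStatDeriv O (fun n => O n k) g j 2 ξ =
      η ^ 2 * linStat O (fun n => O n j ^ 2 * O n k / η ^ 2) (iteratedDeriv 2 g) ξ := by
  simp only [linStatDeriv, linStat, Finset.mul_sum, smul_eq_mul]
  refine Finset.sum_congr rfl fun n _ => ?_
  field_simp

/-- The integrated size of the fourth derivative of `exp (logChar)` in the coordinate `j`. -/
noncomputable def lindebergBound (O : Matrix ι ι ℝ) (η : ℝ) (g : ℝ → ℝ) (a : ℝ) (k j : ι)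
    (ξ : ι → ℝ) : ℝ :=
  |linStat O (fun n => O n j * O n k) (fun x => iteratedDeriv 1 g x - a) ξ| ^ 4 +
    η ^ 2 * |linStat O (fun n => O n j * O n k) (fun x => iteratedDeriv 1 g x - a) ξ| ^ 2 +
    η ^ 4 * |linStat O (fun n => O n j ^ 2 * O n k / η ^ 2) (iteratedDeriv 2 g) ξ| ^ 2 + η ^ 6

lemma lindeberg_algebra {z z' η : ℝ} (hz : 0 ≤ z) (hη : 0 < η) (hη1 : η ≤ 1) :
    (z + η ^ 2) ^ 4 + 6 * (z + η ^ 2) ^ 2 * η ^ 2 + 3 * (η ^ 2 * z' + η ^ 4) ^ 2 +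
      4 * (z + η ^ 2) * η ^ 4 + η ^ 6 ≤
    33 * (z ^ 4 + η ^ 2 * z ^ 2 + η ^ 4 * z' ^ 2 + η ^ 6) := by
  have h8 : η ^ 8 ≤ η ^ 6 := pow_le_pow_of_le_one hη.le hη1 (by norm_num)
  have e0 : (z + η ^ 2) ^ 2 ≤ 2 * (z ^ 2 + η ^ 4) := by nlinarith [sq_nonneg (z - η ^ 2)]
  have e1 : (z + η ^ 2) ^ 4 ≤ 8 * (z ^ 4 + η ^ 8) := by
    calc (z + η ^ 2) ^ 4 = ((z + η ^ 2) ^ 2) ^ 2 := by ring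
      _ ≤ (2 * (z ^ 2 + η ^ 4)) ^ 2 := by gcongr
      _ ≤ _ := by nlinarith [sq_nonneg (z ^ 2 - η ^ 4)]
  have e2 : 6 * (z + η ^ 2) ^ 2 * η ^ 2 ≤ 12 * (η ^ 2 * z ^ 2 + η ^ 6) := by
    calc _ ≤ 6 * (2 * (z ^ 2 + η ^ 4)) * η ^ 2 := by gcongr
      _ = _ := by ring
  have e3 : 3 * (η ^ 2 * z' + η ^ 4) ^ 2 ≤ 6 * (η ^ 4 * z' ^ 2 + η ^ 8) := by
    nlinarith [sq_nonneg (η ^ 2 * z' - η ^ 4)]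
  have e4 : 4 * (z + η ^ 2) * η ^ 4 ≤ 2 * η ^ 2 * z ^ 2 + 6 * η ^ 6 := by
    have : 2 * η ^ 2 * z ^ 2 + 6 * η ^ 6 - 4 * (z + η ^ 2) * η ^ 4 =
      2 * η ^ 2 * (z - η ^ 2) ^ 2 := by ring
    have : 0 ≤ 2 * η ^ 2 * (z - η ^ 2) ^ 2 := by positivity
    linarith
  have p1 : 0 ≤ η ^ 2 * z ^ 2 := by positivity
  have p2 : 0 ≤ η ^ 4 * z' ^ 2 := by positivity
  have p3 : 0 ≤ z ^ 4 := by positivity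
  linarith

/-- The cost of exchanging a single sign for a normal variable. -/
lemma norm_swap_exp_logChar_le (hO : Incoherent O η) (hP : Profile g v a A) (t : ℝ) {k j : ι}
    (hjk : j ≠ k) (ξ : ι → ℝ) :
    ‖∫ x, Complex.exp (logChar O g v k t (Function.update ξ j x)) ∂rademacher -
      ∫ x, Complex.exp (logChar O g v k t (Function.update ξ j x)) ∂stdNormal‖ ≤
    swapConst * (33 * (A * (1 + |t|) ^ 2) ^ 4 *
      lindebergBound O η g a k j (Function.update ξ j 0)) := by
  have hη := hO.eta_pos
  have hη1 := hO.eta_le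
  have hA := hP.one_le
  set D := A * (1 + |t|) ^ 2 with hD
  have ht : 1 ≤ (1 + |t|) ^ 2 := one_le_pow₀ (by linarith [abs_nonneg t])
  have hD1 : 1 ≤ D := by nlinarith
  set L : ℕ → ℝ → ℂ := fun m x => logCharDeriv O g v k t j m (Function.update ξ j x) with hL
  have hL0 : ∀ x, logChar O g v k t (Function.update ξ j x) = L 0 x := fun x =>
    (logCharDeriv_zero O g v k t j _).symm
  have hd : ∀ m x, HasDerivAt (L m) (L (m + 1) x) x := fun m x =>
    hasDerivAt_logCharDeriv hP.mean hP.var k t j m ξ x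
  have hb : ∀ m, m + 1 ≤ 4 → ∀ x, ‖L (m + 1) x‖ ≤ D * η ^ (2 * m) := fun m hm x =>
    norm_logCharDeriv_le hO hP.mean hP.var k t j hm _
  set ξ0 := Function.update ξ j 0 with hξ0
  set z := |linStat O (fun n => O n j * O n k) (fun x => iteratedDeriv 1 g x - a) ξ0| with hz
  set z' := |linStat O (fun n => O n j ^ 2 * O n k / η ^ 2) (iteratedDeriv 2 g) ξ0|
  have hz0 : 0 ≤ z := abs_nonneg _
  have hz'0 : 0 ≤ z' := abs_nonneg _
  have htA : t ^ 2 / 2 * A ≤ D := by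
    rw [hD, ← sq_abs t]; nlinarith [abs_nonneg t]
  have htD : |t| ≤ D := by
    rw [hD]; nlinarith [abs_nonneg t, sq_nonneg |t|]
  have l1 : ‖L 1 0‖ ≤ D * (z + η ^ 2) := by
    refine (norm_I_mul_sub_le _ _).trans ?_
    rw [linStatDeriv_one_eq hO g a hjk, abs_mul, abs_mul,
      abs_of_nonneg (show 0 ≤ t ^ 2 / 2 by positivity)]
    have h2 := abs_linStatDeriv_le hO (sum_abs_sq_col_le hO k) hP.var j (m := 1) (by norm_num) ξ0
    calc _ ≤ |t| * z + t ^ 2 / 2 * (A * η ^ (2 * 1)) := by gcongr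
      _ = |t| * z + t ^ 2 / 2 * A * η ^ 2 := by ring
      _ ≤ D * z + D * η ^ 2 := by gcongr
      _ = _ := by ring
  have l2 : ‖L 2 0‖ ≤ D * (η ^ 2 * z' + η ^ 4) := by
    refine (norm_I_mul_sub_le _ _).trans ?_
    rw [linStatDeriv_two_eq hη g, abs_mul, abs_mul, abs_mul,
      abs_of_nonneg (show 0 ≤ t ^ 2 / 2 by positivity),
      abs_of_nonneg (show 0 ≤ η ^ 2 by positivity)]
    have h2 := abs_linStatDeriv_le hO (sum_abs_sq_col_le hO k) hP.var j (m := 2) (by norm_num) ξ0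
    calc _ ≤ |t| * (η ^ 2 * z') + t ^ 2 / 2 * (A * η ^ (2 * 2)) := by gcongr
      _ = |t| * (η ^ 2 * z') + t ^ 2 / 2 * A * η ^ 4 := by ring
      _ ≤ D * (η ^ 2 * z') + D * η ^ 4 := by gcongr
      _ = _ := by ring
  have lip : ∀ m, m + 2 ≤ 4 → ∀ x, ‖L (m + 1) x‖ ≤ ‖L (m + 1) 0‖ + D * η ^ (2 * (m + 1)) * |x| :=
    fun m hm x => by
      have := norm_sub_le_of_deriv_le (hd (m + 1)) (r := |x|) (fun y _ => hb (m + 1) hm y) le_rfl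
      have h3 := norm_le_norm_add_norm_sub (L (m + 1) 0) (L (m + 1) x)
      rw [norm_sub_rev] at h3
      linarith
  simp only [hL0]
  have hchain := hasDerivAt_exp_chain (hd 0) (hd 1) (hd 2) (hd 3)
  refine norm_rademacher_sub_stdNormal_le (fun x => (hchain x).1) (fun x => (hchain x).2.1)
    (fun x => (hchain x).2.2.1) (fun x => (hchain x).2.2.2) fun x => ?_
  have y0 := abs_nonneg x
  set E := Real.exp |x| with hE
  have hE1 : 1 + |x| ≤ E := by rw [add_comm]; exact Real.add_one_le_exp _
  have hE2 : 1 ≤ E := by linarith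
  have b1 : ‖L 1 x‖ ≤ D * (z + η ^ 2) * E := by
    calc ‖L 1 x‖ ≤ D * (z + η ^ 2) + D * η ^ (2 * 1) * |x| :=
          (lip 0 (by norm_num) x).trans (by gcongr)
      _ ≤ D * (z + η ^ 2) + D * (z + η ^ 2) * |x| := by
          gcongr
          show η ^ 2 ≤ _
          linarith
      _ = D * (z + η ^ 2) * (1 + |x|) := by ring
      _ ≤ _ := by gcongr
  have b2 : ‖L 2 x‖ ≤ D * (η ^ 2 * z' + η ^ 4) * E := by
    calc ‖L 2 x‖ ≤ D * (η ^ 2 * z' + η ^ 4) + D * η ^ (2 * 2) * |x| :=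
          (lip 1 (by norm_num) x).trans (by gcongr)
      _ ≤ D * (η ^ 2 * z' + η ^ 4) + D * (η ^ 2 * z' + η ^ 4) * |x| := by
          gcongr
          have : 0 ≤ η ^ 2 * z' := by positivity
          show η ^ 4 ≤ _
          linarith
      _ = D * (η ^ 2 * z' + η ^ 4) * (1 + |x|) := by ring
      _ ≤ _ := by gcongr
  have b2' : ‖L 2 x‖ ≤ D * η ^ 2 := hb 1 (by norm_num) x
  have b3 : ‖L 3 x‖ ≤ D * η ^ 4 := hb 2 (by norm_num) x
  have b4 : ‖L 4 x‖ ≤ D * η ^ 6 := hb 3 (by norm_num) x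
  rw [norm_mul]
  have hn : ‖Complex.exp (L 0 x)‖ ≤ 1 := by
    rw [← hL0]; exact norm_exp_logChar_le hP.var_nonneg k t _
  have hE5 : Real.exp (5 * |x|) = E ^ 5 := by rw [hE, ← Real.exp_nat_mul]; norm_num
  rw [hE5]
  set a1 := z + η ^ 2
  set a2 := η ^ 2 * z' + η ^ 4
  have ha1 : 0 ≤ a1 := by positivity
  have ha2 : 0 ≤ a2 := by positivity
  calc _ ≤ 1 * (‖L 1 x‖ ^ 4 + 6 * ‖L 1 x‖ ^ 2 * ‖L 2 x‖ + 3 * ‖L 2 x‖ ^ 2 + 4 * ‖L 1 x‖ * ‖L 3 x‖ +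
        ‖L 4 x‖) := by gcongr; exact norm_exp_chain_le _ _ _ _
    _ ≤ 1 * ((D * a1 * E) ^ 4 + 6 * (D * a1 * E) ^ 2 * (D * η ^ 2) + 3 * (D * a2 * E) ^ 2 +
        4 * (D * a1 * E) * (D * η ^ 4) + D * η ^ 6) := by gcongr
    _ = D ^ 4 * E ^ 4 * a1 ^ 4 + D ^ 3 * E ^ 2 * (6 * a1 ^ 2 * η ^ 2) +
        D ^ 2 * E ^ 2 * (3 * a2 ^ 2) +
        D ^ 2 * E ^ 1 * (4 * a1 * η ^ 4) + D ^ 1 * E ^ 0 * η ^ 6 := by ring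
    _ ≤ D ^ 4 * E ^ 5 * a1 ^ 4 + D ^ 4 * E ^ 5 * (6 * a1 ^ 2 * η ^ 2) +
        D ^ 4 * E ^ 5 * (3 * a2 ^ 2) +
        D ^ 4 * E ^ 5 * (4 * a1 * η ^ 4) + D ^ 4 * E ^ 5 * η ^ 6 := by
        gcongr <;> first | assumption | norm_num
    _ = D ^ 4 * E ^ 5 * (a1 ^ 4 + 6 * a1 ^ 2 * η ^ 2 + 3 * a2 ^ 2 + 4 * a1 * η ^ 4 + η ^ 6) := by
        ring
    _ ≤ D ^ 4 * E ^ 5 * (33 * (z ^ 4 + η ^ 2 * z ^ 2 + η ^ 4 * z' ^ 2 + η ^ 6)) := by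
        gcongr; exact lindeberg_algebra hz0 hη hη1
    _ = _ := by rw [lindebergBound]; ring

lemma integrable_lindebergBound {μ : ι → Measure ℝ} [∀ i, IsProbabilityMeasure (μ i)]
    (hO : Incoherent O η) (hP : Profile g v a A) (k j : ι) :
    Integrable (lindebergBound O η g a k j) (Measure.pi μ) := by
  have hw2 : ∑ n, |O n j ^ 2 * O n k / η ^ 2| ≤ 1 := by
    have hη := hO.eta_pos
    refine (Finset.sum_le_sum fun n _ => ?_).trans (hO.sum_abs_mul_le j k)
    rw [abs_div, abs_of_pos (show 0 < η ^ 2 by positivity), div_le_iff₀ (by positivity), sq,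
      mul_assoc, abs_mul, mul_comm]
    exact mul_le_mul_of_nonneg_left (hO.abs_le n j) (abs_nonneg _)
  have h1 := fun m => integrable_pow_linStat (O := O) (μ := μ) (hO.sum_abs_mul_le j k) hP.slope m
  have h2 := integrable_pow_linStat (O := O) (μ := μ) hw2 hP.curvature 2
  exact (((h1 4).add ((h1 2).const_mul _)).add (h2.const_mul _)).add (integrable_const _)

lemma integral_add_mul_add_mul_add {α : Type*} [MeasurableSpace α] {μ : Measure α}
    [IsProbabilityMeasure μ] {f₁ f₂ f₃ : α → ℝ} (h₁ : Integrable f₁ μ) (h₂ : Integrable f₂ μ)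
    (h₃ : Integrable f₃ μ) (c d e : ℝ) :
    ∫ x, (f₁ x + c * f₂ x + d * f₃ x + e) ∂μ =
      ∫ x, f₁ x ∂μ + c * ∫ x, f₂ x ∂μ + d * ∫ x, f₃ x ∂μ + e := by
  have h₁₂ : Integrable (fun x => f₁ x + c * f₂ x) μ := h₁.add (h₂.const_mul c)
  have h₁₃ : Integrable (fun x => f₁ x + c * f₂ x + d * f₃ x) μ := h₁₂.add (h₃.const_mul d)
  rw [integral_add h₁₃ (integrable_const e), integral_add h₁₂ (h₃.const_mul d),
    integral_add h₁ (h₂.const_mul c), integral_const_mul, integral_const_mul, integral_const]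
  simp

/-- The cost of one exchange is of order `η ^ 5`; there are about `η ^ (-4)` exchanges. -/
lemma integral_lindebergBound_le {μ : ι → Measure ℝ} [∀ i, IsProbabilityMeasure (μ i)]
    {J : Finset ι} (hO : Incoherent O η) (hP : Profile g v a A) (hμ : Mixed μ J) (k j : ι) :
    ∫ ξ, lindebergBound O η g a k j ξ ∂Measure.pi μ ≤ (3 * momentConst * A ^ 4 + 1) * η ^ 5 := by
  have hη := hO.eta_pos
  have hη1 := hO.eta_le
  have hA := hP.one_le
  have hm := momentConst_pos
  have hw2 : ∑ n, |O n j ^ 2 * O n k / η ^ 2| ≤ 1 := by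
    refine (Finset.sum_le_sum fun n _ => ?_).trans (hO.sum_abs_mul_le j k)
    rw [abs_div, abs_of_pos (show 0 < η ^ 2 by positivity), div_le_iff₀ (by positivity), sq,
      mul_assoc, abs_mul, mul_comm]
    exact mul_le_mul_of_nonneg_left (hO.abs_le n j) (abs_nonneg _)
  have hw14 : ∀ n, |O n j * O n k| ≤ η ^ 4 := fun n => by
    rw [abs_mul, show η ^ 4 = η ^ 2 * η ^ 2 by ring]
    exact mul_le_mul (hO.abs_le n j) (hO.abs_le n k) (abs_nonneg _) (by positivity)
  have hw24 : ∀ n, |O n j ^ 2 * O n k / η ^ 2| ≤ η ^ 4 := fun n => by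
    rw [abs_div, abs_of_pos (show 0 < η ^ 2 by positivity), div_le_iff₀ (by positivity), abs_mul,
      abs_pow]
    calc _ ≤ (η ^ 2) ^ 2 * η ^ 2 := by
          gcongr
          · exact hO.abs_le n j
          · exact hO.abs_le n k
      _ = _ := by ring
  have h1 := fun m => integrable_pow_linStat (O := O) (μ := μ) (hO.sum_abs_mul_le j k) hP.slope m
  have h2 := integrable_pow_linStat (O := O) (μ := μ) hw2 hP.curvature 2
  have hA0 : 0 < A := by linarith
  have m4 := integral_fourth_linStat_le hO hw14 (hO.sum_abs_mul_le j k) hA0 hP.slope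
    hP.integral_slope hμ
  have m2 := integral_sq_linStat_le hO hw14 (hO.sum_abs_mul_le j k) hA0 hP.slope
    hP.integral_slope hμ
  have m2' := integral_sq_linStat_le hO hw24 hw2 hA0 hP.curvature hP.integral_curvature hμ
  have hsplit := integral_add_mul_add_mul_add (h1 4) (h1 2) h2 (η ^ 2) (η ^ 4) (η ^ 6)
  unfold lindebergBound
  rw [hsplit]
  have hA2 : A ^ 2 ≤ A ^ 4 := pow_le_pow_right₀ hA (by norm_num)
  have hη6 : η ^ 6 ≤ η ^ 5 := pow_le_pow_of_le_one hη.le hη1 (by norm_num)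
  have hη8 : η ^ 8 ≤ η ^ 5 := pow_le_pow_of_le_one hη.le hη1 (by norm_num)
  calc _ ≤ momentConst * A ^ 4 * η ^ 5 + η ^ 2 * (momentConst * A ^ 2 * η ^ 4) +
        η ^ 4 * (momentConst * A ^ 2 * η ^ 4) + η ^ 6 := by gcongr
    _ = momentConst * A ^ 4 * η ^ 5 + momentConst * A ^ 2 * η ^ 6 + momentConst * A ^ 2 * η ^ 8 +
        η ^ 6 := by ring
    _ ≤ momentConst * A ^ 4 * η ^ 5 + momentConst * A ^ 4 * η ^ 5 + momentConst * A ^ 4 * η ^ 5 +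
        η ^ 5 := by gcongr
    _ = _ := by ring

/-- The product law with coordinate `k` frozen at `b` and all others of law `ρ`. -/
noncomputable def frozen (ρ : Measure ℝ) (k : ι) (b : ℝ) (i : ι) : Measure ℝ :=
  if i = k then Measure.dirac b else ρ

instance (ρ : Measure ℝ) [IsProbabilityMeasure ρ] (k : ι) (b : ℝ) (i : ι) :
    IsProbabilityMeasure (frozen ρ k b i) := by
  unfold frozen; split_ifs <;> infer_instance

/-- The constant of `norm_frozen_sub_le`. -/
noncomputable def lindebergConst (A t : ℝ) : ℝ :=
  66 * swapConst * (A * (1 + |t|) ^ 2) ^ 4 * (3 * momentConst * A ^ 4 + 1)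

/-- Lindeberg replacement of fair signs by standard normal variables in the characteristic function
of one output coordinate, given the corresponding input. -/
lemma norm_frozen_sub_le (hO : Incoherent O η) (hP : Profile g v a A) (t : ℝ) (k : ι) {b : ℝ}
    (hb : |b| ≤ 1) :
    ‖∫ ξ, Complex.exp (logChar O g v k t ξ) ∂Measure.pi (frozen rademacher k b) -
      ∫ ξ, Complex.exp (logChar O g v k t ξ) ∂Measure.pi (frozen stdNormal k b)‖ ≤
    lindebergConst A t * η := by
  have hη := hO.eta_pos
  have hs := swapConst_pos
  have hA := hP.one_le
  have hm := momentConst_pos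
  have hc := continuous_logChar (O := O) hP.mean.smooth.continuous hP.var.smooth.continuous k t
  set C := 33 * (A * (1 + |t|) ^ 2) ^ 4 with hC
  have hC0 : 0 ≤ C := by positivity
  set B : ι → (ι → ℝ) → ℝ := fun j ξ => if j = k then 0 else
    swapConst * (C * lindebergBound O η g a k j (Function.update ξ j 0)) with hB
  have hupd : ∀ j S, ∃ μ' : ι → Measure ℝ, (∀ i, IsProbabilityMeasure (μ' i)) ∧
      μ' j = Measure.dirac 0 ∧ (∀ i, i ≠ j →
        hybrid (frozen rademacher k b) (frozen stdNormal k b) S i = μ' i) ∧ Mixed μ' {k, j} := by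
    intro j S
    refine ⟨Function.update (hybrid (frozen rademacher k b) (frozen stdNormal k b) S) j
      (Measure.dirac 0), fun i => ?_, by simp, fun i hi => by simp [hi], ?_, ?_, ?_⟩
    · rcases eq_or_ne i j with rfl | hi
      · simp only [Function.update_self]; infer_instance
      · simp only [Function.update_of_ne hi]; infer_instance
    · exact Finset.card_le_two
    · intro i hi
      simp only [Finset.mem_insert, Finset.mem_singleton, not_or] at hi
      rw [Function.update_of_ne hi.2]
      simp only [hybrid, frozen, if_neg hi.1]
      split_ifs
      · exact Or.inl rfl
      · exact Or.inr rfl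
    · intro i hi
      simp only [Finset.mem_insert, Finset.mem_singleton] at hi
      rcases eq_or_ne i j with rfl | hij
      · exact ⟨0, by simp, by simp⟩
      · have : i = k := hi.resolve_right hij
        refine ⟨b, hb, ?_⟩
        rw [Function.update_of_ne hij]
        simp [hybrid, frozen, this]
  have key := norm_integral_pi_sub_le (μ₁ := frozen rademacher k b) (μ₀ := frozen stdNormal k b)
    (F := fun ξ => Complex.exp (logChar O g v k t ξ)) (M := 1) (by fun_prop)
    (fun ξ => norm_exp_logChar_le hP.var_nonneg k t ξ) (B := B)
    (ε := fun _ => swapConst * (C * ((3 * momentConst * A ^ 4 + 1) * η ^ 5)))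
    (fun j ξ => by
      simp only [hB]
      split_ifs with hjk
      · simp [frozen, hjk]
      · simp only [frozen, if_neg hjk]
        exact norm_swap_exp_logChar_le hO hP t hjk ξ)
    (fun j S => by
      simp only [hB]
      split_ifs with hjk
      · exact integrable_zero _ _ _
      · obtain ⟨μ', i1, e1, e2, e3⟩ := hupd j S
        have := integrable_integral_update j e2 (integrable_lindebergBound hO hP k j)
        simp only [e1, integral_dirac] at this
        exact (this.const_mul C).const_mul swapConst)
    (fun j S _ => by
      simp only [hB]
      split_ifs with hjk
      · rw [integral_zero]; positivity
      · obtain ⟨μ', i1, e1, e2, e3⟩ := hupd j S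
        have := integral_pi_eq_update j e2 (integrable_lindebergBound hO hP k j)
        simp only [e1, integral_dirac] at this
        rw [integral_const_mul, integral_const_mul, ← this]
        gcongr
        exact integral_lindebergBound_le hO hP e3 k j)
  refine key.trans ?_
  rw [Finset.sum_const, nsmul_eq_mul, Finset.card_univ]
  calc _ = swapConst * C * (3 * momentConst * A ^ 4 + 1) * η * (Fintype.card ι * η ^ 4) := by ring
    _ ≤ swapConst * C * (3 * momentConst * A ^ 4 + 1) * η * 2 := by
        gcongr; exact hO.card_le
    _ = _ := by rw [lindebergConst, hC]; ring

end

/-! ### Expansions of characteristic functions -/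

section

open scoped Matrix ContDiff

lemma norm_exp_sub_exp_le {z w : ℂ} (hz : z.re ≤ 0) (hw : w.re ≤ 0) :
    ‖Complex.exp z - Complex.exp w‖ ≤ ‖z - w‖ := by
  have hconv : Convex ℝ {z : ℂ | z.re ≤ 0} := convex_halfSpace_re_le 0
  have := hconv.norm_image_sub_le_of_norm_hasDerivWithin_le (f := Complex.exp)
    (f' := Complex.exp) (C := 1) (x := w) (y := z)
    (fun x _ => (Complex.hasDerivAt_exp x).hasDerivWithinAt)
    (fun x hx => by rw [Complex.norm_exp, Real.exp_le_one_iff]; exact hx) hw hz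
  simpa using this

lemma norm_exp_I_mul_ofReal_sub_le (x : ℝ) :
    ‖Complex.exp (Complex.I * x) - 1 - Complex.I * x + (x : ℂ) ^ 2 / 2‖ ≤ |x| ^ 3 := by
  have hI : ∀ y : ℝ, HasDerivAt (fun y : ℝ => (y : ℂ)) 1 y := fun y =>
    (hasDerivAt_id y).ofReal_comp
  have h0 : ∀ y : ℝ, HasDerivAt (fun y : ℝ => Complex.exp (Complex.I * y))
      (Complex.I * Complex.exp (Complex.I * y)) y := fun y => by
    refine (((hI y).const_mul Complex.I).cexp).congr_deriv (by ring)
  have e1 : ∀ y : ℝ, |y| ≤ |x| →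
      ‖Complex.I * (Complex.exp (Complex.I * y) - 1)‖ ≤ |x| := fun y hy => by
    have := norm_sub_le_of_deriv_le h0 (M := 1) (r := |x|) (fun z _ => by
      rw [norm_mul, Complex.norm_exp]; simp) hy
    simp only [Complex.ofReal_zero, mul_zero, Complex.exp_zero, one_mul] at this
    rw [norm_mul, Complex.norm_I, one_mul]
    exact this.trans hy
  have h1 : ∀ y : ℝ, HasDerivAt
      (fun y : ℝ => Complex.exp (Complex.I * y) - 1 - Complex.I * y)
      (Complex.I * (Complex.exp (Complex.I * y) - 1)) y := fun y => by
    refine (((h0 y).sub_const 1).fun_sub ((hI y).const_mul Complex.I)).congr_deriv (by ring)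
  have e2 : ∀ y : ℝ, |y| ≤ |x| →
      ‖Complex.I * (Complex.exp (Complex.I * y) - 1 - Complex.I * y)‖ ≤ |x| * |x| :=
    fun y hy => by
    have := norm_sub_le_of_deriv_le h1 e1 hy
    rw [norm_mul, Complex.norm_I, one_mul]
    refine le_trans ?_ (this.trans (mul_le_mul_of_nonneg_left hy (abs_nonneg x)))
    simp
  have h2 : ∀ y : ℝ, HasDerivAt
      (fun y : ℝ => Complex.exp (Complex.I * y) - 1 - Complex.I * y + (y : ℂ) ^ 2 / 2)
      (Complex.I * (Complex.exp (Complex.I * y) - 1 - Complex.I * y)) y := fun y => by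
    refine ((h1 y).fun_add (((hI y).fun_pow 2).div_const 2)).congr_deriv ?_
    have := Complex.I_mul_I
    push_cast
    linear_combination ((y : ℂ)) * this
  have := norm_sub_le_of_deriv_le h2 e2 le_rfl
  calc _ ≤ |x| * |x| * |x| := by simpa using this
    _ = _ := by ring

lemma exp_neg_sub_le {y : ℝ} (hy : 0 ≤ y) : |Real.exp (-y) - 1 + y| ≤ y ^ 2 := by
  have h1 := Real.add_one_le_exp (-y)
  have h2 : Real.exp (-y) ≤ (1 + y)⁻¹ := by
    rw [Real.exp_neg]
    exact inv_anti₀ (by linarith) (by rw [add_comm]; exact Real.add_one_le_exp y)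
  have h3 : (1 + y)⁻¹ ≤ 1 - y + y ^ 2 := by
    rw [inv_le_iff_one_le_mul₀ (by linarith)]
    have : 0 ≤ y ^ 3 := by positivity
    linarith [show (1 - y + y ^ 2) * (1 + y) = 1 + y ^ 3 by ring]
  rw [abs_le]; constructor <;> nlinarith [sq_nonneg y]

/-- Second order expansion of `exp (i x - y)`, the variable `y` counting as second order. -/
lemma norm_exp_I_mul_sub_le {x y : ℝ} (hy : 0 ≤ y) :
    ‖Complex.exp (Complex.I * x - y) - (1 + Complex.I * x - (x ^ 2 / 2 + y : ℝ))‖ ≤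
      |x| ^ 3 + |x| * y + y ^ 2 := by
  have hx : ‖Complex.exp (Complex.I * x)‖ = 1 := by rw [Complex.norm_exp]; simp
  have hsplit : Complex.exp (Complex.I * x - y) - (1 + Complex.I * x - (x ^ 2 / 2 + y : ℝ)) =
      (Complex.exp (Complex.I * x) - 1 - Complex.I * x + (x : ℂ) ^ 2 / 2) -
      (Complex.exp (Complex.I * x) - 1) * y +
      Complex.exp (Complex.I * x) * (Real.exp (-y) - 1 + y : ℝ) := by
    rw [sub_eq_add_neg (Complex.I * x) (y : ℂ), Complex.exp_add]
    push_cast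
    ring
  rw [hsplit]
  refine (norm_add_le _ _).trans (add_le_add ((norm_sub_le _ _).trans (add_le_add
    (norm_exp_I_mul_ofReal_sub_le x) ?_)) ?_)
  · rw [norm_mul, Complex.norm_real, Real.norm_eq_abs, abs_of_nonneg hy]
    exact mul_le_mul_of_nonneg_right Real.norm_exp_I_mul_ofReal_sub_one_le hy
  · rw [norm_mul, hx, one_mul, Complex.norm_real]
    exact exp_neg_sub_le hy

/-- The constant of `norm_integral_exp_sub_le`. -/
def charApproxConst (A T t : ℝ) : ℝ := T + A * (1 + T) + t * A ^ 2 + t * (1 + T + A) ^ 2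

lemma charApproxConst_nonneg {A T t : ℝ} (hA : 0 ≤ A) (hT : 0 ≤ T) (ht : 0 ≤ t) :
    0 ≤ charApproxConst A T t := by unfold charApproxConst; positivity

lemma abs_le_one_add_cube (x : ℝ) : |x| ≤ 1 + |x| ^ 3 := by
  have := abs_nonneg x
  rcases le_total |x| 1 with h | h
  · have : 0 ≤ |x| ^ 3 := by positivity
    linarith
  · have := pow_le_pow_right₀ h (show 1 ≤ 3 by norm_num)
    linarith

lemma sq_le_one_add_cube (x : ℝ) : x ^ 2 ≤ 1 + |x| ^ 3 := by
  rw [← sq_abs]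
  have := abs_nonneg x
  rcases le_total |x| 1 with h | h
  · have h1 : 0 ≤ |x| ^ 3 := by positivity
    have h2 := pow_le_one₀ this h (n := 2)
    linarith
  · have := pow_le_pow_right₀ h (show 2 ≤ 3 by norm_num)
    linarith

/-- The characteristic function of a centred variable, damped by a bounded variance term, is close to
that of the normal law with the total variance. -/
lemma norm_integral_exp_sub_le {α : Type*} [MeasurableSpace α] {P : Measure α}
    [IsProbabilityMeasure P] {h v : α → ℝ} {A T t s S : ℝ} (hh : AEStronglyMeasurable h P)
    (hv : AEStronglyMeasurable v P) (hv0 : ∀ x, 0 ≤ v x) (hvA : ∀ x, v x ≤ A)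
    (h3 : Integrable (fun x => |h x| ^ 3) P) (hT : ∫ x, |h x| ^ 3 ∂P ≤ T)
    (h0 : ∫ x, h x ∂P = 0) (hS : ∫ x, (h x ^ 2 + v x) ∂P = S) (hs : |s| ≤ t) :
    ‖∫ x, Complex.exp (Complex.I * (s * h x : ℝ) - (s ^ 2 / 2 * v x : ℝ)) ∂P -
      Complex.exp (-(s ^ 2 / 2 * S : ℝ))‖ ≤ charApproxConst A T t * |s| ^ 3 := by
  have ht : 0 ≤ t := (abs_nonneg s).trans hs
  obtain ⟨x0⟩ : Nonempty α := P.nonempty_of_neZero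
  have hA : 0 ≤ A := (hv0 x0).trans (hvA x0)
  have i13 : Integrable (fun x => 1 + |h x| ^ 3) P := (integrable_const _).add h3
  have ih : Integrable h P := i13.mono' hh (Filter.Eventually.of_forall fun x =>
    abs_le_one_add_cube _)
  have ih2 : Integrable (fun x => h x ^ 2) P := i13.mono' (hh.pow 2)
    (Filter.Eventually.of_forall fun x => by
      rw [Real.norm_eq_abs, abs_of_nonneg (sq_nonneg _)]; exact sq_le_one_add_cube _)
  have iv : Integrable v P := Integrable.of_bound hv A (Filter.Eventually.of_forall fun x => by
    rw [Real.norm_eq_abs, abs_of_nonneg (hv0 x)]; exact hvA x)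
  have hS1 : S ≤ 1 + T + A := by
    rw [← hS]
    calc _ ≤ ∫ x, (1 + |h x| ^ 3 + A) ∂P :=
          integral_mono (ih2.add iv) (i13.add (integrable_const _)) fun x =>
            add_le_add (sq_le_one_add_cube _) (hvA x)
      _ ≤ _ := by
          rw [integral_add i13 (integrable_const _), integral_add (integrable_const _) h3]
          simpa using hT
  have hS0 : 0 ≤ S := by
    rw [← hS]; exact integral_nonneg fun x => add_nonneg (sq_nonneg _) (hv0 x)
  have iexp : Integrable (fun x => Complex.exp (Complex.I * (s * h x : ℝ) -
      (s ^ 2 / 2 * v x : ℝ))) P := by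
    refine Integrable.of_bound ?_ 1 (Filter.Eventually.of_forall fun x => ?_)
    · refine Complex.continuous_exp.comp_aestronglyMeasurable ((AEStronglyMeasurable.const_mul
        (Complex.continuous_ofReal.comp_aestronglyMeasurable (hh.const_mul s)) _).sub
        (Complex.continuous_ofReal.comp_aestronglyMeasurable (hv.const_mul _)))
    · rw [Complex.norm_exp, Real.exp_le_one_iff]
      have := hv0 x
      simp only [Complex.sub_re, Complex.mul_re, Complex.I_re, Complex.I_im, Complex.ofReal_re,
        Complex.ofReal_im]
      have : 0 ≤ s ^ 2 / 2 * v x := by positivity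
      linarith
  have iq : Integrable (fun x => h x ^ 2 + v x) P := ih2.add iv
  have iq1 : Integrable (fun x => (1 : ℂ) + Complex.I * (s * h x : ℝ)) P :=
    (integrable_const _).add ((ih.const_mul s).ofReal.const_mul _)
  have iq2 : Integrable (fun x => ((s ^ 2 / 2 * (h x ^ 2 + v x) : ℝ) : ℂ)) P :=
    (iq.const_mul _).ofReal
  have hpoly : ∫ x, ((1 : ℂ) + Complex.I * (s * h x : ℝ) - (s ^ 2 / 2 * (h x ^ 2 + v x) : ℝ)) ∂P =
      1 - (s ^ 2 / 2 * S : ℝ) := by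
    rw [integral_sub iq1 iq2, integral_add (integrable_const _)
      ((ih.const_mul s).ofReal.const_mul _), integral_const_mul, integral_complex_ofReal,
      integral_complex_ofReal, integral_const_mul, integral_const_mul, h0, hS]
    simp
  have hrem : ‖∫ x, Complex.exp (Complex.I * (s * h x : ℝ) - (s ^ 2 / 2 * v x : ℝ)) ∂P -
      (1 - (s ^ 2 / 2 * S : ℝ))‖ ≤ (T + A * (1 + T) + t * A ^ 2) * |s| ^ 3 := by
    have iq12 : Integrable (fun x => (1 : ℂ) + Complex.I * (s * h x : ℝ) -
        (s ^ 2 / 2 * (h x ^ 2 + v x) : ℝ)) P := iq1.sub iq2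
    rw [← hpoly, ← integral_sub iexp iq12]
    have ib : Integrable (fun x => |s| ^ 3 * (|h x| ^ 3 + A * (1 + |h x| ^ 3) + t * A ^ 2)) P :=
      ((h3.add (i13.const_mul A)).add (integrable_const _)).const_mul _
    calc _ ≤ ∫ x, |s| ^ 3 * (|h x| ^ 3 + A * (1 + |h x| ^ 3) + t * A ^ 2) ∂P := by
          refine norm_integral_le_of_norm_le ib (Filter.Eventually.of_forall fun x => ?_)
          have hvx := hv0 x
          have := norm_exp_I_mul_sub_le (x := s * h x) (y := s ^ 2 / 2 * v x) (by positivity)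
          rw [show (s * h x) ^ 2 / 2 + s ^ 2 / 2 * v x = s ^ 2 / 2 * (h x ^ 2 + v x) by ring]
            at this
          refine this.trans ?_
          rw [abs_mul, ← sq_abs s]
          calc _ = |s| ^ 3 * |h x| ^ 3 + |s| ^ 3 * (v x * |h x|) / 2 +
                |s| ^ 3 * (|s| * v x ^ 2) / 4 := by ring
            _ ≤ |s| ^ 3 * |h x| ^ 3 + |s| ^ 3 * (v x * |h x|) + |s| ^ 3 * (|s| * v x ^ 2) := by
                have h1 : 0 ≤ |s| ^ 3 * (v x * |h x|) := by positivity
                have h2 : 0 ≤ |s| ^ 3 * (|s| * v x ^ 2) := by positivity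
                linarith
            _ = |s| ^ 3 * (|h x| ^ 3 + v x * |h x| + |s| * v x ^ 2) := by ring
            _ ≤ _ := by
                gcongr
                · exact hvA x
                · exact abs_le_one_add_cube _
                · exact hvA x
      _ = |s| ^ 3 * (∫ x, |h x| ^ 3 ∂P + A * (1 + ∫ x, |h x| ^ 3 ∂P) + t * A ^ 2) := by
          have i2 : Integrable (fun x => |h x| ^ 3 + A * (1 + |h x| ^ 3)) P :=
            h3.add (i13.const_mul A)
          rw [integral_const_mul, integral_add i2 (integrable_const _),
            integral_add h3 (i13.const_mul A), integral_const_mul,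
            integral_add (integrable_const _) h3]
          simp
      _ ≤ |s| ^ 3 * (T + A * (1 + T) + t * A ^ 2) := by gcongr
      _ = _ := by ring
  have hend : ‖((1 : ℂ) - (s ^ 2 / 2 * S : ℝ)) - Complex.exp (-(s ^ 2 / 2 * S : ℝ))‖ ≤
      t * (1 + T + A) ^ 2 * |s| ^ 3 := by
    have h1 := exp_neg_sub_le (y := s ^ 2 / 2 * S) (by positivity)
    have h2 : ((1 : ℂ) - (s ^ 2 / 2 * S : ℝ)) - Complex.exp (-(s ^ 2 / 2 * S : ℝ)) =
        ((-(Real.exp (-(s ^ 2 / 2 * S)) - 1 + s ^ 2 / 2 * S) : ℝ) : ℂ) := by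
      push_cast; ring
    rw [h2, Complex.norm_real, Real.norm_eq_abs, abs_neg]
    refine h1.trans ?_
    rw [← sq_abs s]
    calc _ = |s| * S ^ 2 * |s| ^ 3 / 4 := by ring
      _ ≤ |s| * S ^ 2 * |s| ^ 3 := by
          have : 0 ≤ |s| * S ^ 2 * |s| ^ 3 := by positivity
          linarith
      _ ≤ _ := by gcongr
  refine (norm_sub_le_norm_sub_add_norm_sub _ (1 - ((s ^ 2 / 2 * S : ℝ) : ℂ)) _).trans ?_
  refine (add_le_add hrem hend).trans (le_of_eq ?_)
  rw [charApproxConst]; ring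

lemma norm_prod_sub_prod_le_sum {ι : Type*} (s : Finset ι) {x y : ι → ℂ}
    (hx : ∀ i ∈ s, ‖x i‖ ≤ 1) (hy : ∀ i ∈ s, ‖y i‖ ≤ 1) :
    ‖∏ i ∈ s, x i - ∏ i ∈ s, y i‖ ≤ ∑ i ∈ s, ‖x i - y i‖ := by
  classical
  induction s using Finset.induction_on with
  | empty => simp
  | insert i s hi ih =>
    rw [Finset.prod_insert hi, Finset.prod_insert hi, Finset.sum_insert hi]
    have e : x i * ∏ j ∈ s, x j - y i * ∏ j ∈ s, y j =
        (x i - y i) * ∏ j ∈ s, x j + y i * (∏ j ∈ s, x j - ∏ j ∈ s, y j) := by ring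
    rw [e]
    have hp : ‖∏ j ∈ s, x j‖ ≤ 1 := by
      rw [norm_prod]
      exact Finset.prod_le_one (fun j _ => norm_nonneg _) fun j hj =>
        hx j (Finset.mem_insert_of_mem hj)
    refine (norm_add_le _ _).trans (add_le_add ?_ ?_)
    · rw [norm_mul]; exact mul_le_of_le_one_right (norm_nonneg _) hp
    · rw [norm_mul]
      refine (mul_le_of_le_one_left (norm_nonneg _) (hy i (Finset.mem_insert_self i s))).trans ?_
      exact ih (fun j hj => hx j (Finset.mem_insert_of_mem hj))
        fun j hj => hy j (Finset.mem_insert_of_mem hj)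

end

/-! ### The characteristic function for normal inputs -/

section

open scoped Matrix ContDiff
variable {ι : Type*} [Fintype ι] [DecidableEq ι]
variable {O : Matrix ι ι ℝ} {η : ℝ} {g v : ℝ → ℝ} {a A : ℝ}

/-- The derivative of `logChar` in the coordinate `k` is `i t a`, up to a centred linear statistic. -/
lemma norm_logChar_update_sub_le (hO : Incoherent O η) (hP : Profile g v a A) (t : ℝ) (k : ι)
    (ξ : ι → ℝ) (b : ℝ) :
    ‖logChar O g v k t (Function.update ξ k b) -
      (logChar O g v k t ξ + Complex.I * (t * a * (b - ξ k) : ℝ))‖ ≤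
    A * (1 + |t|) ^ 2 *
      ((|linStat O (fun n => O n k * O n k) (fun x => iteratedDeriv 1 g x - a) ξ| + η ^ 2 +
        η ^ 2 * |b - ξ k|) * |b - ξ k|) := by
  have hη := hO.eta_pos
  have hA := hP.one_le
  set D := A * (1 + |t|) ^ 2 with hD
  set z := |linStat O (fun n => O n k * O n k) (fun x => iteratedDeriv 1 g x - a) ξ| with hz
  have hz0 : 0 ≤ z := abs_nonneg _
  set L : ℕ → ℝ → ℂ := fun m x => logCharDeriv O g v k t k m (Function.update ξ k x) with hL
  have hd : ∀ m x, HasDerivAt (L m) (L (m + 1) x) x := fun m x =>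
    hasDerivAt_logCharDeriv hP.mean hP.var k t k m ξ x
  have hb : ∀ m, m + 1 ≤ 4 → ∀ x, ‖L (m + 1) x‖ ≤ D * η ^ (2 * m) := fun m hm x =>
    norm_logCharDeriv_le hO hP.mean hP.var k t k hm _
  have hself : Function.update ξ k (ξ k) = ξ := Function.update_eq_self k ξ
  have htA : t ^ 2 / 2 * A ≤ D := by
    rw [hD, ← sq_abs t]; nlinarith [abs_nonneg t]
  have htD : |t| ≤ D := by
    rw [hD]; nlinarith [abs_nonneg t, sq_nonneg |t|]
  set c : ℂ := Complex.I * (t * a : ℝ) with hc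
  have l1 : ‖L 1 (ξ k) - c‖ ≤ D * (z + η ^ 2) := by
    have e : linStatDeriv O (fun n => O n k) g k 1 ξ - a =
        linStat O (fun n => O n k * O n k) (fun x => iteratedDeriv 1 g x - a) ξ := by
      have h := hO.sum_mul_col k k
      rw [if_pos rfl] at h
      simp only [linStatDeriv, linStat, mul_sub, Finset.sum_sub_distrib]
      rw [← Finset.sum_mul, h, one_mul]
      congr 1
      exact Finset.sum_congr rfl fun n _ => by rw [pow_one, smul_eq_mul, mul_assoc]
    have e2 : L 1 (ξ k) - c = Complex.I *
        (t * linStat O (fun n => O n k * O n k) (fun x => iteratedDeriv 1 g x - a) ξ : ℝ) -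
        (t ^ 2 / 2 * linStatDeriv O (fun n => O n k ^ 2) v k 1 ξ : ℝ) := by
      simp only [hL, hc, hself, logCharDeriv]
      rw [← e]; push_cast; ring
    rw [e2]
    refine (norm_I_mul_sub_le _ _).trans ?_
    rw [abs_mul, abs_mul, abs_of_nonneg (show 0 ≤ t ^ 2 / 2 by positivity)]
    have h2 := abs_linStatDeriv_le hO (sum_abs_sq_col_le hO k) hP.var k (m := 1) (by norm_num) ξ
    calc _ ≤ |t| * z + t ^ 2 / 2 * (A * η ^ (2 * 1)) := by gcongr
      _ = |t| * z + t ^ 2 / 2 * A * η ^ 2 := by ring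
      _ ≤ D * z + D * η ^ 2 := by gcongr
      _ = _ := by ring
  have hshift : ∀ m x, HasDerivAt (fun s => L m (ξ k + s)) (L (m + 1) (ξ k + x)) x := fun m x =>
    HasDerivAt.comp_const_add (ξ k) x (hd m _)
  set y := b - ξ k with hy
  have b1 : ∀ s, |s| ≤ |y| → ‖L 1 (ξ k + s) - c‖ ≤ D * (z + η ^ 2) + D * η ^ 2 * |y| :=
    fun s hs => by
      have h1 := norm_sub_le_of_deriv_le (hshift 1) (r := |y|) (M := D * η ^ (2 * 1))
        (fun x _ => hb 1 (by norm_num) _) hs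
      rw [add_zero] at h1
      have h2 : ‖L 1 (ξ k + s) - L 1 (ξ k)‖ ≤ D * η ^ 2 * |y| :=
        h1.trans (mul_le_mul_of_nonneg_left hs (by positivity))
      have h3 := norm_sub_le_norm_sub_add_norm_sub (L 1 (ξ k + s)) (L 1 (ξ k)) c
      linarith
  have hlin : ∀ x, HasDerivAt (fun s : ℝ => L 0 (ξ k + s) - (s : ℂ) * c)
      (L 1 (ξ k + x) - c) x := fun x => by
    have h1 : HasDerivAt (fun s : ℝ => (s : ℂ) * c) c x := by
      simpa using ((hasDerivAt_id x).ofReal_comp).mul_const c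
    exact (hshift 0 x).fun_sub h1
  have hfin := norm_sub_le_of_deriv_le hlin b1 (y := y) le_rfl
  have e0 : L 0 (ξ k + y) = logChar O g v k t (Function.update ξ k b) := by
    rw [hy, add_sub_cancel]; exact logCharDeriv_zero O g v k t k _
  have e1 : L 0 (ξ k) = logChar O g v k t ξ := by
    have := logCharDeriv_zero O g v k t k ξ
    simp only [hL, hself, this]
  rw [e0, add_zero, e1] at hfin
  calc _ = ‖logChar O g v k t (Function.update ξ k b) - (y : ℂ) * c -
        (logChar O g v k t ξ - ((0 : ℝ) : ℂ) * c)‖ := by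
        congr 1; rw [hc]; push_cast; ring
    _ ≤ _ := hfin.trans (le_of_eq (by ring))

lemma integrable_eval_sq (k : ι) :
    Integrable (fun ξ : ι → ℝ => ξ k ^ 2) (Measure.pi fun _ : ι => stdNormal) :=
  (measurePreserving_eval (fun _ : ι => stdNormal) k).integrable_comp_of_integrable
    (integrable_pow_stdNormal 2)

lemma integral_eval_sq (k : ι) :
    ∫ ξ : ι → ℝ, ξ k ^ 2 ∂(Measure.pi fun _ : ι => stdNormal) = 1 := by
  have h := (measurePreserving_eval (fun _ : ι => stdNormal) k).map_eq
  rw [← integral_sq_stdNormal]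
  conv_rhs => rw [← h]
  rw [integral_map (measurable_pi_apply k).aemeasurable (by fun_prop)]

/-- In the mean, freezing the coordinate `k` at `b` shifts `logChar` by `i t a (b - ξ k)`. -/
lemma norm_integral_update_sub_le (hO : Incoherent O η) (hP : Profile g v a A) (t : ℝ) (k : ι)
    {b : ℝ} (hb : |b| ≤ 1) :
    ‖∫ ξ, Complex.exp (logChar O g v k t ξ) ∂Measure.pi (frozen stdNormal k b) -
      ∫ ξ, Complex.exp (logChar O g v k t ξ + Complex.I * (t * a * (b - ξ k) : ℝ))
        ∂Measure.pi (fun _ : ι => stdNormal)‖ ≤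
    A * (1 + |t|) ^ 2 * (momentConst * A ^ 2 + 9) * η := by
  have hη := hO.eta_pos
  have hη1 := hO.eta_le
  have hA := hP.one_le
  have hm := momentConst_pos
  set D := A * (1 + |t|) ^ 2 with hD
  have hD0 : 0 ≤ D := by positivity
  have hc := continuous_logChar (O := O) hP.mean.smooth.continuous hP.var.smooth.continuous k t
  have hbd := norm_exp_logChar_le (O := O) (g := g) hP.var_nonneg k t
  have hre : ∀ ξ, (logChar O g v k t ξ).re ≤ 0 := fun ξ => by
    have := hbd ξ
    rwa [Complex.norm_exp, Real.exp_le_one_iff] at this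
  have hre2 : ∀ ξ : ι → ℝ,
      (logChar O g v k t ξ + Complex.I * (t * a * (b - ξ k) : ℝ)).re ≤ 0 := fun ξ => by
    have := hre ξ
    simp only [Complex.add_re, Complex.mul_re, Complex.I_re, Complex.I_im, Complex.ofReal_re,
      Complex.ofReal_im]
    linarith
  have i0 : Integrable (fun ξ => Complex.exp (logChar O g v k t ξ))
      (Measure.pi (frozen stdNormal k b)) :=
    integrable_pi_of_bound (M := 1) (by fun_prop) hbd
  have hne : ∀ i, i ≠ k → (fun _ : ι => stdNormal) i = frozen stdNormal k b i := fun i hi => by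
    simp [frozen, hi]
  have hbk : frozen stdNormal k b k = Measure.dirac b := by simp [frozen]
  have e1 := integral_pi_eq_update (μ := fun _ : ι => stdNormal) k hne i0
  have j1 := integrable_integral_update (μ := fun _ : ι => stdNormal) k hne i0
  simp only [hbk, integral_dirac] at e1 j1
  have j2 : Integrable (fun ξ : ι → ℝ =>
      Complex.exp (logChar O g v k t ξ + Complex.I * (t * a * (b - ξ k) : ℝ)))
      (Measure.pi (fun _ : ι => stdNormal)) :=
    integrable_pi_of_bound (M := 1) (by fun_prop) fun ξ => by
      rw [Complex.norm_exp, Real.exp_le_one_iff]; exact hre2 ξ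
  have iz := integrable_pow_linStat (O := O) (μ := fun _ : ι => stdNormal)
    (hO.sum_abs_mul_le k k) hP.slope 2
  have hw4 : ∀ n, |O n k * O n k| ≤ η ^ 4 := fun n => by
    rw [abs_mul, show η ^ 4 = η ^ 2 * η ^ 2 by ring]
    exact mul_le_mul (hO.abs_le n k) (hO.abs_le n k) (abs_nonneg _) (by positivity)
  have hmix : Mixed (fun _ : ι => stdNormal) ∅ :=
    ⟨by simp, fun i _ => Or.inr rfl, fun i hi => absurd hi (by simp)⟩
  have hz2 := integral_sq_linStat_le hO hw4 (hO.sum_abs_mul_le k k) (by linarith) hP.slope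
    hP.integral_slope hmix
  have ik := integrable_eval_sq (ι := ι) k
  rw [e1, ← integral_sub j1 j2]
  set Z : (ι → ℝ) → ℝ := fun ξ =>
    |linStat O (fun n => O n k * O n k) (fun x => iteratedDeriv 1 g x - a) ξ| with hZ
  have ib : Integrable (fun ξ : ι → ℝ => D * (Z ξ ^ 2 * (2 * η ^ 2)⁻¹ + η ^ 2 *
      (5 + 4 * ξ k ^ 2))) (Measure.pi (fun _ : ι => stdNormal)) :=
    ((iz.mul_const _).add (((integrable_const _).add (ik.const_mul 4)).const_mul _)).const_mul D
  calc _ ≤ ∫ ξ : ι → ℝ, D * (Z ξ ^ 2 * (2 * η ^ 2)⁻¹ + η ^ 2 * (5 + 4 * ξ k ^ 2))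
        ∂Measure.pi (fun _ : ι => stdNormal) := by
        refine norm_integral_le_of_norm_le ib (Filter.Eventually.of_forall fun ξ => ?_)
        refine (norm_exp_sub_exp_le (hre _) (hre2 ξ)).trans
          ((norm_logChar_update_sub_le hO hP t k ξ b).trans ?_)
        refine mul_le_mul_of_nonneg_left ?_ hD0
        set y := |b - ξ k| with hy
        have hy0 : 0 ≤ y := abs_nonneg _
        have hy2 : y ^ 2 ≤ 2 + 2 * ξ k ^ 2 := by
          rw [hy, sq_abs]
          have := (sq_le_one_iff_abs_le_one b).2 hb
          nlinarith [sq_nonneg (b + ξ k)]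
        have h1 : Z ξ * y ≤ Z ξ ^ 2 * (2 * η ^ 2)⁻¹ + η ^ 2 * (y ^ 2 / 2) := by
          have e : Z ξ ^ 2 * (2 * η ^ 2)⁻¹ + η ^ 2 * (y ^ 2 / 2) - Z ξ * y =
              (2 * η ^ 2)⁻¹ * (Z ξ - η ^ 2 * y) ^ 2 := by field_simp; ring
          have : 0 ≤ (2 * η ^ 2)⁻¹ * (Z ξ - η ^ 2 * y) ^ 2 := by positivity
          linarith
        have h2 : y ^ 2 / 2 + y + y ^ 2 ≤ 5 + 4 * ξ k ^ 2 := by nlinarith [sq_nonneg (y - 1)]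
        have h3 := mul_le_mul_of_nonneg_left h2 (sq_nonneg η)
        calc _ = Z ξ * y + η ^ 2 * y + η ^ 2 * y ^ 2 := by ring
          _ ≤ _ := by linarith
    _ = D * ((∫ ξ, Z ξ ^ 2 ∂Measure.pi (fun _ : ι => stdNormal)) * (2 * η ^ 2)⁻¹ +
        η ^ 2 * 9) := by
        have i5 : Integrable (fun ξ : ι → ℝ => 5 + 4 * ξ k ^ 2)
          (Measure.pi (fun _ : ι => stdNormal)) := (integrable_const _).add (ik.const_mul 4)
        rw [integral_const_mul, integral_add (iz.mul_const _) (i5.const_mul _),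
          integral_mul_const, integral_const_mul, integral_add (integrable_const _)
          (ik.const_mul 4), integral_const_mul, integral_eval_sq]
        simp only [integral_const, probReal_univ, one_smul]; ring
    _ ≤ D * (momentConst * A ^ 2 * η ^ 4 * (2 * η ^ 2)⁻¹ + η ^ 2 * 9) := by gcongr
    _ = D * (momentConst * A ^ 2 / 2 + 9) * η ^ 2 := by field_simp
    _ ≤ D * (momentConst * A ^ 2 + 9) * η := by
        gcongr
        · have : 0 ≤ momentConst * A ^ 2 := by positivity
          linarith
        · exact pow_le_of_le_one hη.le hη1 (by norm_num)

/-- A bound for `E (A (1 + |z|)) ^ 3`, `z` standard normal. -/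
noncomputable def thirdMomentConst (A : ℝ) : ℝ := ∫ z : ℝ, (A * (1 + |z|)) ^ 3 ∂stdNormal

lemma integrable_one_add_abs_cube (A : ℝ) :
    Integrable (fun z : ℝ => (A * (1 + |z|)) ^ 3) stdNormal := by
  have h : Integrable (fun z : ℝ => |A| ^ 3 * (4 + 24 * Real.exp (1 * |z|))) stdNormal :=
    ((integrable_const _).add ((integrable_exp_mul_abs_stdNormal 1).const_mul 24)).const_mul _
  refine h.mono' (by fun_prop) (Filter.Eventually.of_forall fun z => ?_)
  have h0 := abs_nonneg z
  have h1 := pow_abs_le_exp 3 z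
  rw [norm_pow, norm_mul, Real.norm_eq_abs, Real.norm_eq_abs,
    abs_of_nonneg (show 0 ≤ 1 + |z| by positivity), mul_pow, one_mul]
  refine mul_le_mul_of_nonneg_left ?_ (by positivity)
  simp only [Nat.factorial] at h1
  push_cast at h1
  nlinarith [mul_nonneg (sq_nonneg (|z| - 1)) (show 0 ≤ |z| + 1 by positivity)]

lemma integral_exp_eq_prod (hO : Incoherent O η) (hg : Continuous g) (hv : Continuous v) (t : ℝ)
    (k : ι) (b : ℝ) :
    ∫ ξ, Complex.exp (logChar O g v k t ξ + Complex.I * (t * a * (b - ξ k) : ℝ))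
        ∂Measure.pi (fun _ : ι => stdNormal) =
      Complex.exp (Complex.I * (t * a * b : ℝ)) *
      ∏ n, ∫ z, Complex.exp (Complex.I * (t * O n k * (g z - a * z) : ℝ) -
        ((t * O n k) ^ 2 / 2 * v z : ℝ)) ∂stdNormal := by
  rw [← integral_fintype_prod_eq_prod (fun n z => Complex.exp (Complex.I *
    (t * O n k * (g z - a * z) : ℝ) - ((t * O n k) ^ 2 / 2 * v z : ℝ))), ← integral_const_mul]
  conv_rhs => rw [← hO.measurePreserving.map_eq]
  rw [integral_map hO.measurePreserving.aemeasurable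
    (Continuous.aestronglyMeasurable (by fun_prop))]
  congr 1
  ext ξ
  have hξ : ξ k = ∑ n, O n k * (O *ᵥ ξ) n := by
    conv_lhs => rw [← hO.mulVec_transpose_mulVec ξ]
    rfl
  rw [← Complex.exp_sum, ← Complex.exp_add]
  congr 1
  rw [Finset.sum_sub_distrib, ← Finset.mul_sum, ← Complex.ofReal_sum, ← Complex.ofReal_sum,
    logChar]
  have e1 : ∑ n, t * O n k * (g ((O *ᵥ ξ) n) - a * (O *ᵥ ξ) n) =
      t * linStat O (fun n => O n k) g ξ - t * a * ξ k := by
    rw [hξ, linStat, Finset.mul_sum, Finset.mul_sum, ← Finset.sum_sub_distrib]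
    exact Finset.sum_congr rfl fun n _ => by ring
  have e2 : ∑ n, (t * O n k) ^ 2 / 2 * v ((O *ᵥ ξ) n) =
      t ^ 2 / 2 * linStat O (fun n => O n k ^ 2) v ξ := by
    rw [linStat, Finset.mul_sum]
    exact Finset.sum_congr rfl fun n _ => by ring
  rw [e1, e2]
  push_cast
  ring

lemma sum_abs_cube_le (hO : Incoherent O η) (t : ℝ) (k : ι) :
    ∑ n, |t * O n k| ^ 3 ≤ |t| ^ 3 * η := by
  have hη := hO.eta_pos
  calc _ ≤ ∑ n, |t| ^ 3 * (η * O n k ^ 2) := Finset.sum_le_sum fun n _ => by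
        rw [abs_mul, mul_pow, ← sq_abs (O n k), pow_succ' |O n k|]
        have h := (hO.abs_le n k).trans (pow_le_of_le_one hη.le hO.eta_le two_ne_zero)
        gcongr
    _ = _ := by rw [← Finset.mul_sum, ← Finset.mul_sum, hO.sum_sq_col, mul_one]

lemma prod_exp_neg_eq (hO : Incoherent O η) (t S : ℝ) (k : ι) :
    ∏ n, Complex.exp (-((t * O n k) ^ 2 / 2 * S : ℝ)) = Complex.exp (-(t ^ 2 / 2 * S : ℝ)) := by
  rw [← Complex.exp_sum, Finset.sum_neg_distrib, ← Complex.ofReal_sum]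
  congr 3
  calc _ = t ^ 2 / 2 * S * ∑ n, O n k ^ 2 := by
        rw [Finset.mul_sum]; exact Finset.sum_congr rfl fun n _ => by ring
    _ = _ := by rw [hO.sum_sq_col, mul_one]

lemma abs_mul_col_le (hO : Incoherent O η) (t : ℝ) (n k : ι) : |t * O n k| ≤ |t| := by
  rw [abs_mul]
  exact mul_le_of_le_one_right (abs_nonneg _)
    ((hO.abs_le n k).trans (pow_le_one₀ hO.eta_pos.le hO.eta_le))

lemma norm_exp_neg_le {x : ℝ} (hx : 0 ≤ x) : ‖Complex.exp (-(x : ℂ))‖ ≤ 1 := by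
  rw [← Complex.ofReal_neg, Complex.norm_exp_ofReal, Real.exp_le_one_iff]
  linarith

/-- After the replacement of the signs by normal variables, the characteristic function is a product
of one-dimensional ones, and nearly Gaussian. -/
lemma norm_integral_stdNormal_sub_le (hO : Incoherent O η) (hP : Profile g v a A) (t : ℝ) (k : ι)
    (b : ℝ) {S : ℝ} (h0 : ∫ z, (g z - a * z) ∂stdNormal = 0)
    (hS : ∫ z, ((g z - a * z) ^ 2 + v z) ∂stdNormal = S) :
    ‖∫ ξ, Complex.exp (logChar O g v k t ξ + Complex.I * (t * a * (b - ξ k) : ℝ))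
        ∂Measure.pi (fun _ : ι => stdNormal) -
      Complex.exp (Complex.I * (t * a * b : ℝ) - (t ^ 2 / 2 * S : ℝ))‖ ≤
    charApproxConst A (thirdMomentConst (2 * A)) |t| * |t| ^ 3 * η := by
  have hA := hP.one_le
  have hgc : Continuous g := hP.mean.smooth.continuous
  have hvc : Continuous v := hP.var.smooth.continuous
  have ha : |a| ≤ 2 * A := by
    have h1 := hP.mean.bound 1 (by norm_num) 0
    have h2 := hP.slope.abs_le 0
    calc |a| = |iteratedDeriv 1 g 0 - (iteratedDeriv 1 g 0 - a)| := by ring_nf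
      _ ≤ _ := (abs_sub _ _).trans (by linarith)
  have hcube : ∀ z, |g z - a * z| ^ 3 ≤ (2 * A * (1 + |z|)) ^ 3 := fun z => by
    refine pow_le_pow_left₀ (abs_nonneg _) ?_ 3
    have h1 := hP.mean.abs_le z
    have h2 : |a * z| ≤ 2 * A * |z| := by rw [abs_mul]; gcongr
    have := abs_sub (g z) (a * z)
    linarith
  have i3 : Integrable (fun z => |g z - a * z| ^ 3) stdNormal :=
    (integrable_one_add_abs_cube (2 * A)).mono' (by fun_prop) (Filter.Eventually.of_forall fun z =>
      by rw [Real.norm_eq_abs, abs_of_nonneg (by positivity)]; exact hcube z)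
  have hS0 : 0 ≤ S := by
    rw [← hS]; exact integral_nonneg fun z => add_nonneg (sq_nonneg _) (hP.var_nonneg z)
  have hT : 0 ≤ thirdMomentConst (2 * A) := integral_nonneg fun z => by positivity
  have hC := charApproxConst_nonneg (A := A) (by linarith) hT (abs_nonneg t)
  rw [integral_exp_eq_prod hO hgc hvc, sub_eq_add_neg (Complex.I * ((t * a * b : ℝ) : ℂ)),
    Complex.exp_add, ← mul_sub, norm_mul]
  have h1 : ‖Complex.exp (Complex.I * ((t * a * b : ℝ) : ℂ))‖ = 1 := by
    rw [Complex.norm_exp]; simp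
  rw [h1, one_mul, ← prod_exp_neg_eq hO t S k]
  refine (norm_prod_sub_prod_le_sum _ (fun n _ => ?_)
    fun n _ => norm_exp_neg_le (by positivity)).trans ?_
  · have hle : ∀ z, ‖Complex.exp (Complex.I * (t * O n k * (g z - a * z) : ℝ) -
        ((t * O n k) ^ 2 / 2 * v z : ℝ))‖ ≤ 1 := fun z => by
      rw [Complex.norm_exp, Real.exp_le_one_iff]
      have := hP.var_nonneg z
      simp only [Complex.sub_re, Complex.mul_re, Complex.I_re, Complex.I_im, Complex.ofReal_re,
        Complex.ofReal_im]
      have : 0 ≤ (t * O n k) ^ 2 / 2 * v z := by positivity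
      linarith
    calc _ ≤ ∫ z, (1 : ℝ) ∂stdNormal :=
          norm_integral_le_of_norm_le (integrable_const _) (Filter.Eventually.of_forall hle)
      _ = 1 := by simp
  · calc _ ≤ ∑ n, charApproxConst A (thirdMomentConst (2 * A)) |t| * |t * O n k| ^ 3 :=
          Finset.sum_le_sum fun n _ => norm_integral_exp_sub_le
            (h := fun z => g z - a * z) (v := v)
            (Continuous.aestronglyMeasurable (by fun_prop)) hvc.aestronglyMeasurable
            hP.var_nonneg (fun z => (le_abs_self _).trans (hP.var.abs_le z)) i3
            (integral_mono i3 (integrable_one_add_abs_cube (2 * A)) hcube) h0 hS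
            (abs_mul_col_le hO t n k)
      _ ≤ _ := by
          rw [← Finset.mul_sum, mul_assoc]
          exact mul_le_mul_of_nonneg_left (sum_abs_cube_le hO t k) hC

end

/-! ### A central limit theorem for one output coordinate -/

section

open scoped Matrix
variable {ι : Type*} [Fintype ι] [DecidableEq ι]
variable {O : Matrix ι ι ℝ} {η : ℝ} {f g v : ℝ → ℝ} {a A τ : ℝ}

lemma norm_integral_noise_sub_le (hf : Measurable f) (hfA : ∀ x, |f x| ≤ A) {s t : ℝ}
    (hs : |s| ≤ t) (x : ℝ) {m V : ℝ} (hm : m = ∫ w, f (x + τ * w) ∂stdNormal)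
    (hV : V = ∫ w, f (x + τ * w) ^ 2 ∂stdNormal - m ^ 2) :
    ‖∫ w, Complex.exp (Complex.I * (s * f (x + τ * w) : ℝ)) ∂stdNormal -
      Complex.exp (Complex.I * (s * m : ℝ) - (s ^ 2 / 2 * V : ℝ))‖ ≤
    charApproxConst 0 ((2 * A) ^ 3) t * |s| ^ 3 := by
  have hA : 0 ≤ A := (abs_nonneg _).trans (hfA 0)
  have hF : Measurable fun w => f (x + τ * w) := hf.comp (by fun_prop)
  have iF : Integrable (fun w => f (x + τ * w)) stdNormal :=
    Integrable.of_bound hF.aestronglyMeasurable A (Filter.Eventually.of_forall fun w => hfA _)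
  have iF2 : Integrable (fun w => f (x + τ * w) ^ 2) stdNormal :=
    Integrable.of_bound (hF.pow_const 2).aestronglyMeasurable (A ^ 2)
      (Filter.Eventually.of_forall fun w => by
        rw [norm_pow]; exact pow_le_pow_left₀ (norm_nonneg _) (hfA _) 2)
  have hmA : |m| ≤ A := by
    rw [hm, ← Real.norm_eq_abs]
    calc _ ≤ ∫ w, A ∂stdNormal :=
          norm_integral_le_of_norm_le (integrable_const _) (Filter.Eventually.of_forall fun w =>
            hfA _)
      _ = A := by simp
  have hcube : ∀ w, |f (x + τ * w) - m| ^ 3 ≤ (2 * A) ^ 3 := fun w => by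
    refine pow_le_pow_left₀ (abs_nonneg _) ((abs_sub _ _).trans ?_) 3
    have := hfA (x + τ * w)
    linarith
  have i3 : Integrable (fun w => |f (x + τ * w) - m| ^ 3) stdNormal :=
    Integrable.of_bound ((hF.sub_const m).norm.pow_const 3).aestronglyMeasurable ((2 * A) ^ 3) (Filter.Eventually.of_forall fun w => by
      rw [Real.norm_eq_abs, abs_of_nonneg (by positivity)]; exact hcube w)
  have key := norm_integral_exp_sub_le (P := stdNormal) (h := fun w => f (x + τ * w) - m)
    (v := fun _ => 0) (A := 0) (T := (2 * A) ^ 3) (s := s) (t := t) (S := V)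
    (hF.sub_const m).aestronglyMeasurable (by fun_prop) (fun _ => le_rfl) (fun _ => le_rfl) i3
    (by
      calc _ ≤ ∫ w, (2 * A) ^ 3 ∂stdNormal := integral_mono i3 (integrable_const _) hcube
        _ = _ := by simp)
    (by rw [integral_sub iF (integrable_const _), ← hm]; simp)
    (by
      have e : ∀ w, (f (x + τ * w) - m) ^ 2 + 0 =
          f (x + τ * w) ^ 2 - (2 * m * f (x + τ * w) - m ^ 2) := fun w => by ring
      simp only [e]
      have i1 : Integrable (fun w => 2 * m * f (x + τ * w) - m ^ 2) stdNormal :=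
        (iF.const_mul _).sub (integrable_const _)
      rw [integral_sub iF2 i1, integral_sub (iF.const_mul _) (integrable_const _),
        integral_const_mul, ← hm, integral_const, hV]
      simp
      ring) hs
  have e1 : ∫ w, Complex.exp (Complex.I * (s * f (x + τ * w) : ℝ)) ∂stdNormal =
      Complex.exp (Complex.I * (s * m : ℝ)) * ∫ w, Complex.exp (Complex.I *
        (s * (f (x + τ * w) - m) : ℝ) - (s ^ 2 / 2 * 0 : ℝ)) ∂stdNormal := by
    rw [← integral_const_mul]
    congr 1; ext w
    rw [← Complex.exp_add]
    congr 1; push_cast; ring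
  rw [e1, sub_eq_add_neg (Complex.I * ((s * m : ℝ) : ℂ)), Complex.exp_add, ← mul_sub, norm_mul]
  have h1 : ‖Complex.exp (Complex.I * ((s * m : ℝ) : ℂ))‖ = 1 := by
    rw [Complex.norm_exp]; simp
  rw [h1, one_mul]
  exact key

lemma norm_prod_noise_sub_le (hO : Incoherent O η) (hf : Measurable f) (hfA : ∀ x, |f x| ≤ A)
    (hv0 : ∀ x, 0 ≤ v x)
    (hg : ∀ x, g x = ∫ w, f (x + τ * w) ∂stdNormal)
    (hv : ∀ x, v x = ∫ w, f (x + τ * w) ^ 2 ∂stdNormal - g x ^ 2) (t : ℝ) (k : ι) (ξ : ι → ℝ) :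
    ‖∏ n, ∫ w, Complex.exp (Complex.I * (t * O n k * f ((O *ᵥ ξ) n + τ * w) : ℝ)) ∂stdNormal -
      Complex.exp (logChar O g v k t ξ)‖ ≤
    charApproxConst 0 ((2 * A) ^ 3) |t| * |t| ^ 3 * η := by
  have hA : 0 ≤ A := (abs_nonneg _).trans (hfA 0)
  have e : Complex.exp (logChar O g v k t ξ) = ∏ n, Complex.exp (Complex.I *
      (t * O n k * g ((O *ᵥ ξ) n) : ℝ) - ((t * O n k) ^ 2 / 2 * v ((O *ᵥ ξ) n) : ℝ)) := by
    rw [← Complex.exp_sum, Finset.sum_sub_distrib, ← Finset.mul_sum, ← Complex.ofReal_sum,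
      ← Complex.ofReal_sum, logChar]
    have e1 : t * linStat O (fun n => O n k) g ξ = ∑ n, t * O n k * g ((O *ᵥ ξ) n) := by
      rw [linStat, Finset.mul_sum]; exact Finset.sum_congr rfl fun n _ => by ring
    have e2 : t ^ 2 / 2 * linStat O (fun n => O n k ^ 2) v ξ =
        ∑ n, (t * O n k) ^ 2 / 2 * v ((O *ᵥ ξ) n) := by
      rw [linStat, Finset.mul_sum]; exact Finset.sum_congr rfl fun n _ => by ring
    rw [e1, e2]
  rw [e]
  refine (norm_prod_sub_prod_le_sum _ (fun n _ => ?_) (fun n _ => ?_)).trans ?_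
  · calc _ ≤ ∫ w, (1 : ℝ) ∂stdNormal :=
          norm_integral_le_of_norm_le (integrable_const _) (Filter.Eventually.of_forall fun w => by
            rw [Complex.norm_exp]; simp)
      _ = 1 := by simp
  · rw [Complex.norm_exp, Real.exp_le_one_iff]
    have := hv0 ((O *ᵥ ξ) n)
    simp only [Complex.sub_re, Complex.mul_re, Complex.I_re, Complex.I_im, Complex.ofReal_re,
      Complex.ofReal_im]
    have : 0 ≤ (t * O n k) ^ 2 / 2 * v ((O *ᵥ ξ) n) := by positivity
    linarith
  · calc _ ≤ ∑ n, charApproxConst 0 ((2 * A) ^ 3) |t| * |t * O n k| ^ 3 :=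
          Finset.sum_le_sum fun n _ => norm_integral_noise_sub_le hf hfA (abs_mul_col_le hO t n k)
            _ (hg _) (hv _)
      _ ≤ _ := by
          rw [← Finset.mul_sum, mul_assoc]
          exact mul_le_mul_of_nonneg_left (sum_abs_cube_le hO t k)
            (charApproxConst_nonneg le_rfl (by positivity) (abs_nonneg t))

/-- The constant of `norm_charFun_output_sub_le`. -/
noncomputable def outputConst (A t : ℝ) : ℝ :=
  charApproxConst 0 ((2 * A) ^ 3) |t| * |t| ^ 3 + lindebergConst A t +
    A * (1 + |t|) ^ 2 * (momentConst * A ^ 2 + 9) +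
    charApproxConst A (thirdMomentConst (2 * A)) |t| * |t| ^ 3

/-- The output coordinate `k` of the nonlinear orthogonal system with input `ξ`, noise `τ ω` and
scalar nonlinearity `f`. -/
noncomputable def output (O : Matrix ι ι ℝ) (f : ℝ → ℝ) (τ : ℝ) (k : ι) (ξ ω : ι → ℝ) : ℝ :=
  ∑ n, O n k * f ((O *ᵥ ξ) n + τ * ω n)

lemma measurable_output (O : Matrix ι ι ℝ) (hf : Measurable f) (τ : ℝ) (k : ι) :
    Measurable fun p : (ι → ℝ) × (ι → ℝ) => output O f τ k p.1 p.2 := by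
  unfold output
  refine Finset.measurable_sum _ fun n _ => ((hf.comp ?_).const_mul _)
  exact ((continuous_mulVec_apply O n).measurable.comp measurable_fst).add
    (((measurable_pi_apply n).comp measurable_snd).const_mul _)

/-- Central limit theorem with a rate for the characteristic function of one output coordinate, given
the corresponding input `b`: the limit is normal with mean `a b` and variance `S`, uniformly in the
matrix and in the coordinate. -/
theorem norm_charFun_output_sub_le (hO : Incoherent O η) (hP : Profile g v a A)
    (hf : Measurable f) (hfA : ∀ x, |f x| ≤ A)
    (hg : ∀ x, g x = ∫ w, f (x + τ * w) ∂stdNormal)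
    (hv : ∀ x, v x = ∫ w, f (x + τ * w) ^ 2 ∂stdNormal - g x ^ 2) {S : ℝ}
    (h0 : ∫ z, (g z - a * z) ∂stdNormal = 0)
    (hS : ∫ z, ((g z - a * z) ^ 2 + v z) ∂stdNormal = S) (t : ℝ) (k : ι) {b : ℝ} (hb : |b| ≤ 1) :
    ‖∫ ξ, ∫ ω, Complex.exp (Complex.I * (t * output O f τ k ξ ω : ℝ))
        ∂Measure.pi (fun _ : ι => stdNormal) ∂Measure.pi (frozen rademacher k b) -
      Complex.exp (Complex.I * (t * a * b : ℝ) - (t ^ 2 / 2 * S : ℝ))‖ ≤ outputConst A t * η := by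
  have hinner : ∀ ξ, ∫ ω, Complex.exp (Complex.I * (t * output O f τ k ξ ω : ℝ))
        ∂Measure.pi (fun _ : ι => stdNormal) =
      ∏ n, ∫ w, Complex.exp (Complex.I * (t * O n k * f ((O *ᵥ ξ) n + τ * w) : ℝ)) ∂stdNormal :=
    fun ξ => by
      rw [← integral_fintype_prod_eq_prod (fun n w => Complex.exp (Complex.I *
        (t * O n k * f ((O *ᵥ ξ) n + τ * w) : ℝ)))]
      congr 1; ext ω
      rw [← Complex.exp_sum, ← Finset.mul_sum, ← Complex.ofReal_sum, output, Finset.mul_sum]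
      simp only [mul_assoc]
  simp only [hinner]
  set Φ : (ι → ℝ) → ℂ := fun ξ => ∏ n, ∫ w, Complex.exp (Complex.I *
    (t * O n k * f ((O *ᵥ ξ) n + τ * w) : ℝ)) ∂stdNormal with hΦ
  have hm1 : ∀ n, Measurable fun x : ℝ => ∫ w, Complex.exp (Complex.I *
      (t * O n k * f (x + τ * w) : ℝ)) ∂stdNormal := fun n => by
    have h1 : Measurable fun p : ℝ × ℝ => Complex.exp (Complex.I *
        (t * O n k * f (p.1 + τ * p.2) : ℝ)) := by
      have h2 : Measurable fun p : ℝ × ℝ => f (p.1 + τ * p.2) := hf.comp (by fun_prop)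
      exact Complex.measurable_exp.comp ((Complex.measurable_ofReal.comp
        (h2.const_mul _)).const_mul _)
    exact (h1.stronglyMeasurable.integral_prod_right (ν := stdNormal)).measurable
  have hmΦ : Measurable Φ := Finset.measurable_prod _ fun n _ =>
    (hm1 n).comp (continuous_mulVec_apply O n).measurable
  have hΦ1 : ∀ ξ, ‖Φ ξ‖ ≤ 1 := fun ξ => by
    rw [hΦ, norm_prod]
    refine Finset.prod_le_one (fun n _ => norm_nonneg _) fun n _ => ?_
    calc _ ≤ ∫ w, (1 : ℝ) ∂stdNormal :=
          norm_integral_le_of_norm_le (integrable_const _) (Filter.Eventually.of_forall fun w => by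
            rw [Complex.norm_exp]; simp)
      _ = 1 := by simp
  have iΦ : Integrable Φ (Measure.pi (frozen rademacher k b)) :=
    Integrable.of_bound hmΦ.aestronglyMeasurable 1 (Filter.Eventually.of_forall hΦ1)
  have hc := continuous_logChar (O := O) hP.mean.smooth.continuous hP.var.smooth.continuous k t
  have iL : Integrable (fun ξ => Complex.exp (logChar O g v k t ξ))
      (Measure.pi (frozen rademacher k b)) :=
    integrable_pi_of_bound (M := 1) (by fun_prop)
      (norm_exp_logChar_le (O := O) (g := g) hP.var_nonneg k t)
  have s1 : ‖∫ ξ, Φ ξ ∂Measure.pi (frozen rademacher k b) -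
      ∫ ξ, Complex.exp (logChar O g v k t ξ) ∂Measure.pi (frozen rademacher k b)‖ ≤
      charApproxConst 0 ((2 * A) ^ 3) |t| * |t| ^ 3 * η := by
    rw [← integral_sub iΦ iL]
    calc _ ≤ ∫ ξ : ι → ℝ, charApproxConst 0 ((2 * A) ^ 3) |t| * |t| ^ 3 * η
          ∂Measure.pi (frozen rademacher k b) :=
          norm_integral_le_of_norm_le (integrable_const _) (Filter.Eventually.of_forall fun ξ =>
            norm_prod_noise_sub_le hO hf hfA hP.var_nonneg hg hv t k ξ)
      _ = _ := by simp
  have s2 := norm_frozen_sub_le hO hP t k hb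
  have s3 := norm_integral_update_sub_le hO hP t k hb
  have s4 := norm_integral_stdNormal_sub_le hO hP t k b h0 hS
  refine (norm_sub_le_norm_sub_add_norm_sub _ _ _).trans ((add_le_add s1
    ((norm_sub_le_norm_sub_add_norm_sub _ _ _).trans (add_le_add s2
    ((norm_sub_le_norm_sub_add_norm_sub _ _ _).trans (add_le_add s3 s4))))).trans (le_of_eq ?_))
  rw [outputConst]; ring

end

/-! ### The modulo operation and its Gaussian averages -/

section

open scoped Matrix ContDiff

/-- The real modulo operation, onto `[-K / 2, K / 2)`. -/
noncomputable def rmod (K y : ℝ) : ℝ := y - (⌊y / K + 1 / 2⌋ : ℝ) * K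

lemma measurable_rmod (K : ℝ) : Measurable (rmod K) := by
  unfold rmod
  exact measurable_id.sub ((measurable_from_top.comp (Int.measurable_floor.comp
    ((measurable_id.div_const K).add_const _))).mul_const K)

lemma abs_rmod_le {K : ℝ} (hK : 0 < K) (y : ℝ) : |rmod K y| ≤ K / 2 := by
  have h1 := Int.floor_le (y / K + 1 / 2)
  have h2 := Int.lt_floor_add_one (y / K + 1 / 2)
  have h3 : y = y / K * K := by field_simp
  unfold rmod
  rw [abs_le]
  constructor <;> nlinarith

lemma rmod_add_int_mul {K : ℝ} (hK : 0 < K) (y : ℝ) (n : ℤ) : rmod K (y + n * K) = rmod K y := by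
  have : (y + n * K) / K + 1 / 2 = y / K + 1 / 2 + n := by field_simp; ring
  unfold rmod
  rw [this, Int.floor_add_intCast]
  push_cast; ring

lemma rmod_periodic {K : ℝ} (hK : 0 < K) : Function.Periodic (rmod K) K := fun y => by
  simpa using rmod_add_int_mul hK y 1

lemma rmod_eq_self {K y : ℝ} (hK : 0 < K) (h1 : -(K / 2) ≤ y) (h2 : y < K / 2) : rmod K y = y := by
  have : ⌊y / K + 1 / 2⌋ = 0 := by
    rw [Int.floor_eq_zero_iff]
    have h3 : y = y / K * K := by field_simp
    constructor <;> nlinarith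
  rw [rmod, this]; simp

lemma rmod_neg {K y : ℝ} (h : ∀ n : ℤ, y / K + 1 / 2 ≠ n) : rmod K (-y) = -rmod K y := by
  have : ⌊-y / K + 1 / 2⌋ = -⌊y / K + 1 / 2⌋ := by
    rw [Int.floor_eq_iff]
    have h1 := Int.floor_le (y / K + 1 / 2)
    have h2 := Int.lt_floor_add_one (y / K + 1 / 2)
    have h3 := lt_of_le_of_ne h1 (h _).symm
    push_cast
    rw [neg_div]
    constructor <;> linarith
  unfold rmod
  rw [this]; push_cast; ring

/-- The modulo operation is odd up to a null set. -/
lemma ae_rmod_neg {K τ : ℝ} (hK : 0 < K) (hτ : 0 < τ) (x : ℝ) :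
    ∀ᵐ w ∂stdNormal, rmod K (-(x + τ * w)) = -rmod K (x + τ * w) := by
  have hc : (Set.range fun n : ℤ => (((n : ℝ) - 1 / 2) * K - x) / τ).Countable :=
    Set.countable_range _
  have : NullSingletonClass stdNormal := nullSingletonClass_gaussianReal one_ne_zero
  filter_upwards [hc.ae_notMem stdNormal] with w hw
  refine rmod_neg fun n hn => hw ⟨n, ?_⟩
  simp only
  rw [← hn]
  field_simp
  ring

/-- The Gaussian average of `φ` at scale `τ`. -/
noncomputable def gaussAvg (φ : ℝ → ℝ) (τ x : ℝ) : ℝ := ∫ w, φ (x + τ * w) ∂stdNormal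

variable {φ : ℝ → ℝ} {τ M : ℝ}

lemma integrable_comp_add_mul (hφ : Measurable φ) (hM : ∀ x, |φ x| ≤ M) (x : ℝ) :
    Integrable (fun w => φ (x + τ * w)) stdNormal :=
  Integrable.of_bound (hφ.comp (by fun_prop)).aestronglyMeasurable M
    (Filter.Eventually.of_forall fun _ => hM _)

/-- A translation of the standard normal law is an exponential tilt. -/
lemma integral_add_stdNormal (ψ : ℝ → ℝ) (m : ℝ) :
    ∫ w, ψ (w + m) ∂stdNormal = Real.exp (-(m ^ 2 / 2)) * ∫ w, Real.exp (m * w) * ψ w ∂stdNormal := by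
  rw [integral_gaussianReal_eq_integral_smul one_ne_zero,
    integral_gaussianReal_eq_integral_smul one_ne_zero, ← integral_const_mul,
    ← integral_sub_right_eq_self _ m]
  congr 1; ext w
  simp only [gaussianPDFReal, smul_eq_mul, sub_add_cancel, sub_zero, NNReal.coe_one, mul_one]
  have : Real.exp (-(w - m) ^ 2 / 2) =
      Real.exp (-(m ^ 2 / 2)) * (Real.exp (-w ^ 2 / 2) * Real.exp (m * w)) := by
    rw [← Real.exp_add, ← Real.exp_add]; ring_nf
  rw [this]; ring

lemma contDiff_gaussAvg_of_nonneg (hφ : Measurable φ) (h0 : ∀ x, 0 ≤ φ x) (hM : ∀ x, φ x ≤ M)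
    (hτ : τ ≠ 0) : ContDiff ℝ ∞ (gaussAvg φ τ) := by
  have hm : Measurable fun w => φ (τ * w) := hφ.comp (by fun_prop)
  set ν : Measure ℝ := stdNormal.withDensity fun w => ENNReal.ofReal (φ (τ * w)) with hν
  have hle : ν ≤ ENNReal.ofReal M • stdNormal := by
    rw [hν, ← withDensity_const]
    exact withDensity_mono (Filter.Eventually.of_forall fun w => ENNReal.ofReal_le_ofReal (hM _))
  have hset : integrableExpSet id ν = Set.univ := by
    ext t
    simp only [integrableExpSet, Set.mem_ofPred_eq, Set.mem_univ, iff_true]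
    exact ((integrable_exp_mul_gaussianReal t).smul_measure ENNReal.ofReal_ne_top).mono_measure hle
  have hmgf : ContDiff ℝ ∞ (mgf id ν) := by
    have h := analyticOnNhd_mgf (X := id) (μ := ν)
    rw [hset, interior_univ] at h
    exact contDiffOn_univ.1 (h.contDiffOn uniqueDiffOn_univ)
  have e : gaussAvg φ τ = fun x => Real.exp (-((x / τ) ^ 2 / 2)) * mgf id ν (x / τ) := by
    ext x
    have h1 := integral_add_stdNormal (fun w => φ (τ * w)) (x / τ)
    have h2 : ∀ w, τ * (w + x / τ) = x + τ * w := fun w => by field_simp; ring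
    simp only [h2] at h1
    rw [gaussAvg, h1, mgf, hν, integral_withDensity_eq_integral_toReal_smul
      (hm.ennreal_ofReal) (Filter.Eventually.of_forall fun _ => ENNReal.ofReal_lt_top)]
    congr 2; ext w
    rw [ENNReal.toReal_ofReal (h0 _), smul_eq_mul, mul_comm]; rfl
  rw [e]
  have h3 : ContDiff ℝ ∞ fun x : ℝ => x / τ := contDiff_id.div_const τ
  exact (((h3.pow 2).div_const 2).neg.exp).mul (hmgf.comp h3)

lemma contDiff_gaussAvg (hφ : Measurable φ) (hM : ∀ x, |φ x| ≤ M) (hτ : τ ≠ 0) :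
    ContDiff ℝ ∞ (gaussAvg φ τ) := by
  have h := contDiff_gaussAvg_of_nonneg (φ := fun x => φ x + M) (M := M + M) (hφ.add_const M)
    (fun x => by have := (abs_le.1 (hM x)).1; linarith)
    (fun x => by have := (abs_le.1 (hM x)).2; linarith) hτ
  have e : gaussAvg φ τ = fun x => gaussAvg (fun x => φ x + M) τ x - M := by
    ext x
    simp only [gaussAvg]
    rw [integral_add (integrable_comp_add_mul hφ hM x) (integrable_const _)]
    simp
  rw [e]
  exact h.sub contDiff_const

lemma gaussAvg_periodic {K : ℝ} (h : Function.Periodic φ K) : Function.Periodic (gaussAvg φ τ) K :=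
  fun x => by
    simp only [gaussAvg]
    congr 1; ext w
    rw [add_right_comm, h]

lemma iteratedDeriv_periodic {p : ℝ → ℝ} {K : ℝ} (h : Function.Periodic p K) (m : ℕ) :
    Function.Periodic (iteratedDeriv m p) K := fun x => by
  have := iteratedDeriv_comp_add_const m p K
  have e : (fun z => p (z + K)) = p := funext h
  rw [e] at this
  exact (congrFun this x).symm

/-- A smooth periodic function has bounded derivatives. -/
lemma exists_smoothBounded {p : ℝ → ℝ} {K : ℝ} (hK : K ≠ 0) (hp : ContDiff ℝ ∞ p)
    (h : Function.Periodic p K) : ∃ A, SmoothBounded p A := by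
  have hb : ∀ m, ∃ A, ∀ x, |iteratedDeriv m p x| ≤ A := fun m => by
    have := (iteratedDeriv_periodic h m).isBounded_of_continuous hK (continuous_iteratedDeriv hp m)
    obtain ⟨A, hA⟩ := this.exists_norm_le
    exact ⟨A, fun x => hA _ ⟨x, rfl⟩⟩
  choose A hA using hb
  have hA0 : ∀ m, 0 ≤ A m := fun m => (abs_nonneg _).trans (hA m 0)
  refine ⟨∑ m ∈ Finset.range 5, A m, hp, fun m hm x => (hA m x).trans ?_⟩
  exact Finset.single_le_sum (f := A) (fun i _ => hA0 i) (Finset.mem_range.2 (by omega))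

lemma SmoothBounded.mono {p : ℝ → ℝ} {A B : ℝ} (h : SmoothBounded p A) (hAB : A ≤ B) :
    SmoothBounded p B := ⟨h.smooth, fun m hm x => (h.bound m hm x).trans hAB⟩

/-- Stein's identity for a smooth function with bounded derivatives. -/
lemma integral_deriv_stdNormal {p : ℝ → ℝ} {A : ℝ} (hp : SmoothBounded p A) :
    ∫ x, iteratedDeriv 1 p x ∂stdNormal = ∫ x, p x * x ∂stdNormal := by
  have hd : ∀ x, HasDerivAt p (iteratedDeriv 1 p x) x := fun x => by
    simpa using hasDerivAt_iteratedDeriv hp.smooth 0 x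
  have hpdf : ∀ x, HasDerivAt (gaussianPDFReal 0 1) (-(x * gaussianPDFReal 0 1 x)) x := fun x => by
    have h1 : HasDerivAt (fun x : ℝ => -(x - 0) ^ 2 / (2 * (1 : NNReal))) (-x) x := by
      have := (((((hasDerivAt_id x).sub_const 0).fun_pow 2).neg).div_const (2 * (1 : NNReal) : ℝ))
      refine this.congr_deriv ?_
      simp; ring
    have h2 := (h1.exp).const_mul ((√(2 * Real.pi * (1 : NNReal)))⁻¹)
    refine h2.congr_deriv ?_
    simp only [gaussianPDFReal]; ring
  have hint := integrable_gaussianPDFReal 0 1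
  have hc1 : Continuous (iteratedDeriv 1 p) := continuous_iteratedDeriv hp.smooth 1
  have hxp : Integrable fun x => x * gaussianPDFReal 0 1 x := by
    have : Integrable (fun x : ℝ => x ^ 1) (gaussianReal 0 1) := integrable_pow_stdNormal 1
    rw [gaussianReal_of_var_ne_zero _ one_ne_zero, integrable_withDensity_iff_integrable_smul']
      at this
    · refine this.congr (Filter.Eventually.of_forall fun x => ?_)
      simp [gaussianPDF, ENNReal.toReal_ofReal (gaussianPDFReal_nonneg 0 1 x), mul_comm]
    · exact measurable_gaussianPDF 0 1
    · exact Filter.Eventually.of_forall fun x => gaussianPDF_lt_top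
  have hpc := hp.smooth.continuous
  have key := integral_mul_deriv_eq_deriv_mul_of_integrable (u := p) (v := gaussianPDFReal 0 1)
    (u' := iteratedDeriv 1 p) (v' := fun x => -(x * gaussianPDFReal 0 1 x))
    (fun x _ => hd x) (fun x _ => hpdf x)
    (hxp.neg.bdd_mul (c := A) hpc.aestronglyMeasurable (Filter.Eventually.of_forall hp.abs_le))
    (hint.bdd_mul (c := A) hc1.aestronglyMeasurable
      (Filter.Eventually.of_forall (hp.bound 1 (by norm_num))))
    (hint.bdd_mul (c := A) hpc.aestronglyMeasurable (Filter.Eventually.of_forall hp.abs_le))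
  rw [integral_gaussianReal_eq_integral_smul one_ne_zero,
    integral_gaussianReal_eq_integral_smul one_ne_zero]
  simp only [smul_eq_mul]
  have e1 : ∀ x, gaussianPDFReal 0 1 x * (p x * x) = -(p x * -(x * gaussianPDFReal 0 1 x)) :=
    fun x => by ring
  simp only [e1, integral_neg, key, neg_neg]
  congr 1; ext x; ring

/-- A pair of independent standard normal variables is invariant under rotations. -/
lemma integral_rotate_stdNormal {F : ℝ × ℝ → ℝ} {c s : ℝ} (h : c ^ 2 + s ^ 2 = 1)
    (hF : AEStronglyMeasurable F (stdNormal.prod stdNormal)) :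
    ∫ p : ℝ × ℝ, F (c * p.1 + s * p.2, -s * p.1 + c * p.2) ∂stdNormal.prod stdNormal =
      ∫ p, F p ∂stdNormal.prod stdNormal := by
  obtain ⟨θ, hc, hs⟩ : ∃ θ : ℝ, Real.cos θ = c ∧ Real.sin θ = s := by
    refine ⟨Complex.arg (⟨c, s⟩ : ℂ), ?_, ?_⟩
    · have hn : ‖(⟨c, s⟩ : ℂ)‖ = 1 := by
        rw [Complex.norm_eq_sqrt_sq_add_sq, h, Real.sqrt_one]
      rw [Complex.cos_arg (by intro h0; rw [h0] at hn; simp at hn), hn, div_one]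
    · have hn : ‖(⟨c, s⟩ : ℂ)‖ = 1 := by
        rw [Complex.norm_eq_sqrt_sq_add_sq, h, Real.sqrt_one]
      rw [Complex.sin_arg, hn, div_one]
  have hrot := IsGaussian.map_rotation_eq_self (μ := stdNormal) (by simp) θ
  conv_rhs => rw [← hrot]
  rw [integral_map (by fun_prop) (by rw [hrot]; exact hF)]
  congr 1; ext p
  rw [ContinuousLinearMap.rotation_apply, hc, hs]
  simp

end

/-! ### Gain and power of the modulo operation -/

section

open scoped Matrix ContDiff

/-- The correlation of the reduced sample with its input: the mean slope of the average of the modulo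
operation over noise, when signal plus noise has standard deviation `s`. -/
noncomputable def gain (K s : ℝ) : ℝ := (∫ y, rmod K (s * y) * y ∂stdNormal) / s

/-- The mean power of a reduced Gaussian sample of standard deviation `s`. -/
noncomputable def power (K s : ℝ) : ℝ := ∫ y, rmod K (s * y) ^ 2 ∂stdNormal

lemma integrable_id_stdNormal : Integrable (fun x : ℝ => x) stdNormal := by
  simpa using integrable_pow_stdNormal 1

lemma integral_id_stdNormal : ∫ x : ℝ, x ∂stdNormal = 0 :=
  integral_odd_stdNormal fun _ => rfl

variable {φ : ℝ → ℝ} {M τ : ℝ}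

/-- Averages over noise and then over the signal, expressed through the standard deviation of signal
plus noise. -/
lemma integral_gaussAvg (hφ : Measurable φ) (hM : ∀ x, |φ x| ≤ M) :
    ∫ z, gaussAvg φ τ z ∂stdNormal = ∫ y, φ (√(1 + τ ^ 2) * y) ∂stdNormal := by
  set s := √(1 + τ ^ 2) with hs
  have hs0 : 0 < s := Real.sqrt_pos.2 (by positivity)
  have hs2 : s ^ 2 = 1 + τ ^ 2 := Real.sq_sqrt (by positivity)
  have hF : Measurable fun p : ℝ × ℝ => φ (s * p.1) := hφ.comp (by fun_prop)
  have hG : Measurable fun p : ℝ × ℝ => φ (p.1 + τ * p.2) := hφ.comp (by fun_prop)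
  have h := integral_rotate_stdNormal (c := 1 / s) (s := τ / s)
    (by field_simp; rw [hs2]) hF.aestronglyMeasurable
  have e : ∀ p : ℝ × ℝ, s * (1 / s * p.1 + τ / s * p.2) = p.1 + τ * p.2 := fun p => by
    field_simp
  simp only [e] at h
  have iF : Integrable (fun p : ℝ × ℝ => φ (s * p.1)) (stdNormal.prod stdNormal) :=
    Integrable.of_bound hF.aestronglyMeasurable M (Filter.Eventually.of_forall fun _ => hM _)
  have iG : Integrable (fun p : ℝ × ℝ => φ (p.1 + τ * p.2)) (stdNormal.prod stdNormal) :=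
    Integrable.of_bound hG.aestronglyMeasurable M (Filter.Eventually.of_forall fun _ => hM _)
  rw [integral_prod _ iF, integral_prod _ iG] at h
  simpa [gaussAvg] using h

lemma integral_gaussAvg_mul (hφ : Measurable φ) (hM : ∀ x, |φ x| ≤ M) :
    ∫ z, gaussAvg φ τ z * z ∂stdNormal =
      (∫ y, φ (√(1 + τ ^ 2) * y) * y ∂stdNormal) / √(1 + τ ^ 2) := by
  set s := √(1 + τ ^ 2) with hs
  have hs0 : 0 < s := Real.sqrt_pos.2 (by positivity)
  have hs2 : s ^ 2 = 1 + τ ^ 2 := Real.sq_sqrt (by positivity)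
  have hF0 : Measurable fun p : ℝ × ℝ => φ (s * p.1) := hφ.comp (by fun_prop)
  have hG0 : Measurable fun p : ℝ × ℝ => φ (p.1 + τ * p.2) := hφ.comp (by fun_prop)
  have hF : Measurable fun p : ℝ × ℝ => φ (s * p.1) * (1 / s * p.1 - τ / s * p.2) :=
    hF0.mul (by fun_prop)
  have h := integral_rotate_stdNormal (c := 1 / s) (s := τ / s)
    (by field_simp; rw [hs2]) hF.aestronglyMeasurable
  have e : ∀ p : ℝ × ℝ, s * (1 / s * p.1 + τ / s * p.2) = p.1 + τ * p.2 := fun p => by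
    field_simp
  have e2 : ∀ p : ℝ × ℝ, 1 / s * (1 / s * p.1 + τ / s * p.2) -
      τ / s * (-(τ / s) * p.1 + 1 / s * p.2) = p.1 := fun p => by
    field_simp; rw [hs2]; ring
  simp only [e, e2] at h
  have i1 : Integrable (fun p : ℝ × ℝ => p.1) (stdNormal.prod stdNormal) :=
    integrable_id_stdNormal.comp_fst stdNormal
  have i2 : Integrable (fun p : ℝ × ℝ => p.2) (stdNormal.prod stdNormal) :=
    integrable_id_stdNormal.comp_snd stdNormal
  have iF : Integrable (fun p : ℝ × ℝ => φ (s * p.1) * (1 / s * p.1 - τ / s * p.2))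
      (stdNormal.prod stdNormal) :=
    ((i1.const_mul _).sub (i2.const_mul _)).bdd_mul (c := M) hF0.aestronglyMeasurable
      (Filter.Eventually.of_forall fun _ => hM _)
  have iG : Integrable (fun p : ℝ × ℝ => φ (p.1 + τ * p.2) * p.1) (stdNormal.prod stdNormal) :=
    i1.bdd_mul (c := M) hG0.aestronglyMeasurable (Filter.Eventually.of_forall fun _ => hM _)
  rw [integral_prod _ iF, integral_prod _ iG] at h
  simp only [integral_mul_const, integral_const_mul] at h
  simp only [gaussAvg]
  rw [h]
  have e3 : ∀ x : ℝ, ∫ y, (1 / s * x - τ / s * y) ∂stdNormal = 1 / s * x := fun x => by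
    rw [integral_sub (integrable_const _) (integrable_id_stdNormal.const_mul _),
      integral_const, integral_const_mul, integral_id_stdNormal]
    simp
  simp only [e3]
  rw [← integral_div]
  congr 1; ext x; ring

lemma gaussAvg_rmod_neg {K : ℝ} (hK : 0 < K) (hτ : 0 < τ) (x : ℝ) :
    gaussAvg (rmod K) τ (-x) = -gaussAvg (rmod K) τ x := by
  have h : stdNormal.map (fun x => -x) = stdNormal := by
    rw [gaussianReal_map_neg, neg_zero]
  have h1 : gaussAvg (rmod K) τ (-x) = ∫ w, rmod K (-(x + τ * w)) ∂stdNormal := by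
    rw [gaussAvg]
    conv_lhs => rw [← h]
    rw [integral_map (f := fun w => rmod K (-x + τ * w)) (by fun_prop)
      ((measurable_rmod K).comp (by fun_prop : Measurable fun w => -x + τ * w)).aestronglyMeasurable]
    congr 1; ext w; congr 1; ring
  rw [h1, gaussAvg, ← integral_neg]
  exact integral_congr_ae (ae_rmod_neg hK hτ x)

/-- Conditional mean and variance of a reduced noisy sample form a profile, of slope `gain`; the
variance of the part of the sample that is uncorrelated with its input is `power - gain ^ 2`. -/
theorem exists_profile {K τ : ℝ} (hK : 0 < K) (hτ : 0 < τ) :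
    ∃ A, Profile (gaussAvg (rmod K) τ)
      (fun x => gaussAvg (fun y => rmod K y ^ 2) τ x - gaussAvg (rmod K) τ x ^ 2)
      (gain K √(1 + τ ^ 2)) A ∧ (∀ x, |rmod K x| ≤ A) ∧
      (∫ z, (gaussAvg (rmod K) τ z - gain K √(1 + τ ^ 2) * z) ∂stdNormal = 0) ∧
      ∫ z, ((gaussAvg (rmod K) τ z - gain K √(1 + τ ^ 2) * z) ^ 2 +
        (gaussAvg (fun y => rmod K y ^ 2) τ z - gaussAvg (rmod K) τ z ^ 2)) ∂stdNormal =
        power K √(1 + τ ^ 2) - gain K √(1 + τ ^ 2) ^ 2 := by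
  have hf := measurable_rmod K
  have hfK := abs_rmod_le hK
  have hf2 : Measurable fun y => rmod K y ^ 2 := hf.pow_const 2
  have hfK2 : ∀ y, |rmod K y ^ 2| ≤ (K / 2) ^ 2 := fun y => by
    rw [abs_pow]; exact pow_le_pow_left₀ (abs_nonneg _) (hfK y) 2
  have hper := rmod_periodic hK
  have hper2 : Function.Periodic (fun y => rmod K y ^ 2) K := fun y => by
    simp only [hper y]
  set g := gaussAvg (rmod K) τ with hg
  set q := gaussAvg (fun y => rmod K y ^ 2) τ with hq
  set a := gain K √(1 + τ ^ 2) with ha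
  have hgs : ContDiff ℝ ∞ g := contDiff_gaussAvg hf hfK hτ.ne'
  have hqs : ContDiff ℝ ∞ q := contDiff_gaussAvg hf2 hfK2 hτ.ne'
  have hgp : Function.Periodic g K := gaussAvg_periodic hper
  have hqp : Function.Periodic q K := gaussAvg_periodic hper2
  have hg1 : ContDiff ℝ ∞ (iteratedDeriv 1 g) := by
    rw [iteratedDeriv_one]
    exact (contDiff_infty_iff_deriv.1 hgs).2
  have hg2 : ContDiff ℝ ∞ (iteratedDeriv 2 g) := by
    rw [show (2 : ℕ) = 1 + 1 from rfl, iteratedDeriv_succ]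
    exact (contDiff_infty_iff_deriv.1 hg1).2
  obtain ⟨A1, h1⟩ := exists_smoothBounded hK.ne' hgs hgp
  obtain ⟨A2, h2⟩ := exists_smoothBounded (p := fun x => iteratedDeriv 1 g x - a) hK.ne'
    (hg1.sub contDiff_const) (fun x => by simp only [iteratedDeriv_periodic hgp 1 x])
  obtain ⟨A3, h3⟩ := exists_smoothBounded hK.ne' hg2 (iteratedDeriv_periodic hgp 2)
  obtain ⟨A4, h4⟩ := exists_smoothBounded (p := fun x => q x - g x ^ 2) hK.ne'
    (hqs.sub (hgs.pow 2)) (fun x => by simp only [hgp x, hqp x])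
  have hstein := integral_deriv_stdNormal h1
  have hslope : ∫ z, g z * z ∂stdNormal = a := integral_gaussAvg_mul hf hfK
  have ig : Integrable g stdNormal := Integrable.of_bound hgs.continuous.aestronglyMeasurable A1
    (Filter.Eventually.of_forall h1.abs_le)
  have ig1 : Integrable (iteratedDeriv 1 g) stdNormal :=
    Integrable.of_bound hg1.continuous.aestronglyMeasurable A1
      (Filter.Eventually.of_forall (h1.bound 1 (by norm_num)))
  have hodd : ∀ x, g (-x) = -g x := gaussAvg_rmod_neg hK hτ
  have hodd2 : ∀ x, iteratedDeriv 2 g (-x) = -iteratedDeriv 2 g x := fun x => by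
    have e := iteratedDeriv_comp_neg 2 g x
    have e' : (fun x => g (-x)) = fun x => -g x := funext hodd
    rw [e', iteratedDeriv_fun_neg] at e
    simpa using e.symm
  have hvar : ∀ x, q x - g x ^ 2 = ∫ w, (rmod K (x + τ * w) - g x) ^ 2 ∂stdNormal := fun x => by
    have i1 := integrable_comp_add_mul (τ := τ) hf hfK x
    have i2 := integrable_comp_add_mul (τ := τ) hf2 hfK2 x
    have e : ∀ w, (rmod K (x + τ * w) - g x) ^ 2 =
        rmod K (x + τ * w) ^ 2 - (2 * g x * rmod K (x + τ * w) - g x ^ 2) := fun w => by ring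
    have i3 : Integrable (fun w => 2 * g x * rmod K (x + τ * w) - g x ^ 2) stdNormal :=
      (i1.const_mul _).sub (integrable_const _)
    simp only [e]
    rw [integral_sub i2 i3, integral_sub (i1.const_mul _) (integrable_const _),
      integral_const_mul]
    have e1 : ∫ w, rmod K (x + τ * w) ∂stdNormal = g x := rfl
    have e2 : ∫ w, rmod K (x + τ * w) ^ 2 ∂stdNormal = q x := rfl
    rw [e1, e2, integral_const]
    simp; ring
  have hA : ∀ B ∈ ({A1, A2, A3, A4, K, 1} : Finset ℝ),
      B ≤ |A1| + |A2| + |A3| + |A4| + K + 1 := by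
    have p1 := abs_nonneg A1
    have p2 := abs_nonneg A2
    have p3 := abs_nonneg A3
    have p4 := abs_nonneg A4
    have q1 := le_abs_self A1
    have q2 := le_abs_self A2
    have q3 := le_abs_self A3
    have q4 := le_abs_self A4
    intro B hB
    simp only [Finset.mem_insert, Finset.mem_singleton] at hB
    rcases hB with h | h | h | h | h | h <;> rw [h] <;> linarith
  refine ⟨|A1| + |A2| + |A3| + |A4| + K + 1, ⟨hA 1 (by simp), h1.mono (hA _ (by simp)),
    h2.mono (hA _ (by simp)), h3.mono (hA _ (by simp)), h4.mono (hA _ (by simp)), fun x => ?_, ?_,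
    ?_⟩, fun x => (hfK x).trans ?_, ?_, ?_⟩
  · rw [hvar]; exact integral_nonneg fun w => sq_nonneg _
  · rw [integral_sub ig1 (integrable_const _), hstein, hslope]; simp
  · exact integral_odd_stdNormal hodd2
  · have := hA K (by simp)
    linarith
  · refine integral_odd_stdNormal fun x => ?_
    rw [hodd]; ring
  · have igz : Integrable (fun z => g z * z) stdNormal :=
      integrable_id_stdNormal.bdd_mul (c := A1) hgs.continuous.aestronglyMeasurable
        (Filter.Eventually.of_forall h1.abs_le)
    have iq : Integrable q stdNormal := Integrable.of_bound hqs.continuous.aestronglyMeasurable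
      ((K / 2) ^ 2) (Filter.Eventually.of_forall fun x => by
        calc ‖q x‖ ≤ ∫ w, (K / 2) ^ 2 ∂stdNormal :=
              norm_integral_le_of_norm_le (integrable_const _)
                (Filter.Eventually.of_forall fun w => hfK2 _)
          _ = _ := by simp)
    have e : ∀ z, (g z - a * z) ^ 2 + (q z - g z ^ 2) =
        q z - (2 * a * (g z * z) - a ^ 2 * z ^ 2) := fun z => by ring
    have i3 : Integrable (fun z => 2 * a * (g z * z) - a ^ 2 * z ^ 2) stdNormal :=
      (igz.const_mul _).sub ((integrable_pow_stdNormal 2).const_mul _)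
    simp only [e]
    rw [integral_sub iq i3, integral_sub (igz.const_mul _) ((integrable_pow_stdNormal 2).const_mul _),
      integral_const_mul, integral_const_mul, hslope, integral_sq_stdNormal,
      integral_gaussAvg hf2 hfK2, power]
    ring

end

/-! ### Limiting error probabilities -/

section

open scoped Matrix Topology

/-- Lévy's continuity theorem and the portmanteau lemma, for laws whose characteristic functions
converge at a prescribed pointwise rate: the lower bound on an open set is uniform over such laws. -/
lemma exists_forall_open_le (ν : Measure ℝ) [IsProbabilityMeasure ν] (C : ℝ → ℝ) {U : Set ℝ}
    (hU : IsOpen U) {ε : ℝ} (hε : 0 < ε) :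
    ∃ η₀ > 0, ∀ (μ : Measure ℝ) [IsProbabilityMeasure μ] (η : ℝ), η ≤ η₀ → 0 < η →
      (∀ t, ‖charFun μ t - charFun ν t‖ ≤ C t * η) → ν.real U - ε ≤ μ.real U := by
  by_contra! hcon
  choose! μ hμ η hη h0 hchar hlt using fun n : ℕ =>
    hcon (1 / ((n : ℝ) + 1)) (by positivity)
  have hη0 : Filter.Tendsto η Filter.atTop (𝓝 0) :=
    tendsto_of_tendsto_of_tendsto_of_le_of_le tendsto_const_nhds
      tendsto_one_div_add_atTop_nhds_zero_nat (fun n => (h0 n).le) hη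
  set P : ℕ → ProbabilityMeasure ℝ := fun n => ⟨μ n, hμ n⟩ with hP
  set P₀ : ProbabilityMeasure ℝ := ⟨ν, inferInstance⟩ with hP₀
  have hlim : Filter.Tendsto P Filter.atTop (𝓝 P₀) := by
    refine ProbabilityMeasure.tendsto_of_tendsto_charFun fun t => ?_
    rw [tendsto_iff_norm_sub_tendsto_zero]
    refine tendsto_of_tendsto_of_tendsto_of_le_of_le tendsto_const_nhds
      (g := fun _ => (0 : ℝ)) (h := fun n => C t * η n) ?_ (fun n => norm_nonneg _)
      (fun n => hchar n t)
    simpa using hη0.const_mul (C t)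
  have hport : ν U ≤ Filter.atTop.liminf fun n => μ n U :=
    ProbabilityMeasure.le_liminf_measure_open_of_tendsto hlim hU
  have hpos : 0 < ν.real U - ε := measureReal_nonneg.trans_lt (hlt 0)
  have h1 : ENNReal.ofReal (ν.real U - ε) < ν U := by
    rw [← ofReal_measureReal (μ := ν) (s := U), ENNReal.ofReal_lt_ofReal_iff (by linarith)]
    linarith
  obtain ⟨n, hn⟩ := (Filter.eventually_lt_of_lt_liminf (h1.trans_le hport)).exists
  have h3 := hlt n
  have : IsProbabilityMeasure (μ n) := hμ n
  rw [← ofReal_measureReal (μ := μ n) (s := U), ENNReal.ofReal_lt_ofReal_iff_of_nonneg hpos.le] at hn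
  linarith

lemma gaussianReal_Iio_zero (a : ℝ) {S : ℝ} (hS : 0 < S) :
    (gaussianReal a S.toNNReal).real (Set.Iio 0) = gaussianQ (a / √S) := by
  have hs : 0 < √S := Real.sqrt_pos.2 hS
  have h1 := gaussianReal_map_const_mul (μ := 0) (v := 1) (-√S)
  have h2 := gaussianReal_map_const_add (μ := -√S * 0) (v := (NNReal.mk ((-√S) ^ 2) (sq_nonneg _)) * 1) a
  have hv : NNReal.mk ((-√S) ^ 2) (sq_nonneg _) * 1 = S.toNNReal := by
    ext; simp [Real.sq_sqrt hS.le, hS.le]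
  rw [← h1, Measure.map_map (by fun_prop) (by fun_prop), hv] at h2
  simp only [mul_zero, zero_add] at h2
  rw [← h2, map_measureReal_apply (by fun_prop) measurableSet_Iio, gaussianQ]
  congr 1
  ext x
  simp only [Set.mem_preimage, Function.comp, Set.mem_Iio, Set.mem_Ioi, div_lt_iff₀ hs]
  constructor <;> intro h <;> linarith

lemma gaussianReal_Ioi_zero (a : ℝ) {S : ℝ} (hS : 0 < S) :
    (gaussianReal (-a) S.toNNReal).real (Set.Ioi 0) = gaussianQ (a / √S) := by
  rw [← gaussianReal_Iio_zero a hS, ← gaussianReal_map_neg,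
    map_measureReal_apply (by fun_prop) measurableSet_Ioi]
  congr 1
  ext x
  simp

variable {ι : Type*} [Fintype ι] [DecidableEq ι]

/-- The joint law of inputs and noise, given that input `k` is `b`. -/
noncomputable def inputNoise (k : ι) (b : ℝ) : Measure ((ι → ℝ) × (ι → ℝ)) :=
  (Measure.pi (frozen rademacher k b)).prod (Measure.pi fun _ => stdNormal)

instance (k : ι) (b : ℝ) : IsProbabilityMeasure (inputNoise k b) := by
  unfold inputNoise; infer_instance

lemma charFun_output (O : Matrix ι ι ℝ) {f : ℝ → ℝ} (hf : Measurable f) (τ : ℝ) (k : ι) (b t : ℝ) :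
    charFun ((inputNoise k b).map fun p => output O f τ k p.1 p.2) t =
      ∫ ξ, ∫ ω, Complex.exp (Complex.I * (t * output O f τ k ξ ω : ℝ))
        ∂Measure.pi (fun _ : ι => stdNormal) ∂Measure.pi (frozen rademacher k b) := by
  have hm := measurable_output O hf τ k
  rw [charFun_apply_real, integral_map hm.aemeasurable (by fun_prop), inputNoise, integral_prod]
  · simp only [Complex.ofReal_mul]
    congr 1; ext ξ; congr 1; ext ω; congr 1; ring
  · refine Integrable.of_bound ?_ 1 (Filter.Eventually.of_forall fun p => ?_)
    · exact (Complex.measurable_exp.comp (((Complex.measurable_ofReal.comp hm).const_mul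
        (t : ℂ)).mul_const Complex.I)).aestronglyMeasurable
    · rw [← Complex.ofReal_mul, Complex.norm_exp_ofReal_mul_I]

/-- The two conditional error probabilities of a coordinate are asymptotically at least that of the
Gaussian limit, uniformly over incoherent matrices and coordinates. -/
theorem exists_forall_error_ge {K τ : ℝ} (hK : 0 < K) (hτ : 0 < τ)
    (hS : gain K √(1 + τ ^ 2) ^ 2 < power K √(1 + τ ^ 2)) {ε : ℝ} (hε : 0 < ε) :
    ∃ η₀ > 0, ∀ (ι : Type) [Fintype ι] [DecidableEq ι] (O : Matrix ι ι ℝ) (η : ℝ),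
      Incoherent O η → η ≤ η₀ → ∀ k : ι,
      gaussianQ (gain K √(1 + τ ^ 2) / √(power K √(1 + τ ^ 2) - gain K √(1 + τ ^ 2) ^ 2)) - ε ≤
        (inputNoise k 1).real {p | output O (rmod K) τ k p.1 p.2 < 0} ∧
      gaussianQ (gain K √(1 + τ ^ 2) / √(power K √(1 + τ ^ 2) - gain K √(1 + τ ^ 2) ^ 2)) - ε ≤
        (inputNoise k (-1)).real {p | 0 ≤ output O (rmod K) τ k p.1 p.2} := by
  obtain ⟨A, hP, hA, h0, hvar⟩ := exists_profile hK hτ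
  set a := gain K √(1 + τ ^ 2) with ha
  set S := power K √(1 + τ ^ 2) - a ^ 2 with hSdef
  have hS0 : 0 < S := sub_pos.2 hS
  have hchar : ∀ (ι : Type) [Fintype ι] [DecidableEq ι] (O : Matrix ι ι ℝ) (η : ℝ),
      Incoherent O η → ∀ (k : ι) (b : ℝ), |b| ≤ 1 → ∀ t : ℝ,
      ‖charFun ((inputNoise k b).map fun p => output O (rmod K) τ k p.1 p.2) t -
        charFun (gaussianReal (b * a) S.toNNReal) t‖ ≤ outputConst A t * η := by
    intro ι _ _ O η hO k b hb t
    rw [charFun_output O (measurable_rmod K), charFun_gaussianReal]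
    have h := norm_charFun_output_sub_le hO hP (measurable_rmod K) hA (fun x => rfl) (fun x => rfl)
      h0 hvar t k hb
    convert h using 4
    rw [Real.coe_toNNReal _ hS0.le]
    push_cast; ring
  obtain ⟨η₁, hη₁, H₁⟩ := exists_forall_open_le (gaussianReal (1 * a) S.toNNReal)
    (outputConst A) (isOpen_Iio (a := (0 : ℝ))) hε
  obtain ⟨η₂, hη₂, H₂⟩ := exists_forall_open_le (gaussianReal (-1 * a) S.toNNReal)
    (outputConst A) (isOpen_Ioi (a := (0 : ℝ))) hε
  refine ⟨min η₁ η₂, lt_min hη₁ hη₂, fun ι _ _ O η hO hη k => ?_⟩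
  have hm := measurable_output O (measurable_rmod K) τ k
  have p1 : IsProbabilityMeasure
      ((inputNoise k 1).map fun p => output O (rmod K) τ k p.1 p.2) :=
    Measure.isProbabilityMeasure_map hm.aemeasurable
  have p2 : IsProbabilityMeasure
      ((inputNoise k (-1)).map fun p => output O (rmod K) τ k p.1 p.2) :=
    Measure.isProbabilityMeasure_map hm.aemeasurable
  have r1 := H₁ _ η (hη.trans (min_le_left _ _)) hO.eta_pos (hchar ι O η hO k 1 (by simp))
  have r2 := H₂ _ η (hη.trans (min_le_right _ _)) hO.eta_pos (hchar ι O η hO k (-1) (by simp))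
  rw [one_mul, gaussianReal_Iio_zero a hS0, map_measureReal_apply hm measurableSet_Iio] at r1
  rw [neg_one_mul, gaussianReal_Ioi_zero a hS0, map_measureReal_apply hm measurableSet_Ioi] at r2
  have hsub : (fun p : (ι → ℝ) × (ι → ℝ) => output O (rmod K) τ k p.1 p.2) ⁻¹' Set.Ioi 0 ⊆
      {p : (ι → ℝ) × (ι → ℝ) | 0 ≤ output O (rmod K) τ k p.1 p.2} := fun p hp => by
    rw [Set.mem_preimage, Set.mem_Ioi] at hp
    exact hp.le
  exact ⟨r1, r2.trans (measureReal_mono hsub)⟩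

end

/-! ### The discrete Fourier transform as a real orthogonal matrix -/

section

open scoped Matrix

/-- The phase `2 π k n / N` of the discrete Fourier transform. -/
noncomputable def dftPhase (N : ℕ) (n k : Fin N) : ℝ := 2 * Real.pi * ((k : ℕ) * (n : ℕ)) / N

/-- The unitary inverse discrete Fourier transform, as a real matrix. The indices `(n, true)` and
`(n, false)` stand for real and imaginary part. -/
noncomputable def dftMatrix (N : ℕ) : Matrix (Fin N × Bool) (Fin N × Bool) ℝ := fun i j =>
  (√(N : ℝ))⁻¹ * match i.2, j.2 with
    | true, true => Real.cos (dftPhase N i.1 j.1)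
    | true, false => -Real.sin (dftPhase N i.1 j.1)
    | false, true => Real.sin (dftPhase N i.1 j.1)
    | false, false => Real.cos (dftPhase N i.1 j.1)

lemma sum_exp_dftPhase {N : ℕ} (n n' : Fin N) :
    ∑ k, Complex.exp ((dftPhase N n k - dftPhase N n' k : ℝ) * Complex.I) =
      if n = n' then (N : ℂ) else 0 := by
  split_ifs with h
  · subst h; simp
  · have hN0 : N ≠ 0 := fun h0 => by subst h0; exact n.elim0
    have hN : (N : ℝ) ≠ 0 := by exact_mod_cast hN0
    set ζ := Complex.exp (2 * Real.pi * (((n : ℕ) : ℝ) - ((n' : ℕ) : ℝ)) / N * Complex.I) with hζ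
    have hterm : ∀ k : Fin N, Complex.exp ((dftPhase N n k - dftPhase N n' k : ℝ) * Complex.I) =
        ζ ^ (k : ℕ) := fun k => by
      rw [hζ, ← Complex.exp_nat_mul]
      congr 1
      simp only [dftPhase]
      push_cast
      ring
    simp only [hterm]
    rw [Fin.sum_univ_eq_sum_range (fun k => ζ ^ k) N]
    have h1 : ζ ≠ 1 := by
      rw [hζ, Ne, Complex.exp_eq_one_iff]
      rintro ⟨m, hm⟩
      have h2 : (((n : ℕ) : ℝ) - ((n' : ℕ) : ℝ)) = m * N := by
        have hpi : (2 * Real.pi * Complex.I : ℂ) ≠ 0 := Complex.two_pi_I_ne_zero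
        have hNc : (N : ℂ) ≠ 0 := by exact_mod_cast hN0
        have : ((((n : ℕ) : ℝ) - ((n' : ℕ) : ℝ) : ℝ) : ℂ) = ((m * N : ℝ) : ℂ) := by
          push_cast
          field_simp at hm
          apply mul_left_cancel₀ hpi
          push_cast at hm
          linear_combination (2 * Real.pi * Complex.I : ℂ) * hm
        exact_mod_cast this
      have h3 : ((n : ℕ) : ℤ) - ((n' : ℕ) : ℤ) = m * N := by exact_mod_cast h2
      have h4 : |((n : ℕ) : ℤ) - ((n' : ℕ) : ℤ)| < N := by
        rw [abs_lt]; constructor <;> omega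
      rw [h3, abs_mul, Nat.abs_cast] at h4
      have h5 : |m| < 1 := by
        by_contra! hcon
        have : (0 : ℤ) ≤ N := by positivity
        nlinarith
      have h6 : m = 0 := Int.abs_lt_one_iff.1 h5
      rw [h6, zero_mul, sub_eq_zero] at h3
      exact h (Fin.ext (by exact_mod_cast h3))
    have h2 : ζ ^ N = 1 := by
      rw [hζ, ← Complex.exp_nat_mul, Complex.exp_eq_one_iff]
      refine ⟨(n : ℤ) - (n' : ℤ), ?_⟩
      have hNc : (N : ℂ) ≠ 0 := by exact_mod_cast hN0
      push_cast
      field_simp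
    have h3 := geom_sum_mul ζ N
    rw [h2, sub_self] at h3
    exact (mul_eq_zero.1 h3).resolve_right (sub_ne_zero.2 h1)

lemma sum_cos_dftPhase {N : ℕ} (n n' : Fin N) :
    ∑ k, Real.cos (dftPhase N n k - dftPhase N n' k) = if n = n' then (N : ℝ) else 0 := by
  have h := congrArg Complex.re (sum_exp_dftPhase n n')
  simp only [Complex.re_sum, Complex.exp_ofReal_mul_I_re] at h
  rw [h]
  split_ifs <;> simp

lemma sum_sin_dftPhase {N : ℕ} (n n' : Fin N) :
    ∑ k, Real.sin (dftPhase N n k - dftPhase N n' k) = 0 := by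
  have h := congrArg Complex.im (sum_exp_dftPhase n n')
  simp only [Complex.im_sum, Complex.exp_ofReal_mul_I_im] at h
  rw [h]
  split_ifs <;> simp

lemma dftMatrix_mul_transpose (N : ℕ) : dftMatrix N * (dftMatrix N)ᵀ = 1 := by
  ext ⟨n, c⟩ ⟨n', c'⟩
  have hN0 : N ≠ 0 := fun h0 => by subst h0; exact n.elim0
  have hN : (0 : ℝ) < N := by positivity
  have hs : (√(N : ℝ))⁻¹ * (√(N : ℝ))⁻¹ = (N : ℝ)⁻¹ := by
    rw [← mul_inv, Real.mul_self_sqrt hN.le]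
  have hcos := sum_cos_dftPhase n n'
  have hsin := sum_sin_dftPhase n n'
  rw [Matrix.mul_apply, Fintype.sum_prod_type, Matrix.one_apply]
  simp only [Fintype.sum_bool, Matrix.transpose_apply, dftMatrix]
  have key : ∀ u u' : Fin N → ℝ, ∀ v v' : Fin N → ℝ, ∑ k, ((√(N : ℝ))⁻¹ * u k *
      ((√(N : ℝ))⁻¹ * u' k) + (√(N : ℝ))⁻¹ * v k * ((√(N : ℝ))⁻¹ * v' k)) =
      (N : ℝ)⁻¹ * ∑ k, (u k * u' k + v k * v' k) := fun u u' v v' => by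
    rw [Finset.mul_sum]
    refine Finset.sum_congr rfl fun k _ => ?_
    rw [← hs]; ring
  rcases c <;> rcases c' <;> simp only [key]
  · have e : ∀ k, Real.sin (dftPhase N n k) * Real.sin (dftPhase N n' k) +
        Real.cos (dftPhase N n k) * Real.cos (dftPhase N n' k) =
        Real.cos (dftPhase N n k - dftPhase N n' k) := fun k => by rw [Real.cos_sub]; ring
    simp only [e, hcos]
    by_cases h : n = n'
    · simp [h, hN.ne']
    · simp [h]
  · have e : ∀ k, Real.sin (dftPhase N n k) * Real.cos (dftPhase N n' k) +
        Real.cos (dftPhase N n k) * -Real.sin (dftPhase N n' k) =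
        Real.sin (dftPhase N n k - dftPhase N n' k) := fun k => by rw [Real.sin_sub]; ring
    simp only [e, hsin]
    simp
  · have e : ∀ k, Real.cos (dftPhase N n k) * Real.sin (dftPhase N n' k) +
        -Real.sin (dftPhase N n k) * Real.cos (dftPhase N n' k) =
        -Real.sin (dftPhase N n k - dftPhase N n' k) := fun k => by rw [Real.sin_sub]; ring
    simp only [e, Finset.sum_neg_distrib, hsin]
    simp
  · have e : ∀ k, Real.cos (dftPhase N n k) * Real.cos (dftPhase N n' k) +
        -Real.sin (dftPhase N n k) * -Real.sin (dftPhase N n' k) =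
        Real.cos (dftPhase N n k - dftPhase N n' k) := fun k => by rw [Real.cos_sub]; ring
    simp only [e, hcos]
    by_cases h : n = n'
    · simp [h, hN.ne']
    · simp [h]

/-- The spread parameter of the Fourier matrix: `N ^ (-1 / 4)`. -/
noncomputable def dftSpread (N : ℕ) : ℝ := (√(√(N : ℝ)))⁻¹

lemma incoherent_dftMatrix {N : ℕ} (hN : 1 ≤ N) : Incoherent (dftMatrix N) (dftSpread N) := by
  have hN1 : (1 : ℝ) ≤ N := by exact_mod_cast hN
  have h1 : 1 ≤ √(N : ℝ) := Real.one_le_sqrt.2 hN1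
  have h2 : 1 ≤ √(√(N : ℝ)) := Real.one_le_sqrt.2 h1
  have hsq : dftSpread N ^ 2 = (√(N : ℝ))⁻¹ := by
    rw [dftSpread, inv_pow, Real.sq_sqrt (Real.sqrt_nonneg _)]
  refine ⟨dftMatrix_mul_transpose N, mul_eq_one_comm.1 (dftMatrix_mul_transpose N), ?_,
    by unfold dftSpread; positivity, inv_le_one_of_one_le₀ h2, ?_⟩
  · rintro ⟨n, c⟩ ⟨k, c'⟩
    rw [hsq, dftMatrix, abs_mul, abs_of_nonneg (by positivity)]
    refine mul_le_of_le_one_right (by positivity) ?_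
    rcases c <;> rcases c' <;> simp [Real.abs_cos_le_one, Real.abs_sin_le_one]
  · have h4 : dftSpread N ^ 4 = (N : ℝ)⁻¹ := by
      rw [show dftSpread N ^ 4 = (dftSpread N ^ 2) ^ 2 by ring, hsq, inv_pow,
        Real.sq_sqrt (by positivity)]
    rw [h4]
    have : (N : ℝ) ≠ 0 := by positivity
    simp only [Fintype.card_prod, Fintype.card_fin, Fintype.card_bool]
    push_cast
    rw [mul_right_comm, mul_inv_cancel₀ this, one_mul]

lemma tendsto_dftSpread : Filter.Tendsto dftSpread Filter.atTop (nhds 0) := by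
  unfold dftSpread
  exact Filter.Tendsto.inv_tendsto_atTop (Real.tendsto_sqrt_atTop.comp
    (Real.tendsto_sqrt_atTop.comp tendsto_natCast_atTop_atTop))

end

/-! ### The law of one row of the frame -/

section

open scoped Matrix

/-- The real coordinates of one row of a two-dimensional array, each entry being split into two. -/
def rowCoords {α : Type*} {M N : ℕ} (s : Fin N → α → ℝ × ℝ) (m : Fin M) (x : Fin M → Fin N → α) :
    Fin N × Bool → ℝ :=
  fun i => if i.2 then (s i.1 (x m i.1)).1 else (s i.1 (x m i.1)).2

lemma measurable_rowCoords {α : Type*} [MeasurableSpace α] {M N : ℕ} {s : Fin N → α → ℝ × ℝ}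
    (hs : ∀ n, Measurable (s n)) (m : Fin M) : Measurable (rowCoords (M := M) s m) := by
  refine measurable_pi_iff.2 fun i => ?_
  have h : Measurable fun x : Fin M → Fin N → α => s i.1 (x m i.1) :=
    (hs i.1).comp ((measurable_pi_apply i.1).comp (measurable_pi_apply m))
  unfold rowCoords
  split_ifs
  · exact measurable_fst.comp h
  · exact measurable_snd.comp h

/-- If every entry splits into two independent coordinates of law `ρ`, the coordinates of a row of
independent entries are independent of law `ρ`. -/
lemma map_rowCoords {α : Type*} [MeasurableSpace α] {μ₀ : Measure α} [IsProbabilityMeasure μ₀]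
    {ρ : Measure ℝ} [IsProbabilityMeasure ρ] {M N : ℕ} {s : Fin N → α → ℝ × ℝ}
    (hs : ∀ n, Measurable (s n)) (h : ∀ n, μ₀.map (s n) = ρ.prod ρ) (m : Fin M) :
    (Measure.pi fun _ : Fin M => Measure.pi fun _ : Fin N => μ₀).map (rowCoords s m) =
      Measure.pi fun _ => ρ := by
  symm
  refine Measure.pi_eq fun S hS => ?_
  rw [Measure.map_apply (measurable_rowCoords hs m) (MeasurableSet.univ_pi hS)]
  have hpre : rowCoords (M := M) s m ⁻¹' (Set.univ.pi S) = (fun x => x m) ⁻¹'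
      (Set.univ.pi fun n => s n ⁻¹' (S (n, true) ×ˢ S (n, false))) := by
    ext x
    simp only [Set.mem_preimage, Set.mem_pi, Set.mem_univ, true_implies, rowCoords, Set.mem_prod]
    constructor
    · intro hx n
      exact ⟨by simpa using hx (n, true), by simpa using hx (n, false)⟩
    · rintro hx ⟨n, c⟩
      cases c
      · simpa using (hx n).2
      · simpa using (hx n).1
  have hme := (measurePreserving_eval (fun _ : Fin M => Measure.pi fun _ : Fin N => μ₀) m)
  have hms : ∀ n, MeasurableSet (S (n, true) ×ˢ S (n, false)) := fun n => (hS _).prod (hS _)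
  rw [hpre, ← Measure.map_apply (measurable_pi_apply m)
    (MeasurableSet.univ_pi fun n => hs n (hms n)), hme.map_eq, Measure.pi_pi,
    Fintype.prod_prod_type]
  refine Finset.prod_congr rfl fun n _ => ?_
  rw [← Measure.map_apply (hs n) (hms n), h, Measure.prod_prod, Fintype.prod_bool]

/-- The two antipodal levels that carry a pair of bits. -/
def bitSigns (b : Bool × Bool) : ℝ × ℝ := (if b.1 then 1 else -1, if b.2 then 1 else -1)

lemma uniformOn_bool : (uniformOn Set.univ : Measure Bool) =
    (2⁻¹ : ENNReal) • Measure.dirac true + (2⁻¹ : ENNReal) • Measure.dirac false := by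
  refine Measure.ext_of_singleton fun b => ?_
  rw [uniformOn_univ]
  cases b <;> simp

lemma uniformOn_bool_prod : (uniformOn Set.univ : Measure (Bool × Bool)) =
    (uniformOn Set.univ : Measure Bool).prod (uniformOn Set.univ) := by
  refine Measure.ext_of_singleton fun b => ?_
  have h : ({b} : Set (Bool × Bool)) = {b.1} ×ˢ {b.2} := by ext x; simp [Prod.ext_iff]
  conv_rhs => rw [h]
  rw [Measure.prod_prod, uniformOn_univ, uniformOn_univ, uniformOn_univ]
  simp only [Measure.count_singleton, Fintype.card_prod, Fintype.card_bool, one_div]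
  rw [← ENNReal.mul_inv (by simp) (by simp)]
  norm_num

lemma map_bitSigns : (uniformOn Set.univ : Measure (Bool × Bool)).map bitSigns =
    rademacher.prod rademacher := by
  have h : (uniformOn Set.univ : Measure Bool).map (fun b => if b then (1 : ℝ) else -1) =
      rademacher := by
    rw [uniformOn_bool, Measure.map_add _ _ (by fun_prop), Measure.map_smul, Measure.map_smul,
      Measure.map_dirac' Measurable.of_discrete, Measure.map_dirac' Measurable.of_discrete, rademacher]
    simp
  rw [uniformOn_bool_prod, ← h, Measure.map_prod_map _ _ (by fun_prop) (by fun_prop)]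
  rfl

/-- Real and imaginary part of a noise sample after a rotation, normalized to unit variance. -/
noncomputable def noiseParts (σ : ℝ) (φ z : ℂ) : ℝ × ℝ :=
  (√2 / σ * (φ * z).re, √2 / σ * (φ * z).im)

lemma measurable_noiseParts (σ : ℝ) (φ : ℂ) : Measurable (noiseParts σ φ) := by
  unfold noiseParts; fun_prop

lemma measurable_complex_mk : Measurable fun p : ℝ × ℝ => (⟨p.1, p.2⟩ : ℂ) :=
  Complex.measurableEquivRealProd.symm.measurable

instance (σ : ℝ) : IsProbabilityMeasure (complexGaussian σ) :=
  Measure.isProbabilityMeasure_map measurable_complex_mk.aemeasurable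

lemma map_noiseParts {σ : ℝ} (hσ : 0 < σ) {φ : ℂ} (hφ : ‖φ‖ = 1) :
    (complexGaussian σ).map (noiseParts σ φ) = stdNormal.prod stdNormal := by
  obtain ⟨θ, hθ⟩ : ∃ θ : ℝ, φ = Complex.exp (θ * Complex.I) := by
    refine ⟨Complex.arg φ, ?_⟩
    have := Complex.norm_mul_exp_arg_mul_I φ
    rw [hφ] at this
    simpa using this.symm
  set v := Real.toNNReal (σ ^ 2 / 2) with hv
  have hrot := IsGaussian.map_rotation_eq_self (μ := gaussianReal 0 v) (by simp) (-θ)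
  have hscale : (gaussianReal 0 v).map (fun x => √2 / σ * x) = stdNormal := by
    rw [gaussianReal_map_const_mul, mul_zero]
    congr 1
    ext
    simp only [NNReal.coe_mul, NNReal.coe_mk, NNReal.coe_one, hv,
      Real.coe_toNNReal _ (show 0 ≤ σ ^ 2 / 2 by positivity)]
    rw [div_pow, Real.sq_sqrt (by norm_num)]
    field_simp
  rw [complexGaussian, Measure.map_map (measurable_noiseParts _ _) measurable_complex_mk,
    ← hscale, Measure.map_prod_map _ _ (by fun_prop) (by fun_prop)]
  conv_rhs => rw [← hrot]
  rw [Measure.map_map (by fun_prop) (by fun_prop)]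
  congr 1
  ext p <;>
  simp [noiseParts, hθ, Complex.exp_ofReal_mul_I_re, Complex.exp_ofReal_mul_I_im,
    ContinuousLinearMap.rotation_apply] <;> ring_nf <;> simp

/-- The joint law of the (antipodal) inputs and the normalized noise of one row. -/
noncomputable def rowLaw (ι : Type*) [Fintype ι] : Measure ((ι → ℝ) × (ι → ℝ)) :=
  (Measure.pi fun _ => rademacher).prod (Measure.pi fun _ => stdNormal)

instance (ι : Type*) [Fintype ι] : IsProbabilityMeasure (rowLaw ι) := by
  unfold rowLaw; infer_instance

/-- The data and noise of one row, in real coordinates, when the noise sample `n` is rotated by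
`φ n`. -/
lemma map_rowLaw {σ : ℝ} (hσ : 0 < σ) {M N : ℕ} {φ : Fin N → ℂ} (hφ : ∀ n, ‖φ n‖ = 1) (m : Fin M) :
    ((uniformOn Set.univ : Measure (Fin M → Fin N → Bool × Bool)).prod
      (Measure.pi fun _ : Fin M => Measure.pi fun _ : Fin N => complexGaussian σ)).map
      (Prod.map (rowCoords (fun _ => bitSigns) m) (rowCoords (fun n => noiseParts σ (φ n)) m)) =
    rowLaw (Fin N × Bool) := by
  have hbits : (uniformOn Set.univ : Measure (Fin M → Fin N → Bool × Bool)) =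
      Measure.pi fun _ : Fin M => Measure.pi fun _ : Fin N => uniformOn Set.univ := by
    rw [← Set.pi_univ Set.univ, uniformOn_pi]
    congr 1; ext1 m
    rw [← Set.pi_univ Set.univ, uniformOn_pi]
  rw [hbits, rowLaw, ← map_rowCoords (fun n => measurable_noiseParts σ (φ n))
      (fun n => map_noiseParts hσ (hφ n)) m,
    ← map_rowCoords (μ₀ := (uniformOn Set.univ : Measure (Bool × Bool))) (s := fun _ => bitSigns)
      (fun _ => Measurable.of_discrete) (fun _ => map_bitSigns) m,
    Measure.map_prod_map _ _ (measurable_rowCoords (fun _ => Measurable.of_discrete) m)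
      (measurable_rowCoords (fun n => measurable_noiseParts σ (φ n)) m)]

variable {ι : Type*} [Fintype ι] [DecidableEq ι]

/-- Detection error of the coordinate `k` of the real system. -/
def errorSet (O : Matrix ι ι ℝ) (K τ : ℝ) (k : ι) : Set ((ι → ℝ) × (ι → ℝ)) :=
  {p | ¬ (0 < p.1 k ↔ 0 ≤ output O (rmod K) τ k p.1 p.2)}

lemma measurableSet_errorSet (O : Matrix ι ι ℝ) (K τ : ℝ) (k : ι) :
    MeasurableSet (errorSet O K τ k) := by
  have h1 : MeasurableSet {p : (ι → ℝ) × (ι → ℝ) | 0 < p.1 k} :=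
    measurableSet_lt measurable_const ((measurable_pi_apply k).comp measurable_fst)
  have h2 : MeasurableSet {p : (ι → ℝ) × (ι → ℝ) | 0 ≤ output O (rmod K) τ k p.1 p.2} :=
    measurableSet_le measurable_const (measurable_output O (measurable_rmod K) τ k)
  have e : errorSet O K τ k = ({p : (ι → ℝ) × (ι → ℝ) | 0 < p.1 k} ∩
      {p | 0 ≤ output O (rmod K) τ k p.1 p.2} ∪ {p : (ι → ℝ) × (ι → ℝ) | 0 < p.1 k}ᶜ ∩
      {p | 0 ≤ output O (rmod K) τ k p.1 p.2}ᶜ)ᶜ := by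
    ext p
    simp only [errorSet, Set.mem_compl_iff, Set.mem_union, Set.mem_inter_iff, Set.mem_ofPred_eq]
    tauto
  rw [e]
  exact ((h1.inter h2).union (h1.compl.inter h2.compl)).compl

/-- Conditioning the row law on one input. -/
lemma rowLaw_real_eq (k : ι) {E : Set ((ι → ℝ) × (ι → ℝ))} (hE : MeasurableSet E) :
    (rowLaw ι).real E = ((inputNoise k 1).real E + (inputNoise k (-1)).real E) / 2 := by
  set γ := Measure.pi fun _ : ι => stdNormal with hγ
  set F : (ι → ℝ) → ℝ := fun ξ => γ.real (Prod.mk ξ ⁻¹' E) with hF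
  have hFm : Measurable F := (measurable_measure_prodMk_left hE).ennreal_toReal
  have hF1 : ∀ ξ, ‖F ξ‖ ≤ 1 := fun ξ => by
    rw [Real.norm_eq_abs, abs_of_nonneg measureReal_nonneg]; exact measureReal_le_one
  have iF : ∀ μ : ι → Measure ℝ, (∀ i, IsProbabilityMeasure (μ i)) → Integrable F (Measure.pi μ) :=
    fun μ hμ => Integrable.of_bound hFm.aestronglyMeasurable 1 (Filter.Eventually.of_forall hF1)
  have hprod : ∀ μ : Measure (ι → ℝ), IsProbabilityMeasure μ →
      (μ.prod γ).real E = ∫ ξ, F ξ ∂μ := fun μ hμ => by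
    rw [measureReal_def, Measure.prod_apply hE, integral_eq_lintegral_of_nonneg_ae
      (Filter.Eventually.of_forall fun ξ => measureReal_nonneg) hFm.aestronglyMeasurable]
    congr 2; ext ξ
    exact (ofReal_measureReal (measure_ne_top _ _)).symm
  have hb : ∀ b : ℝ, ∫ ξ, F ξ ∂Measure.pi (frozen rademacher k b) =
      ∫ ξ, F (Function.update ξ k b) ∂Measure.pi (fun _ : ι => rademacher) := fun b => by
    have := integral_pi_eq_update (μ := fun _ : ι => rademacher) (μ' := frozen rademacher k b) k
      (fun i hi => by simp [frozen, hi]) (iF _ inferInstance)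
    rw [this]
    simp [frozen]
  have hu : ∀ b : ℝ, Integrable (fun ξ : ι → ℝ => F (Function.update ξ k b))
      (Measure.pi (fun _ : ι => rademacher)) := fun b =>
    Integrable.of_bound (hFm.comp (by fun_prop)).aestronglyMeasurable 1
      (Filter.Eventually.of_forall fun _ => hF1 _)
  rw [rowLaw, inputNoise, inputNoise, hprod _ inferInstance, hprod _ inferInstance,
    hprod _ inferInstance, hb, hb]
  rw [integral_pi_eq_update (μ := fun _ : ι => rademacher) k (fun i _ => rfl) (iF _ inferInstance)]
  simp only [integral_rademacher, smul_eq_mul]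
  rw [integral_const_mul, integral_add (hu 1) (hu (-1))]
  ring

lemma inputNoise_ae (k : ι) (b : ℝ) : ∀ᵐ p ∂inputNoise k b, p.1 k = b := by
  have h1 : ∀ᵐ ξ ∂Measure.pi (frozen rademacher k b), ξ k = b := by
    have := (measurePreserving_eval (frozen rademacher k b) k)
    refine this.quasiMeasurePreserving.ae (p := fun x => x = b) ?_
    simp [frozen, ae_dirac_eq]
  exact Measure.quasiMeasurePreserving_fst.ae h1

/-- The detection error probability, in terms of the two conditional laws of the output. -/
lemma rowLaw_real_errorSet (O : Matrix ι ι ℝ) (K τ : ℝ) (k : ι) :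
    (rowLaw ι).real (errorSet O K τ k) =
      ((inputNoise k 1).real {p | output O (rmod K) τ k p.1 p.2 < 0} +
        (inputNoise k (-1)).real {p | 0 ≤ output O (rmod K) τ k p.1 p.2}) / 2 := by
  rw [rowLaw_real_eq k (measurableSet_errorSet O K τ k)]
  congr 2
  · refine measureReal_congr ?_
    filter_upwards [inputNoise_ae k 1] with p hp
    apply propext
    change ¬ (0 < p.1 k ↔ 0 ≤ output O (rmod K) τ k p.1 p.2) ↔ output O (rmod K) τ k p.1 p.2 < 0
    rw [hp]; simp
  · refine measureReal_congr ?_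
    filter_upwards [inputNoise_ae k (-1)] with p hp
    apply propext
    change ¬ (0 < p.1 k ↔ 0 ≤ output O (rmod K) τ k p.1 p.2) ↔ 0 ≤ output O (rmod K) τ k p.1 p.2
    rw [hp]; norm_num

end

/-! ### Reduction of the precoded system to a real orthogonal system -/

section

open scoped Matrix

lemma modC_re (K : ℝ) (z : ℂ) : (modC K z).re = rmod K z.re := rfl

lemma modC_im (K : ℝ) (z : ℂ) : (modC K z).im = rmod K z.im := rfl

lemma rmod_mul_mul {r : ℝ} (hr : r ≠ 0) (K y : ℝ) : rmod (r * K) (r * y) = r * rmod K y := by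
  rw [rmod, rmod, mul_div_mul_left _ _ hr]; ring

lemma exists_modC_eq (K : ℝ) (z : ℂ) :
    ∃ a b : ℤ, modC K z = z - K * ((a : ℂ) + (b : ℂ) * Complex.I) := by
  refine ⟨⌊z.re / K + 1 / 2⌋, ⌊z.im / K + 1 / 2⌋, ?_⟩
  apply Complex.ext <;> simp [modC] <;> ring

/-- The precoder removes the interference of the delayed paths: up to a Gaussian-integer multiple of
`K`, only the data symbol arrives. -/
lemma exists_received_precode_eq {P : ℕ} (K : ℝ) {l : Fin (P + 1) → ℕ} (hl0 : l 0 = 0)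
    (hl : ∀ p, p ≠ 0 → 0 < l p) (c : Fin (P + 1) → ℕ → ℂ) (x : ℕ → ℂ) (t : ℕ) (hc : c 0 t ≠ 0)
    (w : ℂ) : ∃ a b : ℤ, received l c (precode K l c x) t w =
      c 0 t * (x t - K * ((a : ℂ) + (b : ℂ) * Complex.I)) + w := by
  obtain ⟨a, b, hab⟩ := exists_modC_eq K (x t - ∑ p : Fin P,
    if _hp : 0 < l p.succ ∧ l p.succ ≤ t then
      c p.succ (t - l p.succ) * precode K l c x (t - l p.succ) / c 0 t
    else 0)
  refine ⟨a, b, ?_⟩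
  rw [received, Fin.sum_univ_succ, hl0, if_pos (Nat.zero_le _), Nat.sub_zero]
  conv_lhs => rw [precode]
  rw [hab, mul_sub, mul_sub, Finset.mul_sum, mul_sub]
  have : ∀ p : Fin P, (if l p.succ ≤ t then
      c p.succ (t - l p.succ) * precode K l c x (t - l p.succ) else 0) =
      c 0 t * (if _hp : 0 < l p.succ ∧ l p.succ ≤ t then
        c p.succ (t - l p.succ) * precode K l c x (t - l p.succ) / c 0 t else 0) := fun p => by
    have hp := hl p.succ (Fin.succ_ne_zero p)
    by_cases h : l p.succ ≤ t
    · rw [if_pos h, dif_pos ⟨hp, h⟩]; field_simp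
    · rw [if_neg h, dif_neg (fun h' => h h'.2), mul_zero]
  rw [Finset.sum_congr rfl fun p _ => this p]
  ring

variable {M N P : ℕ}

/-- The phase that the receiver compensates at time `n M + m`. -/
noncomputable def rxPhase (M N : ℕ) (k : Fin (P + 1) → ℤ) (h : Fin (P + 1) → ℂ) (m : Fin M)
    (n : Fin N) : ℂ :=
  (starRingEnd ℂ) (tap M N k h 0 (n * M + m)) / ‖h 0‖

lemma norm_tap (k : Fin (P + 1) → ℤ) (h : Fin (P + 1) → ℂ) (p : Fin (P + 1)) (t : ℕ) :
    ‖tap M N k h p t‖ = ‖h p‖ := by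
  have : (2 * Real.pi * Complex.I * (k p : ℂ) * (t : ℂ) / ((N : ℂ) * (M : ℂ))) =
      ((2 * Real.pi * (k p : ℝ) * (t : ℝ) / ((N : ℝ) * (M : ℝ)) : ℝ) : ℂ) * Complex.I := by
    push_cast; ring
  rw [tap, this, norm_mul, Complex.norm_exp_ofReal_mul_I, mul_one]

lemma norm_rxPhase (k : Fin (P + 1) → ℤ) {h : Fin (P + 1) → ℂ} (h0 : h 0 ≠ 0) (m : Fin M)
    (n : Fin N) : ‖rxPhase M N k h m n‖ = 1 := by
  rw [rxPhase, norm_div, RCLike.norm_conj, norm_tap, Complex.norm_real, norm_norm,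
    div_self (norm_ne_zero_iff.2 h0)]

lemma timeSymbols_eq [NeZero M] (X : Fin M → Fin N → ℂ) (m : Fin M) (n : Fin N) :
    timeSymbols X (n * M + m) = timeDelay X m n := by
  have hM : 0 < M := Nat.pos_of_ne_zero (NeZero.ne M)
  have h1 : Fin.ofNat M ((n : ℕ) * M + m) = m := by
    apply Fin.ext
    simp [Fin.ofNat, Nat.mod_eq_of_lt m.2]
  have h2 : ((n : ℕ) * M + m) / M = n := by
    rw [mul_comm, Nat.mul_add_div hM, Nat.div_eq_of_lt m.2, add_zero]
  rw [timeSymbols, h1, h2]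

/-- After the modulo operation at the receiver, the symbol at delay `m` and time slot `n` is the
folded data symbol plus noise, scaled by the gain of the first path. -/
lemma modReceived_eq [NeZero M] {K : ℝ} (hK : 0 < K) {l : Fin (P + 1) → ℕ} (hl0 : l 0 = 0)
    (hl : ∀ p, p ≠ 0 → 0 < l p) (k : Fin (P + 1) → ℤ) {h : Fin (P + 1) → ℂ} (h0 : h 0 ≠ 0)
    (X w : Fin M → Fin N → ℂ) (m : Fin M) (n : Fin N) :
    modReceived K l k h X w m n =
      ‖h 0‖ * modC K (timeDelay X m n + rxPhase M N k h m n * w m n / ‖h 0‖) := by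
  have hr : ‖h 0‖ ≠ 0 := norm_ne_zero_iff.2 h0
  have hrC : ((‖h 0‖ : ℝ) : ℂ) ≠ 0 := by exact_mod_cast hr
  set t : ℕ := (n : ℕ) * M + m with ht
  set c0 := tap M N k h 0 t with hc0
  have hn : ‖c0‖ = ‖h 0‖ := norm_tap k h 0 t
  have hc : c0 ≠ 0 := by rw [← norm_ne_zero_iff, hn]; exact hr
  obtain ⟨a, b, hab⟩ := exists_received_precode_eq K hl0 hl (tap M N k h) (timeSymbols X) t hc
    (w m n)
  rw [modReceived]
  simp only [← ht]
  rw [hab, ← hc0, timeSymbols_eq, hn]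
  have hcc : (starRingEnd ℂ) c0 * c0 = (‖h 0‖ : ℂ) ^ 2 := by
    rw [← hn, mul_comm, Complex.mul_conj, Complex.normSq_eq_norm_sq]; push_cast; ring
  have key : (starRingEnd ℂ) c0 * (c0 * (timeDelay X m n - K * ((a : ℂ) + (b : ℂ) * Complex.I)) +
      w m n) / ‖h 0‖ = (‖h 0‖ : ℂ) * ((timeDelay X m n + rxPhase M N k h m n * w m n / ‖h 0‖) +
        (((-a : ℤ) : ℝ) * K : ℝ) + (((-b : ℤ) : ℝ) * K : ℝ) * Complex.I) := by
    rw [mul_add, ← mul_assoc, hcc, rxPhase, ← ht, ← hc0]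
    push_cast
    field_simp
    ring
  rw [key]
  apply Complex.ext
  · rw [modC_re, Complex.re_ofReal_mul, Complex.re_ofReal_mul, rmod_mul_mul hr, modC_re]
    congr 1
    rw [Complex.add_re, Complex.add_re, Complex.ofReal_re, Complex.re_ofReal_mul, Complex.I_re,
      mul_zero, add_zero]
    exact rmod_add_int_mul hK _ _
  · rw [modC_im, Complex.im_ofReal_mul, Complex.im_ofReal_mul, rmod_mul_mul hr, modC_im]
    congr 1
    rw [Complex.add_im, Complex.add_im, Complex.ofReal_im, Complex.im_ofReal_mul, Complex.I_im,
      mul_one, add_zero]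
    exact rmod_add_int_mul hK _ _

/-- The bits of row `m`, as the antipodal inputs of the real system. -/
noncomputable def rowBits (m : Fin M) (b : Fin M → Fin N → Bool × Bool) : Fin N × Bool → ℝ :=
  rowCoords (fun _ => bitSigns) m b

/-- The noise of row `m`, phase-compensated and normalized, in real coordinates. -/
noncomputable def rowNoise (σ : ℝ) (k : Fin (P + 1) → ℤ) (h : Fin (P + 1) → ℂ) (m : Fin M)
    (w : Fin M → Fin N → ℂ) : Fin N × Bool → ℝ :=
  rowCoords (fun n => noiseParts σ (rxPhase M N k h m n)) m w

lemma timeDelay_coords (b : Fin M → Fin N → Bool × Bool) (m : Fin M) (n : Fin N) :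
    (timeDelay (fun i j => qam (b i j)) m n).re = (dftMatrix N *ᵥ rowBits m b) (n, true) ∧
    (timeDelay (fun i j => qam (b i j)) m n).im = (dftMatrix N *ᵥ rowBits m b) (n, false) := by
  have hexp : ∀ k : Fin N, Complex.exp (2 * Real.pi * Complex.I * (k : ℕ) * (n : ℂ) / (N : ℂ)) =
      Real.cos (dftPhase N n k) + Real.sin (dftPhase N n k) * Complex.I := fun k => by
    rw [Complex.ofReal_cos, Complex.ofReal_sin, ← Complex.exp_mul_I]
    congr 1
    rw [dftPhase]; push_cast; ring
  have hre : ∀ k : Fin N, (qam (b m k)).re = rowBits m b (k, true) := fun k => rfl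
  have him : ∀ k : Fin N, (qam (b m k)).im = rowBits m b (k, false) := fun k => rfl
  have hs : (1 / (√(N : ℝ) : ℂ)) = (((√(N : ℝ))⁻¹ : ℝ) : ℂ) := by push_cast; rw [one_div]
  simp only [timeDelay, hexp, hs, Matrix.mulVec, dotProduct, Fintype.sum_prod_type,
    Fintype.sum_bool, dftMatrix]
  constructor
  · rw [Complex.re_ofReal_mul, Complex.re_sum, Finset.mul_sum]
    refine Finset.sum_congr rfl fun k _ => ?_
    rw [Complex.mul_re, hre, him]
    simp [-Complex.ofReal_cos, -Complex.ofReal_sin]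
    ring
  · rw [Complex.im_ofReal_mul, Complex.im_sum, Finset.mul_sum]
    refine Finset.sum_congr rfl fun k _ => ?_
    rw [Complex.mul_im, hre, him]
    simp [-Complex.ofReal_cos, -Complex.ofReal_sin]
    ring

/-- The equalized symbol is, coordinate by coordinate, the output of the real system. -/
lemma equalized_eq_output [NeZero M] {K σ : ℝ} (hK : 0 < K) (hσ : 0 < σ) {l : Fin (P + 1) → ℕ}
    (hl0 : l 0 = 0) (hl : ∀ p, p ≠ 0 → 0 < l p) (k : Fin (P + 1) → ℤ) {h : Fin (P + 1) → ℂ}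
    (h0 : h 0 ≠ 0) (b : Fin M → Fin N → Bool × Bool) (w : Fin M → Fin N → ℂ) (m : Fin M)
    (k' : Fin N) :
    (equalized K l k h (fun i j => qam (b i j)) w m k').re =
      output (dftMatrix N) (rmod K) (σ / (√2 * ‖h 0‖)) (k', true) (rowBits m b)
        (rowNoise σ k h m w) ∧
    (equalized K l k h (fun i j => qam (b i j)) w m k').im =
      output (dftMatrix N) (rmod K) (σ / (√2 * ‖h 0‖)) (k', false) (rowBits m b)
        (rowNoise σ k h m w) := by
  have hr : ‖h 0‖ ≠ 0 := norm_ne_zero_iff.2 h0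
  have hrC : ((‖h 0‖ : ℝ) : ℂ) ≠ 0 := by exact_mod_cast hr
  have h2 : √2 ≠ 0 := by positivity
  set τ := σ / (√2 * ‖h 0‖) with hτ
  set u : Fin N × Bool → ℝ :=
    fun i => rmod K ((dftMatrix N *ᵥ rowBits m b) i + τ * rowNoise σ k h m w i) with hu
  have hmod : ∀ n : Fin N, modReceived K l k h (fun i j => qam (b i j)) w m n =
      ‖h 0‖ * (u (n, true) + u (n, false) * Complex.I) := fun n => by
    rw [modReceived_eq hK hl0 hl k h0]
    congr 1
    apply Complex.ext
    · rw [modC_re, Complex.add_re, (timeDelay_coords b m n).1, Complex.div_ofReal_re]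
      simp only [hu, rowNoise, rowCoords, noiseParts, hτ, if_true]
      simp
      congr 2
      field_simp
    · rw [modC_im, Complex.add_im, (timeDelay_coords b m n).2, Complex.div_ofReal_im]
      simp only [hu, rowNoise, rowCoords, noiseParts, hτ]
      simp
      congr 2
      field_simp
  have hexp : ∀ n : Fin N,
      Complex.exp (-(2 * Real.pi * Complex.I * (n : ℕ) * (k' : ℕ) / (N : ℂ))) =
      Real.cos (dftPhase N n k') - Real.sin (dftPhase N n k') * Complex.I := fun n => by
    have : -(2 * Real.pi * Complex.I * (n : ℕ) * (k' : ℕ) / (N : ℂ)) =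
        ((-dftPhase N n k' : ℝ) : ℂ) * Complex.I := by
      rw [dftPhase]; push_cast; ring
    rw [this, Complex.exp_mul_I, ← Complex.ofReal_cos, ← Complex.ofReal_sin, Real.cos_neg,
      Real.sin_neg]
    push_cast; ring
  have heq : equalized K l k h (fun i j => qam (b i j)) w m k' =
      (((√(N : ℝ))⁻¹ : ℝ) : ℂ) * ∑ n : Fin N, (u (n, true) + u (n, false) * Complex.I) *
        (Real.cos (dftPhase N n k') - Real.sin (dftPhase N n k') * Complex.I) := by
    rw [equalized, mul_div_assoc, Finset.sum_div]
    congr 1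
    · push_cast; rw [one_div]
    · refine Finset.sum_congr rfl fun n _ => ?_
      rw [hmod, hexp]
      field_simp
  rw [heq]
  simp only [output, Fintype.sum_prod_type, Fintype.sum_bool, dftMatrix]
  constructor
  · rw [Complex.re_ofReal_mul, Complex.re_sum, Finset.mul_sum]
    refine Finset.sum_congr rfl fun n _ => ?_
    change _ = _ * u (n, true) + _ * u (n, false)
    simp [-Complex.ofReal_cos, -Complex.ofReal_sin]
    ring
  · rw [Complex.im_ofReal_mul, Complex.im_sum, Finset.mul_sum]
    refine Finset.sum_congr rfl fun n _ => ?_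
    change _ = _ * u (n, true) + _ * u (n, false)
    simp [-Complex.ofReal_cos, -Complex.ofReal_sin]
    ring

end

/-! ### The bit error rate as an average over the gain of the first path -/

section

open scoped Matrix

variable {M N P : ℕ}

lemma measurable_output_uncurry {ι Ω : Type*} [Fintype ι] [DecidableEq ι] [MeasurableSpace Ω]
    (O : Matrix ι ι ℝ) (K : ℝ) (k : ι) {τ : Ω → ℝ} {ξ ω : Ω → ι → ℝ} (hτ : Measurable τ) (hξ : Measurable ξ)
    (hω : Measurable ω) : Measurable fun x => output O (rmod K) (τ x) k (ξ x) (ω x) := by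
  unfold output
  refine Finset.measurable_sum _ fun n _ => (((measurable_rmod K).comp ?_).const_mul _)
  exact ((continuous_mulVec_apply O n).measurable.comp hξ).add
    (hτ.mul ((measurable_pi_apply n).comp hω))

lemma measurableSet_not_pos_iff_nonneg {Ω : Type*} [MeasurableSpace Ω] {f g : Ω → ℝ}
    (hf : Measurable f) (hg : Measurable g) : MeasurableSet {x | ¬ (0 < f x ↔ 0 ≤ g x)} :=
  ((measurableSet_lt measurable_const hf).iff (measurableSet_le measurable_const hg)).compl

/-- The error probability of coordinate `i` in one row, for noise level `τ`. -/
noncomputable def rowError (N : ℕ) (K τ : ℝ) (i : Fin N × Bool) : ℝ :=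
  (rowLaw (Fin N × Bool)).real (errorSet (dftMatrix N) K τ i)

lemma rowError_nonneg (K τ : ℝ) (i : Fin N × Bool) : 0 ≤ rowError N K τ i := measureReal_nonneg

lemma rowError_le_one (K τ : ℝ) (i : Fin N × Bool) : rowError N K τ i ≤ 1 := measureReal_le_one

lemma measurable_rowError (K : ℝ) (i : Fin N × Bool) : Measurable fun τ => rowError N K τ i := by
  have hS : MeasurableSet {x : ℝ × ((Fin N × Bool → ℝ) × (Fin N × Bool → ℝ)) |
      ¬ (0 < x.2.1 i ↔ 0 ≤ output (dftMatrix N) (rmod K) x.1 i x.2.1 x.2.2)} :=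
    measurableSet_not_pos_iff_nonneg (by fun_prop) (measurable_output_uncurry _ _ _ (by fun_prop)
      (by fun_prop) (by fun_prop))
  exact (measurable_measure_prodMk_left (ν := rowLaw (Fin N × Bool)) hS).ennreal_toReal

/-- The normalized noise level seen at the gain `z` of the first path. -/
noncomputable def noiseLevel (σ : ℝ) (z : ℂ) : ℝ := σ / (√2 * ‖z‖)

lemma measurable_noiseLevel (σ : ℝ) : Measurable (noiseLevel σ) := by
  unfold noiseLevel; fun_prop

lemma measurable_rowBits (m : Fin M) : Measurable (rowBits (N := N) m) := Measurable.of_discrete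

lemma measurable_rowNoise {Ω : Type*} [MeasurableSpace Ω] (σ : ℝ) (k : Fin (P + 1) → ℤ) (m : Fin M)
    {h : Ω → Fin (P + 1) → ℂ} {w : Ω → Fin M → Fin N → ℂ} (hh : Measurable h) (hw : Measurable w) :
    Measurable fun x => rowNoise σ k (h x) m (w x) := by
  refine measurable_pi_iff.2 fun i => ?_
  have h1 : Measurable fun x => rxPhase M N k (h x) m i.1 * w x m i.1 := by
    refine Measurable.mul ?_ ((measurable_pi_apply i.1).comp ((measurable_pi_apply m).comp hw))
    have h0 : Measurable fun x => h x 0 := (measurable_pi_apply 0).comp hh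
    unfold rxPhase tap
    exact (Complex.continuous_conj.measurable.comp (h0.mul_const _)).div
      (Complex.measurable_ofReal.comp h0.norm)
  have h2 := Complex.measurable_re.comp h1
  have h3 := Complex.measurable_im.comp h1
  unfold rowNoise rowCoords noiseParts
  split_ifs
  · exact h2.const_mul _
  · exact h3.const_mul _

lemma complexGaussian_singleton_zero {σ : ℝ} (hσ : 0 < σ) : complexGaussian σ {0} = 0 := by
  rw [complexGaussian, Measure.map_apply measurable_complex_mk (measurableSet_singleton 0)]
  have hv : (Real.toNNReal (σ ^ 2 / 2)) ≠ 0 := by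
    rw [Ne, Real.toNNReal_eq_zero, not_le]; positivity
  have : NullSingletonClass (gaussianReal 0 (Real.toNNReal (σ ^ 2 / 2))) :=
    nullSingletonClass_gaussianReal hv
  refine measure_mono_null (t := {(0 : ℝ)} ×ˢ {(0 : ℝ)}) ?_ ?_
  · intro p hp
    have hp' : (⟨p.1, p.2⟩ : ℂ) = 0 := hp
    exact ⟨congrArg Complex.re hp', congrArg Complex.im hp'⟩
  · rw [Measure.prod_prod]; simp

lemma map_rowBits_rowNoise {σ : ℝ} (hσ : 0 < σ) (k : Fin (P + 1) → ℤ) {h : Fin (P + 1) → ℂ}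
    (h0 : h 0 ≠ 0) (m : Fin M) :
    ((uniformOn Set.univ : Measure (Fin M → Fin N → Bool × Bool)).prod
      (Measure.pi fun _ : Fin M => Measure.pi fun _ : Fin N => complexGaussian σ)).map
        (Prod.map (rowBits (N := N) m) (rowNoise (N := N) σ k h m)) = rowLaw (Fin N × Bool) := by
  have := map_rowLaw hσ (norm_rxPhase (N := N) k h0 m) m
  exact this

/-- The error probability of one bit is the row error probability, averaged over the gain of the
first path. -/
lemma systemLaw_real_eq {σ σh K : ℝ} (hσ : 0 < σ) (hσh : 0 < σh) (k : Fin (P + 1) → ℤ)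
    {ν : Measure (Fin (P + 1) → ℂ)} [IsProbabilityMeasure ν]
    (hν : ν.map (fun h => h 0) = complexGaussian σh) (m : Fin M) (i : Fin N × Bool)
    {A : Set ((Fin (P + 1) → ℂ) × (Fin M → Fin N → Bool × Bool) × (Fin M → Fin N → ℂ))}
    (hA : ∀ x, x.1 0 ≠ 0 → (x ∈ A ↔ (rowBits m x.2.1, rowNoise σ k x.1 m x.2.2) ∈
      errorSet (dftMatrix N) K (noiseLevel σ (x.1 0)) i)) :
    (systemLaw M N ν σ).real A =
      ∫ z, rowError N K (noiseLevel σ z) i ∂complexGaussian σh := by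
  let A' : Set ((Fin (P + 1) → ℂ) × (Fin M → Fin N → Bool × Bool) × (Fin M → Fin N → ℂ)) :=
    {x | (rowBits m x.2.1, rowNoise σ k x.1 m x.2.2) ∈
      errorSet (dftMatrix N) K (noiseLevel σ (x.1 0)) i}
  have hbits : Measurable fun x : (Fin (P + 1) → ℂ) × (Fin M → Fin N → Bool × Bool) ×
      (Fin M → Fin N → ℂ) => rowBits m x.2.1 :=
    (measurable_rowBits m).comp (measurable_fst.comp measurable_snd)
  have hnoise : Measurable fun x : (Fin (P + 1) → ℂ) × (Fin M → Fin N → Bool × Bool) ×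
      (Fin M → Fin N → ℂ) => rowNoise σ k x.1 m x.2.2 :=
    measurable_rowNoise σ k m measurable_fst (measurable_snd.comp measurable_snd)
  have hlevel : Measurable fun x : (Fin (P + 1) → ℂ) × (Fin M → Fin N → Bool × Bool) ×
      (Fin M → Fin N → ℂ) => noiseLevel σ (x.1 0) :=
    (measurable_noiseLevel σ).comp ((measurable_pi_apply 0).comp measurable_fst)
  have hA'm : MeasurableSet A' :=
    measurableSet_not_pos_iff_nonneg ((measurable_pi_apply i).comp hbits)
      (measurable_output_uncurry (dftMatrix N) K i hlevel hbits hnoise)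
  have hne : ∀ᵐ h ∂ν, h 0 ≠ 0 := by
    have : ∀ᵐ z ∂ν.map (fun h => h 0), z ≠ 0 := by
      rw [hν, ae_iff]
      simpa using complexGaussian_singleton_zero hσh
    exact ae_of_ae_map (f := fun h : Fin (P + 1) → ℂ => h 0) (measurable_pi_apply 0).aemeasurable this
  have hAA' : A =ᵐ[systemLaw M N ν σ] A' := by
    have : ∀ᵐ x ∂systemLaw M N ν σ, x.1 0 ≠ 0 := Measure.quasiMeasurePreserving_fst.ae hne
    filter_upwards [this] with x hx
    exact propext (hA x hx)
  have hsec : ∀ᵐ h ∂ν, ((uniformOn Set.univ : Measure (Fin M → Fin N → Bool × Bool)).prod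
      (Measure.pi fun _ : Fin M => Measure.pi fun _ : Fin N => complexGaussian σ))
        (Prod.mk h ⁻¹' A') =
      ENNReal.ofReal (rowError N K (noiseLevel σ (h 0)) i) := by
    filter_upwards [hne] with h h0
    have hΦ : Measurable (Prod.map (rowBits (N := N) m) (rowNoise (N := N) σ k h m)) :=
      (measurable_rowBits m).prodMap (measurable_rowCoords (fun n => measurable_noiseParts σ _) m)
    rw [rowError, ofReal_measureReal (measure_ne_top _ _), ← map_rowBits_rowNoise hσ k h0 m,
      Measure.map_apply hΦ (measurableSet_errorSet _ _ _ _)]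
    congr 1
  have hmeas : Measurable fun z => rowError N K (noiseLevel σ z) i :=
    (measurable_rowError K i).comp (measurable_noiseLevel σ)
  rw [measureReal_congr hAA', measureReal_def, systemLaw, Measure.prod_apply hA'm,
    lintegral_congr_ae hsec, ← hν, integral_eq_lintegral_of_nonneg_ae
      (Filter.Eventually.of_forall fun z => rowError_nonneg _ _ _) hmeas.aestronglyMeasurable,
    lintegral_map hmeas.ennreal_ofReal (by fun_prop)]

/-- The bit error probability of a row, averaged over its bits, at the gain `z` of the first
path. -/
noncomputable def meanRowError (N : ℕ) (K σ : ℝ) (z : ℂ) : ℝ :=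
  (∑ i, rowError N K (noiseLevel σ z) i) / (2 * N)

lemma measurable_meanRowError (N : ℕ) (K σ : ℝ) : Measurable (meanRowError N K σ) := by
  unfold meanRowError
  exact (Finset.measurable_sum _ fun i _ =>
    (measurable_rowError K i).comp (measurable_noiseLevel σ)).div_const _

lemma meanRowError_nonneg (N : ℕ) (K σ : ℝ) (z : ℂ) : 0 ≤ meanRowError N K σ z :=
  div_nonneg (Finset.sum_nonneg fun i _ => rowError_nonneg _ _ _) (by positivity)

lemma meanRowError_le_one (N : ℕ) (K σ : ℝ) (z : ℂ) : meanRowError N K σ z ≤ 1 := by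
  refine div_le_one_of_le₀ ?_ (by positivity)
  refine (Finset.sum_le_sum fun i _ => rowError_le_one _ _ i).trans (le_of_eq ?_)
  simp [mul_comm]

/-- The bit error rate depends on the channel only through the law of the gain of the first path. -/
lemma ber_eq_integral [NeZero M] (hN : 0 < N) {α σ σh : ℝ} (hα : 0 < α) (hσ : 0 < σ) (hσh : 0 < σh)
    {l : Fin (P + 1) → ℕ} (hl0 : l 0 = 0) (hl : ∀ p, p ≠ 0 → 0 < l p) (k : Fin (P + 1) → ℤ)
    {ν : Measure (Fin (P + 1) → ℂ)} [IsProbabilityMeasure ν]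
    (hν : ν.map (fun h => h 0) = complexGaussian σh) :
    ber M N α σ l k ν = ∫ z, meanRowError N (modulus α) σ z ∂complexGaussian σh := by
  have hK : 0 < modulus α := by unfold modulus qamOrder; positivity
  have h1 : ∀ (m : Fin M) (k' : Fin N), (systemLaw M N ν σ).real {x | ¬ ((x.2.1 m k').1 = true ↔
      0 ≤ (equalized (modulus α) l k x.1 (fun i j => qam (x.2.1 i j)) x.2.2 m k').re)} =
      ∫ z, rowError N (modulus α) (noiseLevel σ z) (k', true) ∂complexGaussian σh := by
    intro m k'
    refine systemLaw_real_eq hσ hσh k hν m (k', true) fun x hx => ?_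
    rw [Set.mem_ofPred_eq, (equalized_eq_output hK hσ hl0 hl k hx x.2.1 x.2.2 m k').1, errorSet,
      Set.mem_ofPred_eq, noiseLevel]
    have : (x.2.1 m k').1 = true ↔ 0 < rowBits m x.2.1 (k', true) := by
      change _ ↔ 0 < if (x.2.1 m k').1 then (1 : ℝ) else -1
      cases (x.2.1 m k').1 <;> norm_num
    rw [this]
  have h2 : ∀ (m : Fin M) (k' : Fin N), (systemLaw M N ν σ).real {x | ¬ ((x.2.1 m k').2 = true ↔
      0 ≤ (equalized (modulus α) l k x.1 (fun i j => qam (x.2.1 i j)) x.2.2 m k').im)} =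
      ∫ z, rowError N (modulus α) (noiseLevel σ z) (k', false) ∂complexGaussian σh := by
    intro m k'
    refine systemLaw_real_eq hσ hσh k hν m (k', false) fun x hx => ?_
    rw [Set.mem_ofPred_eq, (equalized_eq_output hK hσ hl0 hl k hx x.2.1 x.2.2 m k').2, errorSet,
      Set.mem_ofPred_eq, noiseLevel]
    have : (x.2.1 m k').2 = true ↔ 0 < rowBits m x.2.1 (k', false) := by
      change _ ↔ 0 < if (x.2.1 m k').2 then (1 : ℝ) else -1
      cases (x.2.1 m k').2 <;> norm_num
    rw [this]
  have hint : ∀ i, Integrable (fun z => rowError N (modulus α) (noiseLevel σ z) i)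
      (complexGaussian σh) := fun i =>
    Integrable.of_bound ((measurable_rowError _ i).comp (measurable_noiseLevel σ)).aestronglyMeasurable
      1 (.of_forall fun z => by
        rw [Real.norm_eq_abs, abs_of_nonneg (rowError_nonneg _ _ _)]; exact rowError_le_one _ _ _)
  have hM : (M : ℝ) ≠ 0 := by exact_mod_cast NeZero.ne M
  have hN' : (N : ℝ) ≠ 0 := by exact_mod_cast hN.ne'
  simp only [ber, h1, h2, meanRowError]
  rw [integral_div, integral_finsetSum _ fun i _ => hint i, Fintype.sum_prod_type]
  simp only [Fintype.sum_bool, Finset.sum_const, Finset.card_univ, Fintype.card_fin, nsmul_eq_mul]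
  field_simp

/-- Fatou's lemma, as a comparison of means. -/
lemma eventually_integral_le {Ω : Type*} [MeasurableSpace Ω] {μ : Measure Ω}
    [IsProbabilityMeasure μ] {T : Ω → ℝ} {B : ℕ → Ω → ℝ} {C : ℝ} (hT : Measurable T)
    (hTC : ∀ x, |T x| ≤ C) (hB : ∀ n, Measurable (B n)) (hBC : ∀ n x, |B n x| ≤ C)
    (h : ∀ᵐ x ∂μ, ∃ ε > 0, ∀ᶠ n in Filter.atTop, T x + ε ≤ B n x) :
    ∀ᶠ n in Filter.atTop, ∫ x, T x ∂μ ≤ ∫ x, B n x ∂μ := by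
  have hint : ∀ g : Ω → ℝ, Measurable g → (∀ x, |g x| ≤ C) →
      ENNReal.ofReal (∫ x, g x ∂μ + C) = ∫⁻ x, ENNReal.ofReal (g x + C) ∂μ := fun g hg hgC => by
    have hi : Integrable g μ := Integrable.of_bound hg.aestronglyMeasurable C
      (Filter.Eventually.of_forall hgC)
    have hi' : Integrable (fun x => g x + C) μ := hi.add (integrable_const C)
    rw [← ofReal_integral_eq_lintegral_ofReal hi'
      (Filter.Eventually.of_forall fun x => by
        have := neg_le_of_abs_le (hgC x)
        change 0 ≤ g x + C; linarith)]
    congr 1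
    rw [integral_add hi (integrable_const C)]; simp
  have hlt : ENNReal.ofReal (∫ x, T x ∂μ + C) <
      Filter.liminf (fun n => ENNReal.ofReal (∫ x, B n x ∂μ + C)) Filter.atTop := by
    have h1 : ENNReal.ofReal (∫ x, T x ∂μ + C) < ∫⁻ x, Filter.liminf
        (fun n => ENNReal.ofReal (B n x + C)) Filter.atTop ∂μ := by
      rw [hint T hT hTC]
      refine lintegral_strict_mono (IsProbabilityMeasure.ne_zero μ)
        (Measurable.liminf fun n => ((hB n).add_const C).ennreal_ofReal).aemeasurable ?_ ?_
      · rw [← hint T hT hTC]; exact ENNReal.ofReal_ne_top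
      · filter_upwards [h] with x hx
        obtain ⟨ε, hε, hx⟩ := hx
        have h0 := neg_le_of_abs_le (hTC x)
        calc ENNReal.ofReal (T x + C) < ENNReal.ofReal (T x + ε + C) :=
              (ENNReal.ofReal_lt_ofReal_iff (by linarith)).2 (by linarith)
          _ ≤ _ := Filter.le_liminf_of_le (by isBoundedDefault) (hx.mono fun n hn =>
              ENNReal.ofReal_le_ofReal (by linarith))
    refine h1.trans_le ?_
    simp only [fun n => hint (B n) (hB n) (hBC n)]
    exact lintegral_liminf_le fun n => ((hB n).add_const C).ennreal_ofReal
  filter_upwards [Filter.eventually_lt_of_lt_liminf hlt] with n hn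
  by_contra! hcon
  exact absurd hn (not_lt.2 (ENNReal.ofReal_le_ofReal (by linarith)))

end

/-! ### Passage to the limit of long frames -/

section

open scoped Matrix

variable {K s : ℝ}

lemma measurable_rmod_mul (K s : ℝ) : Measurable fun y => rmod K (s * y) :=
  (measurable_rmod K).comp (by fun_prop)

lemma integrable_rmod_sq (hK : 0 < K) (s : ℝ) :
    Integrable (fun y => rmod K (s * y) ^ 2) stdNormal :=
  Integrable.of_bound ((measurable_rmod_mul K s).pow_const 2).aestronglyMeasurable ((K / 2) ^ 2)
    (.of_forall fun y => by
      rw [Real.norm_eq_abs, abs_pow]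
      exact pow_le_pow_left₀ (abs_nonneg _) (abs_rmod_le hK _) 2)

lemma integrable_rmod_mul_id (hK : 0 < K) (s : ℝ) :
    Integrable (fun y => rmod K (s * y) * y) stdNormal :=
  integrable_id_stdNormal.bdd_mul (measurable_rmod_mul K s).aestronglyMeasurable
    (.of_forall fun y => by rw [Real.norm_eq_abs]; exact abs_rmod_le hK _)

lemma integrable_sq_stdNormal : Integrable (fun x : ℝ => x ^ 2) stdNormal :=
  integrable_pow_stdNormal 2

lemma power_pos (hK : 0 < K) (hs : 0 < s) : 0 < power K s := by
  rw [power, integral_pos_iff_support_of_nonneg (fun _ => sq_nonneg _) (integrable_rmod_sq hK s)]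
  have hsub : Set.Ioo 0 (K / (2 * s)) ⊆ Function.support fun y => rmod K (s * y) ^ 2 := by
    intro y hy
    have h1 : 0 < s * y := mul_pos hs hy.1
    have h2 : s * y < K / 2 := by
      have := mul_lt_mul_of_pos_left hy.2 hs
      have e : s * (K / (2 * s)) = K / 2 := by field_simp
      linarith
    rw [Function.mem_support, rmod_eq_self hK (by linarith) h2]
    positivity
  refine lt_of_lt_of_le (pos_iff_ne_zero.2 fun h => ?_) (measure_mono hsub)
  have := gaussianReal_absolutelyContinuous' 0 one_ne_zero h
  rw [Real.volume_Ioo, ENNReal.ofReal_eq_zero, sub_zero] at this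
  exact absurd this (not_le.2 (by positivity))

/-- The Cauchy-Schwarz inequality between the folded and the unfolded sample. -/
lemma sq_mul_gain_sq_le_power (hK : 0 < K) (hs : 0 < s) : s ^ 2 * gain K s ^ 2 ≤ power K s := by
  have e : s * gain K s = ∫ y, rmod K (s * y) * y ∂stdNormal := by rw [gain]; field_simp
  set g := s * gain K s with hg
  have h0 : 0 ≤ ∫ y, (rmod K (s * y) - g * y) ^ 2 ∂stdNormal :=
    integral_nonneg fun _ => sq_nonneg _
  have h1 : ∫ y, (rmod K (s * y) - g * y) ^ 2 ∂stdNormal =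
      ∫ y, (rmod K (s * y) ^ 2 - 2 * g * (rmod K (s * y) * y)) + g ^ 2 * y ^ 2 ∂stdNormal := by
    congr 1; ext y; ring
  have i1 : Integrable (fun y => rmod K (s * y) ^ 2 - 2 * g * (rmod K (s * y) * y)) stdNormal :=
    (integrable_rmod_sq hK s).sub ((integrable_rmod_mul_id hK s).const_mul _)
  rw [h1, integral_add i1 (integrable_sq_stdNormal.const_mul _),
    integral_sub (integrable_rmod_sq hK s) ((integrable_rmod_mul_id hK s).const_mul _),
    integral_const_mul, integral_const_mul, integral_sq_stdNormal, ← e] at h0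
  have : s ^ 2 * gain K s ^ 2 = g ^ 2 := by rw [hg]; ring
  rw [this, power]; linarith

lemma gain_sq_lt_power (hK : 0 < K) (hs : 1 < s) : gain K s ^ 2 < power K s := by
  have h1 := sq_mul_gain_sq_le_power hK (by linarith : 0 < s)
  rcases eq_or_ne (gain K s) 0 with h | h
  · rw [h]; simpa using power_pos hK (by linarith)
  · have : 0 < gain K s ^ 2 := by positivity
    have h2 : 1 < s ^ 2 := by nlinarith
    nlinarith [mul_lt_mul_of_pos_right h2 this]

/-- The signal amplitude over the standard deviation of the limiting Gaussian disturbance, as a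
function of the normalized noise level. -/
noncomputable def limitRatio (K τ : ℝ) : ℝ :=
  gain K √(1 + τ ^ 2) / √(power K √(1 + τ ^ 2) - gain K √(1 + τ ^ 2) ^ 2)

lemma eventually_le_rowError {τ : ℝ} (hK : 0 < K) (hτ : 0 < τ) {ε : ℝ} (hε : 0 < ε) :
    ∀ᶠ N in Filter.atTop, ∀ i, gaussianQ (limitRatio K τ) - ε ≤ rowError N K τ i := by
  have hs : 1 < √(1 + τ ^ 2) := Real.lt_sqrt_of_sq_lt (by nlinarith [sq_pos_of_pos hτ])
  obtain ⟨η₀, hη₀, h⟩ := exists_forall_error_ge hK hτ (gain_sq_lt_power hK hs) hε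
  filter_upwards [tendsto_dftSpread.eventually (eventually_le_nhds hη₀),
    Filter.eventually_ge_atTop 1] with N hN hN1 i
  have h1 := h (Fin N × Bool) (dftMatrix N) (dftSpread N) (incoherent_dftMatrix hN1) hN i
  rw [rowError, rowLaw_real_errorSet, limitRatio]
  linarith [h1.1, h1.2]

/-- A pointwise comparison with the limiting error rate at every gain of the first path gives a
lower bound on the bit error rate of all large frames. -/
theorem exists_forall_integral_le_ber {α σ σh : ℝ} (hα : 0 < α) (hσ : 0 < σ) (hσh : 0 < σh)
    {T : ℝ → ℝ} {C : ℝ} (hT : Measurable T) (hTC : ∀ r, |T r| ≤ C)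
    (h : ∀ τ, 0 < τ → T τ < gaussianQ (limitRatio (modulus α) τ)) :
    ∃ N₀ : ℕ, ∀ N : ℕ, N₀ ≤ N → ∀ (M : ℕ) [NeZero M] (P : ℕ)
      (l : Fin (P + 1) → ℕ) (k : Fin (P + 1) → ℤ)
      (ν : Measure (Fin (P + 1) → ℂ)) [IsProbabilityMeasure ν],
      l 0 = 0 → (∀ p, p ≠ 0 → 0 < l p) → ν.map (fun h => h 0) = complexGaussian σh →
      ∫ z, T (noiseLevel σ z) ∂complexGaussian σh ≤ ber M N α σ l k ν := by
  have hK : 0 < modulus α := by unfold modulus qamOrder; positivity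
  have hev := eventually_integral_le (μ := complexGaussian σh) (T := fun z => T (noiseLevel σ z))
    (B := fun N z => meanRowError N (modulus α) σ z) (C := max C 1)
    (hT.comp (measurable_noiseLevel σ)) (fun z => (hTC _).trans (le_max_left _ _))
    (fun N => measurable_meanRowError N _ σ)
    (fun N z => by
      rw [abs_of_nonneg (meanRowError_nonneg _ _ _ _)]
      exact (meanRowError_le_one _ _ _ _).trans (le_max_right _ _)) (by
    have h0 : ∀ᵐ z ∂complexGaussian σh, z ≠ 0 := by
      rw [ae_iff]; simpa using complexGaussian_singleton_zero hσh
    filter_upwards [h0] with z hz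
    have hτ : 0 < noiseLevel σ z := by
      have := norm_pos_iff.2 hz
      unfold noiseLevel; positivity
    set q := gaussianQ (limitRatio (modulus α) (noiseLevel σ z)) with hq
    have hlt := h _ hτ
    refine ⟨(q - T (noiseLevel σ z)) / 2, by linarith, ?_⟩
    filter_upwards [eventually_le_rowError hK hτ (half_pos (sub_pos.2 hlt)),
      Filter.eventually_ge_atTop 1] with N hN hN1
    have hN0 : (0 : ℝ) < N := by exact_mod_cast hN1
    rw [meanRowError, le_div_iff₀ (by positivity)]
    refine le_trans (le_of_eq ?_) (Finset.sum_le_sum fun i _ => hN i)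
    simp only [Finset.sum_const, Finset.card_univ, Fintype.card_prod, Fintype.card_fin,
      Fintype.card_bool, nsmul_eq_mul]
    push_cast
    ring)
  obtain ⟨N₀, hN₀⟩ := Filter.eventually_atTop.1 hev
  refine ⟨max N₀ 1, fun N hN M _ P l k ν _ hl0 hl hν => ?_⟩
  rw [ber_eq_integral (lt_of_lt_of_le one_pos ((le_max_right _ _).trans hN)) hα hσ hσh hl0 hl k hν]
  exact hN₀ N ((le_max_left _ _).trans hN)

end

/-! ### The multiples removed by the modulo operation -/

section

/-- The standard normal density. -/
noncomputable abbrev normalPDF (x : ℝ) : ℝ := gaussianPDFReal 0 1 x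

lemma normalPDF_eq (x : ℝ) : normalPDF x = (√(2 * Real.pi))⁻¹ * Real.exp (-(x ^ 2 / 2)) := by
  simp [normalPDF, gaussianPDFReal, neg_div]

lemma normalPDF_pos (x : ℝ) : 0 < normalPDF x := gaussianPDFReal_pos 0 1 x one_ne_zero

lemma continuous_normalPDF : Continuous normalPDF := by
  have : normalPDF = fun x => (√(2 * Real.pi))⁻¹ * Real.exp (-(x ^ 2 / 2)) :=
    funext normalPDF_eq
  rw [this]; fun_prop

lemma normalPDF_neg (x : ℝ) : normalPDF (-x) = normalPDF x := by
  rw [normalPDF_eq, normalPDF_eq, neg_sq]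

lemma normalPDF_le_of_sq_le {x y : ℝ} (h : x ^ 2 ≤ y ^ 2) : normalPDF y ≤ normalPDF x := by
  rw [normalPDF_eq, normalPDF_eq]; gcongr

lemma integral_stdNormal_eq (F : ℝ → ℝ) : ∫ y, F y ∂stdNormal = ∫ y, F y * normalPDF y := by
  rw [integral_gaussianReal_eq_integral_smul one_ne_zero]
  congr 1; ext y; rw [smul_eq_mul, mul_comm]

lemma integrable_stdNormal_iff {F : ℝ → ℝ} :
    Integrable F stdNormal ↔ Integrable fun y => F y * normalPDF y := by
  have h := integrable_withDensity_iff_integrable_smul' (μ := volume) (g := F)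
    (measurable_gaussianPDF 0 1) (.of_forall fun _ => gaussianPDF_lt_top)
  rw [stdNormal, gaussianReal_of_var_ne_zero 0 one_ne_zero, h]
  refine integrable_congr (.of_forall fun y => ?_)
  simp only [toReal_gaussianPDF, smul_eq_mul, mul_comm]

lemma integrable_normalPDF : Integrable normalPDF := integrable_gaussianPDFReal 0 1

instance : NullSingletonClass stdNormal := nullSingletonClass_gaussianReal one_ne_zero

/-- The line is cut into half-open cells of length `κ` centred at the multiples of `κ`. -/
def cell (κ : ℝ) (n : ℤ) : Set ℝ := Set.Ico (n * κ - κ / 2) (n * κ + κ / 2)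

lemma measurableSet_cell (κ : ℝ) (n : ℤ) : MeasurableSet (cell κ n) := measurableSet_Ico

lemma hasSum_integral_cell {κ : ℝ} (hκ : 0 < κ) {μ : Measure ℝ} {F : ℝ → ℝ}
    (hF : Integrable F μ) : HasSum (fun n : ℤ => ∫ y in cell κ n, F y ∂μ) (∫ y, F y ∂μ) := by
  have e : cell κ = fun n : ℤ => Set.Ico (-(κ / 2) + n • κ) (-(κ / 2) + (n + 1) • κ) := by
    ext n : 1
    simp only [cell, zsmul_eq_mul]
    congr 1
    · ring
    · push_cast; ring
  have h := hasSum_integral_iUnion (μ := μ) (f := F) (s := cell κ) (measurableSet_cell κ)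
    (by rw [e]; exact Set.pairwise_disjoint_Ico_add_zsmul _ _) hF.integrableOn
  rwa [e, iUnion_Ico_add_zsmul hκ, ← e, setIntegral_univ] at h

variable {K s : ℝ}

lemma floor_of_mem_cell (hK : 0 < K) {n : ℤ} {y : ℝ} (hy : y ∈ cell K n) :
    ⌊y / K + 1 / 2⌋ = n := by
  have h : y = y / K * K := by field_simp
  obtain ⟨h1, h2⟩ := hy
  rw [Int.floor_eq_iff]
  constructor <;> nlinarith

lemma mul_mem_cell (hs : 0 < s) {n : ℤ} {y : ℝ} (hy : y ∈ cell (K / s) n) :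
    s * y ∈ cell K n := by
  obtain ⟨h1, h2⟩ := hy
  have h1 := mul_le_mul_of_nonneg_left h1 hs.le
  have h2 := mul_lt_mul_of_pos_left h2 hs
  have e1 : s * (n * (K / s) - K / s / 2) = n * K - K / 2 := by field_simp
  have e2 : s * (n * (K / s) + K / s / 2) = n * K + K / 2 := by field_simp
  exact ⟨by linarith, by linarith⟩

/-- The residue and the multiple that is removed are negatively correlated: on each cell the residue
averages to zero with respect to length, and the Gaussian density decreases away from the origin. -/
lemma integral_sub_rmod_mul_rmod_nonpos (hK : 0 < K) (hs : 0 < s) :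
    ∫ y, (s * y - rmod K (s * y)) * rmod K (s * y) ∂stdNormal ≤ 0 := by
  have hi : Integrable (fun y => (s * y - rmod K (s * y)) * rmod K (s * y)) stdNormal := by
    have : (fun y => (s * y - rmod K (s * y)) * rmod K (s * y)) =
        fun y => s * (rmod K (s * y) * y) - rmod K (s * y) ^ 2 := by ext y; ring
    rw [this]
    exact ((integrable_rmod_mul_id hK s).const_mul s).sub (integrable_rmod_sq hK s)
  have hκ : 0 < K / s := by positivity
  rw [integral_stdNormal_eq]
  refine (hasSum_integral_cell hκ (integrable_stdNormal_iff.1 hi)).nonpos fun n => ?_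
  have hle : ∫ y in cell (K / s) n, (s * y - rmod K (s * y)) * rmod K (s * y) * normalPDF y ≤
      ∫ y in cell (K / s) n, n * K * (s * y - n * K) * normalPDF (n * (K / s)) := by
    refine setIntegral_mono_on (integrable_stdNormal_iff.1 hi).integrableOn ?_
      (measurableSet_cell _ _) fun y hy => ?_
    · refine ((by fun_prop : Continuous fun y : ℝ =>
        n * K * (s * y - n * K) * normalPDF (n * (K / s))).integrableOn_Icc).mono_set
          Set.Ico_subset_Icc_self
    · have hc := mul_mem_cell hs hy
      have e : rmod K (s * y) = s * y - n * K := by rw [rmod, floor_of_mem_cell hK hc]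
      rw [e, sub_sub_cancel]
      obtain ⟨h1, h2⟩ := hc
      -- the sign of `n (s y - n K)` decides whether `y` is farther from `0` than the cell centre
      have hsq : s ^ 2 * (y ^ 2 - (n * (K / s)) ^ 2) = (s * y - n * K) * (s * y + n * K) := by
        field_simp; ring
      have hs2 : 0 < s ^ 2 := by positivity
      rcases lt_trichotomy n 0 with hn | hn | hn
      · have hn' : (n : ℝ) ≤ -1 := by exact_mod_cast Int.le_sub_one_of_lt hn
        have hnK : (n : ℝ) * K ≤ -K := by nlinarith
        rcases le_total 0 (s * y - n * K) with h0 | h0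
        · have : y ^ 2 ≤ (n * (K / s)) ^ 2 := by
            have : (s * y - n * K) * (s * y + n * K) ≤ 0 :=
              mul_nonpos_of_nonneg_of_nonpos h0 (by linarith)
            nlinarith
          exact mul_le_mul_of_nonpos_left (normalPDF_le_of_sq_le this)
            (mul_nonpos_of_nonpos_of_nonneg (by linarith) h0)
        · have : (n * (K / s)) ^ 2 ≤ y ^ 2 := by
            have : 0 ≤ (s * y - n * K) * (s * y + n * K) :=
              mul_nonneg_of_nonpos_of_nonpos h0 (by linarith)
            nlinarith
          exact mul_le_mul_of_nonneg_left (normalPDF_le_of_sq_le this)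
            (mul_nonneg_of_nonpos_of_nonpos (by linarith) h0)
      · subst hn; simp
      · have hn' : (1 : ℝ) ≤ n := by exact_mod_cast hn
        have hnK : K ≤ (n : ℝ) * K := by nlinarith
        rcases le_total 0 (s * y - n * K) with h0 | h0
        · have : (n * (K / s)) ^ 2 ≤ y ^ 2 := by
            have : 0 ≤ (s * y - n * K) * (s * y + n * K) := mul_nonneg h0 (by linarith)
            nlinarith
          exact mul_le_mul_of_nonneg_left (normalPDF_le_of_sq_le this)
            (mul_nonneg (by linarith) h0)
        · have : y ^ 2 ≤ (n * (K / s)) ^ 2 := by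
            have : (s * y - n * K) * (s * y + n * K) ≤ 0 :=
              mul_nonpos_of_nonpos_of_nonneg h0 (by linarith)
            nlinarith
          exact mul_le_mul_of_nonpos_left (normalPDF_le_of_sq_le this)
            (mul_nonpos_of_nonneg_of_nonpos (by linarith) h0)
  refine hle.trans (le_of_eq ?_)
  rw [cell, integral_Ico_eq_integral_Ioc, ← intervalIntegral.integral_of_le (by linarith)]
  rw [intervalIntegral.integral_mul_const, intervalIntegral.integral_const_mul,
    intervalIntegral.integral_sub ((by fun_prop : Continuous fun y => s * y).intervalIntegrable _ _)
      (continuous_const.intervalIntegrable _ _), intervalIntegral.integral_const_mul,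
    integral_id]
  simp only [intervalIntegral.integral_const, smul_eq_mul]
  field_simp
  ring

/-- The mean power of the multiples of `K` that the folding removes. -/
noncomputable def excess (K s : ℝ) : ℝ := ∫ y, (s * y - rmod K (s * y)) ^ 2 ∂stdNormal

lemma integrable_excess (hK : 0 < K) (s : ℝ) :
    Integrable (fun y => (s * y - rmod K (s * y)) ^ 2) stdNormal := by
  have : (fun y => (s * y - rmod K (s * y)) ^ 2) =
      fun y => s ^ 2 * y ^ 2 - 2 * s * (rmod K (s * y) * y) + rmod K (s * y) ^ 2 := by
    ext y; ring
  rw [this]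
  exact ((integrable_sq_stdNormal.const_mul _).sub
    ((integrable_rmod_mul_id hK s).const_mul _)).add (integrable_rmod_sq hK s)

lemma integral_rmod_mul_id (hs : 0 < s) : ∫ y, rmod K (s * y) * y ∂stdNormal = s * gain K s := by
  rw [gain]; field_simp

/-- Expansion of the square. -/
lemma excess_eq (hK : 0 < K) (hs : 0 < s) :
    excess K s = power K s - s ^ 2 * (2 * gain K s - 1) := by
  have : ∀ y, (s * y - rmod K (s * y)) ^ 2 =
      s ^ 2 * y ^ 2 - 2 * s * (rmod K (s * y) * y) + rmod K (s * y) ^ 2 := fun y => by ring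
  have i1 : Integrable (fun y => s ^ 2 * y ^ 2 - 2 * s * (rmod K (s * y) * y)) stdNormal :=
    (integrable_sq_stdNormal.const_mul _).sub ((integrable_rmod_mul_id hK s).const_mul _)
  simp only [excess, this]
  rw [integral_add i1 (integrable_rmod_sq hK s), integral_sub (integrable_sq_stdNormal.const_mul _)
    ((integrable_rmod_mul_id hK s).const_mul _), integral_const_mul, integral_const_mul,
    integral_sq_stdNormal, integral_rmod_mul_id hs, power]
  ring

/-- The inequality behind the power loss: folding costs more power than it costs gain. -/
lemma le_excess (hK : 0 < K) (hs : 0 < s) : s ^ 2 * (1 - gain K s) ≤ excess K s := by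
  have h := integral_sub_rmod_mul_rmod_nonpos hK hs
  have : ∀ y, (s * y - rmod K (s * y)) * rmod K (s * y) =
      s * (rmod K (s * y) * y) - rmod K (s * y) ^ 2 := fun y => by ring
  simp only [this] at h
  rw [integral_sub ((integrable_rmod_mul_id hK s).const_mul _) (integrable_rmod_sq hK s),
    integral_const_mul, integral_rmod_mul_id hs] at h
  rw [excess_eq hK hs, power]
  linarith

end

/-! ### Power loss and modulo signal loss -/

section

lemma gaussianQ_sub {a b : ℝ} (h : a ≤ b) :
    gaussianQ a - gaussianQ b = stdNormal.real (Set.Ioc a b) := by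
  have hu : Set.Ioi a = Set.Ioc a b ∪ Set.Ioi b := (Set.Ioc_union_Ioi_eq_Ioi h).symm
  rw [gaussianQ, gaussianQ, hu, measureReal_union Set.Ioc_disjoint_Ioi_same measurableSet_Ioi]
  ring

lemma gaussianQ_sub_eq_integral (a b : ℝ) :
    gaussianQ a - gaussianQ b = ∫ x in a..b, normalPDF x := by
  have key : ∀ a b : ℝ, a ≤ b → gaussianQ a - gaussianQ b = ∫ x in a..b, normalPDF x := by
    intro a b h
    rw [gaussianQ_sub h, intervalIntegral.integral_of_le h, measureReal_def,
      gaussianReal_apply_eq_integral 0 one_ne_zero, ENNReal.toReal_ofReal]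
    exact integral_nonneg fun x => (normalPDF_pos x).le
  rcases le_total a b with h | h
  · exact key a b h
  · rw [intervalIntegral.integral_symm, ← key b a h]; ring

lemma hasDerivAt_gaussianQ (x : ℝ) : HasDerivAt gaussianQ (-normalPDF x) x := by
  have e : gaussianQ = fun x => gaussianQ 0 - ∫ t in (0 : ℝ)..x, normalPDF t := by
    ext x; rw [← gaussianQ_sub_eq_integral]; ring
  rw [e]
  exact (continuous_normalPDF.integral_hasStrictDerivAt 0 x).hasDerivAt.const_sub _

lemma continuous_gaussianQ : Continuous gaussianQ :=
  continuous_iff_continuousAt.2 fun x => (hasDerivAt_gaussianQ x).continuousAt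

lemma strictAnti_gaussianQ : StrictAnti gaussianQ :=
  strictAnti_of_deriv_neg fun x => by
    rw [(hasDerivAt_gaussianQ x).deriv]; exact neg_neg_of_pos (normalPDF_pos x)

lemma gaussianQ_nonneg (x : ℝ) : 0 ≤ gaussianQ x := measureReal_nonneg

lemma gaussianQ_le_one (x : ℝ) : gaussianQ x ≤ 1 := measureReal_le_one

lemma gaussianQ_pos (x : ℝ) : 0 < gaussianQ x :=
  (gaussianQ_nonneg (x + 1)).trans_lt (strictAnti_gaussianQ (by linarith))

lemma stdNormal_real_Iio_neg (x : ℝ) : stdNormal.real (Set.Iio (-x)) = gaussianQ x := by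
  have h : stdNormal.map (fun x => -x) = stdNormal := by rw [gaussianReal_map_neg, neg_zero]
  conv_lhs => rw [← h]
  rw [map_measureReal_apply (by fun_prop) measurableSet_Iio, gaussianQ]
  congr 1; ext y; simp

lemma gaussianQ_neg (x : ℝ) : gaussianQ (-x) = 1 - gaussianQ x := by
  have h1 := probReal_compl_eq_one_sub (μ := stdNormal) (measurableSet_Iic (a := -x))
  rw [Set.compl_Iic] at h1
  rw [← stdNormal_real_Iio_neg x, measureReal_congr (Iio_ae_eq_Iic (μ := stdNormal)), ← h1]; rfl

lemma gaussianQ_zero : gaussianQ 0 = 1 / 2 := by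
  have := gaussianQ_neg 0
  rw [neg_zero] at this
  linarith

variable {K s : ℝ}

lemma setIntegral_Ioi_id (μ : ℝ) : ∫ y in Set.Ioi μ, y ∂stdNormal = normalPDF μ := by
  have hd : ∀ x : ℝ, HasDerivAt (fun x => -normalPDF x) (x * normalPDF x) x := fun x => by
    have e : (fun x => -normalPDF x) = fun x => -((√(2 * Real.pi))⁻¹ * Real.exp (-(x ^ 2 / 2))) := by
      ext x; rw [normalPDF_eq]
    rw [e, normalPDF_eq]
    have h1 : HasDerivAt (fun x : ℝ => -(x ^ 2 / 2)) (-x) x := by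
      have := ((hasDerivAt_pow 2 x).div_const 2).neg
      exact this.congr_deriv (by norm_num)
    exact ((h1.exp.const_mul _).neg).congr_deriv (by ring)
  have ht : Filter.Tendsto (fun x => -normalPDF x) Filter.atTop (nhds 0) := by
    have h0 : Filter.Tendsto (fun x : ℝ => Real.exp (-(x ^ 2 / 2))) Filter.atTop (nhds 0) :=
      Real.tendsto_exp_neg_atTop_nhds_zero.comp
        ((Filter.tendsto_pow_atTop two_ne_zero).atTop_div_const two_pos)
    have := (h0.const_mul (√(2 * Real.pi))⁻¹).neg
    simpa [normalPDF_eq] using this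
  have hint : Integrable fun x => x * normalPDF x :=
    integrable_stdNormal_iff.1 integrable_id_stdNormal
  have h := integral_Ioi_of_hasDerivAt_of_tendsto' (a := μ) (fun x _ => hd x) hint.integrableOn ht
  have : ∫ y in Set.Ioi μ, y ∂stdNormal = ∫ y in Set.Ioi μ, y * normalPDF y := by
    rw [← integral_indicator measurableSet_Ioi, ← integral_indicator measurableSet_Ioi,
      integral_stdNormal_eq]
    congr 1; ext y
    by_cases hy : y ∈ Set.Ioi μ <;> simp [hy]
  rw [this, h]; simp

lemma setIntegral_Iio_neg (μ : ℝ) (F : ℝ → ℝ) :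
    ∫ y in Set.Iio (-μ), F (-y) ∂stdNormal = ∫ y in Set.Ioi μ, F y ∂stdNormal := by
  have h : MeasurePreserving (fun x : ℝ => -x) stdNormal stdNormal :=
    ⟨by fun_prop, by rw [gaussianReal_map_neg, neg_zero]⟩
  have := h.setIntegral_preimage_emb (MeasurableEquiv.neg ℝ).measurableEmbedding F (Set.Ioi μ)
  rw [← this]
  congr 2; ext y; simp

/-- Whatever exceeds half the modulus is reduced by at least one multiple of the modulus. -/
lemma le_sub_rmod (hK : 0 < K) {y : ℝ} (hy : K / 2 < y) : K ≤ y - rmod K y := by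
  have h1 : 1 ≤ ⌊y / K + 1 / 2⌋ := by
    rw [Int.le_floor, Int.cast_one]
    have : 1 / 2 < y / K := by rw [lt_div_iff₀ hK]; linarith
    linarith
  have h2 : (1 : ℝ) ≤ ⌊y / K + 1 / 2⌋ := by exact_mod_cast h1
  rw [rmod, sub_sub_cancel]; nlinarith

lemma sub_rmod_le (hK : 0 < K) {y : ℝ} (hy : y < -(K / 2)) : y - rmod K y ≤ -K := by
  have h1 : ⌊y / K + 1 / 2⌋ < 0 := by
    rw [Int.floor_lt, Int.cast_zero]
    have : y / K < -(1 / 2) := by rw [div_lt_iff₀ hK]; linarith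
    linarith
  have h2 : (⌊y / K + 1 / 2⌋ : ℝ) ≤ -1 := by exact_mod_cast Int.le_sub_one_of_lt h1
  rw [rmod, sub_sub_cancel]; nlinarith

lemma sub_rmod_nonneg (hK : 0 < K) {y : ℝ} (hy : 0 ≤ y) : 0 ≤ y - rmod K y := by
  have h1 : 0 ≤ ⌊y / K + 1 / 2⌋ := Int.floor_nonneg.2 (by positivity)
  have h2 : (0 : ℝ) ≤ ⌊y / K + 1 / 2⌋ := by exact_mod_cast h1
  rw [rmod, sub_sub_cancel]; positivity

lemma sub_rmod_nonpos (hK : 0 < K) {y : ℝ} (hy : y ≤ 0) : y - rmod K y ≤ 0 := by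
  have h1 : ⌊y / K + 1 / 2⌋ < 1 := by
    rw [Int.floor_lt, Int.cast_one]
    have : y / K ≤ 0 := div_nonpos_of_nonpos_of_nonneg hy hK.le
    linarith
  have h2 : (⌊y / K + 1 / 2⌋ : ℝ) ≤ 0 := by exact_mod_cast Int.lt_add_one_iff.1 h1
  rw [rmod, sub_sub_cancel]; nlinarith

/-- An integral is bounded below by the contribution of the two tails. -/
lemma tails_le_integral {F G : ℝ → ℝ} (hF : Integrable F stdNormal) (hG : Integrable G stdNormal)
    {μ : ℝ} (hμ : 0 ≤ μ) (h0 : ∀ y, 0 ≤ F y) (h1 : ∀ y, μ < y → G y ≤ F y)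
    (h2 : ∀ y, y < -μ → G (-y) ≤ F y) :
    2 * ∫ y in Set.Ioi μ, G y ∂stdNormal ≤ ∫ y, F y ∂stdNormal := by
  have hd : Disjoint (Set.Iio (-μ)) (Set.Ioi μ) := by
    rw [Set.disjoint_left]; intro y hy hy'
    simp only [Set.mem_Iio, Set.mem_Ioi] at hy hy'; linarith
  have hG' : Integrable (fun y => G (-y)) stdNormal := by
    have h : MeasurePreserving (fun x : ℝ => -x) stdNormal stdNormal :=
      ⟨by fun_prop, by rw [gaussianReal_map_neg, neg_zero]⟩
    exact h.integrable_comp_of_integrable hG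
  calc 2 * ∫ y in Set.Ioi μ, G y ∂stdNormal
      = ∫ y in Set.Iio (-μ), G (-y) ∂stdNormal + ∫ y in Set.Ioi μ, G y ∂stdNormal := by
        rw [setIntegral_Iio_neg μ G]; ring
    _ ≤ ∫ y in Set.Iio (-μ), F y ∂stdNormal + ∫ y in Set.Ioi μ, F y ∂stdNormal :=
        add_le_add (setIntegral_mono_on hG'.integrableOn hF.integrableOn measurableSet_Iio h2)
          (setIntegral_mono_on hG.integrableOn hF.integrableOn measurableSet_Ioi h1)
    _ = ∫ y in Set.Iio (-μ) ∪ Set.Ioi μ, F y ∂stdNormal :=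
        (setIntegral_union hd measurableSet_Ioi hF.integrableOn hF.integrableOn).symm
    _ ≤ ∫ y, F y ∂stdNormal := setIntegral_le_integral hF (.of_forall h0)

/-- The gain that folding costs is at least the contribution of the tails, where at least one
multiple of `K` is removed. -/
lemma tail_le_one_sub_gain (hK : 0 < K) (hs : 0 < s) :
    4 * (K / (2 * s)) * normalPDF (K / (2 * s)) ≤ 1 - gain K s := by
  set μ := K / (2 * s) with hμ
  have hμ0 : 0 < μ := by positivity
  have hsμ : s * μ = K / 2 := by rw [hμ]; field_simp
  have hi : Integrable (fun y => (s * y - rmod K (s * y)) * (s * y)) stdNormal := by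
    have : (fun y => (s * y - rmod K (s * y)) * (s * y)) =
        fun y => s ^ 2 * y ^ 2 - s * (rmod K (s * y) * y) := by ext y; ring
    rw [this]
    exact (integrable_sq_stdNormal.const_mul _).sub ((integrable_rmod_mul_id hK s).const_mul s)
  have hval : ∫ y, (s * y - rmod K (s * y)) * (s * y) ∂stdNormal = s ^ 2 * (1 - gain K s) := by
    have : ∀ y, (s * y - rmod K (s * y)) * (s * y) =
        s ^ 2 * y ^ 2 - s * (rmod K (s * y) * y) := fun y => by ring
    simp only [this]
    rw [integral_sub (integrable_sq_stdNormal.const_mul _)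
      ((integrable_rmod_mul_id hK s).const_mul s), integral_const_mul, integral_const_mul,
      integral_sq_stdNormal, integral_rmod_mul_id hs]
    ring
  have h := tails_le_integral (G := fun y => K * s * y) hi
    (integrable_id_stdNormal.const_mul (K * s)) hμ0.le
    (fun y => by
      rcases le_total 0 y with hy | hy
      · exact mul_nonneg (sub_rmod_nonneg hK (by positivity)) (by positivity)
      · exact mul_nonneg_of_nonpos_of_nonpos
          (sub_rmod_nonpos hK (mul_nonpos_of_nonneg_of_nonpos hs.le hy))
          (mul_nonpos_of_nonneg_of_nonpos hs.le hy))
    (fun y hy => by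
      have h1 : K / 2 < s * y := by rw [← hsμ]; exact mul_lt_mul_of_pos_left hy hs
      have h2 := le_sub_rmod hK h1
      have : 0 < s * y := by linarith
      change K * s * y ≤ _
      nlinarith)
    (fun y hy => by
      have h1 : s * y < -(K / 2) := by
        rw [← hsμ, ← mul_neg]; exact mul_lt_mul_of_pos_left hy hs
      have h2 := sub_rmod_le hK h1
      have : s * y < 0 := by linarith
      change K * s * (-y) ≤ _
      nlinarith)
  rw [hval, integral_const_mul, setIntegral_Ioi_id] at h
  have hK2 : K = 2 * s * μ := by linarith
  have hs2 : 0 < s ^ 2 := by positivity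
  refine le_of_mul_le_mul_left ?_ hs2
  calc s ^ 2 * (4 * μ * normalPDF μ) = 2 * (K * s * normalPDF μ) := by rw [hK2]; ring
    _ ≤ _ := h

lemma gain_lt_one (hK : 0 < K) (hs : 0 < s) : gain K s < 1 := by
  have h1 := tail_le_one_sub_gain hK hs
  have : 0 < 4 * (K / (2 * s)) * normalPDF (K / (2 * s)) :=
    mul_pos (by positivity) (normalPDF_pos _)
  linarith

/-- The power of the removed multiples is at least the contribution of the tails. -/
lemma tail_le_excess (hK : 0 < K) (hs : 0 < s) :
    2 * K ^ 2 * gaussianQ (K / (2 * s)) ≤ excess K s := by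
  set μ := K / (2 * s) with hμ
  have hμ0 : 0 < μ := by positivity
  have hsμ : s * μ = K / 2 := by rw [hμ]; field_simp
  have h := tails_le_integral (G := fun _ => K ^ 2) (integrable_excess hK s)
    (integrable_const _) hμ0.le (fun y => sq_nonneg _)
    (fun y hy => by
      have h1 : K / 2 < s * y := by rw [← hsμ]; exact mul_lt_mul_of_pos_left hy hs
      have h2 := le_sub_rmod hK h1
      change K ^ 2 ≤ _
      nlinarith)
    (fun y hy => by
      have h1 : s * y < -(K / 2) := by
        rw [← hsμ, ← mul_neg]; exact mul_lt_mul_of_pos_left hy hs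
      have h2 := sub_rmod_le hK h1
      change K ^ 2 ≤ _
      nlinarith)
  rw [setIntegral_const, smul_eq_mul] at h
  change _ ≤ excess K s at h
  refine le_trans (le_of_eq ?_) h
  rw [gaussianQ]; ring

lemma excess_pos (hK : 0 < K) (hs : 0 < s) : 0 < excess K s :=
  lt_of_lt_of_le (mul_pos (by positivity) (gaussianQ_pos _)) (tail_le_excess hK hs)

/-- More noise means more folding. -/
lemma excess_one_le (hK : 0 < K) (hs : 1 ≤ s) : excess K 1 ≤ excess K s := by
  refine integral_mono (integrable_excess hK 1) (integrable_excess hK s) fun y => ?_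
  change (1 * y - rmod K (1 * y)) ^ 2 ≤ (s * y - rmod K (s * y)) ^ 2
  rw [one_mul]
  rcases le_total 0 y with hy | hy
  · refine pow_le_pow_left₀ (sub_rmod_nonneg hK hy) ?_ 2
    rw [rmod, rmod, sub_sub_cancel, sub_sub_cancel]
    gcongr
    nlinarith
  · have h1 : s * y - rmod K (s * y) ≤ y - rmod K y := by
      rw [rmod, rmod, sub_sub_cancel, sub_sub_cancel]
      gcongr
      nlinarith
    nlinarith [sub_rmod_nonpos hK hy]

lemma modSignalVar_eq {α : ℝ} (hα : 0 < α) : modSignalVar α = 2 * excess (modulus α) 1 := by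
  have hK : 0 < modulus α := by unfold modulus qamOrder; positivity
  set K := modulus α with hKdef
  have hE : symbolEnergy = 2 := by unfold symbolEnergy qamOrder; norm_num
  have h := (hasSum_integral_cell hK (integrable_excess hK 1)).mul_left 2
  rw [← excess] at h
  rw [← h.tsum_eq, modSignalVar]
  congr 1; ext n
  have h1 : ∫ y in cell K n, (1 * y - rmod K (1 * y)) ^ 2 ∂stdNormal =
      ∫ y in cell K n, (n * K) ^ 2 ∂stdNormal := by
    refine setIntegral_congr_fun (measurableSet_cell K n) fun y hy => ?_
    simp only [one_mul, rmod, sub_sub_cancel, floor_of_mem_cell hK hy]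
  rw [h1, setIntegral_const, smul_eq_mul, hE, ← hKdef, div_self two_ne_zero, Real.sqrt_one, one_mul,
    one_mul, gaussianQ_sub (by nlinarith), cell, measureReal_congr Ico_ae_eq_Ioc]
  have e1 : (2 * (n : ℝ) - 1) * (K / 2) = n * K - K / 2 := by ring
  have e2 : (2 * (n : ℝ) + 1) * (K / 2) = n * K + K / 2 := by ring
  rw [e1, e2]; ring

variable {τ : ℝ}

lemma one_lt_sqrt_one_add_sq (hτ : 0 < τ) : 1 < √(1 + τ ^ 2) :=
  Real.lt_sqrt_of_sq_lt (by nlinarith [sq_pos_of_pos hτ])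

/-- A positive upper bound on the limiting ratio, in squared form. -/
lemma limitRatio_lt (hK : 0 < K) (hτ : 0 < τ) {x : ℝ} (hx : 0 ≤ x)
    (h : 0 < gain K √(1 + τ ^ 2) →
      gain K √(1 + τ ^ 2) ^ 2 < x ^ 2 * (power K √(1 + τ ^ 2) - gain K √(1 + τ ^ 2) ^ 2)) :
    limitRatio K τ < x ∨ limitRatio K τ ≤ 0 := by
  have hD := gain_sq_lt_power hK (one_lt_sqrt_one_add_sq hτ)
  set a := gain K √(1 + τ ^ 2)
  set P := power K √(1 + τ ^ 2)
  have hD0 : 0 < P - a ^ 2 := by linarith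
  have hr : 0 < √(P - a ^ 2) := Real.sqrt_pos.2 hD0
  rcases le_or_gt a 0 with ha | ha
  · exact Or.inr (div_nonpos_of_nonpos_of_nonneg ha hr.le)
  · left
    change a / √(P - a ^ 2) < x
    rw [div_lt_iff₀ hr]
    refine lt_of_pow_lt_pow_left₀ 2 (by positivity) ?_
    rw [mul_pow, Real.sq_sqrt hD0.le]
    exact h ha

lemma gaussianQ_lt_limitRatio (hK : 0 < K) (hτ : 0 < τ) {x : ℝ} (hx : 0 < x)
    (h : 0 < gain K √(1 + τ ^ 2) →
      gain K √(1 + τ ^ 2) ^ 2 < x ^ 2 * (power K √(1 + τ ^ 2) - gain K √(1 + τ ^ 2) ^ 2)) :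
    gaussianQ x < gaussianQ (limitRatio K τ) := by
  rcases limitRatio_lt hK hτ hx.le h with h1 | h1
  · exact strictAnti_gaussianQ h1
  · exact strictAnti_gaussianQ (h1.trans_lt hx)

/-- Folding never improves on the unfolded channel. -/
lemma gaussianQ_inv_lt_limitRatio (hK : 0 < K) (hτ : 0 < τ) :
    gaussianQ (1 / τ) < gaussianQ (limitRatio K τ) := by
  refine gaussianQ_lt_limitRatio hK hτ (by positivity) fun ha => ?_
  have hs : 0 < √(1 + τ ^ 2) := by positivity
  have hs2 : √(1 + τ ^ 2) ^ 2 = 1 + τ ^ 2 := Real.sq_sqrt (by positivity)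
  have h1 := le_excess hK hs
  have h2 := gain_lt_one hK hs
  have h3 := excess_eq hK hs
  rw [hs2] at h1 h3
  set a := gain K √(1 + τ ^ 2)
  set P := power K √(1 + τ ^ 2)
  rw [div_pow, one_pow, one_div_mul_eq_div, lt_div_iff₀ (by positivity)]
  have : (1 + τ ^ 2) * (1 - a) ^ 2 < (1 + τ ^ 2) * (1 - a) := by
    have : 0 < (1 + τ ^ 2) := by positivity
    nlinarith [mul_pos (mul_pos this ha) (sub_pos.2 h2)]
  nlinarith

/-- The folding of the data alone already limits the error rate from below. -/
lemma berMSL_lt_limitRatio {α : ℝ} (hα : 0 < α) (hτ : 0 < τ) :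
    berMSL α < gaussianQ (limitRatio (modulus α) τ) := by
  have hK : 0 < modulus α := by unfold modulus qamOrder; positivity
  rw [berMSL, modSignalVar_eq hα]
  set K := modulus α
  have hE1 := excess_pos hK one_pos
  refine gaussianQ_lt_limitRatio hK hτ (by positivity) fun ha => ?_
  have hs := one_lt_sqrt_one_add_sq hτ
  have hs0 : 0 < √(1 + τ ^ 2) := by linarith
  have h1 := le_excess hK hs0
  have h2 := gain_lt_one hK hs0
  have h3 := excess_eq hK hs0
  have h4 := excess_one_le hK hs.le
  rw [Real.sq_sqrt (by positivity)]
  set s := √(1 + τ ^ 2)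
  set a := gain K s
  set P := power K s
  have hs2 : 1 < s ^ 2 := by nlinarith
  have e : 2 / (2 * excess K 1) * (P - a ^ 2) = (P - a ^ 2) / excess K 1 := by field_simp
  rw [e, lt_div_iff₀ hE1]
  have h5 : a ^ 2 * excess K 1 ≤ a ^ 2 * excess K s := mul_le_mul_of_nonneg_left h4 (sq_nonneg _)
  have h6 : s ^ 2 * (1 - a) * (1 - a ^ 2) ≤ excess K s * (1 - a ^ 2) :=
    mul_le_mul_of_nonneg_right h1 (by nlinarith)
  have h7 : s ^ 2 * (a * (1 - a + a ^ 2)) ≥ s ^ 2 * a ^ 2 :=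
    mul_le_mul_of_nonneg_left (by nlinarith [mul_nonneg ha.le (sq_nonneg (1 - a))]) (by positivity)
  have h8 : a ^ 2 < s ^ 2 * a ^ 2 := by nlinarith [sq_pos_of_pos ha]
  nlinarith

end

/-! ### Averages over Rayleigh fading -/

section

variable {σ : ℝ}

/-- The modulus of a circularly symmetric Gaussian variable is Rayleigh distributed. -/
lemma integral_norm_complexGaussian (hσ : 0 < σ) (F : ℝ → ℝ) (hF : Measurable F) :
    ∫ z, F ‖z‖ ∂complexGaussian σ =
      ∫ r in Set.Ioi 0, 2 * r / σ ^ 2 * Real.exp (-(1 / σ ^ 2) * r ^ 2) * F r := by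
  set v := Real.toNNReal (σ ^ 2 / 2) with hv
  have hv' : (v : ℝ) = σ ^ 2 / 2 := Real.coe_toNNReal _ (by positivity)
  have hv0 : v ≠ 0 := by rw [Ne, ← NNReal.coe_eq_zero, hv']; positivity
  have hnorm : ∀ p : ℝ × ℝ, ‖(⟨p.1, p.2⟩ : ℂ)‖ = √(p.1 ^ 2 + p.2 ^ 2) := fun p => by
    rw [Complex.norm_eq_sqrt_sq_add_sq]
  have hdm : Measurable fun p : ℝ × ℝ => gaussianPDF 0 v p.1 * gaussianPDF 0 v p.2 :=
    ((measurable_gaussianPDF _ _).comp measurable_fst).mul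
      ((measurable_gaussianPDF _ _).comp measurable_snd)
  have hFn : Measurable fun z : ℂ => F ‖z‖ := hF.comp measurable_norm
  rw [complexGaussian, integral_map measurable_complex_mk.aemeasurable
    hFn.aestronglyMeasurable, ← hv, gaussianReal_of_var_ne_zero 0 hv0,
    prod_withDensity (measurable_gaussianPDF _ _) (measurable_gaussianPDF _ _),
    integral_withDensity_eq_integral_toReal_smul
      hdm
      (.of_forall fun p => ENNReal.mul_lt_top gaussianPDF_lt_top gaussianPDF_lt_top)]
  have hdens : ∀ p : ℝ × ℝ, (gaussianPDF 0 v p.1 * gaussianPDF 0 v p.2).toReal •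
      F ‖(⟨p.1, p.2⟩ : ℂ)‖ = 1 / (Real.pi * σ ^ 2) *
        Real.exp (-(1 / σ ^ 2) * (p.1 ^ 2 + p.2 ^ 2)) * F √(p.1 ^ 2 + p.2 ^ 2) := fun p => by
    have hpi := Real.pi_pos
    rw [ENNReal.toReal_mul, toReal_gaussianPDF, toReal_gaussianPDF, hnorm, smul_eq_mul,
      gaussianPDFReal, gaussianPDFReal, hv']
    have e1 : √(2 * Real.pi * (σ ^ 2 / 2)) * √(2 * Real.pi * (σ ^ 2 / 2)) = Real.pi * σ ^ 2 := by
      rw [Real.mul_self_sqrt (by positivity)]; ring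
    have e2 : Real.exp (-(p.1 - 0) ^ 2 / (2 * (σ ^ 2 / 2))) *
        Real.exp (-(p.2 - 0) ^ 2 / (2 * (σ ^ 2 / 2))) =
        Real.exp (-(1 / σ ^ 2) * (p.1 ^ 2 + p.2 ^ 2)) := by
      rw [← Real.exp_add]; congr 1; field_simp; ring
    rw [← e2, ← e1]
    field_simp
  simp only [hdens]
  rw [← Measure.volume_eq_prod, ← integral_comp_polarCoord_symm]
  have hpol : ∀ p ∈ polarCoord.target, p.1 • (1 / (Real.pi * σ ^ 2) *
      Real.exp (-(1 / σ ^ 2) * ((polarCoord.symm p).1 ^ 2 + (polarCoord.symm p).2 ^ 2)) *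
        F √((polarCoord.symm p).1 ^ 2 + (polarCoord.symm p).2 ^ 2)) =
      (p.1 * (1 / (Real.pi * σ ^ 2)) * Real.exp (-(1 / σ ^ 2) * p.1 ^ 2) * F p.1) * 1 := by
    rintro ⟨r, θ⟩ hp
    have hr : 0 < r := hp.1
    have e : (r * Real.cos θ) ^ 2 + (r * Real.sin θ) ^ 2 = r ^ 2 := by
      rw [mul_pow, mul_pow, ← mul_add, Real.cos_sq_add_sin_sq, mul_one]
    simp only [polarCoord_symm_apply, e, Real.sqrt_sq hr.le, smul_eq_mul]
    ring
  rw [setIntegral_congr_fun polarCoord.open_target.measurableSet hpol, polarCoord_target,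
    Measure.volume_eq_prod,
    setIntegral_prod_mul (fun r => r * (1 / (Real.pi * σ ^ 2)) *
      Real.exp (-(1 / σ ^ 2) * r ^ 2) * F r) (fun _ => 1)]
  have hθ : ∫ _ in Set.Ioo (-Real.pi) Real.pi, (1 : ℝ) = 2 * Real.pi := by
    simp [Real.pi_pos.le]; ring
  rw [hθ, ← integral_mul_const]
  congr 1; ext r
  have := Real.pi_ne_zero
  field_simp

/-- The error rate of antipodal signalling over a Rayleigh fading gain. -/
lemma integral_gaussianQ_norm (hσ : 0 < σ) (c : ℝ) :
    ∫ z, gaussianQ (c * ‖z‖) ∂complexGaussian σ = 1 / 2 * (1 - c / √(c ^ 2 + 2 / σ ^ 2)) := by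
  rw [integral_norm_complexGaussian hσ (fun r => gaussianQ (c * r))
    (continuous_gaussianQ.comp (by fun_prop)).measurable]
  set b := 1 / σ ^ 2 with hb
  have hb0 : 0 < b := by positivity
  have hpi := Real.pi_pos
  set G : ℝ → ℝ := fun r => -(Real.exp (-b * r ^ 2) * gaussianQ (c * r)) with hG
  have hd : ∀ r, HasDerivAt G (2 * r / σ ^ 2 * Real.exp (-b * r ^ 2) * gaussianQ (c * r) +
      c * (√(2 * Real.pi))⁻¹ * Real.exp (-(b + c ^ 2 / 2) * r ^ 2)) r := fun r => by
    have h1 : HasDerivAt (fun r : ℝ => -b * r ^ 2) (-b * (2 * r)) r := by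
      simpa using (hasDerivAt_pow 2 r).const_mul (-b)
    have h2 : HasDerivAt (fun r => gaussianQ (c * r)) (-normalPDF (c * r) * c) r := by
      have h3 : HasDerivAt (fun r : ℝ => c * r) c r := by simpa using (hasDerivAt_id r).const_mul c
      exact (hasDerivAt_gaussianQ (c * r)).comp r h3
    have h := (h1.exp.mul h2).neg
    refine h.congr_deriv ?_
    have e : Real.exp (-(b + c ^ 2 / 2) * r ^ 2) =
        Real.exp (-b * r ^ 2) * Real.exp (-((c * r) ^ 2 / 2)) := by
      rw [← Real.exp_add]; ring_nf
    rw [normalPDF_eq, e, hb]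
    ring
  have i1 : Integrable fun r => 2 * r / σ ^ 2 * Real.exp (-b * r ^ 2) * gaussianQ (c * r) := by
    refine (((integrable_mul_exp_neg_mul_sq hb0).const_mul (2 / σ ^ 2)).bdd_mul
      (f := fun r => gaussianQ (c * r)) (c := 1)
      (continuous_gaussianQ.comp (by fun_prop)).aestronglyMeasurable (.of_forall fun r => ?_)).congr
      (.of_forall fun r => ?_)
    · rw [Real.norm_eq_abs, abs_of_nonneg (gaussianQ_nonneg _)]; exact gaussianQ_le_one _
    · change gaussianQ (c * r) * (2 / σ ^ 2 * (r * Real.exp (-b * r ^ 2))) = _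
      ring
  have i2 : Integrable fun r => c * (√(2 * Real.pi))⁻¹ * Real.exp (-(b + c ^ 2 / 2) * r ^ 2) :=
    (integrable_exp_neg_mul_sq (by positivity)).const_mul _
  have ht : Filter.Tendsto G Filter.atTop (nhds 0) := by
    have h0 : Filter.Tendsto (fun r : ℝ => Real.exp (-(b * r ^ 2))) Filter.atTop (nhds 0) :=
      Real.tendsto_exp_neg_atTop_nhds_zero.comp
        ((Filter.tendsto_pow_atTop two_ne_zero).const_mul_atTop hb0)
    refine squeeze_zero_norm (fun r => ?_) h0
    rw [hG, norm_neg, norm_mul, Real.norm_eq_abs, Real.norm_eq_abs, Real.abs_exp,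
      abs_of_nonneg (gaussianQ_nonneg _), neg_mul]
    exact mul_le_of_le_one_right (Real.exp_pos _).le (gaussianQ_le_one _)
  have h := integral_Ioi_of_hasDerivAt_of_tendsto' (a := 0) (fun r _ => hd r)
    (i1.add i2).integrableOn ht
  rw [integral_add i1.integrableOn i2.integrableOn, integral_const_mul, integral_gaussian_Ioi] at h
  have hG0 : G 0 = -(1 / 2) := by simp [hG, gaussianQ_zero]
  have e : (√(2 * Real.pi))⁻¹ * √(Real.pi / (b + c ^ 2 / 2)) = 1 / √(c ^ 2 + 2 / σ ^ 2) := by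
    rw [← Real.sqrt_inv, ← Real.sqrt_mul (by positivity), ← Real.sqrt_one,
      ← Real.sqrt_div (by norm_num)]
    congr 1
    rw [hb]; field_simp; ring
  rw [hG0, mul_assoc, ← mul_div_assoc, e] at h
  rw [eq_sub_of_add_eq h]
  ring

/-- The error rate at noise level `τ` without folding, averaged over the gain. -/
lemma integral_gaussianQ_noiseLevel {σw σh : ℝ} (hσw : 0 < σw) (hσh : 0 < σh) {κ : ℝ} (hκ : 0 ≤ κ) :
    ∫ z, gaussianQ (κ * (1 / noiseLevel σw z)) ∂complexGaussian σh =
      1 / 2 * (1 - √(σh ^ 2 * κ ^ 2 / (σw ^ 2 + σh ^ 2 * κ ^ 2))) := by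
  have e : ∀ z, κ * (1 / noiseLevel σw z) = κ * √2 / σw * ‖z‖ := fun z => by
    rw [noiseLevel, one_div_div]; ring
  simp only [e]
  rw [integral_gaussianQ_norm hσh]
  congr 2
  have hnn : 0 ≤ κ * √2 / σw := by positivity
  rw [← Real.sqrt_sq hnn, Real.sq_sqrt (sq_nonneg _), ← Real.sqrt_div (sq_nonneg _)]
  congr 1
  rw [div_pow, mul_pow, Real.sq_sqrt (by norm_num)]
  rcases hκ.eq_or_lt with h | h
  · rw [← h]; simp
  · field_simp
    ring

lemma berPL_eq_integral {σw σh : ℝ} (hσw : 0 < σw) (hσh : 0 < σh) :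
    berPL σw σh = ∫ z, gaussianQ (1 / noiseLevel σw z) ∂complexGaussian σh := by
  have h := integral_gaussianQ_noiseLevel hσw hσh zero_le_one
  simp only [one_mul] at h
  rw [h, berPL]
  have hE : symbolEnergy = 2 := by unfold symbolEnergy qamOrder; norm_num
  congr 3
  rw [hE]; field_simp

/-- The probability that noise of standard deviation `1 / u` carries the level `1` into the negative
half of its own cell of length `K`, or into the negative half of the next cell. The absolute values
continue the formula to `K < 2` in the way that the rate `berMNL` does. -/
noncomputable def foldedQ (K u : ℝ) : ℝ :=
  gaussianQ u - gaussianQ ((K / 2 + 1) * u) + gaussianQ (|K / 2 - 1| * u) - gaussianQ (|K - 1| * u)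

lemma continuous_foldedQ (K : ℝ) : Continuous (foldedQ K) := by
  have := continuous_gaussianQ
  unfold foldedQ; fun_prop

lemma abs_foldedQ_le (K u : ℝ) : |foldedQ K u| ≤ 2 := by
  have h1 := gaussianQ_nonneg u
  have h2 := gaussianQ_le_one u
  have h3 := gaussianQ_nonneg ((K / 2 + 1) * u)
  have h4 := gaussianQ_le_one ((K / 2 + 1) * u)
  have h5 := gaussianQ_nonneg (|K / 2 - 1| * u)
  have h6 := gaussianQ_le_one (|K / 2 - 1| * u)
  have h7 := gaussianQ_nonneg (|K - 1| * u)
  have h8 := gaussianQ_le_one (|K - 1| * u)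
  rw [foldedQ, abs_le]
  constructor <;> linarith

lemma berMNL_eq_integral {α σw σh : ℝ} (hα : 0 < α) (hσw : 0 < σw) (hσh : 0 < σh) :
    berMNL α σw σh =
      ∫ z, foldedQ (modulus α) (1 / noiseLevel σw z) ∂complexGaussian σh := by
  have hint : ∀ κ : ℝ, Integrable (fun z => gaussianQ (κ * (1 / noiseLevel σw z)))
      (complexGaussian σh) := fun κ =>
    Integrable.of_bound (continuous_gaussianQ.measurable.comp
      (((measurable_noiseLevel σw).const_div 1).const_mul κ)).aestronglyMeasurable 1
      (.of_forall fun z => by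
        rw [Real.norm_eq_abs, abs_of_nonneg (gaussianQ_nonneg _)]; exact gaussianQ_le_one _)
  have hK : modulus α = 4 * α := by
    rw [modulus, qamOrder, show (4 : ℝ) = 2 ^ 2 by norm_num, Real.sqrt_sq (by norm_num)]; ring
  have h1 := hint 1
  simp only [one_mul] at h1
  have h2 : Integrable (fun z => gaussianQ (1 / noiseLevel σw z) -
      gaussianQ ((modulus α / 2 + 1) * (1 / noiseLevel σw z))) (complexGaussian σh) :=
    h1.sub (hint _)
  have h3 : Integrable (fun z => gaussianQ (1 / noiseLevel σw z) -
      gaussianQ ((modulus α / 2 + 1) * (1 / noiseLevel σw z)) +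
      gaussianQ (|modulus α / 2 - 1| * (1 / noiseLevel σw z))) (complexGaussian σh) :=
    h2.add (hint _)
  have hone := integral_gaussianQ_noiseLevel hσw hσh zero_le_one
  simp only [one_mul] at hone
  simp only [foldedQ]
  rw [integral_sub h3 (hint _), integral_add h2 (hint _), integral_sub h1 (hint _), hone,
    integral_gaussianQ_noiseLevel hσw hσh (by rw [hK]; positivity),
    integral_gaussianQ_noiseLevel hσw hσh (abs_nonneg _),
    integral_gaussianQ_noiseLevel hσw hσh (abs_nonneg _), sq_abs, sq_abs, berMNL, hK,
    show 4 * α / 2 = 2 * α by ring]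
  ring_nf

end

/-! ### Numerical bounds for the Gaussian tail -/

section

/-- The Taylor polynomials of `exp (-y)` enclose it. -/
lemma exp_neg_taylor (n : ℕ) : ∀ y : ℝ, 0 ≤ y →
    0 ≤ (-1) ^ n * (Real.exp (-y) - ∑ k ∈ Finset.range n, (-y) ^ k / (k.factorial : ℝ)) := by
  induction n with
  | zero => intro y _; simpa using (Real.exp_pos _).le
  | succ n ih =>
    intro y hy
    set g : ℝ → ℝ := fun y => (-1) ^ (n + 1) *
      (Real.exp (-y) - ∑ k ∈ Finset.range (n + 1), (-y) ^ k / (k.factorial : ℝ)) with hg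
    have hd : ∀ t, HasDerivAt g ((-1) ^ n *
        (Real.exp (-t) - ∑ k ∈ Finset.range n, (-t) ^ k / (k.factorial : ℝ))) t := by
      intro t
      have h1 : HasDerivAt (fun t : ℝ => Real.exp (-t)) (-Real.exp (-t)) t := by
        simpa using (hasDerivAt_neg t).exp
      have h2 : HasDerivAt (fun t : ℝ => ∑ k ∈ Finset.range n,
          (-t) ^ (k + 1) / ((k + 1).factorial : ℝ))
          (∑ k ∈ Finset.range n, -((-t) ^ k / (k.factorial : ℝ))) t := by
        refine HasDerivAt.fun_sum fun k _ => ?_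
        have h3 := (((hasDerivAt_neg t).pow (k + 1)).div_const ((k + 1).factorial : ℝ))
        refine h3.congr_deriv ?_
        rw [Nat.factorial_succ]
        have : (k.factorial : ℝ) ≠ 0 := by positivity
        push_cast
        field_simp
      have e : g = fun t => (-1) ^ (n + 1) * (Real.exp (-t) - (∑ k ∈ Finset.range n,
          (-t) ^ (k + 1) / ((k + 1).factorial : ℝ) + 1)) := by
        ext t; simp [hg, Finset.sum_range_succ']
      rw [e]
      refine ((h1.sub (h2.add_const 1)).const_mul _).congr_deriv ?_
      rw [Finset.sum_neg_distrib]; ring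
    have h0 : g 0 = 0 := by
      simp [hg, Finset.sum_range_succ']
    have hmono : MonotoneOn g (Set.Ici 0) := by
      refine monotoneOn_of_deriv_nonneg (convex_Ici 0)
        (fun t _ => (hd t).continuousAt.continuousWithinAt)
        (fun t _ => (hd t).differentiableAt.differentiableWithinAt) fun t ht => ?_
      rw [interior_Ici] at ht
      rw [(hd t).deriv]; exact ih t ht.le
    rw [← h0]
    exact hmono Set.self_mem_Ici hy hy

lemma exp_neg_ge (y : ℝ) (hy : 0 ≤ y) :
    ∑ k ∈ Finset.range 10, (-y) ^ k / (k.factorial : ℝ) ≤ Real.exp (-y) := by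
  have := exp_neg_taylor 10 y hy
  norm_num at this ⊢
  linarith

lemma exp_neg_le (y : ℝ) (hy : 0 ≤ y) :
    Real.exp (-y) ≤ ∑ k ∈ Finset.range 9, (-y) ^ k / (k.factorial : ℝ) := by
  have := exp_neg_taylor 9 y hy
  norm_num at this ⊢
  linarith

lemma normalPDF_zero_bounds : 0.39894 < normalPDF 0 ∧ normalPDF 0 < 0.39895 := by
  have h1 := Real.pi_gt_d6
  have h2 := Real.pi_lt_d6
  have e : normalPDF 0 = (√(2 * Real.pi))⁻¹ := by rw [normalPDF_eq]; simp
  have hs : 0 < √(2 * Real.pi) := by positivity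
  rw [e]
  constructor
  · rw [lt_inv_comm₀ (by norm_num) hs, Real.sqrt_lt' (by norm_num)]
    norm_num; linarith
  · rw [inv_lt_comm₀ hs (by norm_num)]
    refine Real.lt_sqrt_of_sq_lt ?_
    norm_num; linarith

lemma normalPDF_eq_mul (x : ℝ) : normalPDF x = normalPDF 0 * Real.exp (-(x ^ 2 / 2)) := by
  rw [normalPDF_eq, normalPDF_eq]; simp

lemma integral_normalPDF_eq (x : ℝ) : ∫ t in (0 : ℝ)..x, normalPDF t = 1 / 2 - gaussianQ x := by
  rw [← gaussianQ_sub_eq_integral, gaussianQ_zero]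

lemma integral_taylor (x : ℝ) (n : ℕ) :
    ∫ t in (0 : ℝ)..x, ∑ k ∈ Finset.range n, (-(t ^ 2 / 2)) ^ k / (k.factorial : ℝ) =
      ∑ k ∈ Finset.range n, (-1) ^ k * x ^ (2 * k + 1) /
        (2 ^ k * (k.factorial : ℝ) * (2 * k + 1)) := by
  rw [intervalIntegral.integral_finsetSum fun k _ =>
    (by fun_prop : Continuous fun t : ℝ => (-(t ^ 2 / 2)) ^ k / (k.factorial : ℝ)).intervalIntegrable
      _ _]
  refine Finset.sum_congr rfl fun k _ => ?_
  have : ∀ t : ℝ, (-(t ^ 2 / 2)) ^ k / (k.factorial : ℝ) =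
      (-1) ^ k / (2 ^ k * k.factorial) * t ^ (2 * k) := fun t => by
    rw [neg_pow, div_pow, ← pow_mul]; ring
  simp only [this]
  rw [intervalIntegral.integral_const_mul, integral_pow]
  push_cast
  have h1 : (2 * (k : ℝ) + 1) ≠ 0 := by positivity
  have h2 : (k.factorial : ℝ) ≠ 0 := by positivity
  field_simp
  simp

/-- Lower bound on the tail function from the Taylor polynomial of the density. -/
lemma gaussianQ_ge {x : ℝ} (hx : 0 ≤ x) : 1 / 2 - 0.39895 * ∑ k ∈ Finset.range 7,
    (-1) ^ k * x ^ (2 * k + 1) / (2 ^ k * (k.factorial : ℝ) * (2 * k + 1)) ≤ gaussianQ x := by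
  have h1 : ∫ t in (0 : ℝ)..x, normalPDF t ≤ ∫ t in (0 : ℝ)..x, normalPDF 0 *
      ∑ k ∈ Finset.range 7, (-(t ^ 2 / 2)) ^ k / (k.factorial : ℝ) := by
    refine intervalIntegral.integral_mono_on hx (continuous_normalPDF.intervalIntegrable _ _)
      ((by fun_prop : Continuous fun t : ℝ => normalPDF 0 *
        ∑ k ∈ Finset.range 7, (-(t ^ 2 / 2)) ^ k / (k.factorial : ℝ)).intervalIntegrable _ _)
      fun t _ => ?_
    rw [normalPDF_eq_mul]
    refine mul_le_mul_of_nonneg_left ?_ (normalPDF_pos 0).le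
    have := exp_neg_taylor 7 (t ^ 2 / 2) (by positivity)
    norm_num at this ⊢
    linarith
  rw [integral_normalPDF_eq, intervalIntegral.integral_const_mul, integral_taylor] at h1
  set S := ∑ k ∈ Finset.range 7,
    (-1) ^ k * x ^ (2 * k + 1) / (2 ^ k * (k.factorial : ℝ) * (2 * k + 1)) with hS
  have hS0 : 0 ≤ S := by
    by_contra! hneg
    have h2 : (0 : ℝ) ≤ 1 / 2 - gaussianQ x := by
      rw [← integral_normalPDF_eq]
      exact intervalIntegral.integral_nonneg hx fun t _ => (normalPDF_pos t).le
    nlinarith [normalPDF_pos 0]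
  have := mul_le_mul_of_nonneg_right normalPDF_zero_bounds.2.le hS0
  linarith

/-- Upper bound on the tail function from the Taylor polynomial of the density. -/
lemma gaussianQ_le {x : ℝ} (hx : 0 ≤ x) (hS0 : 0 ≤ ∑ k ∈ Finset.range 6,
      (-1) ^ k * x ^ (2 * k + 1) / (2 ^ k * (k.factorial : ℝ) * (2 * k + 1))) :
    gaussianQ x ≤ 1 / 2 - 0.39894 * ∑ k ∈ Finset.range 6,
      (-1) ^ k * x ^ (2 * k + 1) / (2 ^ k * (k.factorial : ℝ) * (2 * k + 1)) := by
  have h1 : ∫ t in (0 : ℝ)..x, normalPDF 0 *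
      ∑ k ∈ Finset.range 6, (-(t ^ 2 / 2)) ^ k / (k.factorial : ℝ) ≤
      ∫ t in (0 : ℝ)..x, normalPDF t := by
    refine intervalIntegral.integral_mono_on hx
      ((by fun_prop : Continuous fun t : ℝ => normalPDF 0 *
        ∑ k ∈ Finset.range 6, (-(t ^ 2 / 2)) ^ k / (k.factorial : ℝ)).intervalIntegrable _ _)
      (continuous_normalPDF.intervalIntegrable _ _) fun t _ => ?_
    rw [normalPDF_eq_mul t]
    refine mul_le_mul_of_nonneg_left ?_ (normalPDF_pos 0).le
    have := exp_neg_taylor 6 (t ^ 2 / 2) (by positivity)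
    norm_num at this ⊢
    linarith
  rw [integral_normalPDF_eq, intervalIntegral.integral_const_mul, integral_taylor] at h1
  have := mul_le_mul_of_nonneg_right normalPDF_zero_bounds.1.le hS0
  linarith

lemma tendsto_normalPDF_atTop : Filter.Tendsto normalPDF Filter.atTop (nhds 0) := by
  have h0 : Filter.Tendsto (fun x : ℝ => Real.exp (-(x ^ 2 / 2))) Filter.atTop (nhds 0) :=
    Real.tendsto_exp_neg_atTop_nhds_zero.comp
      ((Filter.tendsto_pow_atTop two_ne_zero).atTop_div_const two_pos)
  have := h0.const_mul (normalPDF 0)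
  rw [mul_zero] at this
  exact this.congr fun x => (normalPDF_eq_mul x).symm

lemma hasDerivAt_normalPDF (x : ℝ) : HasDerivAt normalPDF (-x * normalPDF x) x := by
  have e : normalPDF = fun x => normalPDF 0 * Real.exp (-(x ^ 2 / 2)) := funext normalPDF_eq_mul
  have h1 : HasDerivAt (fun x : ℝ => -(x ^ 2 / 2)) (-x) x :=
    ((hasDerivAt_pow 2 x).div_const 2).neg.congr_deriv (by norm_num)
  rw [normalPDF_eq_mul x]
  conv => arg 1; rw [e]
  exact (h1.exp.const_mul _).congr_deriv (by ring)

lemma tendsto_gaussianQ_atTop : Filter.Tendsto gaussianQ Filter.atTop (nhds 0) := by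
  have h := intervalIntegral_tendsto_integral_Ioi 0 integrable_normalPDF.integrableOn
    Filter.tendsto_id
  have h2 : ∫ t in Set.Ioi (0 : ℝ), normalPDF t = 1 / 2 := by
    rw [← gaussianQ_zero, gaussianQ, measureReal_def, gaussianReal_apply_eq_integral 0 one_ne_zero,
      ENNReal.toReal_ofReal]
    exact integral_nonneg fun x => (normalPDF_pos x).le
  rw [h2] at h
  have h3 := h.const_sub (1 / 2)
  rw [sub_self] at h3
  refine h3.congr fun x => ?_
  rw [id, integral_normalPDF_eq]; ring

/-- A function that decreases to its limit `0` at infinity is nonnegative. -/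
lemma nonneg_of_deriv_nonpos {G G' : ℝ → ℝ} (hd : ∀ x, 0 < x → HasDerivAt G (G' x) x)
    (h : ∀ x, 0 < x → G' x ≤ 0) (hG : Filter.Tendsto G Filter.atTop (nhds 0)) {x : ℝ}
    (hx : 0 < x) : 0 ≤ G x := by
  have hanti : AntitoneOn G (Set.Ioi 0) := by
    refine antitoneOn_of_deriv_nonpos (convex_Ioi 0)
      (fun t ht => (hd t ht).continuousAt.continuousWithinAt)
      (fun t ht => (hd t (by rwa [interior_Ioi] at ht)).differentiableAt.differentiableWithinAt)
      fun t ht => ?_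
    rw [interior_Ioi] at ht
    rw [(hd t ht).deriv]; exact h t ht
  refine le_of_tendsto hG ?_
  filter_upwards [Filter.eventually_ge_atTop x] with y hy
  exact hanti hx (hx.trans_le hy) hy

/-- An upper bound on the Mills ratio. -/
lemma gaussianQ_le_mills {x : ℝ} (hx : 0 < x) :
    gaussianQ x ≤ normalPDF x * ((x ^ 2 + 2) / (x * (x ^ 2 + 3))) := by
  have hd : ∀ x : ℝ, 0 < x → HasDerivAt
      (fun x => normalPDF x * ((x ^ 2 + 2) / (x * (x ^ 2 + 3))) - gaussianQ x)
      (-6 * normalPDF x / (x * (x ^ 2 + 3)) ^ 2) x := fun x hx => by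
    have h1 : HasDerivAt (fun x : ℝ => x ^ 2 + 2) (2 * x) x :=
      ((hasDerivAt_pow 2 x).add_const 2).congr_deriv (by norm_num)
    have h2 : HasDerivAt (fun x : ℝ => x * (x ^ 2 + 3)) (3 * x ^ 2 + 3) x :=
      ((hasDerivAt_id x).mul ((hasDerivAt_pow 2 x).add_const 3)).congr_deriv (by
        norm_num; ring)
    have h3 := ((hasDerivAt_normalPDF x).mul (h1.div h2 (by positivity))).sub
      (hasDerivAt_gaussianQ x)
    refine h3.congr_deriv ?_
    simp only [Pi.div_apply]
    field_simp
    ring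
  have ht : Filter.Tendsto (fun x => normalPDF x * ((x ^ 2 + 2) / (x * (x ^ 2 + 3))) - gaussianQ x)
      Filter.atTop (nhds 0) := by
    have h1 : Filter.Tendsto (fun x => normalPDF x * ((x ^ 2 + 2) / (x * (x ^ 2 + 3))))
        Filter.atTop (nhds 0) := by
      refine squeeze_zero' ?_ ?_ tendsto_normalPDF_atTop
      · filter_upwards [Filter.eventually_gt_atTop 0] with x hx
        exact mul_nonneg (normalPDF_pos x).le (by positivity)
      · filter_upwards [Filter.eventually_ge_atTop 1] with x hx
        refine mul_le_of_le_one_right (normalPDF_pos x).le ?_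
        rw [div_le_one (by positivity)]
        nlinarith [mul_nonneg (sub_nonneg.2 hx) (sq_nonneg x)]
    simpa using h1.sub tendsto_gaussianQ_atTop
  have := nonneg_of_deriv_nonpos hd (fun x hx => ?_) ht hx
  · linarith
  · exact div_nonpos_of_nonpos_of_nonneg (by have := normalPDF_pos x; linarith) (by positivity)

/-- A lower bound on the Mills ratio. -/
lemma mills_le_gaussianQ {x : ℝ} (hx : 0 < x) :
    normalPDF x * (x / (1 + x ^ 2)) ≤ gaussianQ x := by
  have hd : ∀ x : ℝ, 0 < x → HasDerivAt
      (fun x => gaussianQ x - normalPDF x * (x / (1 + x ^ 2)))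
      (-2 * normalPDF x / (1 + x ^ 2) ^ 2) x := fun x hx => by
    have h1 : HasDerivAt (fun x : ℝ => 1 + x ^ 2) (2 * x) x :=
      ((hasDerivAt_pow 2 x).const_add 1).congr_deriv (by norm_num)
    have h3 := (hasDerivAt_gaussianQ x).sub
      ((hasDerivAt_normalPDF x).mul ((hasDerivAt_id x).div h1 (by positivity)))
    refine h3.congr_deriv ?_
    simp only [Pi.div_apply, id]
    field_simp
    ring
  have ht : Filter.Tendsto (fun x => gaussianQ x - normalPDF x * (x / (1 + x ^ 2)))
      Filter.atTop (nhds 0) := by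
    have h1 : Filter.Tendsto (fun x => normalPDF x * (x / (1 + x ^ 2)))
        Filter.atTop (nhds 0) := by
      refine squeeze_zero' ?_ ?_ tendsto_normalPDF_atTop
      · filter_upwards [Filter.eventually_gt_atTop 0] with x hx
        exact mul_nonneg (normalPDF_pos x).le (by positivity)
      · filter_upwards [Filter.eventually_ge_atTop 1] with x hx
        refine mul_le_of_le_one_right (normalPDF_pos x).le ?_
        rw [div_le_one (by positivity)]
        nlinarith
    simpa using tendsto_gaussianQ_atTop.sub h1
  have := nonneg_of_deriv_nonpos hd (fun x hx => ?_) ht hx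
  · linarith
  · exact div_nonpos_of_nonpos_of_nonneg (by have := normalPDF_pos x; linarith) (by positivity)

lemma mul_normalPDF_le {a b : ℝ} (ha : 1 ≤ a) (hab : a ≤ b) :
    b * normalPDF b ≤ a * normalPDF a := by
  have h1 : normalPDF a = normalPDF b * Real.exp ((b ^ 2 - a ^ 2) / 2) := by
    rw [normalPDF_eq_mul a, normalPDF_eq_mul b, mul_assoc, ← Real.exp_add]; ring_nf
  have h2 := Real.add_one_le_exp ((b ^ 2 - a ^ 2) / 2)
  have h3 : b ≤ a * ((b ^ 2 - a ^ 2) / 2 + 1) := by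
    have : 0 ≤ (b - a) * (a * (b + a) / 2 - 1) := mul_nonneg (by linarith) (by nlinarith)
    nlinarith
  rw [h1]
  have h4 : a * ((b ^ 2 - a ^ 2) / 2 + 1) ≤ a * Real.exp ((b ^ 2 - a ^ 2) / 2) :=
    mul_le_mul_of_nonneg_left h2 (by linarith)
  nlinarith [normalPDF_pos b]

variable {K τ : ℝ}

lemma gaussianQ_le_limitRatio (hK : 0 < K) (hτ : 0 < τ) {x : ℝ} (hx : 0 ≤ x)
    (h : 0 < gain K √(1 + τ ^ 2) →
      gain K √(1 + τ ^ 2) ^ 2 ≤ x ^ 2 * (power K √(1 + τ ^ 2) - gain K √(1 + τ ^ 2) ^ 2)) :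
    gaussianQ x ≤ gaussianQ (limitRatio K τ) := by
  have hD := gain_sq_lt_power hK (one_lt_sqrt_one_add_sq hτ)
  refine strictAnti_gaussianQ.antitone ?_
  rw [limitRatio]
  set a := gain K √(1 + τ ^ 2)
  set P := power K √(1 + τ ^ 2)
  have hD0 : 0 < P - a ^ 2 := by linarith
  have hr : 0 < √(P - a ^ 2) := Real.sqrt_pos.2 hD0
  rcases le_or_gt a 0 with ha | ha
  · exact (div_nonpos_of_nonpos_of_nonneg ha hr.le).trans hx
  · rw [div_le_iff₀ hr]
    refine le_of_sq_le_sq ?_ (by positivity)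
    rw [mul_pow, Real.sq_sqrt hD0.le]
    exact h ha

/-- Bound on the limiting ratio from a lower bound on the loss of gain. -/
lemma gaussianQ_le_of_le_one_sub_gain (hK : 0 < K) {u : ℝ} (hu : 0 < u) {L x : ℝ}
    (hL : L ≤ 1 - gain K √(1 + (1 / u) ^ 2)) (hx : 0 ≤ x)
    (h : u ^ 2 * (1 - L) ≤ x ^ 2 * (1 + u ^ 2 * L)) :
    gaussianQ x ≤ gaussianQ (limitRatio K (1 / u)) := by
  refine gaussianQ_le_limitRatio hK (by positivity) hx fun ha => ?_
  have hs : 0 < √(1 + (1 / u) ^ 2) := by positivity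
  have hs2 : √(1 + (1 / u) ^ 2) ^ 2 = 1 + (1 / u) ^ 2 := Real.sq_sqrt (by positivity)
  have h1 := le_excess hK hs
  rw [excess_eq hK hs, hs2] at h1
  set a := gain K √(1 + (1 / u) ^ 2)
  set P := power K √(1 + (1 / u) ^ 2)
  have hu2 : 0 < u ^ 2 := by positivity
  -- in terms of the loss `1 - a`, the disturbance has power at least `a (1 / u ^ 2 + 1 - a)`
  have h2 : a * (1 + u ^ 2 * (1 - a)) ≤ u ^ 2 * (P - a ^ 2) := by
    have e : u ^ 2 * (1 + (1 / u) ^ 2) = u ^ 2 + 1 := by field_simp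
    have := mul_le_mul_of_nonneg_left h1 hu2.le
    have e2 : u ^ 2 * (P - (1 + (1 / u) ^ 2) * (2 * a - 1)) =
        u ^ 2 * P - (u ^ 2 + 1) * (2 * a - 1) := by rw [← e]; ring
    rw [← mul_assoc, e, e2] at this
    nlinarith
  have h3 : u ^ 2 * a ≤ x ^ 2 * (1 + u ^ 2 * (1 - a)) := by
    have : x ^ 2 * (1 + u ^ 2 * L) ≤ x ^ 2 * (1 + u ^ 2 * (1 - a)) := by gcongr
    nlinarith
  refine le_of_mul_le_mul_left ?_ hu2
  calc u ^ 2 * a ^ 2 = a * (u ^ 2 * a) := by ring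
    _ ≤ a * (x ^ 2 * (1 + u ^ 2 * (1 - a))) := by gcongr
    _ = x ^ 2 * (a * (1 + u ^ 2 * (1 - a))) := by ring
    _ ≤ x ^ 2 * (u ^ 2 * (P - a ^ 2)) := by gcongr
    _ = _ := by ring

/-- Bound on the limiting ratio from a lower bound on the power of the removed multiples. -/
lemma gaussianQ_le_of_le_excess (hK : 0 < K) {u : ℝ} (hu : 0 < u) {L x : ℝ}
    (hL : (1 + (1 / u) ^ 2) * L ≤ excess K √(1 + (1 / u) ^ 2)) (hx : 0 ≤ x)
    (h : u ^ 2 ≤ x ^ 2 * (1 + (1 + u ^ 2) * L)) :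
    gaussianQ x ≤ gaussianQ (limitRatio K (1 / u)) := by
  refine gaussianQ_le_limitRatio hK (by positivity) hx fun ha => ?_
  have hs : 0 < √(1 + (1 / u) ^ 2) := by positivity
  have hs2 : √(1 + (1 / u) ^ 2) ^ 2 = 1 + (1 / u) ^ 2 := Real.sq_sqrt (by positivity)
  have h1 := le_excess hK hs
  have ha1 := gain_lt_one hK hs
  have hE := excess_eq hK hs
  rw [hs2] at h1 hE
  set a := gain K √(1 + (1 / u) ^ 2)
  set P := power K √(1 + (1 / u) ^ 2)
  set E := excess K √(1 + (1 / u) ^ 2)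
  have hu2 : 0 < u ^ 2 := by positivity
  have e : u ^ 2 * (1 + (1 / u) ^ 2) = u ^ 2 + 1 := by field_simp
  have h1' : (u ^ 2 + 1) * (1 - a) ≤ u ^ 2 * E := by
    have := mul_le_mul_of_nonneg_left h1 hu2.le
    rwa [← mul_assoc, e] at this
  have hL' : (u ^ 2 + 1) * L ≤ u ^ 2 * E := by
    have := mul_le_mul_of_nonneg_left hL hu2.le
    rwa [← mul_assoc, e] at this
  have hP : u ^ 2 * (P - a ^ 2) = u ^ 2 * E + (u ^ 2 + 1) * (2 * a - 1) - u ^ 2 * a ^ 2 := by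
    rw [hE, ← e]; ring
  -- `E (1 - a ^ 2)` dominates `(1 - a) ^ 2` times the total power
  have h2 : (u ^ 2 + 1) * (1 - a) ^ 2 ≤ u ^ 2 * E * (1 - a ^ 2) := by
    have h3 : 0 ≤ 1 - a ^ 2 := by nlinarith
    have h4 := mul_le_mul_of_nonneg_right h1' h3
    have h5 : 0 ≤ (u ^ 2 + 1) * ((1 - a) ^ 2 * a) := by positivity
    nlinarith
  have h6 : a ^ 2 * (1 + (1 + u ^ 2) * L) ≤ u ^ 2 * (P - a ^ 2) := by
    have := mul_le_mul_of_nonneg_left hL' (sq_nonneg a)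
    nlinarith
  refine le_of_mul_le_mul_left ?_ hu2
  calc u ^ 2 * a ^ 2 = a ^ 2 * u ^ 2 := by ring
    _ ≤ a ^ 2 * (x ^ 2 * (1 + (1 + u ^ 2) * L)) := by gcongr
    _ = x ^ 2 * (a ^ 2 * (1 + (1 + u ^ 2) * L)) := by ring
    _ ≤ x ^ 2 * (u ^ 2 * (P - a ^ 2)) := by gcongr
    _ = _ := by ring

end

/-! ### Modulo noise loss: comparison by the nearest levels, strong noise -/

section

variable {K u : ℝ}

/-- Half the modulus over the standard deviation `√(1 + 1 / u ^ 2)` of the received sample. -/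
noncomputable def foldPoint (K u : ℝ) : ℝ := K / (2 * √(1 + (1 / u) ^ 2))

lemma foldPoint_pos (hK : 0 < K) (u : ℝ) : 0 < foldPoint K u := by
  unfold foldPoint; positivity

lemma foldPoint_sq (hu : 0 < u) : foldPoint K u ^ 2 * (1 + u ^ 2) = (u * K / 2) ^ 2 := by
  rw [foldPoint, div_pow, mul_pow, Real.sq_sqrt (by positivity)]
  field_simp
  ring

lemma foldedQ_eq (hK : 2 ≤ K) (u : ℝ) : foldedQ K u = gaussianQ u - gaussianQ (u * K / 2 + u) +
    gaussianQ (u * K / 2 - u) - gaussianQ (2 * (u * K / 2) - u) := by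
  have e1 : (K / 2 + 1) * u = u * K / 2 + u := by ring
  have e2 : (K / 2 - 1) * u = u * K / 2 - u := by ring
  have e3 : (K - 1) * u = 2 * (u * K / 2) - u := by ring
  rw [foldedQ, abs_of_nonneg (by linarith), abs_of_nonneg (by linarith), e1, e2, e3]

lemma gaussianQ_sub_le {a b : ℝ} (ha : 0 ≤ a) (hab : a ≤ b) :
    gaussianQ a - gaussianQ b ≤ (b - a) * normalPDF a := by
  rw [gaussianQ_sub_eq_integral]
  have h : ∫ x in a..b, normalPDF x ≤ ∫ _ in a..b, normalPDF a :=
    intervalIntegral.integral_mono_on hab (continuous_normalPDF.intervalIntegrable _ _)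
      (continuous_const.intervalIntegrable _ _) fun x hx =>
        normalPDF_le_of_sq_le (pow_le_pow_left₀ ha hx.1 2)
  simpa using h

lemma mul_normalPDF_le_quarter (u : ℝ) : u * normalPDF u ≤ 0.25 := by
  have h1 : u * Real.exp (-(u ^ 2 / 2)) ≤ Real.exp (-(1 / 2)) := by
    have h2 : u ≤ Real.exp (u - 1) := by linarith [Real.add_one_le_exp (u - 1)]
    calc u * Real.exp (-(u ^ 2 / 2)) ≤ Real.exp (u - 1) * Real.exp (-(u ^ 2 / 2)) := by gcongr
      _ = Real.exp (u - 1 - u ^ 2 / 2) := by rw [← Real.exp_add]; ring_nf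
      _ ≤ _ := Real.exp_le_exp.2 (by nlinarith [sq_nonneg (u - 1)])
  have h3 := exp_neg_le (1 / 2) (by norm_num)
  norm_num [Finset.sum_range_succ, Nat.factorial] at h3
  obtain ⟨h4, h5⟩ := normalPDF_zero_bounds
  rw [normalPDF_eq_mul u]
  calc u * (normalPDF 0 * Real.exp (-(u ^ 2 / 2))) =
        normalPDF 0 * (u * Real.exp (-(u ^ 2 / 2))) := by ring
    _ ≤ normalPDF 0 * Real.exp (-(1 / 2)) := by gcongr
    _ ≤ 0.39895 * 0.61 := by gcongr; norm_num at h3 ⊢; linarith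
    _ ≤ _ := by norm_num

/-- The density decreases on the positive axis, so its rightmost value bounds the mass of an
interval from below. -/
lemma mul_normalPDF_le_gaussianQ_sub {a b : ℝ} (ha : 0 ≤ a) (hab : a ≤ b) :
    (b - a) * normalPDF b ≤ gaussianQ a - gaussianQ b := by
  rw [gaussianQ_sub_eq_integral]
  have h : ∫ _ in a..b, normalPDF b ≤ ∫ x in a..b, normalPDF x :=
    intervalIntegral.integral_mono_on hab (continuous_const.intervalIntegrable _ _)
      (continuous_normalPDF.intervalIntegrable _ _) fun x hx =>
        normalPDF_le_of_sq_le (by nlinarith [hx.1, hx.2])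
  simpa using h

lemma sinh_le_mul_exp {z : ℝ} (hz : 0 ≤ z) : Real.sinh z ≤ z * Real.exp (z ^ 2 / 6) := by
  have h1 := Real.hasSum_sinh z
  have h2 : HasSum (fun n : ℕ => z * ((z ^ 2 / 6) ^ n / (n.factorial : ℝ)))
      (z * Real.exp (z ^ 2 / 6)) := by
    have := NormedSpace.expSeries_div_hasSum_exp (𝔸 := ℝ) (z ^ 2 / 6)
    rw [← Real.exp_eq_exp_ℝ] at this
    exact this.mul_left z
  have hf : ∀ n : ℕ, (6 : ℝ) ^ n * n.factorial ≤ (2 * n + 1).factorial := fun n => by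
    induction n with
    | zero => simp
    | succ n ih =>
      have e : (2 * (n + 1) + 1).factorial = (2 * n + 3) * ((2 * n + 2) * (2 * n + 1).factorial) := by
        rw [show 2 * (n + 1) + 1 = (2 * n + 2) + 1 by ring, Nat.factorial_succ,
          show 2 * n + 2 = (2 * n + 1) + 1 by ring, Nat.factorial_succ]
      rw [e, Nat.factorial_succ]
      push_cast
      have hn : (0 : ℝ) ≤ n := by positivity
      have h0 : (0 : ℝ) ≤ (2 * n + 1).factorial := by positivity
      calc (6 : ℝ) ^ (n + 1) * ((n + 1) * n.factorial) = 6 * (n + 1) * (6 ^ n * n.factorial) := by ring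
        _ ≤ 6 * (n + 1) * (2 * n + 1).factorial := by gcongr
        _ ≤ (2 * n + 3) * ((2 * n + 2) * (2 * n + 1).factorial) := by nlinarith [mul_nonneg hn h0]
  refine hasSum_le (fun n => ?_) h1 h2
  have e : z * ((z ^ 2 / 6) ^ n / (n.factorial : ℝ)) = z ^ (2 * n + 1) / (6 ^ n * n.factorial) := by
    rw [div_pow, ← pow_mul]; field_simp; ring
  rw [e]
  exact div_le_div_of_nonneg_left (by positivity) (by positivity) (hf n)

/-- The mass of a short interval far from the origin. -/
lemma gaussianQ_sub_le_exp {x u : ℝ} (hx : 0 < x) (hu : 0 ≤ u) :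
    gaussianQ (x - u) - gaussianQ (x + u) ≤
      2 * u * normalPDF 0 * Real.exp (-(x ^ 2 / 2) + x ^ 2 * u ^ 2 / 6) := by
  have h1 : gaussianQ (x - u) - gaussianQ (x + u) =
      ∫ v in (-u)..u, normalPDF (v + x) := by
    rw [gaussianQ_sub_eq_integral, intervalIntegral.integral_comp_add_right]
    congr 1 <;> ring
  have hd : ∀ v : ℝ, HasDerivAt (fun v => -(normalPDF 0 * Real.exp (-(x ^ 2 / 2)) / x) *
      Real.exp (-(x * v))) (normalPDF 0 * Real.exp (-(x ^ 2 / 2)) * Real.exp (-(x * v))) v :=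
    fun v => by
    have h2 : HasDerivAt (fun v : ℝ => -(x * v)) (-x) v := by
      exact (((hasDerivAt_id v).const_mul x).neg).congr_deriv (by simp)
    refine (h2.exp.const_mul _).congr_deriv ?_
    field_simp
  have h3 : ∫ v in (-u)..u, normalPDF (v + x) ≤
      ∫ v in (-u)..u, normalPDF 0 * Real.exp (-(x ^ 2 / 2)) * Real.exp (-(x * v)) := by
    refine intervalIntegral.integral_mono_on (by linarith)
      ((continuous_normalPDF.comp (by fun_prop)).intervalIntegrable _ _)
      ((by fun_prop : Continuous fun v : ℝ =>
        normalPDF 0 * Real.exp (-(x ^ 2 / 2)) * Real.exp (-(x * v))).intervalIntegrable _ _)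
      fun v _ => ?_
    rw [normalPDF_eq_mul (v + x), mul_assoc, ← Real.exp_add]
    refine mul_le_mul_of_nonneg_left (Real.exp_le_exp.2 ?_) (normalPDF_pos 0).le
    nlinarith [sq_nonneg v]
  rw [intervalIntegral.integral_eq_sub_of_hasDerivAt (fun v _ => hd v)
    ((by fun_prop : Continuous fun v : ℝ =>
        normalPDF 0 * Real.exp (-(x ^ 2 / 2)) * Real.exp (-(x * v))).intervalIntegrable _ _)] at h3
  have h4 := sinh_le_mul_exp (z := x * u) (by positivity)
  rw [Real.sinh_eq] at h4
  rw [h1]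
  refine h3.trans ?_
  have e1 : Real.exp (-(x ^ 2 / 2) + x ^ 2 * u ^ 2 / 6) =
      Real.exp (-(x ^ 2 / 2)) * Real.exp ((x * u) ^ 2 / 6) := by rw [← Real.exp_add]; ring_nf
  have e2 : -(normalPDF 0 * Real.exp (-(x ^ 2 / 2)) / x) * Real.exp (-(x * u)) -
      -(normalPDF 0 * Real.exp (-(x ^ 2 / 2)) / x) * Real.exp (-(x * -u)) =
      normalPDF 0 * Real.exp (-(x ^ 2 / 2)) * (2 / x) *
        ((Real.exp (x * u) - Real.exp (-(x * u))) / 2) := by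
    rw [mul_neg, neg_neg]; field_simp; ring
  rw [e1, e2]
  calc _ ≤ normalPDF 0 * Real.exp (-(x ^ 2 / 2)) * (2 / x) *
        (x * u * Real.exp ((x * u) ^ 2 / 6)) := by
        refine mul_le_mul_of_nonneg_left h4 ?_
        have := normalPDF_pos 0; positivity
    _ = _ := by field_simp

/-- The case of strong noise. The folded levels cost twice the mass of the interval of radius `u`
around `x = u * K / 2`, hence about `2 u φ(x)`. The power of the removed multiples lowers the limiting
ratio by the factor `1 - η` with `η ≥ 2 exp (-μ ^ 2 / 2)`, which increases the tail by more. -/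
lemma foldedQ_lt_of_le_half (hK : 2 ≤ K) (hu : 0 < u) (hx : 5 ≤ u * K) (hu2 : u ≤ 1 / 2) :
    foldedQ K u < gaussianQ (limitRatio K (1 / u)) := by
  have hK0 : 0 < K := by linarith
  set μ := foldPoint K u with hμ
  set x := u * K / 2 with hxdef
  have hx2 : 5 / 2 ≤ x := by linarith
  have hμ0 : 0 < μ := foldPoint_pos hK0 u
  have hμx : μ ^ 2 * (1 + u ^ 2) = x ^ 2 := foldPoint_sq hu
  set U := u ^ 2 with hU
  have hU0 : 0 < U := by positivity
  have hU1 : U ≤ 1 / 4 := by nlinarith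
  have hμ5 : 5 ≤ μ ^ 2 := by nlinarith
  set Z := Real.exp (-(μ ^ 2 / 2)) with hZ
  have hZ0 : 0 < Z := Real.exp_pos _
  have hZ1 : Z ≤ 0.1 := by
    have h1 : Z ≤ Real.exp (-(5 / 2)) := Real.exp_le_exp.2 (by linarith)
    have h2 := exp_neg_le (5 / 2) (by norm_num)
    norm_num [Finset.sum_range_succ, Nat.factorial] at h2
    linarith
  obtain ⟨hφ1, hφ2⟩ := normalPDF_zero_bounds
  set L := 8 * μ ^ 2 * (normalPDF μ * (μ / (1 + μ ^ 2))) with hL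
  have hLE : (1 + (1 / u) ^ 2) * L ≤ excess K √(1 + (1 / u) ^ 2) := by
    have hs : 0 < √(1 + (1 / u) ^ 2) := by positivity
    refine le_trans ?_ (tail_le_excess hK0 hs)
    have e : 2 * K ^ 2 = (1 + (1 / u) ^ 2) * (8 * μ ^ 2) := by
      have e1 : 1 + (1 / u) ^ 2 = (1 + U) / U := by rw [hU]; field_simp; ring
      have e2 : (1 + U) / U * (8 * μ ^ 2) = 8 * (μ ^ 2 * (1 + U)) / U := by ring
      rw [e1, e2, hμx, hxdef, hU]; field_simp; ring
    rw [e, hL, ← mul_assoc]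
    exact mul_le_mul_of_nonneg_left (mills_le_gaussianQ hμ0) (by positivity)
  set δ := (1 + U) * L with hδ
  have hδZ : 6.6 * Z ≤ δ := by
    have e : δ = 8 * ((1 + U) * μ) * (μ ^ 2 / (1 + μ ^ 2)) * normalPDF 0 * Z := by
      rw [hδ, hL, normalPDF_eq_mul μ]; ring
    have h1 : 5 / 2 ≤ (1 + U) * μ := by
      refine le_trans hx2 (le_of_sq_le_sq ?_ (by positivity))
      rw [← hμx]; nlinarith [mul_pos hU0 (sq_pos_of_pos hμ0)]
    have h2 : 5 / 6 ≤ μ ^ 2 / (1 + μ ^ 2) := by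
      rw [div_le_div_iff₀ (by norm_num) (by positivity)]; linarith
    rw [e]
    refine mul_le_mul_of_nonneg_right ?_ hZ0.le
    calc (6.6 : ℝ) ≤ 8 * (5 / 2) * (5 / 6) * 0.39894 := by norm_num
      _ ≤ _ := by gcongr
  have hδ0 : 0 < δ := by linarith [mul_pos (by norm_num : (0 : ℝ) < 6.6) hZ0]
  set η := δ / (2 + 1.5 * δ) with hη
  have hη2 : 2 * Z ≤ η := by
    rw [hη, le_div_iff₀ (by positivity)]
    nlinarith
  have hη1 : η ≤ 1 := by rw [hη, div_le_one (by positivity)]; linarith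
  clear_value Z L μ x
  have hR := gaussianQ_le_of_le_excess hK0 hu (x := u * (1 - η)) hLE
    (mul_nonneg hu.le (by linarith)) (by
      rw [← hU, ← hδ, mul_pow, ← hU]
      have e : 1 - η = (2 + 0.5 * δ) / (2 + 1.5 * δ) := by
        rw [hη, eq_div_iff (by positivity)]; field_simp; ring
      rw [e, mul_assoc]
      refine le_mul_of_one_le_right hU0.le ?_
      rw [div_pow, div_mul_eq_mul_div, one_le_div (by positivity)]
      nlinarith [pow_pos hδ0 3])
  have h1 := mul_normalPDF_le_gaussianQ_sub (a := u * (1 - η)) (b := u)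
    (mul_nonneg hu.le (by linarith)) (by nlinarith)
  have h2 := gaussianQ_sub_le_exp (x := x) (u := u) (by linarith) hu.le
  have h3 := gaussianQ_pos (2 * x - u)
  rw [foldedQ_eq hK, ← hxdef]
  have h4 : Real.exp (-(x ^ 2 / 2) + x ^ 2 * u ^ 2 / 6) ≤ Z * Real.exp (-(u ^ 2 / 2)) := by
    rw [hZ, ← Real.exp_add, ← hμx, ← hU]
    refine Real.exp_le_exp.2 ?_
    have : U * 1 ≤ U * (μ ^ 2 * (2 / 3 - U / 3)) := by
      refine mul_le_mul_of_nonneg_left ?_ hU0.le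
      calc (1 : ℝ) ≤ 5 * (2 / 3 - U / 3) := by linarith
        _ ≤ μ ^ 2 * (2 / 3 - U / 3) := mul_le_mul_of_nonneg_right hμ5 (by linarith)
    linarith
  have h5 : 2 * u * normalPDF 0 * Real.exp (-(x ^ 2 / 2) + x ^ 2 * u ^ 2 / 6) ≤
      (u - u * (1 - η)) * normalPDF u := by
    have hpos : 0 ≤ u * normalPDF u := mul_nonneg hu.le (normalPDF_pos u).le
    have hA := mul_le_mul_of_nonneg_left h4 (mul_nonneg hu.le (normalPDF_pos 0).le)
    have hB := mul_le_mul_of_nonneg_right hη2 hpos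
    have hC : normalPDF 0 * (Z * Real.exp (-(u ^ 2 / 2))) = Z * normalPDF u := by
      rw [normalPDF_eq_mul u]; ring
    rw [mul_assoc u, mul_assoc u, hC] at hA
    linarith
  linarith

/-- Comparison for far folded levels, reduced to numerical bounds. With `μ = foldPoint K u` and
`c = 4 μ φ(μ) ≤ 1 - gain`, the limiting ratio is at most `u (1 - κ c)`, which increases the tail by at
least `u κ c φ(u)`. This has to exceed `Q(v)`, which is at most `h φ(v)` by the Mills ratio; `g` bounds
`μ u` from below and `f` the exponent `(μ ^ 2 + u ^ 2 - v ^ 2) / 2` from above. -/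
lemma foldedQ_lt_of_far (hK : 2 ≤ K) (hu : 0 < u) {v κ g f h : ℝ} (hv : v = u * K / 2 - u)
    (hv0 : 0 < v) (hμ1 : 1 + u ^ 2 ≤ (u + v) ^ 2) (hκ0 : 0 ≤ κ) (hκ1 : κ ≤ 1)
    (hκ : ∀ c, 0 ≤ c → c ≤ 1 → 1 - c ≤ (1 - κ * c) ^ 2 * (1 + u ^ 2 * c))
    (hg0 : 0 ≤ g) (hg : g ^ 2 * (1 + u ^ 2) ≤ u ^ 2 * (u + v) ^ 2)
    (hf : (1 + u ^ 2) ^ 2 ≤ (u * v - 1) ^ 2 + 2 * f * (1 + u ^ 2))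
    (hh : (v ^ 2 + 2) / (v * (v ^ 2 + 3)) ≤ h)
    (hnum : h ≤ 4 * κ * 0.39894 * g * Real.exp (-f)) :
    foldedQ K u < gaussianQ (limitRatio K (1 / u)) := by
  have hK0 : 0 < K := by linarith
  have hx : u * K / 2 = u + v := by linarith
  set μ := foldPoint K u with hμ
  have hμ0 : 0 < μ := foldPoint_pos hK0 u
  have hμx : μ ^ 2 * (1 + u ^ 2) = (u + v) ^ 2 := by rw [← hx]; exact foldPoint_sq hu
  have hU0 : 0 < u ^ 2 := by positivity
  have hμ1' : 1 ≤ μ := by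
    by_contra! hcon
    have h1 : μ ^ 2 < 1 := by nlinarith
    have h2 := mul_lt_mul_of_pos_right h1 (by positivity : 0 < 1 + u ^ 2)
    linarith
  obtain ⟨hφ1, hφ2⟩ := normalPDF_zero_bounds
  set c := 4 * μ * normalPDF μ with hc
  have hc0 : 0 ≤ c := by have := normalPDF_pos μ; positivity
  have hc1 : c ≤ 1 := by linarith [mul_normalPDF_le_quarter μ]
  have hcg : c ≤ 1 - gain K √(1 + (1 / u) ^ 2) := tail_le_one_sub_gain hK0 (by positivity)
  have hκc : κ * c ≤ 1 := mul_le_one₀ hκ1 hc0 hc1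
  have hR := gaussianQ_le_of_le_one_sub_gain hK0 hu (x := u * (1 - κ * c)) hcg
    (mul_nonneg hu.le (by linarith)) (by
      rw [mul_pow, mul_assoc]
      exact mul_le_mul_of_nonneg_left (hκ c hc0 hc1) hU0.le)
  have h1 := mul_normalPDF_le_gaussianQ_sub (a := u * (1 - κ * c)) (b := u)
    (mul_nonneg hu.le (by linarith)) (by nlinarith [mul_nonneg hu.le (mul_nonneg hκ0 hc0)])
  have hgμ : g ≤ μ * u := by
    refine le_of_sq_le_sq ?_ (by positivity)
    have : g ^ 2 * (1 + u ^ 2) ≤ (μ * u) ^ 2 * (1 + u ^ 2) := by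
      rw [mul_pow, mul_right_comm, hμx]; linarith
    exact le_of_mul_le_mul_right this (by positivity)
  have hexp : Real.exp (-f) * normalPDF v ≤ normalPDF μ * Real.exp (-(u ^ 2 / 2)) := by
    rw [normalPDF_eq_mul v, normalPDF_eq_mul μ, mul_left_comm, mul_assoc, ← Real.exp_add,
      ← Real.exp_add]
    refine mul_le_mul_of_nonneg_left (Real.exp_le_exp.2 ?_) (normalPDF_pos 0).le
    have e : (1 + u ^ 2) * (v ^ 2 - μ ^ 2 - u ^ 2) = (u * v - 1) ^ 2 - (1 + u ^ 2) ^ 2 := by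
      have : (1 + u ^ 2) * μ ^ 2 = (u + v) ^ 2 := by rw [mul_comm]; exact hμx
      linear_combination -this
    have : (1 + u ^ 2) * (-(2 * f)) ≤ (1 + u ^ 2) * (v ^ 2 - μ ^ 2 - u ^ 2) := by
      rw [e]; linarith
    have := le_of_mul_le_mul_left this (by positivity)
    linarith
  have h2 : gaussianQ v ≤ (u - u * (1 - κ * c)) * normalPDF u := by
    have hnv := normalPDF_pos v
    calc gaussianQ v ≤ normalPDF v * ((v ^ 2 + 2) / (v * (v ^ 2 + 3))) := gaussianQ_le_mills hv0
      _ ≤ normalPDF v * (4 * κ * 0.39894 * g * Real.exp (-f)) := by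
          gcongr; exact hh.trans hnum
      _ ≤ normalPDF v * (4 * κ * normalPDF 0 * (μ * u) * Real.exp (-f)) := by gcongr
      _ = 4 * κ * normalPDF 0 * (μ * u) * (Real.exp (-f) * normalPDF v) := by ring
      _ ≤ 4 * κ * normalPDF 0 * (μ * u) * (normalPDF μ * Real.exp (-(u ^ 2 / 2))) := by
          have := normalPDF_pos 0
          gcongr
      _ = _ := by rw [normalPDF_eq_mul u, hc]; ring
  have h3 := gaussianQ_pos (2 * (u * K / 2) - u)
  have h4 := gaussianQ_pos (u * K / 2 + u)
  rw [foldedQ_eq hK, ← hv]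
  linarith

lemma mills_ratio_antitone {a b : ℝ} (ha : 0 < a) (hab : a ≤ b) :
    (b ^ 2 + 2) / (b * (b ^ 2 + 3)) ≤ (a ^ 2 + 2) / (a * (a ^ 2 + 3)) := by
  have hb : 0 < b := ha.trans_le hab
  have e : ∀ t : ℝ, 0 < t → (t ^ 2 + 2) / (t * (t ^ 2 + 3)) = 1 / t * (1 - 1 / (t ^ 2 + 3)) :=
    fun t ht => by field_simp; ring
  rw [div_le_div_iff₀ (by positivity) (by positivity)]
  have h1 : 0 ≤ (b - a) := by linarith
  have h2 : 0 ≤ (b - a) * (a ^ 2 * b ^ 2 + 2 * a ^ 2 + 2 * b ^ 2 + 6 - a * b) := by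
    refine mul_nonneg h1 ?_
    nlinarith [sq_nonneg (a - b), mul_pos ha hb]
  nlinarith

end

/-! ### Modulo noise loss: comparison by the nearest levels, reduction to numerical bounds -/

section

variable {K u : ℝ}

/-- The hypothesis on `κ` of `foldedQ_lt_of_far` for `κ = 0.6`. -/
lemma loss_bound_of_quarter {U c : ℝ} (hU : 1 / 4 ≤ U) (hc0 : 0 ≤ c) :
    1 - c ≤ (1 - 0.6 * c) ^ 2 * (1 + U * c) := by
  have h1 : (1 - 0.6 * c) ^ 2 * (1 + 1 / 4 * c) ≤ (1 - 0.6 * c) ^ 2 * (1 + U * c) := by gcongr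
  nlinarith [pow_nonneg hc0 3, mul_nonneg hc0 hc0]

/-- The hypothesis on `κ` of `foldedQ_lt_of_far` for `κ = 0.8`. -/
lemma loss_bound_of_large {U c : ℝ} (hU : 0.81 ≤ U) (hc0 : 0 ≤ c) :
    1 - c ≤ (1 - 0.8 * c) ^ 2 * (1 + U * c) := by
  have h1 : (1 - 0.8 * c) ^ 2 * (1 + 0.81 * c) ≤ (1 - 0.8 * c) ^ 2 * (1 + U * c) := by gcongr
  nlinarith [mul_nonneg hc0 (sq_nonneg (c - 0.633))]

lemma sq_mul_one_add_le {a b U : ℝ} (ha : 0 < a) (haU : a ≤ U) (hb : b ^ 2 * (1 + a) ≤ 4 * a ^ 2) :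
    b ^ 2 * (1 + U) ≤ 4 * U ^ 2 := by
  have h6 : b ^ 2 ≤ 4 * a := by
    by_contra! h
    have := mul_lt_mul_of_pos_right h (by linarith : 0 < 1 + a)
    linarith
  have h7 : b ^ 2 * (U - a) ≤ 4 * a * (U - a) := mul_le_mul_of_nonneg_right h6 (by linarith)
  linarith [mul_nonneg (sub_nonneg.2 haU) (ha.le.trans haU)]

/-- The far folded level at moderate noise: the level `v = u K / 2 - u` is at least `5 / 2 - u`. -/
lemma foldedQ_lt_of_le_of_le (hK : 2 ≤ K) (hu : 1 / 2 ≤ u) (hx : 5 ≤ u * K) (hu4 : u ≤ 1.25) :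
    foldedQ K u < gaussianQ (limitRatio K (1 / u)) := by
  have hu0 : 0 < u := by linarith
  set v := u * K / 2 - u with hv
  have hv1 : 5 / 2 - u ≤ v := by linarith
  have hv0 : 0 < v := by linarith
  have hμ1 : 1 + u ^ 2 ≤ (u + v) ^ 2 := by nlinarith
  have hκ1 : ∀ c, 0 ≤ c → c ≤ 1 → 1 - c ≤ (1 - 0.6 * c) ^ 2 * (1 + u ^ 2 * c) :=
    fun c h0 _ => loss_bound_of_quarter (by nlinarith) h0
  have hκ2 : 0.9 ≤ u → ∀ c, 0 ≤ c → c ≤ 1 → 1 - c ≤ (1 - 0.8 * c) ^ 2 * (1 + u ^ 2 * c) :=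
    fun h c h0 _ => loss_bound_of_large (by nlinarith) h0
  have hx2 : 6.25 ≤ (u + v) ^ 2 := by nlinarith
  -- the exponent, when the folded level is at its minimal distance `5 / 2 - u`
  have hF : u ≤ 2 → ∀ f, 0 ≤ 2 * f * (1 + u ^ 2) + 2.5 * u * (2.5 * u - 2 * u ^ 2 - 2) →
      (1 + u ^ 2) ^ 2 ≤ (u * v - 1) ^ 2 + 2 * f * (1 + u ^ 2) := fun h2 f hf => by
    have h3 : 0 ≤ u * (5 / 2 - u) - 1 := by nlinarith
    have h4 : u * (5 / 2 - u) - 1 ≤ u * v - 1 := by nlinarith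
    have h5 : (u * (5 / 2 - u) - 1) ^ 2 ≤ (u * v - 1) ^ 2 := pow_le_pow_left₀ h3 h4 2
    nlinarith
  have hG : ∀ g, g ^ 2 * (1 + u ^ 2) ≤ 6.25 * u ^ 2 →
      g ^ 2 * (1 + u ^ 2) ≤ u ^ 2 * (u + v) ^ 2 := fun g hg => by nlinarith [sq_nonneg u]
  -- On each cell of `u`, `g` and `f` are rounded values of the least `u (5 / 2) / √(1 + u ^ 2)` and the
  -- greatest exponent, and the Mills ratio is taken at the least `v`.
  rcases le_or_gt u 0.7 with h1 | h1
  · refine foldedQ_lt_of_far hK hu0 hv hv0 hμ1 (by norm_num) (by norm_num) hκ1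
      (g := 1.118) (f := 0.73) (by norm_num) (hG _ (by nlinarith))
      (hF (by linarith) _ ?_) (mills_ratio_antitone (a := 1.8) (by norm_num) (by linarith)) ?_
    · nlinarith [mul_nonneg (sub_nonneg.2 hu) (sub_nonneg.2 h1),
        mul_nonneg (mul_nonneg (sub_nonneg.2 hu) (sub_nonneg.2 h1)) hu0.le]
    · have := exp_neg_ge 0.73 (by norm_num)
      norm_num [Finset.sum_range_succ, Nat.factorial] at this ⊢
      linarith
  rcases le_or_gt u 0.9 with h2 | h2
  · refine foldedQ_lt_of_far hK hu0 hv hv0 hμ1 (by norm_num) (by norm_num) hκ1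
      (g := 1.433) (f := 0.86) (by norm_num) (hG _ (by nlinarith))
      (hF (by linarith) _ ?_) (mills_ratio_antitone (a := 1.6) (by norm_num) (by linarith)) ?_
    · nlinarith [mul_nonneg (sub_nonneg.2 h1.le) (sub_nonneg.2 h2),
        mul_nonneg (mul_nonneg (sub_nonneg.2 h1.le) (sub_nonneg.2 h2)) hu0.le]
    · have := exp_neg_ge 0.86 (by norm_num)
      norm_num [Finset.sum_range_succ, Nat.factorial] at this ⊢
      linarith
  rcases le_or_gt u 1.1 with h3 | h3
  · refine foldedQ_lt_of_far hK hu0 hv hv0 hμ1 (by norm_num) (by norm_num) (hκ2 h2.le)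
      (g := 1.672) (f := 1.05) (by norm_num) (hG _ (by nlinarith))
      (hF (by linarith) _ ?_) (mills_ratio_antitone (a := 1.4) (by norm_num) (by linarith)) ?_
    · nlinarith [mul_nonneg (sub_nonneg.2 h2.le) (sub_nonneg.2 h3),
        mul_nonneg (mul_nonneg (sub_nonneg.2 h2.le) (sub_nonneg.2 h3)) hu0.le]
    · have := exp_neg_ge 1.05 (by norm_num)
      norm_num [Finset.sum_range_succ, Nat.factorial] at this ⊢
      linarith
  · have h4 := hu4
    refine foldedQ_lt_of_far hK hu0 hv hv0 hμ1 (by norm_num) (by norm_num) (hκ2 h2.le)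
      (g := 1.849) (f := 1.23) (by norm_num) (hG _ (by nlinarith))
      (hF (by linarith) _ ?_) (mills_ratio_antitone (a := 1.25) (by norm_num) (by linarith)) ?_
    · nlinarith [mul_nonneg (sub_nonneg.2 h3.le) (sub_nonneg.2 h4),
        mul_nonneg (mul_nonneg (sub_nonneg.2 h3.le) (sub_nonneg.2 h4)) hu0.le]
    · have := exp_neg_ge 1.23 (by norm_num)
      norm_num [Finset.sum_range_succ, Nat.factorial] at this ⊢
      linarith

/-- The far folded level at weak noise: the level `v = u K / 2 - u` is at least `u`. -/
lemma foldedQ_lt_of_le (hK : 2 ≤ K) (hu : 1 / 2 ≤ u) (hx : 5 ≤ u * K) (huv : u ≤ u * K / 2 - u) :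
    foldedQ K u < gaussianQ (limitRatio K (1 / u)) := by
  rcases le_or_gt u 1.25 with h4 | h4
  · exact foldedQ_lt_of_le_of_le hK hu hx h4
  have hu0 : 0 < u := by linarith
  set v := u * K / 2 - u with hv
  have hv0 : 0 < v := by linarith
  have hμ1 : 1 + u ^ 2 ≤ (u + v) ^ 2 := by nlinarith
  have hκ2 : ∀ c, 0 ≤ c → c ≤ 1 → 1 - c ≤ (1 - 0.8 * c) ^ 2 * (1 + u ^ 2 * c) :=
    fun c h0 _ => loss_bound_of_large (by nlinarith) h0
  -- the exponent, when it is at the minimal distance `u`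
  have hF' : ∀ f, u ^ 2 * (2 - f) ≤ f →
      (1 + u ^ 2) ^ 2 ≤ (u * v - 1) ^ 2 + 2 * f * (1 + u ^ 2) := fun f hf => by
    have h3 : 0 ≤ u ^ 2 - 1 := by nlinarith
    have h4 : u ^ 2 - 1 ≤ u * v - 1 := by nlinarith
    have h5 : (u ^ 2 - 1) ^ 2 ≤ (u * v - 1) ^ 2 := pow_le_pow_left₀ h3 h4 2
    nlinarith
  have hG' : ∀ g, g ^ 2 * (1 + u ^ 2) ≤ 4 * (u ^ 2) ^ 2 →
      g ^ 2 * (1 + u ^ 2) ≤ u ^ 2 * (u + v) ^ 2 := fun g hg => by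
    have : (2 * u) ^ 2 ≤ (u + v) ^ 2 := pow_le_pow_left₀ (by positivity) (by linarith) 2
    nlinarith [sq_nonneg u]
  -- As `v` is at least `u`, both `g` and the Mills ratio are extremal at the left end of a
  -- cell, and `f` at its right end.
  rcases le_or_gt u 1.4 with h5 | h5
  · refine foldedQ_lt_of_far hK hu0 hv hv0 hμ1 (by norm_num) (by norm_num) hκ2
      (g := 1.952) (f := 1.325) (by norm_num)
      (hG' _ (sq_mul_one_add_le (a := 1.5625) (by norm_num) (by nlinarith) (by norm_num)))
      (hF' _ (by nlinarith))
      (mills_ratio_antitone (a := 1.25) (by norm_num) (by linarith)) ?_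
    have := exp_neg_ge 1.325 (by norm_num)
    norm_num [Finset.sum_range_succ, Nat.factorial] at this ⊢
    linarith
  rcases le_or_gt u 1.7 with h6 | h6
  · refine foldedQ_lt_of_far hK hu0 hv hv0 hμ1 (by norm_num) (by norm_num) hκ2
      (g := 2.278) (f := 1.487) (by norm_num)
      (hG' _ (sq_mul_one_add_le (a := 1.96) (by norm_num) (by nlinarith) (by norm_num)))
      (hF' _ (by nlinarith))
      (mills_ratio_antitone (a := 1.4) (by norm_num) (by linarith)) ?_
    have := exp_neg_ge 1.487 (by norm_num)
    norm_num [Finset.sum_range_succ, Nat.factorial] at this ⊢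
    linarith
  · refine foldedQ_lt_of_far hK hu0 hv hv0 hμ1 (by norm_num) (by norm_num) hκ2
      (g := 2.93) (f := 2) (by norm_num)
      (hG' _ (sq_mul_one_add_le (a := 2.89) (by norm_num) (by nlinarith) (by norm_num)))
      (hF' _ (by nlinarith))
      (mills_ratio_antitone (a := 1.7) (by norm_num) (by linarith)) ?_
    have := exp_neg_ge 2 (by norm_num)
    norm_num [Finset.sum_range_succ, Nat.factorial] at this ⊢
    linarith

/-- Comparison for near folded levels, reduced to numerical bounds: `b` bounds the normalized
folding point, `C` the loss of gain, and `r` the limiting ratio. -/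
lemma foldedQ_lt_of_near (hK : 2 ≤ K) (hu : 0 < u) {v b C r u₁ v₁ q : ℝ}
    (hv : v = u * K / 2 - u) (hμ1 : 1 + u ^ 2 ≤ (u + v) ^ 2)
    (hb0 : 0 ≤ b) (hb : (u + v) ^ 2 ≤ b ^ 2 * (1 + u ^ 2))
    (hC : C ≤ 4 * b * 0.39894 * Real.exp (-(b ^ 2 / 2))) (hr0 : 0 ≤ r) (hr : 1 - C ≤ r ^ 2 * C)
    (hu₁ : u₁ ≤ u) (hv₁ : v₁ ≤ v) (hq : gaussianQ u₁ + gaussianQ v₁ ≤ q) (hq' : q ≤ gaussianQ r) :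
    foldedQ K u < gaussianQ (limitRatio K (1 / u)) := by
  have hK0 : 0 < K := by linarith
  have hx : u * K / 2 = u + v := by linarith
  set μ := foldPoint K u with hμ
  have hμ0 : 0 < μ := foldPoint_pos hK0 u
  have hμx : μ ^ 2 * (1 + u ^ 2) = (u + v) ^ 2 := by rw [← hx]; exact foldPoint_sq hu
  have hU0 : 0 < u ^ 2 := by positivity
  have hμ1' : 1 ≤ μ := by
    by_contra! hcon
    have h1 : μ ^ 2 < 1 := by nlinarith
    have h2 := mul_lt_mul_of_pos_right h1 (by positivity : 0 < 1 + u ^ 2)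
    linarith
  have hμb : μ ≤ b := by
    refine le_of_sq_le_sq ?_ hb0
    refine le_of_mul_le_mul_right ?_ (by positivity : 0 < 1 + u ^ 2)
    rw [hμx]; exact hb
  have hφ := normalPDF_zero_bounds.1
  have hCg : C ≤ 1 - gain K √(1 + (1 / u) ^ 2) := by
    refine hC.trans (le_trans ?_ (tail_le_one_sub_gain hK0 (by positivity)))
    have h1 := mul_normalPDF_le hμ1' hμb
    change _ ≤ 4 * μ * normalPDF μ
    calc _ ≤ 4 * b * normalPDF 0 * Real.exp (-(b ^ 2 / 2)) := by gcongr
      _ = 4 * (b * normalPDF b) := by rw [normalPDF_eq_mul b]; ring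
      _ ≤ _ := by linarith
  have hR := gaussianQ_le_of_le_one_sub_gain hK0 hu (x := r) hCg hr0 (by nlinarith)
  have h1 := strictAnti_gaussianQ.antitone hu₁
  have h2 := strictAnti_gaussianQ.antitone hv₁
  have h3 := gaussianQ_pos (2 * (u * K / 2) - u)
  have h4 := gaussianQ_pos (u * K / 2 + u)
  rw [foldedQ_eq hK, ← hv]
  linarith

end

/-! ### Modulo noise loss: comparison by the nearest levels -/

section

variable {K u : ℝ}

/-- By the Cauchy–Schwarz inequality, `(u + v) ^ 2 ≤ (1 + u ^ 2) * (1 + v ^ 2)`, so a bound on the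
folded level bounds the normalized folding point. -/
lemma add_sq_le_of_le {v v₂ b : ℝ} (hv0 : 0 ≤ v) (hv : v ≤ v₂) (hb : 1 + v₂ ^ 2 ≤ b ^ 2) :
    (u + v) ^ 2 ≤ b ^ 2 * (1 + u ^ 2) := by
  have h1 : v ^ 2 ≤ v₂ ^ 2 := pow_le_pow_left₀ hv0 hv 2
  calc (u + v) ^ 2 ≤ (1 + v ^ 2) * (1 + u ^ 2) := by nlinarith [sq_nonneg (1 - u * v)]
    _ ≤ b ^ 2 * (1 + u ^ 2) := by gcongr; linarith

/-- For `u * K ≥ 5` the tails at the nearest levels decide the comparison. -/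
theorem foldedQ_lt_of_spatial (hK : 2.4 ≤ K) (hu : 0 < u) (hx : 5 ≤ u * K) :
    foldedQ K u < gaussianQ (limitRatio K (1 / u)) := by
  have hK2 : 2 ≤ K := by linarith
  rcases le_or_gt u (1 / 2) with hu2 | hu2
  · exact foldedQ_lt_of_le_half hK2 hu hx hu2
  rcases le_or_gt u (u * K / 2 - u) with huv | huv
  · exact foldedQ_lt_of_le hK2 hu2.le hx huv
  obtain ⟨v, hv⟩ : ∃ v, v = u * K / 2 - u := ⟨_, rfl⟩
  rw [← hv] at huv
  have hv0 : 0.4166 ≤ v := by nlinarith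
  have hxv : 2.5 ≤ u + v := by linarith
  have hμ1 : 1 + u ^ 2 ≤ (u + v) ^ 2 := by nlinarith
  -- On the cell `v₁ ≤ v ≤ v₂`, `b` is `√(1 + v₂ ^ 2)` rounded up and `u₁` is `2.5 - v₂`, `1.25` or
  -- `v₁`, since `v < u` and `u + v ≥ 2.5`. For large `v` the bound `b = 2` from `u + v ≤ 2 u` takes over.
  rcases le_or_gt v 0.6 with h1 | h1
  · refine foldedQ_lt_of_near hK2 hu hv hμ1 (b := 1.1662) (C := 0.94) (r := 0.26) (u₁ := 1.9)
      (v₁ := 0.4166) (q := 0.375) (by norm_num) (add_sq_le_of_le (by linarith) h1 (by norm_num)) ?_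
      (by norm_num) (by norm_num) (by linarith) hv0 ?_ ?_
    · have := exp_neg_ge (1.1662 ^ 2 / 2) (by norm_num)
      norm_num [Finset.sum_range_succ, Nat.factorial] at this ⊢
      linarith
    · have e1 := gaussianQ_le (x := 1.9) (by norm_num) (by norm_num [Finset.sum_range_succ, Nat.factorial])
      have e2 := gaussianQ_le (x := 0.4166) (by norm_num) (by norm_num [Finset.sum_range_succ, Nat.factorial])
      norm_num [Finset.sum_range_succ, Nat.factorial] at e1 e2 ⊢
      linarith
    · have e1 := gaussianQ_ge (x := 0.26) (by norm_num)
      norm_num [Finset.sum_range_succ, Nat.factorial] at e1 ⊢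
      linarith
  rcases le_or_gt v 0.9 with h2 | h2
  · refine foldedQ_lt_of_near hK2 hu hv hμ1 (b := 1.3454) (C := 0.868) (r := 0.39) (u₁ := 1.6)
      (v₁ := 0.6) (q := 0.335) (by norm_num) (add_sq_le_of_le (by linarith) h2 (by norm_num)) ?_
      (by norm_num) (by norm_num) (by linarith) h1.le ?_ ?_
    · have := exp_neg_ge (1.3454 ^ 2 / 2) (by norm_num)
      norm_num [Finset.sum_range_succ, Nat.factorial] at this ⊢
      linarith
    · have e1 := gaussianQ_le (x := 1.6) (by norm_num) (by norm_num [Finset.sum_range_succ, Nat.factorial])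
      have e2 := gaussianQ_le (x := 0.6) (by norm_num) (by norm_num [Finset.sum_range_succ, Nat.factorial])
      norm_num [Finset.sum_range_succ, Nat.factorial] at e1 e2 ⊢
      linarith
    · have e1 := gaussianQ_ge (x := 0.39) (by norm_num)
      norm_num [Finset.sum_range_succ, Nat.factorial] at e1 ⊢
      linarith
  rcases le_or_gt v 1.1 with h3 | h3
  · refine foldedQ_lt_of_near hK2 hu hv hμ1 (b := 1.4867) (C := 0.784) (r := 0.53) (u₁ := 1.4)
      (v₁ := 0.9) (q := 0.27) (by norm_num) (add_sq_le_of_le (by linarith) h3 (by norm_num)) ?_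
      (by norm_num) (by norm_num) (by linarith) h2.le ?_ ?_
    · have := exp_neg_ge (1.4867 ^ 2 / 2) (by norm_num)
      norm_num [Finset.sum_range_succ, Nat.factorial] at this ⊢
      linarith
    · have e1 := gaussianQ_le (x := 1.4) (by norm_num) (by norm_num [Finset.sum_range_succ, Nat.factorial])
      have e2 := gaussianQ_le (x := 0.9) (by norm_num) (by norm_num [Finset.sum_range_succ, Nat.factorial])
      norm_num [Finset.sum_range_succ, Nat.factorial] at e1 e2 ⊢
      linarith
    · have e1 := gaussianQ_ge (x := 0.53) (by norm_num)
      norm_num [Finset.sum_range_succ, Nat.factorial] at e1 ⊢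
      linarith
  rcases le_or_gt v 1.3 with h4 | h4
  · refine foldedQ_lt_of_near hK2 hu hv hμ1 (b := 1.6402) (C := 0.681) (r := 0.685) (u₁ := 1.25)
      (v₁ := 1.1) (q := 0.244) (by norm_num) (add_sq_le_of_le (by linarith) h4 (by norm_num)) ?_
      (by norm_num) (by norm_num) (by linarith) h3.le ?_ ?_
    · have := exp_neg_ge (1.6402 ^ 2 / 2) (by norm_num)
      norm_num [Finset.sum_range_succ, Nat.factorial] at this ⊢
      linarith
    · have e1 := gaussianQ_le (x := 1.25) (by norm_num) (by norm_num [Finset.sum_range_succ, Nat.factorial])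
      have e2 := gaussianQ_le (x := 1.1) (by norm_num) (by norm_num [Finset.sum_range_succ, Nat.factorial])
      norm_num [Finset.sum_range_succ, Nat.factorial] at e1 e2 ⊢
      linarith
    · have e1 := gaussianQ_ge (x := 0.685) (by norm_num)
      norm_num [Finset.sum_range_succ, Nat.factorial] at e1 ⊢
      linarith
  rcases le_or_gt v 1.4 with h5 | h5
  · refine foldedQ_lt_of_near hK2 hu hv hμ1 (b := 1.7205) (C := 0.624) (r := 0.777) (u₁ := 1.3)
      (v₁ := 1.3) (q := 0.2) (by norm_num) (add_sq_le_of_le (by linarith) h5 (by norm_num)) ?_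
      (by norm_num) (by norm_num) (by linarith) h4.le ?_ ?_
    · have := exp_neg_ge (1.7205 ^ 2 / 2) (by norm_num)
      norm_num [Finset.sum_range_succ, Nat.factorial] at this ⊢
      linarith
    · have e1 := gaussianQ_le (x := 1.3) (by norm_num) (by norm_num [Finset.sum_range_succ, Nat.factorial])
      norm_num [Finset.sum_range_succ, Nat.factorial] at e1 ⊢
      linarith
    · have e1 := gaussianQ_ge (x := 0.777) (by norm_num)
      norm_num [Finset.sum_range_succ, Nat.factorial] at e1 ⊢
      linarith
  rcases le_or_gt v 1.55 with h6 | h6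
  · refine foldedQ_lt_of_near hK2 hu hv hμ1 (b := 1.8446) (C := 0.536) (r := 0.931) (u₁ := 1.4)
      (v₁ := 1.4) (q := 0.17) (by norm_num) (add_sq_le_of_le (by linarith) h6 (by norm_num)) ?_
      (by norm_num) (by norm_num) (by linarith) h5.le ?_ ?_
    · have := exp_neg_ge (1.8446 ^ 2 / 2) (by norm_num)
      norm_num [Finset.sum_range_succ, Nat.factorial] at this ⊢
      linarith
    · have e1 := gaussianQ_le (x := 1.4) (by norm_num) (by norm_num [Finset.sum_range_succ, Nat.factorial])
      norm_num [Finset.sum_range_succ, Nat.factorial] at e1 ⊢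
      linarith
    · have e1 := gaussianQ_ge (x := 0.931) (by norm_num)
      norm_num [Finset.sum_range_succ, Nat.factorial] at e1 ⊢
      linarith
  · refine foldedQ_lt_of_near hK2 hu hv hμ1 (b := 2) (C := 0.431) (r := 1.15) (u₁ := 1.55)
      (v₁ := 1.55) (q := 0.124) (by norm_num) (by nlinarith) ?_
      (by norm_num) (by norm_num) (by linarith) h6.le ?_ ?_
    · have := exp_neg_ge (2 ^ 2 / 2) (by norm_num)
      norm_num [Finset.sum_range_succ, Nat.factorial] at this ⊢
      linarith
    · have e1 := gaussianQ_le (x := 1.55) (by norm_num) (by norm_num [Finset.sum_range_succ, Nat.factorial])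
      norm_num [Finset.sum_range_succ, Nat.factorial] at e1 ⊢
      linarith
    · have e1 := gaussianQ_ge (x := 1.15) (by norm_num)
      norm_num [Finset.sum_range_succ, Nat.factorial] at e1 ⊢
      linarith

end

/-! ### Poisson summation for the Gaussian density -/

section

lemma summable_cexp_neg_quadratic {a : ℝ} (ha : 0 < a) (b : ℂ) :
    Summable fun n : ℤ => Complex.exp (-Real.pi * a * (n : ℂ) ^ 2 + 2 * Real.pi * b * n) := by
  have h := (summable_jacobiTheta₂_term_iff (-Complex.I * b) (Complex.I * a)).2 (by simpa using ha)
  refine h.congr fun n => ?_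
  rw [jacobiTheta₂_term]
  congr 1
  ring_nf
  rw [Complex.I_sq]
  ring

lemma summable_cexp_neg_quadratic_shift {a : ℝ} (ha : 0 < a) (b : ℂ) :
    Summable fun n : ℤ => Complex.exp (-Real.pi / a * ((n : ℂ) + Complex.I * b) ^ 2) := by
  have h := (summable_cexp_neg_quadratic (inv_pos.2 ha) (-(Complex.I * b) / a)).mul_left
    (Complex.exp (Real.pi / a * b ^ 2))
  refine h.congr fun n => ?_
  rw [← Complex.exp_add]
  congr 1
  push_cast
  ring_nf
  rw [Complex.I_sq]
  ring

/-- Poisson summation for the Gaussian density with alternating signs. -/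
lemma hasSum_alternating_normalPDF {x : ℝ} (hx : 0 < x) (v : ℝ) : ∃ S,
    HasSum (fun j : ℤ => Real.cos (Real.pi * j) * normalPDF (v - j * x)) S ∧
    HasSum (fun m : ℤ => x⁻¹ * (Real.cos (2 * Real.pi * (m + 1 / 2) * v / x) *
      Real.exp (-(2 * Real.pi ^ 2 * (m + 1 / 2) ^ 2 / x ^ 2)))) S := by
  have hπ := Real.pi_pos
  set a : ℝ := x ^ 2 / (2 * Real.pi) with ha
  have ha0 : 0 < a := by positivity
  set b : ℂ := v * x / (2 * Real.pi) - Complex.I / 2 with hb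
  set c : ℂ := (((√(2 * Real.pi))⁻¹ * Real.exp (-(v ^ 2 / 2)) : ℝ) : ℂ) with hc
  have h1 := ((summable_cexp_neg_quadratic ha0 b).hasSum.mul_left c)
  have h2 := ((summable_cexp_neg_quadratic_shift ha0 b).hasSum.mul_left
    (c * (1 / (a : ℂ) ^ (1 / 2 : ℂ))))
  rw [mul_assoc, ← Complex.tsum_exp_neg_quadratic (by simpa using ha0) b] at h2
  have hx' : (x : ℂ) ≠ 0 := by exact_mod_cast hx.ne'
  have hπ' : (Real.pi : ℂ) ≠ 0 := by exact_mod_cast hπ.ne'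
  have hsqrt : (a : ℂ) ^ (1 / 2 : ℂ) = ((x / √(2 * Real.pi) : ℝ) : ℂ) := by
    rw [show (1 / 2 : ℂ) = ((1 / 2 : ℝ) : ℂ) by norm_num, ← Complex.ofReal_cpow ha0.le,
      ← Real.sqrt_eq_rpow, ha, Real.sqrt_div (by positivity), Real.sqrt_sq hx.le]
  refine ⟨_, (Complex.hasSum_re h1).congr_fun fun j => ?_, (Complex.hasSum_re h2).congr_fun fun m => ?_⟩
  · have e : c * Complex.exp (-Real.pi * a * (j : ℂ) ^ 2 + 2 * Real.pi * b * j) =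
        ((normalPDF (v - j * x) : ℝ) : ℂ) * Complex.exp ((-(Real.pi * j) : ℝ) * Complex.I) := by
      rw [hc, normalPDF_eq]
      push_cast
      have : ∀ A B C D E : ℂ, B * C = D * E → A * B * C = A * D * E :=
        fun A B C D E h => by linear_combination A * h
      refine this _ _ _ _ _ ?_
      rw [← Complex.exp_add, ← Complex.exp_add]
      congr 1
      rw [hb, ha]
      push_cast
      field_simp
      ring
    rw [e, Complex.re_ofReal_mul, Complex.exp_ofReal_mul_I_re, Real.cos_neg]
    ring
  · have e : c * (1 / (a : ℂ) ^ (1 / 2 : ℂ)) *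
        Complex.exp (-Real.pi / a * ((m : ℂ) + Complex.I * b) ^ 2) =
        ((x⁻¹ * Real.exp (-(2 * Real.pi ^ 2 * (m + 1 / 2) ^ 2 / x ^ 2)) : ℝ) : ℂ) *
          Complex.exp ((-(2 * Real.pi * (m + 1 / 2) * v / x) : ℝ) * Complex.I) := by
      have hs : (√(2 * Real.pi))⁻¹ * (1 / (x / √(2 * Real.pi))) = x⁻¹ := by
        have : √(2 * Real.pi) ≠ 0 := by positivity
        field_simp
      have hs' := congrArg (fun t : ℝ => (t : ℂ)) hs
      push_cast at hs'
      rw [hsqrt, hc]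
      push_cast
      rw [← hs']
      have : ∀ A B C D E F : ℂ, C * D = E * F → A * C * B * D = A * B * E * F :=
        fun A B C D E F h => by linear_combination A * B * h
      refine this _ _ _ _ _ _ ?_
      rw [← Complex.exp_add, ← Complex.exp_add]
      congr 1
      rw [hb, ha]
      push_cast
      field_simp
      ring_nf
      simp only [Complex.I_sq, Complex.I_pow_three, Complex.I_pow_four]
      ring
    rw [e, Complex.re_ofReal_mul, Complex.exp_ofReal_mul_I_re, Real.cos_neg]
    ring

end

/-! ### Alternating sums of the levels -/

section

lemma cos_pi_mul_add_one (n : ℕ) : Real.cos (Real.pi * (n + 1)) = -(-1) ^ n := by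
  have := Real.cos_nat_mul_pi (n + 1)
  push_cast at this
  rw [mul_comm, this, pow_succ]; ring

/-- An alternating series over the integers, folded at the origin. -/
lemma hasSum_nat_of_hasSum_alternating {g : ℤ → ℝ} {S : ℝ}
    (h : HasSum (fun j : ℤ => Real.cos (Real.pi * j) * g j) S) :
    HasSum (fun n : ℕ => (-1) ^ n * (g (n + 1) + g (-(n + 1)))) (g 0 - S) := by
  have h1 := (hasSum_nat_add_iff' 1).2 h.nat_add_neg
  have h2 := h1.neg
  have e : g 0 - S = -(S + Real.cos (Real.pi * (0 : ℤ)) * g 0 - ∑ i ∈ Finset.range 1,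
      (Real.cos (Real.pi * ((i : ℕ) : ℤ)) * g (i : ℤ) +
        Real.cos (Real.pi * ((-(i : ℤ) : ℤ) : ℝ)) * g (-(i : ℤ)))) := by
    simp
  rw [e]
  refine h2.congr_fun fun n => ?_
  have e1 : Real.cos (Real.pi * (((n + 1 : ℕ) : ℤ) : ℝ)) = -(-1) ^ n := by
    push_cast; exact cos_pi_mul_add_one n
  have e2 : Real.cos (Real.pi * ((-((n + 1 : ℕ) : ℤ) : ℤ) : ℝ)) = -(-1) ^ n := by
    push_cast; rw [mul_neg, Real.cos_neg]; exact cos_pi_mul_add_one n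
  rw [e1, e2]
  push_cast
  ring

/-- The two nearest levels on either side, with alternating signs, dominate the first Fourier mode
of the full alternating sum of the levels. -/
lemma cos_sub_le_alternating_levels {x v : ℝ} (hx : 0 < x) (hv0 : 0 ≤ v) (hvx : v ≤ x)
    {q : ℝ} (hq : q = Real.exp (-(Real.pi ^ 2 / (2 * x ^ 2)))) (hq8 : q ^ 8 ≤ 0.00185) :
    2 / x * q * (Real.cos (Real.pi * v / x) - 0.0019) ≤
      normalPDF v - normalPDF (x - v) + normalPDF (2 * x - v) - normalPDF (x + v) +
        normalPDF (2 * x + v) := by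
  obtain ⟨S, h1, h2⟩ := hasSum_alternating_normalPDF hx v
  have hq0 : 0 < q := by rw [hq]; exact Real.exp_pos _
  have h3 := hasSum_nat_of_hasSum_alternating h1
  have hanti : Antitone fun n : ℕ => normalPDF (v - ((n + 1 : ℤ) : ℝ) * x) +
      normalPDF (v - ((-(n + 1) : ℤ) : ℝ) * x) := by
    refine antitone_nat_of_succ_le fun n => ?_
    have hn : (0 : ℝ) ≤ n := by positivity
    push_cast
    have hnx := mul_nonneg hn hx.le
    refine add_le_add (normalPDF_le_of_sq_le ?_) (normalPDF_le_of_sq_le ?_)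
    · rw [← neg_sq (v - _), ← neg_sq (v - (n + 1 + 1) * x)]
      exact pow_le_pow_left₀ (by linarith) (by linarith) 2
    · exact pow_le_pow_left₀ (by linarith) (by linarith) 2
  have h4 := hanti.alternating_series_le_tendsto h3.tendsto_sum_nat 1
  have e1 : normalPDF (v - x) = normalPDF (x - v) := by rw [← normalPDF_neg]; ring_nf
  have e2 : normalPDF (v - 2 * x) = normalPDF (2 * x - v) := by rw [← normalPDF_neg]; ring_nf
  norm_num [Finset.sum_range_succ] at h4
  rw [e1, e2, add_comm v x, add_comm v (2 * x)] at h4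
  have h5 := h2.nat_add_neg_add_one
  have h6 : HasSum (fun n : ℕ => 2 / x * (Real.cos (2 * Real.pi * (n + 1 / 2) * v / x) *
      q ^ ((2 * n + 1) ^ 2))) S := by
    refine h5.congr_fun fun n => ?_
    have e3 : 2 * Real.pi * (((-((n : ℤ) + 1) : ℤ) : ℝ) + 1 / 2) * v / x =
        -(2 * Real.pi * (n + 1 / 2) * v / x) := by push_cast; ring
    have e4 : (((-((n : ℤ) + 1) : ℤ) : ℝ) + 1 / 2) ^ 2 = ((n : ℝ) + 1 / 2) ^ 2 := by
      push_cast; ring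
    have e5 : q ^ ((2 * n + 1) ^ 2) =
        Real.exp (-(2 * Real.pi ^ 2 * ((n : ℝ) + 1 / 2) ^ 2 / x ^ 2)) := by
      rw [hq, ← Real.exp_nat_mul]
      congr 1
      push_cast
      field_simp
    rw [e3, Real.cos_neg, e4, e5]
    push_cast
    ring
  have h7 := (hasSum_nat_add_iff' 1).2 h6
  have hq16 : q ^ 16 ≤ 0.00185 * 0.00185 := by
    calc q ^ 16 = q ^ 8 * q ^ 8 := by ring
      _ ≤ _ := by gcongr
  have h8 := ((hasSum_geometric_of_lt_one (by positivity : 0 ≤ q ^ 16)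
    (by linarith)).mul_left (2 / x * -(q ^ 9)))
  have h9 := hasSum_le (fun n => ?_) h8 h7
  · have h10 : q ^ 8 * (1 - q ^ 16)⁻¹ ≤ 0.0019 := by
      rw [← div_eq_mul_inv, div_le_iff₀ (by linarith)]
      linarith
    have h11 : 2 / x * (-(q ^ 9) * (1 - q ^ 16)⁻¹) ≥ 2 / x * (-(0.0019 * q)) := by
      have : q ^ 9 * (1 - q ^ 16)⁻¹ ≤ 0.0019 * q := by
        calc _ = q * (q ^ 8 * (1 - q ^ 16)⁻¹) := by ring
          _ ≤ q * 0.0019 := by gcongr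
          _ = _ := by ring
      refine mul_le_mul_of_nonneg_left (by linarith) (by positivity)
    have e6 : 2 * Real.pi * (1 / 2) * v / x = Real.pi * v / x := by ring
    simp only [Finset.range_one, Finset.sum_singleton, Nat.cast_zero, zero_add, mul_zero, one_pow,
      pow_one, e6] at h9
    have e7 : 2 / x * q * (Real.cos (Real.pi * v / x) - 0.0019) =
      2 / x * (Real.cos (Real.pi * v / x) * q) + 2 / x * (-(0.0019 * q)) := by ring
    rw [e7]
    linarith
  · have hq1 : q ≤ 1 := by
      by_contra! hc
      have := one_lt_pow₀ hc (n := 8) (by norm_num)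
      linarith
    have e8 : 2 / x * -(q ^ 9) * (q ^ 16) ^ n = 2 / x * (-(q ^ (9 + 16 * n))) := by
      rw [pow_add, pow_mul]; ring
    rw [e8]
    refine mul_le_mul_of_nonneg_left ?_ (by positivity)
    have h10 : q ^ ((2 * (n + 1) + 1) ^ 2) ≤ q ^ (9 + 16 * n) := by
      refine pow_le_pow_of_le_one hq0.le hq1 ?_
      rcases n with _ | n
      · norm_num
      · nlinarith
    have h11 := Real.neg_one_le_cos (2 * Real.pi * (((n + 1 : ℕ) : ℝ) + 1 / 2) * v / x)
    have h12 : 0 < q ^ ((2 * (n + 1) + 1) ^ 2) := by positivity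
    nlinarith

end

/-! ### Fourier series of gain and power -/

section

variable {K s : ℝ}

/-- The factor by which a centred normal law of standard deviation `s` damps the first harmonic of
period `K`. -/
noncomputable def nome (K s : ℝ) : ℝ := Real.exp (-(2 * Real.pi ^ 2 * s ^ 2 / K ^ 2))

lemma nome_pos (K s : ℝ) : 0 < nome K s := Real.exp_pos _

lemma nome_le_one (K s : ℝ) : nome K s ≤ 1 := Real.exp_le_one_iff.2 (by
  have : 0 ≤ 2 * Real.pi ^ 2 * s ^ 2 / K ^ 2 := by positivity
  linarith)

/-- Stein's identity on one cell: the jumps at the folding points appear as boundary terms. -/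
lemma setIntegral_cell_rmod_mul_id (hK : 0 < K) (hs : 0 < s) (n : ℤ) :
    ∫ y in cell (K / s) n, rmod K (s * y) * y * normalPDF y =
      s * (∫ y in cell (K / s) n, normalPDF y) - K / 2 *
        (normalPDF ((n + 1 / 2) * (K / s)) + normalPDF ((n - 1 / 2) * (K / s))) := by
  have e : ∫ y in cell (K / s) n, rmod K (s * y) * y * normalPDF y =
      ∫ y in cell (K / s) n, (s * y - n * K) * y * normalPDF y :=
    setIntegral_congr_fun (measurableSet_cell _ _) fun y hy => by
      rw [rmod, floor_of_mem_cell hK (mul_mem_cell hs hy)]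
  have hκ : 0 < K / s := by positivity
  have hle : (n : ℝ) * (K / s) - K / s / 2 ≤ n * (K / s) + K / s / 2 := by linarith
  have hc := continuous_normalPDF
  have i1 : Continuous fun y => (s * y - n * K) * y * normalPDF y := by fun_prop
  have hd : ∀ y : ℝ, HasDerivAt (fun y => -((s * y - n * K) * normalPDF y))
      ((s * y - n * K) * y * normalPDF y - s * normalPDF y) y := fun y => by
    have h1 : HasDerivAt (fun y : ℝ => s * y - n * K) s y := by
      exact (((hasDerivAt_id y).const_mul s).sub_const (n * K)).congr_deriv (by simp)
    exact ((h1.mul (hasDerivAt_normalPDF y)).neg).congr_deriv (by ring)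
  have hF := intervalIntegral.integral_eq_sub_of_hasDerivAt
    (a := n * (K / s) - K / s / 2) (b := n * (K / s) + K / s / 2) (fun y _ => hd y)
    ((i1.sub (hc.const_mul s)).intervalIntegrable _ _)
  rw [intervalIntegral.integral_sub (i1.intervalIntegrable _ _)
    ((hc.const_mul s).intervalIntegrable _ _), intervalIntegral.integral_const_mul] at hF
  rw [e, cell, integral_Ico_eq_integral_Ioc, integral_Ico_eq_integral_Ioc,
    ← intervalIntegral.integral_of_le hle, ← intervalIntegral.integral_of_le hle]
  have e1 : (n : ℝ) * (K / s) + K / s / 2 = (n + 1 / 2) * (K / s) := by ring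
  have e2 : (n : ℝ) * (K / s) - K / s / 2 = (n - 1 / 2) * (K / s) := by ring
  have e3 : s * ((n + 1 / 2) * (K / s)) - n * K = K / 2 := by field_simp; ring
  have e4 : s * ((n - 1 / 2) * (K / s)) - n * K = -(K / 2) := by field_simp; ring
  rw [e1, e2] at hF ⊢
  rw [e3, e4] at hF
  linear_combination hF

/-- Poisson summation for the values of the density at the folding points. -/
lemma hasSum_normalPDF_half {κ : ℝ} (hκ : 0 < κ) : ∃ S,
    HasSum (fun j : ℤ => Real.cos (Real.pi * j) * Real.exp (-(2 * Real.pi ^ 2 / κ ^ 2)) ^ (j.natAbs ^ 2))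
      S ∧ HasSum (fun n : ℤ => κ * normalPDF ((n + 1 / 2) * κ)) S := by
  have hπ := Real.pi_pos
  obtain ⟨S, h1, h2⟩ := hasSum_alternating_normalPDF (x := 2 * Real.pi / κ) (by positivity) 0
  have h0 : 0 < √(2 * Real.pi) := by positivity
  have h00 : √(2 * Real.pi) * √(2 * Real.pi) = 2 * Real.pi := Real.mul_self_sqrt (by positivity)
  refine ⟨√(2 * Real.pi) * S, (h1.mul_left _).congr_fun fun j => ?_,
    (h2.mul_left _).congr_fun fun n => ?_⟩
  · rw [normalPDF_eq, ← Real.exp_nat_mul]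
    have e : ((j.natAbs ^ 2 : ℕ) : ℝ) = (j : ℝ) ^ 2 := by
      push_cast; rw [Nat.cast_natAbs]; push_cast; exact sq_abs _
    have e2 : (j : ℝ) ^ 2 * -(2 * Real.pi ^ 2 / κ ^ 2) = -((0 - j * (2 * Real.pi / κ)) ^ 2 / 2) := by
      field_simp; ring
    rw [e, e2]
    field_simp
  · rw [normalPDF_eq]
    have e2 : 2 * Real.pi ^ 2 * (n + 1 / 2) ^ 2 / (2 * Real.pi / κ) ^ 2 =
        (((n : ℝ) + 1 / 2) * κ) ^ 2 / 2 := by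
      field_simp
    rw [e2]
    simp only [mul_zero, zero_div, Real.cos_zero, one_mul]
    rw [inv_div]
    field_simp
    linear_combination -h00

/-- The gain as an alternating theta series. -/
lemma hasSum_gain (hK : 0 < K) (hs : 0 < s) :
    HasSum (fun n : ℕ => (-1) ^ n * (2 * nome K s ^ ((n + 1) ^ 2))) (gain K s) := by
  have hκ : 0 < K / s := by positivity
  obtain ⟨S, h1, h2⟩ := hasSum_normalPDF_half hκ
  have hq : Real.exp (-(2 * Real.pi ^ 2 / (K / s) ^ 2)) = nome K s := by
    rw [nome]; congr 2; field_simp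
  rw [hq] at h1
  have h2' : HasSum (fun n : ℤ => K / s * normalPDF ((n - 1 / 2) * (K / s))) S := by
    have := (Equiv.subRight (1 : ℤ)).hasSum_iff.2 h2
    refine this.congr_fun fun n => ?_
    simp only [Function.comp, Equiv.subRight_apply]
    push_cast
    ring_nf
  have h3 := hasSum_integral_cell hκ
    (integrable_stdNormal_iff.1 (integrable_rmod_mul_id hK s))
  have h4 := hasSum_integral_cell hκ integrable_normalPDF
  have e1 : ∫ y, normalPDF y = 1 := integral_gaussianPDFReal_eq_one 0 one_ne_zero
  rw [← integral_stdNormal_eq, integral_rmod_mul_id hs] at h3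
  rw [e1] at h4
  have h5 := (h4.mul_left s).sub ((h2.add h2').mul_left (s / 2))
  have h6 : s * gain K s = s * 1 - s / 2 * (S + S) := by
    refine h3.unique (h5.congr_fun fun n => ?_)
    rw [setIntegral_cell_rmod_mul_id hK hs]
    field_simp
  have h7 : gain K s = 1 - S := by
    have : s * gain K s = s * (1 - S) := by linear_combination h6
    exact mul_left_cancel₀ hs.ne' this
  have h8 := hasSum_nat_of_hasSum_alternating h1
  rw [h7]
  simp only [Int.natAbs_zero, ne_eq, OfNat.ofNat_ne_zero, not_false_eq_true, zero_pow, pow_zero]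
    at h8
  refine h8.congr_fun fun n => ?_
  have e2 : ((n : ℤ) + 1).natAbs = n + 1 := by omega
  have e3 : (-((n : ℤ) + 1)).natAbs = n + 1 := by omega
  rw [e2, e3]
  ring

/-- Truncation of the alternating series after three terms. -/
lemma gain_le_nome (hK : 0 < K) (hs : 0 < s) :
    gain K s ≤ 2 * nome K s * (1 - nome K s ^ 3 + nome K s ^ 8) := by
  have hq0 := nome_pos K s
  have hq1 := nome_le_one K s
  have hanti : Antitone fun n : ℕ => 2 * nome K s ^ ((n + 1) ^ 2) :=
    antitone_nat_of_succ_le fun n => by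
      have := pow_le_pow_of_le_one hq0.le hq1
        (show (n + 1) ^ 2 ≤ (n + 1 + 1) ^ 2 from Nat.pow_le_pow_left (by omega) 2)
      linarith
  have h := hanti.tendsto_le_alternating_series (hasSum_gain hK hs).tendsto_sum_nat 1
  norm_num [Finset.sum_range_succ] at h
  linarith

/-- The Fourier series of the squared modulo operation, from that of the second Bernoulli
polynomial. -/
lemma rmod_sq_hasSum (hK : 0 < K) (y : ℝ) :
    HasSum (fun n : ℕ => K ^ 2 / Real.pi ^ 2 *
      (1 / (n : ℝ) ^ 2 * Real.cos (2 * Real.pi * n * (y / K + 1 / 2))))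
      (rmod K y ^ 2 - K ^ 2 / 12) := by
  have hπ := Real.pi_pos
  set w := Int.fract (y / K + 1 / 2) with hw
  have h := hasSum_one_div_nat_pow_mul_cos one_ne_zero
    (x := w) ⟨Int.fract_nonneg _, (Int.fract_lt_one _).le⟩
  have hB : (Polynomial.map (algebraMap ℚ ℝ) (Polynomial.bernoulli (2 * 1))).eval w =
      w ^ 2 - w + 1 / 6 := by
    norm_num [Polynomial.bernoulli, Finset.sum_range_succ, bernoulli_two, bernoulli_one,
      Nat.choose]
    ring
  rw [hB] at h
  have h2 := h.mul_left (K ^ 2 / Real.pi ^ 2)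
  have e1 : rmod K y ^ 2 - K ^ 2 / 12 = K ^ 2 / Real.pi ^ 2 * ((-1 : ℝ) ^ (1 + 1) *
      (2 * Real.pi) ^ (2 * 1) / 2 / (Nat.factorial (2 * 1)) * (w ^ 2 - w + 1 / 6)) := by
    have : rmod K y = K * (w - 1 / 2) := by
      rw [rmod, hw, Int.fract]; field_simp; ring
    rw [this]
    norm_num [Nat.factorial]
    field_simp
    ring
  rw [e1]
  refine h2.congr_fun fun n => ?_
  have e2 : 2 * Real.pi * n * (y / K + 1 / 2) =
      2 * Real.pi * n * w + ((n * ⌊y / K + 1 / 2⌋ : ℤ) : ℝ) * (2 * Real.pi) := by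
    rw [hw, Int.fract]; push_cast; ring
  rw [e2, Real.cos_add_int_mul_two_pi, mul_one]

lemma integral_cos_stdNormal (t c : ℝ) :
    ∫ y, Real.cos (t * y + c) ∂stdNormal = Real.cos c * Real.exp (-(t ^ 2 / 2)) := by
  have h := charFun_gaussianReal (μ := 0) (v := 1) t
  rw [charFun_apply_real] at h
  have hi : Integrable (fun y : ℝ => Complex.exp (t * y * Complex.I)) stdNormal := by
    refine (integrable_const (1 : ℝ)).mono' (by fun_prop) (.of_forall fun y => ?_)
    rw [← Complex.ofReal_mul, Complex.norm_exp_ofReal_mul_I]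
  have e : ∀ y : ℝ, Real.cos (t * y + c) =
      (Complex.exp (c * Complex.I) * Complex.exp (t * y * Complex.I)).re := fun y => by
    rw [← Complex.exp_add, ← Complex.exp_ofReal_mul_I_re]
    push_cast; ring_nf
  simp_rw [e]
  have h2 := integral_re (hi.const_mul (Complex.exp (c * Complex.I)))
  simp only [RCLike.re_eq_complex_re] at h2
  rw [h2, integral_const_mul, h]
  have e2 : Complex.exp (t * (0 : ℝ) * Complex.I - (1 : NNReal) * t ^ 2 / 2) =
      ((Real.exp (-(t ^ 2 / 2)) : ℝ) : ℂ) := by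
    push_cast; congr 1; ring
  rw [e2, mul_comm, Complex.re_ofReal_mul, Complex.exp_ofReal_mul_I_re, mul_comm]

/-- The mean power is the variance of a uniform sample, up to a correction by the first harmonic. -/
lemma le_power_nome (hK : 0 < K) (s : ℝ) :
    K ^ 2 * (1 / 12 - nome K s / Real.pi ^ 2) ≤ power K s := by
  have hπ := Real.pi_pos
  set F : ℕ → ℝ → ℝ := fun n y => K ^ 2 / Real.pi ^ 2 *
      (1 / (n : ℝ) ^ 2 * Real.cos (2 * Real.pi * n * (s / K) * y + Real.pi * n)) with hF
  have hpt : ∀ y, HasSum (fun n => F n y) (rmod K (s * y) ^ 2 - K ^ 2 / 12) := fun y => by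
    refine (rmod_sq_hasSum hK (s * y)).congr_fun fun n => ?_
    simp only [hF]; congr 3; field_simp
  have hint : ∀ n, ∫ y, F n y ∂stdNormal =
      K ^ 2 / Real.pi ^ 2 * (1 / (n : ℝ) ^ 2 * ((-1) ^ n * nome K s ^ (n ^ 2))) := fun n => by
    simp only [hF]
    rw [integral_const_mul, integral_const_mul, integral_cos_stdNormal, nome, ← Real.exp_nat_mul]
    have e1 : Real.cos (Real.pi * n) = (-1) ^ n := by rw [mul_comm]; exact Real.cos_nat_mul_pi n
    have e2 : ((n ^ 2 : ℕ) : ℝ) * -(2 * Real.pi ^ 2 * s ^ 2 / K ^ 2) =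
        -((2 * Real.pi * n * (s / K)) ^ 2 / 2) := by push_cast; field_simp
    rw [e1, e2]
  have hbd : ∀ n y, ‖F n y‖ ≤ K ^ 2 / Real.pi ^ 2 * (1 / (n : ℝ) ^ 2) := fun n y => by
    simp only [hF, norm_mul, Real.norm_eq_abs]
    rw [abs_of_nonneg (by positivity : 0 ≤ K ^ 2 / Real.pi ^ 2),
      abs_of_nonneg (by positivity : 0 ≤ 1 / (n : ℝ) ^ 2)]
    exact mul_le_mul_of_nonneg_left (mul_le_of_le_one_right (by positivity) (Real.abs_cos_le_one _))
      (by positivity)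
  have hFi : ∀ n, Integrable (F n) stdNormal := fun n =>
    (integrable_const (K ^ 2 / Real.pi ^ 2 * (1 / (n : ℝ) ^ 2))).mono'
      (by fun_prop) (.of_forall (hbd n))
  have hsum : Summable fun n => ∫ y, ‖F n y‖ ∂stdNormal := by
    refine Summable.of_nonneg_of_le (fun n => integral_nonneg fun _ => norm_nonneg _) (fun n => ?_)
      ((Real.summable_one_div_nat_pow.2 one_lt_two).mul_left (K ^ 2 / Real.pi ^ 2))
    refine (integral_mono (hFi n).norm (integrable_const _) (hbd n)).trans ?_
    simp
  have h := hasSum_integral_of_summable_integral_norm hFi hsum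
  have e : ∫ y, ∑' n, F n y ∂stdNormal = power K s - K ^ 2 / 12 := by
    simp_rw [fun y => (hpt y).tsum_eq]
    rw [integral_sub (integrable_rmod_sq hK s) (integrable_const _), power]
    simp
  rw [e] at h
  simp_rw [hint] at h
  have h2 := ((hasSum_nat_add_iff' 1).2 h).neg
  have hq0 := nome_pos K s
  have hq1 := nome_le_one K s
  have hanti : Antitone fun n : ℕ => K ^ 2 / Real.pi ^ 2 *
      (1 / ((n : ℝ) + 1) ^ 2 * nome K s ^ ((n + 1) ^ 2)) := by
    refine antitone_nat_of_succ_le fun n => ?_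
    have := pow_le_pow_of_le_one hq0.le hq1
        (show (n + 1) ^ 2 ≤ (n + 1 + 1) ^ 2 from Nat.pow_le_pow_left (by omega) 2)
    have h3 : 1 / (((n + 1 : ℕ) : ℝ) + 1) ^ 2 ≤ 1 / ((n : ℝ) + 1) ^ 2 := by
      push_cast; gcongr; linarith
    gcongr
  have h3 : HasSum (fun n : ℕ => (-1) ^ n * (K ^ 2 / Real.pi ^ 2 *
      (1 / ((n : ℝ) + 1) ^ 2 * nome K s ^ ((n + 1) ^ 2)))) (-(power K s - K ^ 2 / 12)) := by
    simp only [Finset.range_one, Finset.sum_singleton, Nat.cast_zero, ne_eq, OfNat.ofNat_ne_zero,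
      not_false_eq_true, zero_pow, div_zero, zero_mul, mul_zero, sub_zero] at h2
    refine h2.congr_fun fun n => ?_
    push_cast
    rw [pow_succ (-1 : ℝ)]
    ring
  have h4 := hanti.tendsto_le_alternating_series h3.tendsto_sum_nat 0
  norm_num at h4
  have e5 : K ^ 2 * (1 / 12 - nome K s / Real.pi ^ 2) =
      K ^ 2 / 12 - K ^ 2 / Real.pi ^ 2 * nome K s := by ring
  rw [e5]; linarith

end

/-! ### Modulo noise loss: comparison by the first harmonic -/

section

variable {K u : ℝ}

/-- The first Fourier mode bounds the distance of the folded tail from `1 / 2`. -/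
lemma foldedQ_le_sin (hK : 2 ≤ K) (hu : 0 < u) {p : ℝ}
    (hp : p = Real.exp (-(2 * Real.pi ^ 2 / (u * K) ^ 2))) (hp8 : p ^ 8 ≤ 0.00185) :
    foldedQ K u ≤ 1 / 2 -
      2 / Real.pi * p * (Real.sin (2 * Real.pi / K) - 0.0019 * (2 * Real.pi / K)) := by
  have hπ := Real.pi_pos
  have hK0 : 0 < K := by linarith
  set x := u * K / 2 with hx
  have hx0 : 0 < x := by positivity
  have hux : u ≤ x := by rw [hx]; nlinarith
  have hpx : p = Real.exp (-(Real.pi ^ 2 / (2 * x ^ 2))) := by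
    rw [hp, hx]; congr 2; field_simp
  -- `H` increases on `[0, u]`, by the pointwise bound on the alternating sum of the levels
  set H : ℝ → ℝ := fun v => -gaussianQ v - gaussianQ (x - v) + gaussianQ (2 * x - v) +
    gaussianQ (x + v) - gaussianQ (2 * x + v) -
    2 / x * p * (x / Real.pi * Real.sin (Real.pi * v / x) - 0.0019 * v) with hH
  have hd : ∀ v, HasDerivAt H (normalPDF v - normalPDF (x - v) + normalPDF (2 * x - v) -
      normalPDF (x + v) + normalPDF (2 * x + v) -
      2 / x * p * (Real.cos (Real.pi * v / x) - 0.0019)) v := fun v => by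
    have d1 := (hasDerivAt_gaussianQ (x - v)).comp v ((hasDerivAt_id v).const_sub x)
    have d2 := (hasDerivAt_gaussianQ (2 * x - v)).comp v ((hasDerivAt_id v).const_sub (2 * x))
    have d3 := (hasDerivAt_gaussianQ (x + v)).comp v ((hasDerivAt_id v).const_add x)
    have d4 := (hasDerivAt_gaussianQ (2 * x + v)).comp v ((hasDerivAt_id v).const_add (2 * x))
    have d5 : HasDerivAt (fun v : ℝ => Real.pi * v / x) (Real.pi / x) v := by
      exact (((hasDerivAt_id v).const_mul Real.pi).div_const x).congr_deriv (by simp)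
    have d6 := (((d5.sin.const_mul (x / Real.pi)).sub
      ((hasDerivAt_id v).const_mul 0.0019)).const_mul (2 / x * p))
    refine (((((((hasDerivAt_gaussianQ v).neg).sub d1).add d2).add d3).sub d4).sub d6).congr_deriv ?_
    field_simp
    ring
  have hmono : MonotoneOn H (Set.Icc 0 u) := by
    refine monotoneOn_of_deriv_nonneg (convex_Icc 0 u)
      (fun v _ => (hd v).continuousAt.continuousWithinAt)
      (fun v _ => (hd v).differentiableAt.differentiableWithinAt) fun v hv => ?_
    rw [interior_Icc] at hv
    rw [(hd v).deriv]
    linarith [cos_sub_le_alternating_levels hx0 hv.1.le (hv.2.le.trans hux) hpx hp8]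
  have h := hmono (Set.left_mem_Icc.2 hu.le) (Set.right_mem_Icc.2 hu.le) hu.le
  have e1 : Real.pi * u / x = 2 * Real.pi / K := by rw [hx]; field_simp
  have e2 : 2 / x * p * (x / Real.pi * Real.sin (2 * Real.pi / K) - 0.0019 * u) =
      2 / Real.pi * p * (Real.sin (2 * Real.pi / K) - 0.0019 * (2 * Real.pi / K)) := by
    rw [← e1]; field_simp
  simp only [hH, e1, e2, mul_zero, zero_div, Real.sin_zero, sub_zero, add_zero, gaussianQ_zero] at h
  have h3 := gaussianQ_pos (2 * x + u)
  rw [foldedQ_eq hK, ← hx]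
  have e3 : x + u = u + x := add_comm _ _
  linarith

/-- The damping `exp (-y ^ 2 / 2)` more than makes up for the decrease of `sin y / y`. -/
lemma le_exp_mul_sin {y : ℝ} (hy0 : 0 < y) (hy : y ≤ 5 * Real.pi / 6) :
    0.9973 * y ≤ Real.exp (y ^ 2 / 2) * (Real.sin y - 0.0019 * y) := by
  have hπ2 := Real.pi_lt_d4
  have hexp : 1 + y ^ 2 / 2 + y ^ 4 / 8 ≤ Real.exp (y ^ 2 / 2) := by
    have := Real.quadratic_le_exp_of_nonneg (by positivity : 0 ≤ y ^ 2 / 2)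
    have e : (y ^ 2 / 2) ^ 2 / 2 = y ^ 4 / 8 := by ring
    linarith
  rcases le_or_gt (y ^ 2) 5 with h5 | h5
  · have h1 := Real.sin_ge_sub_cube hy0.le
    have h2 : y * (1 - 0.0019 - y ^ 2 / 6) ≤ Real.sin y - 0.0019 * y := by
      have : y * (1 - 0.0019 - y ^ 2 / 6) = y - y ^ 3 / 6 - 0.0019 * y := by ring
      linarith
    have h3 : 0 ≤ y * (1 - 0.0019 - y ^ 2 / 6) := mul_nonneg hy0.le (by linarith)
    have h4 : 0.9973 ≤ (1 + y ^ 2 / 2 + y ^ 4 / 8) * (1 - 0.0019 - y ^ 2 / 6) := by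
      have ht : 0 ≤ y ^ 2 := by positivity
      have e : y ^ 4 = (y ^ 2) ^ 2 := by ring
      rw [e]
      generalize y ^ 2 = t at *
      nlinarith [mul_nonneg ht (sub_nonneg.2 h5), mul_nonneg (mul_nonneg ht ht) (sub_nonneg.2 h5)]
    calc 0.9973 * y ≤ (1 + y ^ 2 / 2 + y ^ 4 / 8) * (1 - 0.0019 - y ^ 2 / 6) * y :=
          mul_le_mul_of_nonneg_right h4 hy0.le
      _ = (1 + y ^ 2 / 2 + y ^ 4 / 8) * (y * (1 - 0.0019 - y ^ 2 / 6)) := by ring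
      _ ≤ _ := mul_le_mul hexp h2 h3 (Real.exp_pos _).le
  · have hπ1 := Real.pi_gt_d4
    have hy2 : 2 ≤ y := by nlinarith
    have hs : 1 / 2 ≤ Real.sin y := by
      rw [← Real.sin_pi_div_six, ← Real.sin_pi_sub y]
      exact Real.sin_le_sin_of_le_of_le_pi_div_two (by linarith) (by linarith) (by linarith)
    have h6 : 6 ≤ Real.exp (y ^ 2 / 2) := by
      have : 25 ≤ y ^ 4 := by nlinarith
      linarith
    have h7 : 0.49 ≤ Real.sin y - 0.0019 * y := by linarith
    calc 0.9973 * y ≤ 6 * 0.49 := by linarith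
      _ ≤ _ := mul_le_mul h6 h7 (by norm_num) (Real.exp_pos _).le

lemma one_sub_cube_add_sq_le {q : ℝ} (hq0 : 0 < q) (hq1 : q ≤ 0.4545) :
    0 ≤ 1 - q ^ 3 + q ^ 8 ∧ (1 - q ^ 3 + q ^ 8) ^ 2 ≤ 1 - 1.86 * q ^ 3 := by
  have h5 : q ^ 8 ≤ 0.02 * q ^ 3 := by
    have : q ^ 5 ≤ 0.02 := (pow_le_pow_left₀ hq0.le hq1 5).trans (by norm_num)
    calc q ^ 8 = q ^ 5 * q ^ 3 := by ring
      _ ≤ _ := by gcongr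
  have h6 : q ^ 3 ≤ 0.0939 := (pow_le_pow_left₀ hq0.le hq1 3).trans (by norm_num)
  have h7 : 0 < q ^ 3 := by positivity
  have h8 : 0 < q ^ 8 := by positivity
  refine ⟨by linarith, (pow_le_pow_left₀ (by linarith)
    (show 1 - q ^ 3 + q ^ 8 ≤ 1 - 0.98 * q ^ 3 by linarith) 2).trans ?_⟩
  generalize q ^ 3 = t at *
  nlinarith

/-- The numerical inequality between the theta series, in terms of the nome `q` of the gain. -/
lemma sq_mul_le_of_nome {q Y κ : ℝ} (hq0 : 0 < q) (hq1 : q ≤ 0.4545) (hY0 : 0 ≤ Y)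
    (hY : Y ≤ 2 * q * (0.4545 - q)) (hκ1 : 1.5914 ≤ κ) (hκ2 : κ ≤ 1.5915) :
    (1 - q ^ 3 + q ^ 8) ^ 2 * (1 + κ ^ 2 * Y) ≤ κ ^ 2 * (Real.pi ^ 2 / 12 - q) := by
  have hπ1 := Real.pi_gt_d4
  have hκκ1 : 2.5325 ≤ κ ^ 2 := by nlinarith
  have hκκ2 : κ ^ 2 ≤ 2.5329 := by nlinarith
  have hπ3 : 9.869 / 12 ≤ Real.pi ^ 2 / 12 := by nlinarith
  obtain ⟨-, hc⟩ := one_sub_cube_add_sq_le hq0 hq1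
  have hr : 2.5325 * (9.869 / 12 - q) ≤ κ ^ 2 * (Real.pi ^ 2 / 12 - q) :=
    mul_le_mul hκκ1 (by linarith) (by linarith) (by positivity)
  refine le_trans ?_ hr
  have hl : κ ^ 2 * Y ≤ 2.5329 * (2 * q * (0.4545 - q)) :=
    mul_le_mul hκκ2 hY hY0 (by norm_num)
  have hB : 0 ≤ 2.5329 * (2 * q * (0.4545 - q)) :=
    mul_nonneg (by norm_num) (mul_nonneg (by positivity) (by linarith))
  have h7 : 0 < q ^ 3 := by positivity
  have hcub : 0 ≤ (q - 0.39) ^ 2 * (q + 0.78) := by positivity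
  calc (1 - q ^ 3 + q ^ 8) ^ 2 * (1 + κ ^ 2 * Y)
      ≤ (1 - 1.86 * q ^ 3) * (1 + 2.5329 * (2 * q * (0.4545 - q))) :=
        mul_le_mul hc (by linarith) (by positivity) ((sq_nonneg _).trans hc)
    _ ≤ 1 + 2.5329 * (2 * q * (0.4545 - q)) - 1.86 * q ^ 3 := by
        have := mul_nonneg h7.le hB
        linarith
    _ ≤ 2.5325 * (9.869 / 12 - q) := by nlinarith [sq_nonneg (q - 0.39)]

/-- The squared limiting ratio is at most `(κ q y) ^ 2`. -/
lemma gain_sq_mul_le {a P q c κ y : ℝ} (hq0 : 0 < q) (hy0 : 0 < y) (ha : 0 < a)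
    (hg : a ≤ 2 * q * c) (hP : 4 / y ^ 2 * (Real.pi ^ 2 / 12 - q) ≤ P)
    (hmain : c ^ 2 * (1 + κ ^ 2 * (y ^ 2 * q ^ 2)) ≤ κ ^ 2 * (Real.pi ^ 2 / 12 - q)) :
    a ^ 2 ≤ (κ * q * y) ^ 2 * (P - a ^ 2) := by
  have ha2 : a ^ 2 ≤ 4 * q ^ 2 * c ^ 2 := by
    calc a ^ 2 ≤ (2 * q * c) ^ 2 := pow_le_pow_left₀ ha.le hg 2
      _ = _ := by ring
  have h10 : a ^ 2 * (1 + (κ * q * y) ^ 2) ≤ (κ * q * y) ^ 2 * P := by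
    calc a ^ 2 * (1 + (κ * q * y) ^ 2) ≤ 4 * q ^ 2 * c ^ 2 * (1 + (κ * q * y) ^ 2) := by gcongr
      _ = 4 * q ^ 2 * (c ^ 2 * (1 + κ ^ 2 * (y ^ 2 * q ^ 2))) := by ring
      _ ≤ 4 * q ^ 2 * (κ ^ 2 * (Real.pi ^ 2 / 12 - q)) := by gcongr
      _ = (κ * q * y) ^ 2 * (4 / y ^ 2 * (Real.pi ^ 2 / 12 - q)) := by field_simp
      _ ≤ (κ * q * y) ^ 2 * P := by gcongr
  linarith

/-- Comparison of the first Fourier modes of the folded tail, the gain and the power. -/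
theorem foldedQ_lt_of_fourier (hK : 2.4 ≤ K) (hu : 0 < u) (hx : u * K ≤ 5) :
    foldedQ K u < gaussianQ (limitRatio K (1 / u)) := by
  have hπ1 := Real.pi_gt_d4
  have hπ2 := Real.pi_lt_d4
  have hπ0 := Real.pi_pos
  have hK0 : 0 < K := by linarith
  set y := 2 * Real.pi / K with hy
  have hy0 : 0 < y := by positivity
  have hy1 : y ≤ 5 * Real.pi / 6 := by rw [hy, div_le_iff₀ hK0]; nlinarith
  set s := √(1 + (1 / u) ^ 2) with hs
  have hs0 : 0 < s := by positivity
  have hs2 : s ^ 2 = 1 + (1 / u) ^ 2 := Real.sq_sqrt (by positivity)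
  obtain ⟨p, hp⟩ : ∃ p, p = Real.exp (-(2 * Real.pi ^ 2 / (u * K) ^ 2)) := ⟨_, rfl⟩
  have hp0 : 0 < p := by rw [hp]; exact Real.exp_pos _
  have hp1 : p ≤ 0.4545 := by
    have h1 : p ≤ Real.exp (-0.7888) := by
      rw [hp, Real.exp_le_exp, neg_le_neg_iff, le_div_iff₀ (by positivity)]
      have : (u * K) ^ 2 ≤ 5 ^ 2 := pow_le_pow_left₀ (by positivity) hx 2
      nlinarith
    have h2 := exp_neg_le 0.7888 (by norm_num)
    norm_num [Finset.sum_range_succ, Nat.factorial] at h1 h2 ⊢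
    linarith
  have hp8 : p ^ 8 ≤ 0.00185 :=
    (pow_le_pow_left₀ hp0.le hp1 8).trans (by norm_num)
  set q := nome K s with hq
  have hq0 : 0 < q := nome_pos K s
  have hpq : p = q * Real.exp (y ^ 2 / 2) := by
    rw [hp, hq, nome, ← Real.exp_add, hs2, hy]; congr 1; field_simp; ring
  have hqp : q ≤ p := by
    rw [hpq]; exact le_mul_of_one_le_right hq0.le (Real.one_le_exp (by positivity))
  -- `p / q = exp (y ^ 2 / 2)` is at least `1 + y ^ 2 / 2`
  have hyq : y ^ 2 * q ^ 2 ≤ 2 * q * (0.4545 - q) := by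
    have := Real.add_one_le_exp (y ^ 2 / 2)
    have h1 : q * (y ^ 2 / 2 + 1) ≤ p := by rw [hpq]; gcongr
    nlinarith
  -- `X = κ q y` is slightly less than the lower bound for `1 / 2 - foldedQ` divided by `φ(0)`
  set κ := 2 * 0.9973 / (0.39895 * Real.pi) with hκ
  have hκ0 : 0 < κ := by positivity
  have hκ1 : 1.5914 ≤ κ := by rw [hκ, le_div_iff₀ (by positivity)]; linarith
  have hκ2 : κ ≤ 1.5915 := by rw [hκ, div_le_iff₀ (by positivity)]; linarith
  set X := κ * q * y with hX
  have hX0 : 0 < X := by positivity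
  have h1 := foldedQ_le_sin (by linarith) hu hp hp8
  rw [← hy] at h1
  have h2 : normalPDF 0 * X < 2 / Real.pi * p * (Real.sin y - 0.0019 * y) := by
    calc normalPDF 0 * X < 0.39895 * X := mul_lt_mul_of_pos_right normalPDF_zero_bounds.2 hX0
      _ = 2 / Real.pi * q * (0.9973 * y) := by rw [hX, hκ]; field_simp
      _ ≤ 2 / Real.pi * q * (Real.exp (y ^ 2 / 2) * (Real.sin y - 0.0019 * y)) :=
          mul_le_mul_of_nonneg_left (le_exp_mul_sin hy0 hy1) (by positivity)
      _ = _ := by rw [hpq]; ring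
  have h3 : 1 / 2 - normalPDF 0 * X ≤ gaussianQ X := by
    have := gaussianQ_sub_le le_rfl hX0.le
    rw [gaussianQ_zero, sub_zero] at this
    linarith
  have h4 : gaussianQ X ≤ gaussianQ (limitRatio K (1 / u)) := by
    refine gaussianQ_le_limitRatio hK0 (by positivity) hX0.le fun ha => ?_
    rw [← hs] at ha ⊢
    have hg := gain_le_nome hK0 hs0
    have hP := le_power_nome hK0 s
    rw [← hq] at hg hP
    have eP : K ^ 2 * (1 / 12 - q / Real.pi ^ 2) = 4 / y ^ 2 * (Real.pi ^ 2 / 12 - q) := by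
      rw [hy]; field_simp; ring
    rw [eP] at hP
    set c := 1 - q ^ 3 + q ^ 8 with hc
    have hq1 : q ≤ 0.4545 := hqp.trans hp1
    have hmain := sq_mul_le_of_nome hq0 hq1 (by positivity) hyq hκ1 hκ2
    rw [← hc] at hmain
    exact gain_sq_mul_le hq0 hy0 ha hg hP hmain
  linarith

end

/-! ### Modulo noise loss: small moduli -/

section

variable {K u : ℝ}

lemma modulus_eq (α : ℝ) : modulus α = 4 * α := by
  rw [modulus, qamOrder, show (4 : ℝ) = 2 ^ 2 by norm_num, Real.sqrt_sq (by norm_num)]; ring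

/-- For a small modulus the folded tail stays away from `1 / 2`. -/
lemma foldedQ_le_of_le (hK0 : 0 < K) (hK : K ≤ 1.6) (hu : 0 < u) : foldedQ K u ≤ 0.455 := by
  have hφ := normalPDF_zero_bounds
  have hanti := strictAnti_gaussianQ.antitone
  have h1 : gaussianQ (1.8 * u) ≤ gaussianQ ((K / 2 + 1) * u) := hanti (by nlinarith)
  have hA : gaussianQ u - gaussianQ (1.8 * u) ≤ 0.2 := by
    have h2 := gaussianQ_sub_le hu.le (show u ≤ 1.8 * u by linarith)
    have h3 := mul_normalPDF_le_quarter u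
    have e : (1.8 * u - u) * normalPDF u = 0.8 * (u * normalPDF u) := by ring
    linarith
  rw [foldedQ]
  rcases le_or_gt K (4 / 3) with h43 | h43
  · have h2 : gaussianQ (|K / 2 - 1| * u) ≤ gaussianQ (|K - 1| * u) := by
      refine hanti (mul_le_mul_of_nonneg_right ?_ hu.le)
      rw [abs_of_neg (by linarith : K / 2 - 1 < 0), abs_le]
      constructor <;> linarith
    linarith
  rw [abs_of_neg (by linarith : K / 2 - 1 < 0), abs_of_pos (by linarith : 0 < K - 1)]
  have h2 : gaussianQ (-(K / 2 - 1) * u) ≤ gaussianQ (0.2 * u) := hanti (by nlinarith)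
  have h3 : gaussianQ (0.6 * u) ≤ gaussianQ ((K - 1) * u) := hanti (by nlinarith)
  rcases le_or_gt u 1.5 with hu1 | hu1
  · have h4 := gaussianQ_sub_le (show 0 ≤ 0.2 * u by linarith) (show 0.2 * u ≤ 0.6 * u by linarith)
    have h5 : (0.6 * u - 0.2 * u) * normalPDF (0.2 * u) ≤ (0.6 * u - 0.2 * u) * 0.39895 :=
      mul_le_mul_of_nonneg_left
        ((normalPDF_le_of_sq_le (by nlinarith)).trans hφ.2.le) (by linarith)
    linarith
  · have h4 : gaussianQ u ≤ gaussianQ 1.5 := hanti hu1.le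
    have h5 : gaussianQ (0.2 * u) ≤ gaussianQ 0.3 := hanti (by linarith)
    have e1 := gaussianQ_le (x := 1.5) (by norm_num)
      (by norm_num [Finset.sum_range_succ, Nat.factorial])
    have e2 := gaussianQ_le (x := 0.3) (by norm_num)
      (by norm_num [Finset.sum_range_succ, Nat.factorial])
    have h6 := gaussianQ_pos (1.8 * u)
    have h7 := gaussianQ_pos (0.6 * u)
    norm_num [Finset.sum_range_succ, Nat.factorial] at e1 e2 h2 h3 h4 h5 h6 h7 h1 ⊢
    linarith

/-- For a small modulus the gain is so small that the limiting ratio is at most `1 / 10`. -/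
lemma foldedQ_lt_of_le_modulus (hK0 : 0 < K) (hK : K ≤ 1.6) (hu : 0 < u) :
    foldedQ K u < gaussianQ (limitRatio K (1 / u)) := by
  have hπ1 := Real.pi_gt_d4
  have hπ0 := Real.pi_pos
  refine (foldedQ_le_of_le hK0 hK hu).trans_lt ?_
  have h1 : (0.455 : ℝ) < gaussianQ 0.1 := by
    have := gaussianQ_sub_le (a := 0) (b := 0.1) le_rfl (by norm_num)
    have hφ := normalPDF_zero_bounds
    rw [gaussianQ_zero] at this
    norm_num at this hφ ⊢
    linarith
  refine h1.trans_le (gaussianQ_le_limitRatio hK0 (by positivity) (by norm_num) fun ha => ?_)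
  set s := √(1 + (1 / u) ^ 2) with hs
  have hs0 : 0 < s := by positivity
  have hs2 : s ^ 2 = 1 + (1 / u) ^ 2 := Real.sq_sqrt (by positivity)
  have hg := gain_le_nome hK0 hs0
  have hP := le_power_nome hK0 s
  obtain ⟨t, ht⟩ : ∃ t, t = 2 * Real.pi ^ 2 / K ^ 2 := ⟨_, rfl⟩
  have ht7 : 7.7 ≤ t := by
    rw [ht, le_div_iff₀ (by positivity)]
    have : K ^ 2 ≤ 1.6 ^ 2 := pow_le_pow_left₀ hK0.le hK 2
    nlinarith
  have hKt : K ^ 2 = 2 * Real.pi ^ 2 / t := by rw [ht]; field_simp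
  have hq0 := nome_pos K s
  have hqt : nome K s * t ^ 3 ≤ 6 := by
    have h2 : nome K s ≤ Real.exp (-t) := by
      rw [nome, Real.exp_le_exp, neg_le_neg_iff, hs2, ht]
      refine div_le_div_of_nonneg_right ?_ (by positivity)
      nlinarith [mul_nonneg (sq_nonneg Real.pi) (sq_nonneg (1 / u))]
    have h3 : t ^ 3 / 6 ≤ Real.exp t := by
      have := Real.pow_div_factorial_le_exp t (by linarith) 3
      norm_num [Nat.factorial] at this
      exact this
    have h4 : Real.exp (-t) * Real.exp t = 1 := by rw [← Real.exp_add]; simp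
    calc nome K s * t ^ 3 ≤ Real.exp (-t) * (6 * Real.exp t) := by
          gcongr; linarith
      _ = 6 := by linear_combination 6 * h4
  rw [hKt] at hP
  generalize nome K s = q at *
  generalize gain K s = a at *
  generalize power K s = P at *
  have ht3 : 456 ≤ t ^ 3 := by
    have := pow_le_pow_left₀ (by norm_num) ht7 3
    norm_num at this; linarith
  have hq1 : q ≤ 0.0132 := by nlinarith
  have ha2 : a ^ 2 ≤ 4 * q ^ 2 := by
    have h5 : a ≤ 2 * q := by
      refine hg.trans (mul_le_of_le_one_right (by positivity) ?_)
      have : q ^ 8 ≤ q ^ 3 := pow_le_pow_of_le_one hq0.le (by linarith) (by norm_num)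
      linarith
    calc a ^ 2 ≤ (2 * q) ^ 2 := pow_le_pow_left₀ ha.le h5 2
      _ = _ := by ring
  have hP2 : 1.6 ≤ P * t := by
    have e : 2 * Real.pi ^ 2 / t * (1 / 12 - q / Real.pi ^ 2) * t = Real.pi ^ 2 / 6 - 2 * q := by
      field_simp; ring
    have h6 := mul_le_mul_of_nonneg_right hP (by linarith : 0 ≤ t)
    rw [e] at h6
    nlinarith
  -- `q ^ 2 * t` is at most `36 / t ^ 5`
  have hqt2 : q ^ 2 * t ≤ 0.0014 := by
    have h7 : q * t ≤ 0.102 := by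
      have h8 : q * t * t ^ 2 ≤ 6 := by linarith
      have h9 : 59 ≤ t ^ 2 := by nlinarith
      have h10 : 0 < q * t := by positivity
      nlinarith
    calc q ^ 2 * t = q * (q * t) := by ring
      _ ≤ 0.0132 * 0.102 := by gcongr
      _ ≤ _ := by norm_num
  have h11 : a ^ 2 * t * 1.01 ≤ 0.01 * (P * t) := by
    have := mul_le_mul_of_nonneg_right ha2 (by linarith : 0 ≤ t)
    linarith
  have h12 : 1.01 * a ^ 2 ≤ 0.01 * P := by
    refine le_of_mul_le_mul_right ?_ (by linarith : 0 < t)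
    linarith
  norm_num at h12 ⊢
  linarith

/-- The pointwise comparison behind the modulo-noise bound: at every noise level, the limiting
error probability exceeds the folded tail, unless the modulus is close to `2`. -/
theorem foldedQ_lt_limitRatio {α τ : ℝ} (hα : 0 < α) (hα' : 1 / 10 ≤ |α - 1 / 2|) (hτ : 0 < τ) :
    foldedQ (modulus α) (1 / τ) < gaussianQ (limitRatio (modulus α) τ) := by
  have hu : 0 < 1 / τ := by positivity
  have h : foldedQ (4 * α) (1 / τ) < gaussianQ (limitRatio (4 * α) (1 / (1 / τ))) := by
    rcases le_abs.1 hα' with h | h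
    · rcases le_total (1 / τ * (4 * α)) 5 with h5 | h5
      · exact foldedQ_lt_of_fourier (by linarith) hu h5
      · exact foldedQ_lt_of_spatial (by linarith) hu h5
    · exact foldedQ_lt_of_le_modulus (by linarith) (by linarith) hu
  rwa [one_div_one_div, ← modulus_eq] at h

end

/-! ### The three lower bounds -/

section

lemma exists_forall_le_ber {α σ σh : ℝ} (hα : 0 < α) (hσ : 0 < σ) (hσh : 0 < σh) :
    ∃ N₀ : ℕ, ∀ N : ℕ, N₀ ≤ N → ∀ (M : ℕ) [NeZero M] (P : ℕ)
      (l : Fin (P + 1) → ℕ) (k : Fin (P + 1) → ℤ)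
      (ν : Measure (Fin (P + 1) → ℂ)) [IsProbabilityMeasure ν],
      l 0 = 0 → (∀ p, p ≠ 0 → 0 < l p) → ν.map (fun h => h 0) = complexGaussian σh →
      berPL σ σh ≤ ber M N α σ l k ν ∧ berMSL α ≤ ber M N α σ l k ν ∧
        (1 / 10 ≤ |α - 1 / 2| → berMNL α σ σh ≤ ber M N α σ l k ν) := by
  have hK : 0 < modulus α := by rw [modulus_eq]; positivity
  have hinv : Measurable fun τ : ℝ => 1 / τ := by fun_prop
  obtain ⟨N₁, h1⟩ := exists_forall_integral_le_ber hα hσ hσh (T := fun τ => gaussianQ (1 / τ))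
    (C := 1) (continuous_gaussianQ.measurable.comp hinv)
    (fun r => abs_le.2 ⟨by linarith [gaussianQ_nonneg (1 / r)], gaussianQ_le_one _⟩)
    (fun τ hτ => gaussianQ_inv_lt_limitRatio hK hτ)
  obtain ⟨N₂, h2⟩ := exists_forall_integral_le_ber hα hσ hσh (T := fun _ => berMSL α)
    (C := |berMSL α|) measurable_const (fun _ => le_rfl)
    (fun τ hτ => berMSL_lt_limitRatio hα hτ)
  have h3 : ∃ N₃ : ℕ, ∀ N : ℕ, N₃ ≤ N → ∀ (M : ℕ) [NeZero M] (P : ℕ)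
      (l : Fin (P + 1) → ℕ) (k : Fin (P + 1) → ℤ)
      (ν : Measure (Fin (P + 1) → ℂ)) [IsProbabilityMeasure ν],
      l 0 = 0 → (∀ p, p ≠ 0 → 0 < l p) → ν.map (fun h => h 0) = complexGaussian σh →
      1 / 10 ≤ |α - 1 / 2| → berMNL α σ σh ≤ ber M N α σ l k ν := by
    by_cases hα' : 1 / 10 ≤ |α - 1 / 2|
    · obtain ⟨N₃, h3⟩ := exists_forall_integral_le_ber hα hσ hσh
        (T := fun τ => foldedQ (modulus α) (1 / τ)) (C := 2)
        ((continuous_foldedQ _).measurable.comp hinv) (fun r => abs_foldedQ_le _ _)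
        (fun τ hτ => foldedQ_lt_limitRatio hα hα' hτ)
      refine ⟨N₃, fun N hN M _ P l k ν _ hl0 hl hν _ => ?_⟩
      rw [berMNL_eq_integral hα hσ hσh]
      exact h3 N hN M P l k ν hl0 hl hν
    · exact ⟨0, fun N _ M _ P l k ν _ _ _ _ h => absurd h hα'⟩
  obtain ⟨N₃, h3⟩ := h3
  refine ⟨max N₁ (max N₂ N₃), fun N hN M _ P l k ν _ hl0 hl hν => ⟨?_, ?_, fun hα' => ?_⟩⟩
  · rw [berPL_eq_integral hσ hσh]
    exact h1 N ((le_max_left _ _).trans hN) M P l k ν hl0 hl hν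
  · have := h2 N (((le_max_left _ _).trans (le_max_right _ _)).trans hN) M P l k ν hl0 hl hν
    have hp : IsProbabilityMeasure (complexGaussian σh) := inferInstance
    simpa using this
  · exact h3 N (((le_max_right _ _).trans (le_max_right _ _)).trans hN) M P l k ν hl0 hl hν hα'

end

end ODDM

theorem theorem1 (α σw σh : ℝ) (hα : 0 < α) (hσw : 0 < σw) (hσh : 0 < σh) :
    ∃ N₀ : ℕ, ∀ N : ℕ, N₀ ≤ N → ∀ (M : ℕ) [NeZero M] (P : ℕ)
      (l : Fin (P + 1) → ℕ) (k : Fin (P + 1) → ℤ)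
      (ν : MeasureTheory.Measure (Fin (P + 1) → ℂ)) [MeasureTheory.IsProbabilityMeasure ν],
      l 0 = 0 → (∀ p, p ≠ 0 → 0 < l p) →
      ν.map (fun h => h 0) = ODDM.complexGaussian σh →
      max (ODDM.berPL σw σh) (ODDM.berMSL α) ≤ ODDM.ber M N α σw l k ν ∧
      (1 / 10 ≤ |α - 1 / 2| →
        max (ODDM.berPL σw σh) (max (ODDM.berMNL α σw σh) (ODDM.berMSL α)) ≤
          ODDM.ber M N α σw l k ν) := by
  obtain ⟨N₀, h⟩ := ODDM.exists_forall_le_ber hα hσw hσh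
  refine ⟨N₀, fun N hN M _ P l k ν _ hl0 hl hν => ?_⟩
  obtain ⟨h1, h2, h3⟩ := h N hN M P l k ν hl0 hl hν
  exact ⟨max_le h1 h2, fun hα' => max_le h1 (max_le (h3 hα') h2)⟩
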